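/- **Setting.** $|\cdot|$ is the Euclidean norm of vectors and the spectral norm of matrices. Circuits consist of arbitrary one-qubit unitaries with any number of controls; a gate with $c$ controls counts as $1+c$ atomic gates. Let $N\ge 1$. For a matrix $P\in\mathbb C^{M'\times 2^m}$ with orthonormal rows, its $\mathrm{C}_P\mathrm{NOT}$ gate is $P^\dagger P\otimes X+(\mathrm{Id}-P^\dagger P)\otimes\mathrm{Id}_2$ on $m+1$ qubits; a circuit for it may use clean workspace qubits, which it returns to $0$ and whose number is at most its number of gates. A *block encoding* $U=(U,\Pi_1,\Pi_2,\gamma)$ of a matrix $S$ up to relative tolerance $\varepsilon\ge 0$ consists of a circuit for a unitary $U$ on $m$ qubits, projections $\Pi_1,\Pi_2$ with orthonormal rows together with circuits for their $\mathrm{C}_\Pi\mathrm{NOT}$ gates, and a number $\gamma\ge|S|$, such that $|\gamma\Pi_2U\Pi_1^\dagger-S|\le\varepsilon|S|$; it is *exact* if $\varepsilon=0$. Its *information efficiency* is $\eta(U)=|\Pi_2U\Pi_1^\dagger|$, and $t(U)$ is the number of atomic gates of its three circuits. Vectors are encoded as column matrices. The space $\mathbb C^N$ is represented on $n$ qubits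 by a fixed $E\in\mathbb C^{N\times 2^n}$ with orthonormal rows: on a tensor power $(\mathbb C^N)^{\otimes k}$ every projection is $E^{\otimes k}$, with the copies of $E$ on arbitrary disjoint sets of qubits, tensored with $\langle 0|$ on all other qubits (for $k=0$, the input side of a vector, it is $\langle 0|$). An *encoding algorithm* takes $\varepsilon,\delta\in(0,1)$ and an exact block encoding $U_x$ of a vector $x\in\mathbb C^N$. It knows the numbers of qubits, the projections and $\gamma$ of $U_x$, but uses the three circuits of $U_x$ only as black boxes (possibly inverted or controlled). Depending on all earlier outcomes it repeatedly runs a circuit, with calls to these black boxes, on qubits in state $0$ and measures them, or it stops and returns a block encoding, whose circuits may also contain such calls. Classical computation is free. The *complexity* of the algorithm is $t(\text{output})/t(U_x)$. Fix a constant $C_{\mathrm{ie}}\in[\tfrac14,1)$. The algorithm is an *efficient amplified encoding* of a function $f$ on a set $D$ if there is a constant $L$, independent of $x,U_x,\varepsilon,\delta$, such that for all $x\in D$ and all $U_x$ with $\eta(U_x)\ge C_{\mathrm{ie}}$, with probability at least $1-\delta$ it returns a block encoding $W$ of $f(x)$ up to relative tolerance $\varepsilon$ with $\eta(W)\ge C_{\mathrm{ie}}$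 (and of the stated complexity), after executing at most $L\,t(W)\,\varepsilon^{-1}(1+\log_2\delta^{-1})$ gates. It is an *exact constructive encoding* of a matrix-valued function $F$ if for all $x$ and all $U_x$ with $\eta(U_x)\ge C_{\mathrm{ie}}$ it returns, without executing any gate, an exact block encoding of $F(x)$. **Theorem (Amplified encoding of a polynomial and its Jacobian).** There is a constant $C>0$, depending only on $C_{\mathrm{ie}}$, with the following property. Let $N,K\ge1$, let $E$ be as above, and let $A_k\in\mathbb C^{N\times N^k}$, $k=0,\dots,K$, be symmetric in their $k$ arguments. Let $U_k$ be exact block encodings of $A_k$ with $t(U_k)\le t_{\max}$ and $\eta(U_k)\ge\eta_{\min}>0$ for all $k$. Put $$f(x)=\sum_{k=0}^KA_kx^{\otimes k}\qquad(x\in\mathbb C^N).$$ 1. There is an efficient amplified encoding of $f$ on $\{x: f(x)\ne0\}$ with complexity at most $$C\,\frac{K\,t_{\max}}{\eta_{\min}|f(x)|}\sum_{k=0}^K|A_k|\,|x|^k .$$ 2. The Jacobian of $f$ is $Df(x)=\sum_{k=1}^KkA_k(x^{\otimes(k-1)}\otimes\mathrm{Id})\in\mathbb C^{N\times N}$, and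 there is an exact constructive encoding of $Df$ with information efficiency $$\eta\ge\eta_{\min}\,C_{\mathrm{ie}}^{K-1}\,|Df(x)|\Big[\sum_{k=1}^Kk\,|A_k|\,|x|^{k-1}\Big]^{-1}$$ (no condition if the sum in brackets is $0$) and with complexity at most $C\max\{K-1,1\}\,t_{\max}$. The unitary of the returned encoding calls the unitary of $U_x$ at most $K-1$ times. -/

import Mathlib

namespace QEnc

open scoped Matrix Kronecker

/-! ### Norms -/

/-- The spectral norm (operator norm for the Euclidean norms) of a matrix. -/
noncomputable def specNorm {ι κ : Type} [Fintype ι] [Fintype κ] [DecidableEq κ]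
    (S : Matrix ι κ ℂ) : ℝ :=
  ‖(Matrix.toEuclideanLin S).toContinuousLinearMap‖

/-- A vector regarded as a column matrix. -/
def column {N : ℕ} (v : EuclideanSpace ℂ (Fin N)) : Matrix (Fin N) Unit ℂ :=
  fun i _ => v i

/-! ### Gates and circuits

`Q` is a set of qubits. Its computational basis states are the maps `Q → Bool`. -/

/-- An arbitrary unitary on one qubit, applied if all the control qubits are in state `1`. -/
structure Gate (Q : Type) where
  target : Q
  controls : Finset Q
  target_notMem : target ∉ controls
  V : Matrix.unitaryGroup Bool ℂ

namespace Gate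

/-- The number of atomic gates charged for a gate: a one-qubit gate counts once, and every control
adds one. (A gate with `c` controls is compiled into `O(c + 1)` one- and two-qubit gates; a gate
that acts on a bounded number of qubits is charged a bounded number.) -/
def cost {Q : Type} (g : Gate Q) : ℕ := 1 + g.controls.card

/-- The unitary matrix of a gate on all of `Q`. -/
noncomputable def matrix {Q : Type} [Fintype Q] [DecidableEq Q] (g : Gate Q) :
    Matrix (Q → Bool) (Q → Bool) ℂ := fun s' s =>
  if ∀ c ∈ g.controls, s c = true then
    if ∀ q, q ≠ g.target → s' q = s q then (g.V : Matrix Bool Bool ℂ) (s' g.target) (s g.target)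
    else 0
  else if s' = s then 1 else 0

/-- The inverse gate. -/
noncomputable def inv {Q : Type} (g : Gate Q) : Gate Q := { g with V := g.V⁻¹ }

/-- The gate `g` on the qubits `e q`, with the additional controls `ctrl`. -/
def place {Q Q' : Type} [DecidableEq Q'] (e : Q ↪ Q') (ctrl : Finset Q')
    (h : ∀ q, e q ∉ ctrl) (g : Gate Q) : Gate Q' where
  target := e g.target
  controls := g.controls.map e ∪ ctrl
  target_notMem := by
    simp only [Finset.mem_union, Finset.mem_map', not_or]
    exact ⟨g.target_notMem, h _⟩
  V := g.V

end Gate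

/-- A circuit is the list of its gates, the first gate being applied first. -/
abbrev Circuit (Q : Type) := List (Gate Q)

/-- The number of atomic gates of a circuit. -/
def Circuit.gates {Q : Type} (c : Circuit Q) : ℕ := (c.map Gate.cost).sum

/-- The unitary matrix implemented by a circuit. -/
noncomputable def Circuit.matrix {Q : Type} [Fintype Q] [DecidableEq Q] :
    Circuit Q → Matrix (Q → Bool) (Q → Bool) ℂ
  | [] => 1
  | g :: c => Circuit.matrix c * g.matrix

/-- The inverse circuit. -/
noncomputable def Circuit.inv {Q : Type} (c : Circuit Q) : Circuit Q := (c.map Gate.inv).reverse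

/-! ### Subspace projections and their controlled-NOT gates -/

/-- The Pauli matrix `X`. -/
def pauliX : Matrix Bool Bool ℂ := fun f' f => if f' = f then 0 else 1

/-- The controlled-NOT gate of a projection `P` with orthonormal rows: the last qubit is flipped
if and only if the other qubits are in the range of `Pᴴ`. -/
noncomputable def projNot {ν : Type} [Fintype ν] {m : ℕ} (P : Matrix ν (Fin m → Bool) ℂ) :
    Matrix ((Fin m → Bool) × Bool) ((Fin m → Bool) × Bool) ℂ :=
  (Pᴴ * P) ⊗ₖ pauliX + (1 - Pᴴ * P) ⊗ₖ (1 : Matrix Bool Bool ℂ)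

/-- The qubits of a circuit for a controlled-NOT gate of a projection on `m` qubits: these `m`
qubits, the qubit to be flipped, and `b` workspace qubits. -/
abbrev ProjQubits (m b : ℕ) : Type := Fin m ⊕ (Unit ⊕ Fin b)

/-- The circuit `c` implements the controlled-NOT gate of `P`. The workspace qubits start in state
`0` and are returned to state `0`, and there are no superfluous ones. -/
def ImplementsProjNot {ν : Type} [Fintype ν] {m b : ℕ} (c : Circuit (ProjQubits m b))
    (P : Matrix ν (Fin m → Bool) ℂ) : Prop :=
  b ≤ c.gates ∧
  ∀ (a' a : Fin m → Bool) (f' f : Bool) (w : Fin b → Bool),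
    c.matrix (Sum.elim a' (Sum.elim (fun _ => f') w))
        (Sum.elim a (Sum.elim (fun _ => f) (fun _ => false))) =
      if w = (fun _ => false) then projNot P (a', f') (a, f) else 0

/-! ### Block encodings -/

/-- All data of a block encoding except its circuits: the number `m` of qubits, the numbers of
workspace qubits of the two projection gates, the projections and the normalization factor. -/
structure Interface (ν₁ ν₂ : Type) where
  m : ℕ
  b₁ : ℕ
  b₂ : ℕ
  P₁ : Matrix ν₁ (Fin m → Bool) ℂ
  P₂ : Matrix ν₂ (Fin m → Bool) ℂ
  γ : ℝ

/-- The data of a block encoding `(U, Π₁, Π₂, γ)`: a circuit for `U` and circuits for the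
controlled-NOT gates of `Π₁` and `Π₂`, written with the instructions `G`. -/
structure Encoding (G : Type → Type) (ν₁ ν₂ : Type) extends Interface ν₁ ν₂ where
  circ : List (G (Fin m))
  proj₁ : List (G (ProjQubits m b₁))
  proj₂ : List (G (ProjQubits m b₂))

section
variable {ν₁ ν₂ : Type}

/-- The number of atomic gates of a block encoding. -/
def Encoding.gates (U : Encoding Gate ν₁ ν₂) : ℕ :=
  Circuit.gates U.circ + Circuit.gates U.proj₁ + Circuit.gates U.proj₂

/-- The encoded block `Π₂ U Π₁ᴴ`. -/
noncomputable def Encoding.block (U : Encoding Gate ν₁ ν₂) : Matrix ν₂ ν₁ ℂ :=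
  U.P₂ * Circuit.matrix U.circ * U.P₁ᴴ

variable [Fintype ν₁] [DecidableEq ν₁] [Fintype ν₂] [DecidableEq ν₂]

/-- The information efficiency `|Π₂ U Π₁ᴴ|`. -/
noncomputable def Encoding.eff (U : Encoding Gate ν₁ ν₂) : ℝ := specNorm U.block

/-- `U` is a block encoding of `S` up to relative tolerance `ε`. -/
structure Encoding.IsBlockEncoding (U : Encoding Gate ν₁ ν₂) (S : Matrix ν₂ ν₁ ℂ) (ε : ℝ) :
    Prop where
  orthonormal₁ : U.P₁ * U.P₁ᴴ = 1
  orthonormal₂ : U.P₂ * U.P₂ᴴ = 1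
  implements₁ : ImplementsProjNot U.proj₁ U.P₁
  implements₂ : ImplementsProjNot U.proj₂ U.P₂
  le_gamma : specNorm S ≤ U.γ
  approx : specNorm ((U.γ : ℂ) • U.block - S) ≤ ε * specNorm S

end

/-! ### Standard projections

The space `ℂ^N` is represented on `n` qubits by a fixed projection `E` with orthonormal rows. The
projections of the encodings below consist of one or several copies of `E`, placed on arbitrary
disjoint qubits, tensored with `⟨0|` on all the remaining qubits. This makes the output of one
encoding a valid input of another one. -/

/-- The projection `⟨0|` on all qubits. -/
def zeroProj (m : ℕ) : Matrix Unit (Fin m → Bool) ℂ :=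
  fun _ s => if s = (fun _ => false) then 1 else 0

open Classical in
/-- The projection `E^{⊗k} ⊗ ⟨0|`, with the `i`-th copy of `E` on the qubits `pos (i, ·)`. -/
noncomputable def tensorProj {N n m : ℕ} (E : Matrix (Fin N) (Fin n → Bool) ℂ) (k : ℕ)
    (pos : Fin k × Fin n ↪ Fin m) : Matrix (Fin k → Fin N) (Fin m → Bool) ℂ := fun j s =>
  if ∀ q, q ∉ Set.range pos → s q = false then ∏ i, E (j i) (fun r => s (pos (i, r))) else 0

open Classical in
/-- The projection `E ⊗ ⟨0|`, with `E` on the qubits `pos ·`. -/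
noncomputable def dataProj {N n m : ℕ} (E : Matrix (Fin N) (Fin n → Bool) ℂ)
    (pos : Fin n ↪ Fin m) : Matrix (Fin N) (Fin m → Bool) ℂ := fun i s =>
  if ∀ q, q ∉ Set.range pos → s q = false then E i (fun r => s (pos r)) else 0

section
variable {N n : ℕ} (E : Matrix (Fin N) (Fin n → Bool) ℂ)

/-- `U` is a block encoding of the vector `v ∈ ℂ^N` up to relative tolerance `ε`. -/
def EncodesVector (U : Encoding Gate Unit (Fin N)) (v : EuclideanSpace ℂ (Fin N)) (ε : ℝ) :
    Prop :=
  U.IsBlockEncoding (column v) ε ∧ U.P₁ = zeroProj U.m ∧ ∃ pos, U.P₂ = dataProj E pos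

/-- `U` is a block encoding of the `N × N` matrix `S` up to relative tolerance `ε`. -/
def EncodesMatrix (U : Encoding Gate (Fin N) (Fin N)) (S : Matrix (Fin N) (Fin N) ℂ) (ε : ℝ) :
    Prop :=
  U.IsBlockEncoding S ε ∧ (∃ pos, U.P₁ = dataProj E pos) ∧ ∃ pos, U.P₂ = dataProj E pos

/-- `U` is an exact block encoding of the matrix `S : (ℂ^N)^{⊗k} → ℂ^N`. -/
def EncodesCoefficient {k : ℕ} (U : Encoding Gate (Fin k → Fin N) (Fin N))
    (S : Matrix (Fin N) (Fin k → Fin N) ℂ) : Prop :=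
  U.IsBlockEncoding S 0 ∧ (∃ pos, U.P₁ = tensorProj E k pos) ∧ ∃ pos, U.P₂ = dataProj E pos

end

/-! ### Algorithms with access to a block encoding

An algorithm that takes a block encoding as its input knows the interface of the input, but it
uses the three circuits of the input as black boxes only. -/

/-- The three circuits of a block encoding. -/
inductive Port where
  | main
  | proj₁
  | proj₂

/-- The qubits of the three circuits. -/
def Interface.PortQubits {μ₁ μ₂ : Type} (I : Interface μ₁ μ₂) : Port → Type
  | .main => Fin I.m
  | .proj₁ => ProjQubits I.m I.b₁
  | .proj₂ => ProjQubits I.m I.b₂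

/-- The instructions of a circuit on the qubits `Q` with calls to an input block encoding: a gate,
or one of the circuits of the input or its inverse, on the qubits `e ·`, with control qubits. -/
inductive Instr {μ₁ μ₂ : Type} (I : Interface μ₁ μ₂) (Q : Type) where
  | gate (g : Gate Q)
  | call (p : Port) (inverse : Bool) (e : I.PortQubits p ↪ Q) (ctrl : Finset Q)
      (h : ∀ q, e q ∉ ctrl)

section
variable {μ₁ μ₂ ν₁ ν₂ : Type}

/-- The three circuits of a block encoding. -/
def Encoding.port (U : Encoding Gate μ₁ μ₂) : (p : Port) → Circuit (U.toInterface.PortQubits p)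
  | .main => U.circ
  | .proj₁ => U.proj₁
  | .proj₂ => U.proj₂

/-- The gates that stand for an instruction when the input block encoding is `U`. -/
noncomputable def Instr.expand (U : Encoding Gate μ₁ μ₂) {Q : Type} [DecidableEq Q] :
    Instr U.toInterface Q → Circuit Q
  | .gate g => [g]
  | .call p inverse e ctrl h =>
      (if inverse then Circuit.inv (U.port p) else U.port p).map (Gate.place e ctrl h)

/-- Substitution of the circuits of the input `U` for the calls. -/
noncomputable def substitute (U : Encoding Gate μ₁ μ₂) {Q : Type} [DecidableEq Q]
    (c : List (Instr U.toInterface Q)) : Circuit Q :=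
  c.flatMap (Instr.expand U)

/-- Whether an instruction is a call of the circuit `U` of the input, or of its inverse. -/
def Instr.isMain {I : Interface μ₁ μ₂} {Q : Type} : Instr I Q → Bool
  | .call .main _ _ _ _ => true
  | _ => false

/-- The block encoding with calls `T`, for the input `U`. -/
noncomputable def Encoding.instantiate (U : Encoding Gate μ₁ μ₂)
    (T : Encoding (Instr U.toInterface) ν₁ ν₂) : Encoding Gate ν₁ ν₂ where
  toInterface := T.toInterface
  circ := substitute U T.circ
  proj₁ := substitute U T.proj₁
  proj₂ := substitute U T.proj₂

/-- One step of an algorithm: it runs a circuit on `q` qubits, starting from all qubits in state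
`0`, and measures all the qubits, or it stops and returns a block encoding. -/
inductive Action (I : Interface μ₁ μ₂) (ν₁ ν₂ : Type) where
  | run (q : ℕ) (c : List (Instr I (Fin q)))
  | output (T : Encoding (Instr I) ν₁ ν₂)

/-- The steps of an algorithm as a function of all the previous measurement outcomes. -/
abbrev Strategy (I : Interface μ₁ μ₂) (ν₁ ν₂ : Type) := List (List Bool) → Action I ν₁ ν₂

open Classical in
/-- The probability that `𝒮`, used with the input `U`, stops after at most `T` further
measurements, and that the block encoding `W` which it returns and the total number `c` of executed
gates satisfy `good W c`; here `h` are the past outcomes and `c₀` counts the gates executed so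
far. -/
noncomputable def probWithin (U : Encoding Gate μ₁ μ₂) (𝒮 : Strategy U.toInterface ν₁ ν₂)
    (good : Encoding Gate ν₁ ν₂ → ℕ → Prop) : (T : ℕ) → (h : List (List Bool)) → (c₀ : ℕ) → ℝ
  | 0, h, c₀ =>
      match 𝒮 h with
      | .output W => if good (U.instantiate W) c₀ then 1 else 0
      | .run _ _ => 0
  | T + 1, h, c₀ =>
      match 𝒮 h with
      | .output W => if good (U.instantiate W) c₀ then 1 else 0
      | .run q c => ∑ s : Fin q → Bool,
          ‖(substitute U c).matrix s (fun _ => false)‖ ^ 2 *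
            probWithin U 𝒮 good T (h ++ [List.ofFn s]) (c₀ + (substitute U c).gates)

/-- With probability at least `p`, the algorithm stops, and its output and the number of executed
gates satisfy `good`. -/
def SucceedsWithProb (U : Encoding Gate μ₁ μ₂) (𝒮 : Strategy U.toInterface ν₁ ν₂) (p : ℝ)
    (good : Encoding Gate ν₁ ν₂ → ℕ → Prop) : Prop :=
  ∃ T : ℕ, p ≤ probWithin U 𝒮 good T [] 0

/-- The complexity of an encoding algorithm that returns `W` for the input `U`. -/
noncomputable def complexity (W : Encoding Gate ν₁ ν₂) (U : Encoding Gate μ₁ μ₂) : ℝ :=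
  (W.gates : ℝ) / (U.gates : ℝ)

end

/-- An algorithm that takes a tolerance `ε`, a failure probability `δ` and a block encoding of a
vector of `ℂ^N`. -/
abbrev EncodingAlgorithm (N : ℕ) (ν₁ ν₂ : Type) :=
  (ε δ : ℝ) → (I : Interface Unit (Fin N)) → Strategy I ν₁ ν₂

section
variable {N n : ℕ} (E : Matrix (Fin N) (Fin n → Bool) ℂ) (Cie : ℝ)

/-- `𝒜` is an efficient amplified encoding of the function `f`, restricted to the set `D`, whose
complexity at `x` is at most `compl x`: given an input that encodes `x ∈ D` with information
efficiency at least `Cie`, it returns with probability at least `1 - δ` a block encoding of `f x` up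
to relative tolerance `ε`, with information efficiency at least `Cie`, and it executes
`O(t ε⁻¹ (1 + log δ⁻¹))` gates, where `t` is the number of gates of the output. -/
def IsEfficientAmplifiedEncoding (𝒜 : EncodingAlgorithm N Unit (Fin N))
    (f : EuclideanSpace ℂ (Fin N) → EuclideanSpace ℂ (Fin N)) (D : Set (EuclideanSpace ℂ (Fin N)))
    (compl : EuclideanSpace ℂ (Fin N) → ℝ) : Prop :=
  ∃ L : ℝ, ∀ ε δ : ℝ, 0 < ε → ε < 1 → 0 < δ → δ < 1 →
    ∀ x ∈ D, ∀ U : Encoding Gate Unit (Fin N), EncodesVector E U x 0 → Cie ≤ U.eff →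
      SucceedsWithProb U (𝒜 ε δ U.toInterface) (1 - δ) fun W c =>
        EncodesVector E W (f x) ε ∧ Cie ≤ W.eff ∧ complexity W U ≤ compl x ∧
          (c : ℝ) ≤ L * (W.gates * ε⁻¹ * (1 + Real.logb 2 δ⁻¹))

/-- `𝒟` is an exact constructive encoding of the matrix-valued function `F`: without executing any
gate, it returns an exact block encoding of `F x`. At `x` the output has information efficiency at
least `effic x` and complexity at most `compl x`, and its unitary calls the unitary of the input at
most `uses` times. -/
def IsExactConstructiveEncoding (𝒟 : EncodingAlgorithm N (Fin N) (Fin N))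
    (F : EuclideanSpace ℂ (Fin N) → Matrix (Fin N) (Fin N) ℂ)
    (effic compl : EuclideanSpace ℂ (Fin N) → ℝ) (uses : ℕ) : Prop :=
  ∀ ε δ : ℝ, 0 < ε → ε < 1 → 0 < δ → δ < 1 →
    ∀ (x : EuclideanSpace ℂ (Fin N)) (U : Encoding Gate Unit (Fin N)),
      EncodesVector E U x 0 → Cie ≤ U.eff →
      ∃ T : Encoding (Instr U.toInterface) (Fin N) (Fin N),
        𝒟 ε δ U.toInterface [] = .output T ∧
        EncodesMatrix E (U.instantiate T) (F x) 0 ∧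
        effic x ≤ (U.instantiate T).eff ∧
        complexity (U.instantiate T) U ≤ compl x ∧
        T.circ.countP Instr.isMain ≤ uses

end

/-! ### Polynomials -/

/-- The tensor power `x^{⊗k}`. -/
noncomputable def tensorPow {N : ℕ} (k : ℕ) (x : EuclideanSpace ℂ (Fin N)) :
    (Fin k → Fin N) → ℂ :=
  fun j => ∏ i, x (j i)

/-- The polynomial `A₀ + A₁ x + ⋯ + A_K x^{⊗K}`. -/
noncomputable def polyEval {N : ℕ} (A : (k : ℕ) → Matrix (Fin N) (Fin k → Fin N) ℂ) (K : ℕ)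
    (x : EuclideanSpace ℂ (Fin N)) : EuclideanSpace ℂ (Fin N) :=
  WithLp.toLp 2 (∑ k ∈ Finset.range (K + 1), A k *ᵥ tensorPow k x)

/-- The matrix `∑_{k=1}^K k A_k (x^{⊗(k-1)} ⊗ Id)`; the index below is `k - 1`. -/
noncomputable def polyJacobian {N : ℕ} (A : (k : ℕ) → Matrix (Fin N) (Fin k → Fin N) ℂ) (K : ℕ)
    (x : EuclideanSpace ℂ (Fin N)) : Matrix (Fin N) (Fin N) ℂ := fun a b =>
  ∑ k ∈ Finset.range K, ((k + 1 : ℕ) : ℂ) *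
    ∑ j : Fin k → Fin N, A (k + 1) a (Fin.snoc (α := fun _ => Fin N) j b) * tensorPow k x j

end QEnc

open QEnc

/-!
The polynomial is a linear combination of the terms `A_k x^{⊗k}`. If `x / γ` is the block of an
encoding, `k` copies of its state are the argument of `U_k`. A copy has a component outside the
range of the projection, which would spoil the product; a projection gate marks this component by
an additional qubit (`Blk.purified`), and as the projections of the result demand the state `0` of
that qubit, only the tensor power of the encoded vector remains. A control register with a unary code
selects the term, and its preparation and unpreparation yield the linear combination with
probabilities as weights (`prep_select`, `circ_block`). With weights proportional to `γ_k γ^k` this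
is an exact encoding of `f x / ∑ γ_k γ^k` (`polyBlk_block`). For the Jacobian one argument of every
term is left open (`jacBlk_block`), and no measurement is needed
(`isExactConstructiveEncoding_jacAlgorithm`). That the encoded matrix is the derivative is due to the
symmetry of `A_k`, as all the arguments contribute the same (`hasFDerivAt_polyEval`).

The vector encoding so obtained may have a small information efficiency `η₀ = |f x| / ∑ γ_k γ^k`.
It is amplified by Grover iterations, which map the amplitude `sin θ` to `sin ((2 r + 1) θ)`
(`Blk.Valid.prob_amplify`). To amplify to almost one, `η₀` has to be known up to a relative error
`τ ~ ε`; moreover the normalization factor of the returned encoding has to be correct up to that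
error. The estimate is obtained in two phases. A search through the numbers `3 ^ i` of iterations
finds the order of magnitude of `η₀` (`SuccAfter.search`). Then a sequence of tests shrinks the known
interval by a constant factor each (`SuccAfter.ladder`): a test for an interval of length `w` uses
`O(1 / w)` iterations and a prior rescaling, so that the two ends of the interval have success
probabilities that differ by a constant (`exists_test`). If `l` tests are left, the test is repeated
`O(l log δ⁻¹)` times; both the failure probabilities and the costs then form geometric-like sums, so
that neither a factor `log ε⁻¹` nor `log log` appears: the cost is dominated by the last tests, of
size `1 / (τ η₀)` times that of the encoding.

The complexity bound contains `|x|^k` rather than `γ^k`. For inputs of information efficiency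
less than one these may differ by a factor `Cie ^ (-k)`, so the input itself has to be amplified to an
efficiency of almost one before it is used `k` times. Its efficiency is estimated by tests of the
input with an accuracy proportional to `τ η₀ / κ`; an error of this size changes the value of
the polynomial by a multiple of `τ |f x|` (`norm_polyEval_smul_sub_le`, `GoodEstimates.encodes`).
The returned encoding then has `O(K t_max |f x|⁻¹ ∑ γ_k |x|^k)` times as many gates as the input
(`GoodEstimates.complexity_le`), and conversely at least a multiple of `η₀⁻¹` times as many, with a
factor that depends on the degree only; this bounds the number of executed gates
(`GoodEstimates.executed_le`).

A bound for the number of qubits is needed wherever a projection is enlarged by `⟨0|` on further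
qubits. Every qubit that a projection requires to be in state `0` is touched by each circuit for its
controlled-NOT gate (`ImplementsProjNot.mem_touched`), hence the number of these qubits is at most
the number of gates.
-/

namespace QEnc
open scoped Matrix
set_option linter.unusedSectionVars false
set_option synthInstance.maxSize 1000

/-! ### Placing operators on registers -/

section Lift
variable {P Q R S : Type} [Fintype P] [DecidableEq P] [Fintype Q] [DecidableEq Q]
  [Fintype R] [DecidableEq R] [Fintype S] [DecidableEq S]

open Classical in
/-- The operator `M` on the qubits `e ·`, applied if all the qubits in `ctrl` are in state `1`. -/
noncomputable def lift (e : P ↪ Q) (ctrl : Finset Q) (M : Matrix (P → Bool) (P → Bool) ℂ) :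
    Matrix (Q → Bool) (Q → Bool) ℂ := fun t s =>
  if ∀ c ∈ ctrl, s c = true then
    if ∀ q, q ∉ Set.range e → t q = s q then M (t ∘ e) (s ∘ e) else 0
  else if t = s then 1 else 0

open Classical in
/-- The isometry that places basis states on the qubits `e ·`, all the other qubits being in the
basis state `w`. -/
noncomputable def inj (e : P ↪ Q) (w : Q → Bool) : Matrix (Q → Bool) (P → Bool) ℂ := fun t u =>
  if t = Function.extend e u w then 1 else 0

theorem extend_comp_self (e : P ↪ Q) (u : P → Bool) (w : Q → Bool) :
    Function.extend e u w ∘ e = u := by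
  funext p; exact e.injective.extend_apply _ _ _

theorem extend_off (e : P ↪ Q) (u : P → Bool) (w : Q → Bool) {q : Q} (h : q ∉ Set.range e) :
    Function.extend e u w q = w q :=
  Function.extend_apply' _ _ _ fun ⟨a, ha⟩ => h ⟨a, ha⟩

theorem eq_extend_iff (e : P ↪ Q) (t w : Q → Bool) (u : P → Bool) :
    t = Function.extend e u w ↔ (∀ q, q ∉ Set.range e → t q = w q) ∧ t ∘ e = u := by
  constructor
  · rintro rfl
    exact ⟨fun q hq => extend_off e u w hq, extend_comp_self e u w⟩
  · rintro ⟨h1, rfl⟩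
    funext q
    by_cases hq : q ∈ Set.range e
    · obtain ⟨p, rfl⟩ := hq
      exact (e.injective.extend_apply (t ∘ e) w p).symm
    · rw [extend_off e _ w hq, h1 q hq]

open Classical in
/-- A sum over the states that agree with `s` outside a register is a sum over the states of the
register. -/
theorem sum_agree (e : P ↪ Q) (s : Q → Bool) (g : (Q → Bool) → ℂ) :
    (∑ t, if ∀ q, q ∉ Set.range e → t q = s q then g t else 0) =
      ∑ u : P → Bool, g (Function.extend e u s) := by
  symm
  refine Fintype.sum_of_injective (fun u : P → Bool => Function.extend e u s) ?_ _ _ ?_ ?_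
  · intro u v h
    have := congrArg (fun t => t ∘ e) h
    simpa [extend_comp_self] using this
  · intro t ht
    rw [if_neg]
    intro h
    exact ht ⟨t ∘ e, ((eq_extend_iff e t s (t ∘ e)).2 ⟨h, rfl⟩).symm⟩
  · intro u
    rw [if_pos]
    intro q hq
    exact extend_off e u s hq

theorem mul_inj_apply {ι : Type} (A : Matrix ι (Q → Bool) ℂ) (e : P ↪ Q) (w : Q → Bool) (t : ι)
    (u : P → Bool) : (A * inj e w) t u = A t (Function.extend e u w) := by
  simp [Matrix.mul_apply, inj]

open Classical in
theorem inj_mul_apply {ι : Type} (e : P ↪ Q) (w : Q → Bool) (A : Matrix (P → Bool) ι ℂ)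
    (t : Q → Bool) (u : ι) :
    (inj e w * A) t u = if ∀ q, q ∉ Set.range e → t q = w q then A (t ∘ e) u else 0 := by
  simp only [Matrix.mul_apply, inj, eq_extend_iff]
  split_ifs with h
  · rw [Finset.sum_eq_single (t ∘ e)]
    · rw [if_pos ⟨h, rfl⟩, one_mul]
    · intro b _ hb
      rw [if_neg (fun h' => hb h'.2.symm), zero_mul]
    · simp
  · refine Finset.sum_eq_zero fun b _ => ?_
    rw [if_neg (fun h' => h h'.1), zero_mul]

theorem inj_conjTranspose_mul_apply {ι : Type} (e : P ↪ Q) (w : Q → Bool)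
    (A : Matrix (Q → Bool) ι ℂ) (u : P → Bool) (s : ι) :
    ((inj e w)ᴴ * A) u s = A (Function.extend e u w) s := by
  simp [Matrix.mul_apply, inj, Matrix.conjTranspose_apply, apply_ite]

theorem inj_conjTranspose_mul_inj (e : P ↪ Q) (w : Q → Bool) : (inj e w)ᴴ * inj e w = 1 := by
  ext u v
  rw [mul_inj_apply, Matrix.conjTranspose_apply, inj, Matrix.one_apply]
  by_cases h : u = v
  · simp [h]
  · rw [if_neg h, if_neg, star_zero]
    intro h'
    apply h
    have := congrArg (fun t => t ∘ e) h'
    simpa [extend_comp_self] using this.symm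

/-- The isometry that places basis states on the qubits `e ·`, the other qubits being in state `0`. -/
noncomputable abbrev zinj (e : P ↪ Q) : Matrix (Q → Bool) (P → Bool) ℂ := inj e fun _ => false

theorem extend_extend (e : P ↪ Q) (f : Q ↪ R) (u : P → Bool) (w : R → Bool) :
    Function.extend f (Function.extend e u (w ∘ f)) w = Function.extend (e.trans f) u w := by
  rw [eq_extend_iff]
  constructor
  · intro r hr
    by_cases h : r ∈ Set.range f
    · obtain ⟨q, rfl⟩ := h
      rw [f.injective.extend_apply, extend_off]
      · rfl
      · rintro ⟨p, rfl⟩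
        exact hr ⟨p, rfl⟩
    · rw [extend_off _ _ _ h]
  · funext p
    simp [f.injective.extend_apply, e.injective.extend_apply]

theorem inj_mul_inj (e : P ↪ Q) (f : Q ↪ R) (w : R → Bool) :
    inj f w * inj e (w ∘ f) = inj (e.trans f) w := by
  ext t u
  rw [mul_inj_apply, inj, inj, extend_extend]

/-- Base change: an operator `C` that acts as `M` when part of its qubits are in the basis state
`w` acts in the same way inside a larger register. The controls are among the qubits in the
state `w`. -/
theorem lift_mul_inj (e : R ↪ P) (g : P ↪ Q) (h : S ↪ Q) (j : R ↪ S) (w : Q → Bool)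
    (hsq : ∀ a, h (j a) = g (e a)) (hpb : ∀ s p, h s = g p → ∃ a, j a = s ∧ e a = p)
    (ctrl : Finset Q) (hctrl : ∀ c ∈ ctrl, c ∉ Set.range h)
    (C : Matrix (P → Bool) (P → Bool) ℂ) (M : Matrix (R → Bool) (R → Bool) ℂ)
    (hCM : C * inj e (w ∘ g) = inj e (w ∘ g) * M) [Decidable (∀ c ∈ ctrl, w c = true)] :
    lift g ctrl C * inj h w =
      inj h w * (if ∀ c ∈ ctrl, w c = true then lift j ∅ M else 1) := by
  classical
  ext t u
  have hc : (∀ c ∈ ctrl, Function.extend h u w c = true) ↔ ∀ c ∈ ctrl, w c = true :=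
    forall₂_congr fun c hcc => by rw [extend_off h u w (hctrl c hcc)]
  rw [mul_inj_apply, lift]
  simp only [hc]
  split_ifs with hw h1 h2
  · have hcomp : Function.extend h u w ∘ g = Function.extend e (u ∘ j) (w ∘ g) := by
      rw [eq_extend_iff]
      constructor
      · intro p hp
        have : g p ∉ Set.range h := by
          rintro ⟨s, hs⟩
          obtain ⟨a, -, ha⟩ := hpb s p hs
          exact hp ⟨a, ha⟩
        simp [extend_off h u w this]
      · funext a
        simp [← hsq, h.injective.extend_apply]
    have hCM' := congrFun (congrFun hCM (t ∘ g)) (u ∘ j)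
    rw [mul_inj_apply, inj_mul_apply] at hCM'
    rw [hcomp, hCM', inj_mul_apply]
    simp only [lift, Finset.notMem_empty, false_imp_iff, implies_true, if_true]
    have key : (∀ q, q ∉ Set.range e → (t ∘ g) q = (w ∘ g) q) ↔
        (∀ q, q ∉ Set.range h → t q = w q) ∧ (∀ q, q ∉ Set.range j → (t ∘ h) q = u q) := by
      constructor
      · intro hp
        constructor
        · intro q hq
          by_cases hqg : q ∈ Set.range g
          · obtain ⟨p, rfl⟩ := hqg
            refine hp p ?_
            rintro ⟨a, rfl⟩
            exact hq ⟨j a, hsq a⟩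
          · rw [h1 q hqg, extend_off h u w hq]
        · intro s hs
          have : h s ∉ Set.range g := by
            rintro ⟨p, hp'⟩
            obtain ⟨a, ha, -⟩ := hpb s p hp'.symm
            exact hs ⟨a, ha⟩
          simp only [Function.comp_apply]
          rw [h1 _ this, h.injective.extend_apply]
      · rintro ⟨ha, -⟩ p hp
        refine ha (g p) ?_
        rintro ⟨s, hs⟩
        obtain ⟨a, -, ha⟩ := hpb s p hs
        exact hp ⟨a, ha⟩
    have hcc : (t ∘ g) ∘ e = (t ∘ h) ∘ j := by
      funext a; simp [hsq]
    rw [hcc]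
    by_cases hA : ∀ q, q ∉ Set.range h → t q = w q <;>
    by_cases hB : ∀ q, q ∉ Set.range j → (t ∘ h) q = u q
    · rw [if_pos (key.2 ⟨hA, hB⟩), if_pos hA, if_pos hB]
    · rw [if_neg (fun hh => hB (key.1 hh).2), if_pos hA, if_neg hB]
    · rw [if_neg (fun hh => hA (key.1 hh).1), if_neg hA]
    · rw [if_neg (fun hh => hA (key.1 hh).1), if_neg hA]
  · rw [inj_mul_apply]
    split_ifs with hA
    · simp only [lift, Finset.notMem_empty, false_imp_iff, implies_true, if_true]
      rw [if_neg]
      intro hB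
      apply h1
      intro q hq
      by_cases hqh : q ∈ Set.range h
      · obtain ⟨s, rfl⟩ := hqh
        rw [h.injective.extend_apply]
        refine hB s ?_
        rintro ⟨a, rfl⟩
        exact hq ⟨e a, (hsq a).symm⟩
      · rw [hA q hqh, extend_off h u w hqh]
    · rfl
  all_goals
    have h3 := congrFun (congrFun (Matrix.mul_one (inj h w)) t) u
    rw [h3, inj]
  · rw [if_pos h2]
  · rw [if_neg h2]

theorem eq_iff_agree (e : P ↪ Q) (t s : Q → Bool) :
    t = s ↔ (∀ q, q ∉ Set.range e → t q = s q) ∧ t ∘ e = s ∘ e := by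
  constructor
  · rintro rfl; exact ⟨fun _ _ => rfl, rfl⟩
  · rintro ⟨h1, h2⟩
    rw [(eq_extend_iff e t s _).2 ⟨h1, rfl⟩, h2, ← (eq_extend_iff e s s _).2 ⟨fun _ _ => rfl, rfl⟩]

theorem lift_one (e : P ↪ Q) (ctrl : Finset Q) : lift e ctrl 1 = 1 := by
  classical
  ext t s
  simp only [lift, Matrix.one_apply]
  simp only [← ite_and, ← eq_iff_agree e t s, ite_self]

theorem lift_mul (e : P ↪ Q) (ctrl : Finset Q) (hc : ∀ p, e p ∉ ctrl)
    (M N : Matrix (P → Bool) (P → Bool) ℂ) :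
    lift e ctrl (M * N) = lift e ctrl M * lift e ctrl N := by
  classical
  ext t s
  rw [Matrix.mul_apply]
  by_cases h : ∀ c ∈ ctrl, s c = true
  · have h1 : ∀ v, lift e ctrl M t v * lift e ctrl N v s =
        if ∀ q, q ∉ Set.range e → v q = s q then
          (lift e ctrl M t v * N (v ∘ e) (s ∘ e)) else 0 := by
      intro v
      simp only [lift, if_pos h, mul_ite, mul_zero]
    simp only [h1]
    rw [sum_agree]
    have h2 : ∀ u : P → Bool, lift e ctrl M t (Function.extend e u s) =
        if ∀ q, q ∉ Set.range e → t q = s q then M (t ∘ e) u else 0 := by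
      intro u
      rw [lift, if_pos, extend_comp_self]
      · have : (∀ q, q ∉ Set.range e → t q = Function.extend e u s q) ↔
            ∀ q, q ∉ Set.range e → t q = s q :=
          forall₂_congr fun q hq => by rw [extend_off e u s hq]
        simp only [this]
      · intro c hcc
        rw [extend_off, h c hcc]
        rintro ⟨p, rfl⟩
        exact hc p hcc
    simp only [h2, extend_comp_self]
    rw [lift, if_pos h]
    split_ifs with h3
    · rw [Matrix.mul_apply]
    · simp
  · have h1 : ∀ v, lift e ctrl M t v * lift e ctrl N v s =
        if v = s then lift e ctrl M t v else 0 := by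
      intro v
      simp only [lift, if_neg h, mul_ite, mul_one, mul_zero]
    simp only [h1]
    rw [Finset.sum_ite_eq' Finset.univ s, if_pos (Finset.mem_univ _), lift, lift, if_neg h, if_neg h]

theorem lift_conjTranspose (e : P ↪ Q) (ctrl : Finset Q) (hc : ∀ p, e p ∉ ctrl)
    (M : Matrix (P → Bool) (P → Bool) ℂ) : (lift e ctrl M)ᴴ = lift e ctrl Mᴴ := by
  classical
  ext t s
  rw [Matrix.conjTranspose_apply, lift, lift]
  have hoff : ∀ c ∈ ctrl, c ∉ Set.range e := by
    rintro c hcc ⟨p, rfl⟩; exact hc p hcc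
  by_cases h : ∀ q, q ∉ Set.range e → t q = s q
  · have h' : ∀ q, q ∉ Set.range e → s q = t q := fun q hq => (h q hq).symm
    have : (∀ c ∈ ctrl, t c = true) ↔ ∀ c ∈ ctrl, s c = true :=
      forall₂_congr fun c hcc => by rw [h c (hoff c hcc)]
    simp only [this, if_pos h, if_pos h']
    by_cases h1 : ∀ c ∈ ctrl, s c = true
    · rw [if_pos h1, if_pos h1, Matrix.conjTranspose_apply]
    · rw [if_neg h1, if_neg h1]
      by_cases h2 : t = s
      · rw [if_pos h2, if_pos h2.symm, star_one]
      · rw [if_neg h2, if_neg (Ne.symm h2), star_zero]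
  · have h' : ¬ ∀ q, q ∉ Set.range e → s q = t q := fun hh => h fun q hq => (hh q hq).symm
    have h1 : ¬ t = s := by rintro rfl; exact h fun _ _ => rfl
    simp only [if_neg h, if_neg h', if_neg h1, if_neg (Ne.symm h1)]
    split_ifs <;> simp

theorem lift_trans (e : P ↪ Q) (g : Q ↪ R) (c : Finset Q) (c' : Finset R)
    (M : Matrix (P → Bool) (P → Bool) ℂ) :
    lift g c' (lift e c M) = lift (e.trans g) (c.map g ∪ c') M := by
  classical
  ext t s
  simp only [lift, Finset.mem_union, Finset.mem_map]
  have hU : (∀ x, (∃ a ∈ c, g a = x) ∨ x ∈ c' → s x = true) ↔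
      (∀ x ∈ c', s x = true) ∧ ∀ x ∈ c, (s ∘ g) x = true := by
    constructor
    · intro h; exact ⟨fun x hx => h x (Or.inr hx), fun x hx => h _ (Or.inl ⟨x, hx, rfl⟩)⟩
    · rintro ⟨h1, h2⟩ x (⟨a, ha, rfl⟩ | hx)
      · exact h2 a ha
      · exact h1 x hx
  have hoff : (∀ q, q ∉ Set.range (e.trans g) → t q = s q) ↔
      (∀ q, q ∉ Set.range g → t q = s q) ∧
        ∀ q, q ∉ Set.range e → (t ∘ g) q = (s ∘ g) q := by
    constructor
    · intro h
      refine ⟨fun q hq => h q ?_, fun q hq => h (g q) ?_⟩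
      · rintro ⟨p, rfl⟩; exact hq ⟨e p, rfl⟩
      · rintro ⟨p, hp⟩; exact hq ⟨p, g.injective hp⟩
    · rintro ⟨h1, h2⟩ q hq
      by_cases hqg : q ∈ Set.range g
      · obtain ⟨x, rfl⟩ := hqg
        refine h2 x ?_
        rintro ⟨p, rfl⟩; exact hq ⟨p, rfl⟩
      · exact h1 q hqg
  have heq := eq_iff_agree g t s
  simp only [hU, hoff]
  by_cases h1 : ∀ x ∈ c', s x = true
  · by_cases h2 : ∀ x ∈ c, (s ∘ g) x = true
    · by_cases h3 : ∀ q, q ∉ Set.range g → t q = s q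
      · by_cases h4 : ∀ q, q ∉ Set.range e → (t ∘ g) q = (s ∘ g) q
        · rw [if_pos h1, if_pos h3, if_pos h2, if_pos h4, if_pos ⟨h1, h2⟩, if_pos ⟨h3, h4⟩]; rfl
        · rw [if_pos h1, if_pos h3, if_pos h2, if_neg h4, if_pos ⟨h1, h2⟩,
            if_neg (fun h : _ ∧ _ => h4 h.2)]
      · rw [if_pos h1, if_neg h3, if_pos ⟨h1, h2⟩, if_neg (fun h : _ ∧ _ => h3 h.1)]
    · rw [if_pos h1, if_neg h2, if_neg (fun h : _ ∧ _ => h2 h.2)]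
      by_cases h3 : ∀ q, q ∉ Set.range g → t q = s q
      · rw [if_pos h3]
        by_cases h5 : t ∘ g = s ∘ g
        · rw [if_pos h5, if_pos (heq.2 ⟨h3, h5⟩)]
        · rw [if_neg h5, if_neg (fun h => h5 (heq.1 h).2)]
      · rw [if_neg h3, if_neg (fun h => h3 (heq.1 h).1)]
  · rw [if_neg h1, if_neg (fun h : _ ∧ _ => h1 h.1)]

/-- Operators on disjoint registers commute. -/
theorem lift_commute (e : P ↪ Q) (g : R ↪ Q) (hd : ∀ p r, e p ≠ g r)
    (M : Matrix (P → Bool) (P → Bool) ℂ) (N : Matrix (R → Bool) (R → Bool) ℂ) :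
    lift e ∅ M * lift g ∅ N = lift g ∅ N * lift e ∅ M := by
  classical
  -- both products have the entries `M (t ∘ e) (s ∘ e) * N (t ∘ g) (s ∘ g)`
  have key : ∀ {P R : Type} [Fintype P] [DecidableEq P] [Fintype R] [DecidableEq R]
      (e : P ↪ Q) (g : R ↪ Q) (hd : ∀ p r, e p ≠ g r)
      (M : Matrix (P → Bool) (P → Bool) ℂ) (N : Matrix (R → Bool) (R → Bool) ℂ) (t s : Q → Bool),
      (lift e ∅ M * lift g ∅ N) t s =
        if ∀ q, q ∉ Set.range e → q ∉ Set.range g → t q = s q then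
          M (t ∘ e) (s ∘ e) * N (t ∘ g) (s ∘ g) else 0 := by
    intro P R _ _ _ _ e g hd M N t s
    rw [Matrix.mul_apply]
    have h1 : ∀ v, lift e ∅ M t v * lift g ∅ N v s =
        if ∀ q, q ∉ Set.range g → v q = s q then lift e ∅ M t v * N (v ∘ g) (s ∘ g) else 0 := by
      intro v
      simp [lift]
    simp only [h1]
    rw [sum_agree]
    simp only [extend_comp_self, lift, Finset.notMem_empty, false_imp_iff, implies_true, if_true]
    have hse : ∀ u : R → Bool, Function.extend g u s ∘ e = s ∘ e := by
      intro u; funext p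
      exact extend_off g u s (by rintro ⟨r, hr⟩; exact hd p r hr.symm)
    simp only [hse]
    have hcond : ∀ u : R → Bool, (∀ q, q ∉ Set.range e → t q = Function.extend g u s q) ↔
        (∀ q, q ∉ Set.range e → q ∉ Set.range g → t q = s q) ∧ t ∘ g = u := by
      intro u
      constructor
      · intro h
        constructor
        · intro q hq hg; rw [h q hq, extend_off g u s hg]
        · funext r
          have := h (g r) (by rintro ⟨p, hp⟩; exact hd p r hp)
          rw [g.injective.extend_apply] at this
          exact this
      · rintro ⟨h, rfl⟩ q hq
        by_cases hg : q ∈ Set.range g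
        · obtain ⟨r, rfl⟩ := hg; rw [g.injective.extend_apply]; rfl
        · rw [extend_off g _ s hg, h q hq hg]
    simp only [hcond, ite_and]
    split_ifs with h
    · simp
    · simp
  ext t s
  rw [key e g hd, key g e (fun r p => (hd p r).symm), mul_comm]
  have : (∀ q, q ∉ Set.range e → q ∉ Set.range g → t q = s q) ↔
      ∀ q, q ∉ Set.range g → q ∉ Set.range e → t q = s q :=
    ⟨fun h q a b => h q b a, fun h q a b => h q b a⟩
  simp only [this]

theorem lift_sub (e : P ↪ Q) (M N : Matrix (P → Bool) (P → Bool) ℂ) :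
    lift e ∅ (M - N) = lift e ∅ M - lift e ∅ N := by
  ext t s
  simp only [lift, Finset.notMem_empty, false_imp_iff, implies_true, if_true, Matrix.sub_apply]
  split_ifs <;> simp

theorem lift_add (e : P ↪ Q) (M N : Matrix (P → Bool) (P → Bool) ℂ) :
    lift e ∅ (M + N) = lift e ∅ M + lift e ∅ N := by
  ext t s
  simp only [lift, Finset.notMem_empty, false_imp_iff, implies_true, if_true, Matrix.add_apply]
  split_ifs <;> simp

end Lift

/-! ### Circuits -/

section Circuits
variable {Q Q' : Type} [Fintype Q] [DecidableEq Q] [Fintype Q'] [DecidableEq Q']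

/-- A one-qubit register. -/
def single (q : Q) : Unit ↪ Q := ⟨fun _ => q, fun _ _ _ => rfl⟩

/-- A one-qubit matrix as an operator on a one-qubit register. -/
def unitOp (V : Matrix Bool Bool ℂ) : Matrix (Unit → Bool) (Unit → Bool) ℂ :=
  fun a b => V (a ()) (b ())

theorem unitOp_mul (V W : Matrix Bool Bool ℂ) : unitOp (V * W) = unitOp V * unitOp W := by
  ext a b
  simp only [unitOp, Matrix.mul_apply]
  exact ((Equiv.funUnique Unit Bool).sum_comp (fun x => V (a ()) x * W x (b ()))).symm

theorem unitOp_one : unitOp 1 = 1 := by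
  ext a b
  simp only [unitOp, Matrix.one_apply]
  congr 1
  rw [funext_iff]
  exact propext ⟨fun h _ => h, fun h => h ()⟩

theorem Gate.matrix_eq_lift (g : Gate Q) :
    g.matrix = lift (single g.target) g.controls (unitOp g.V) := by
  classical
  ext t s
  have : ∀ q, q ∉ Set.range (single g.target) ↔ q ≠ g.target := by
    intro q; exact ⟨fun h hq => h ⟨(), hq.symm⟩, fun h ⟨_, hq⟩ => h hq.symm⟩
  simp only [Gate.matrix, lift, this]
  rfl

theorem Gate.matrix_place (g : Gate Q) (e : Q ↪ Q') (ctrl : Finset Q') (h : ∀ q, e q ∉ ctrl) :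
    (g.place e ctrl h).matrix = lift e ctrl g.matrix := by
  rw [Gate.matrix_eq_lift, Gate.matrix_eq_lift, lift_trans]
  rfl

theorem Gate.matrix_mul_inv (g : Gate Q) : g.matrix * g.inv.matrix = 1 := by
  rw [Gate.matrix_eq_lift, Gate.matrix_eq_lift]
  have hc : ∀ p, single g.target p ∉ g.controls := fun _ => g.target_notMem
  refine (lift_mul (single g.target) g.controls hc _ _).symm.trans ?_
  rw [← unitOp_mul]
  have : (g.V : Matrix Bool Bool ℂ) * (g.inv.V : Matrix Bool Bool ℂ) = 1 := by
    have : g.V * g.inv.V = 1 := mul_inv_cancel g.V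
    exact congrArg Subtype.val this
  rw [this, unitOp_one, lift_one]

theorem Gate.inv_matrix (g : Gate Q) : g.inv.matrix = g.matrixᴴ := by
  rw [Gate.matrix_eq_lift, Gate.matrix_eq_lift,
    lift_conjTranspose _ _ (fun _ => g.target_notMem)]
  congr 1

theorem Circuit.matrix_append (c d : Circuit Q) :
    Circuit.matrix (c ++ d) = Circuit.matrix d * Circuit.matrix c := by
  induction c with
  | nil => simp [Circuit.matrix]
  | cons g c ih => simp [Circuit.matrix, ih, Matrix.mul_assoc]

theorem Circuit.matrix_singleton (g : Gate Q) : Circuit.matrix [g] = g.matrix := by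
  simp [Circuit.matrix]

theorem Circuit.matrix_place (c : Circuit Q) (e : Q ↪ Q') (ctrl : Finset Q')
    (h : ∀ q, e q ∉ ctrl) :
    Circuit.matrix (c.map (Gate.place e ctrl h)) = lift e ctrl (Circuit.matrix c) := by
  induction c with
  | nil => simp [Circuit.matrix, lift_one]
  | cons g c ih => simp [Circuit.matrix, ih, Gate.matrix_place, lift_mul e ctrl h]

theorem Circuit.matrix_inv (c : Circuit Q) : Circuit.matrix c.inv = (Circuit.matrix c)ᴴ := by
  induction c with
  | nil => simp [Circuit.matrix, Circuit.inv]
  | cons g c ih =>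
    have : Circuit.inv (g :: c) = Circuit.inv c ++ [g.inv] := by simp [Circuit.inv]
    rw [this, Circuit.matrix_append, ih, Circuit.matrix_singleton, Circuit.matrix,
      Matrix.conjTranspose_mul, Gate.inv_matrix]

theorem Circuit.matrix_mul_conjTranspose (c : Circuit Q) :
    Circuit.matrix c * (Circuit.matrix c)ᴴ = 1 := by
  induction c with
  | nil => simp [Circuit.matrix]
  | cons g c ih =>
    rw [Circuit.matrix, Matrix.conjTranspose_mul, Matrix.mul_assoc, ← Matrix.mul_assoc g.matrix,
      ← Gate.inv_matrix, Gate.matrix_mul_inv, Matrix.one_mul, ih]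

theorem Circuit.conjTranspose_mul_matrix (c : Circuit Q) :
    (Circuit.matrix c)ᴴ * Circuit.matrix c = 1 :=
  mul_eq_one_comm.1 (Circuit.matrix_mul_conjTranspose c)

theorem Circuit.gates_append (c d : Circuit Q) :
    Circuit.gates (c ++ d) = Circuit.gates c + Circuit.gates d := by
  simp [Circuit.gates]

theorem Circuit.gates_inv (c : Circuit Q) : Circuit.gates c.inv = Circuit.gates c := by
  have : (Gate.cost ∘ Gate.inv : Gate Q → ℕ) = Gate.cost := rfl
  simp [Circuit.gates, Circuit.inv, List.sum_reverse, this]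

theorem Gate.cost_place_le (g : Gate Q) (e : Q ↪ Q') (ctrl : Finset Q') (h : ∀ q, e q ∉ ctrl) :
    (g.place e ctrl h).cost ≤ g.cost + ctrl.card := by
  have := Finset.card_union_le (g.controls.map e) ctrl
  rw [Finset.card_map] at this
  simp only [Gate.cost, Gate.place]
  omega

theorem Gate.le_cost_place (g : Gate Q) (e : Q ↪ Q') (ctrl : Finset Q') (h : ∀ q, e q ∉ ctrl) :
    g.cost ≤ (g.place e ctrl h).cost := by
  have := Finset.card_le_card (Finset.subset_union_left (s₁ := g.controls.map e) (s₂ := ctrl))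
  rw [Finset.card_map] at this
  simp only [Gate.cost, Gate.place]
  omega

theorem Circuit.gates_place_le (c : Circuit Q) (e : Q ↪ Q') (ctrl : Finset Q')
    (h : ∀ q, e q ∉ ctrl) :
    Circuit.gates (c.map (Gate.place e ctrl h)) ≤ (1 + ctrl.card) * Circuit.gates c := by
  induction c with
  | nil => simp [Circuit.gates]
  | cons g c ih =>
    simp only [Circuit.gates, List.map_cons, List.sum_cons] at ih ⊢
    have h1 := Gate.cost_place_le g e ctrl h
    have h2 : 1 ≤ g.cost := by simp [Gate.cost]
    nlinarith

theorem Circuit.le_gates_place (c : Circuit Q) (e : Q ↪ Q') (ctrl : Finset Q')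
    (h : ∀ q, e q ∉ ctrl) :
    Circuit.gates c ≤ Circuit.gates (c.map (Gate.place e ctrl h)) := by
  induction c with
  | nil => simp [Circuit.gates]
  | cons g c ih =>
    simp only [Circuit.gates, List.map_cons, List.sum_cons] at ih ⊢
    have h1 := Gate.le_cost_place g e ctrl h
    omega

end Circuits

/-! ### Circuits with calls -/

section Prog
variable {μ₁ μ₂ : Type} {I : Interface μ₁ μ₂} {Q Q' : Type} [Fintype Q] [DecidableEq Q]
  [Fintype Q'] [DecidableEq Q']

/-- An instruction on the qubits `e ·`, with the additional controls `ctrl`. -/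
def Instr.place (e : Q ↪ Q') (ctrl : Finset Q') (h : ∀ q, e q ∉ ctrl) : Instr I Q → Instr I Q'
  | .gate g => .gate (g.place e ctrl h)
  | .call p b e' c' h' => .call p b (e'.trans e) (c'.map e ∪ ctrl) (by
      intro q
      simp only [Finset.mem_union, Function.Embedding.trans_apply, Finset.mem_map', not_or]
      exact ⟨h' _, h _⟩)

/-- The inverse of an instruction. -/
noncomputable def Instr.inv : Instr I Q → Instr I Q
  | .gate g => .gate g.inv
  | .call p b e c h => .call p (!b) e c h

/-- Placing a circuit with calls on the qubits `e ·`, with the additional controls `ctrl`. -/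
def place (e : Q ↪ Q') (ctrl : Finset Q') (h : ∀ q, e q ∉ ctrl) (c : List (Instr I Q)) :
    List (Instr I Q') :=
  c.map (Instr.place e ctrl h)

/-- Placing a circuit with calls on the qubits `e ·`. -/
def on (e : Q ↪ Q') (c : List (Instr I Q)) : List (Instr I Q') :=
  place e ∅ (fun _ => Finset.notMem_empty _) c

/-- The inverse of a circuit with calls. -/
noncomputable def inverse (c : List (Instr I Q)) : List (Instr I Q) := (c.map Instr.inv).reverse

variable {I : Type} (U : Encoding Gate μ₁ μ₂)

/-- The unitary of a circuit with calls, for the input `U`. -/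
noncomputable def sem (c : List (Instr U.toInterface Q)) : Matrix (Q → Bool) (Q → Bool) ℂ :=
  Circuit.matrix (substitute U c)

/-- The number of atomic gates of a circuit with calls, for the input `U`. -/
noncomputable def cost (c : List (Instr U.toInterface Q)) : ℕ := Circuit.gates (substitute U c)

variable {U}

theorem substitute_append (c d : List (Instr U.toInterface Q)) :
    substitute U (c ++ d) = substitute U c ++ substitute U d := by
  simp [substitute]

theorem Instr.expand_place (e : Q ↪ Q') (ctrl : Finset Q') (h : ∀ q, e q ∉ ctrl)
    (i : Instr U.toInterface Q) :
    Instr.expand U (i.place e ctrl h) = (Instr.expand U i).map (Gate.place e ctrl h) := by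
  cases i with
  | gate g => rfl
  | call p b e' c' h' =>
    simp only [Instr.place, Instr.expand, List.map_map]
    refine List.map_congr_left fun g _ => ?_
    have : DecidableEq (U.toInterface.PortQubits p) := Classical.decEq _
    simp only [Function.comp_apply, Gate.place, Finset.map_union, Finset.map_map,
      Finset.union_assoc]
    rfl

theorem substitute_place (e : Q ↪ Q') (ctrl : Finset Q') (h : ∀ q, e q ∉ ctrl)
    (c : List (Instr U.toInterface Q)) :
    substitute U (place e ctrl h c) = (substitute U c).map (Gate.place e ctrl h) := by
  induction c with
  | nil => rfl
  | cons i c ih =>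
    have h1 : substitute U (place e ctrl h (i :: c)) =
        Instr.expand U (i.place e ctrl h) ++ substitute U (place e ctrl h c) := rfl
    have h2 : substitute U (i :: c) = Instr.expand U i ++ substitute U c := rfl
    rw [h1, h2, ih, Instr.expand_place, List.map_append]

theorem Circuit.inv_append {Q : Type} (c d : Circuit Q) :
    Circuit.inv (c ++ d) = Circuit.inv d ++ Circuit.inv c := by
  simp [Circuit.inv]

theorem Circuit.inv_inv {Q : Type} (c : Circuit Q) : c.inv.inv = c := by
  have : (Gate.inv ∘ Gate.inv : Gate Q → Gate Q) = id := by
    funext g; simp [Gate.inv]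
  simp [Circuit.inv, this]

theorem Instr.expand_inv (i : Instr U.toInterface Q) :
    Instr.expand U i.inv = Circuit.inv (Instr.expand U i) := by
  cases i with
  | gate g => rfl
  | call p b e c h =>
    have key : ∀ d : Circuit (U.toInterface.PortQubits p),
        (Circuit.inv d).map (Gate.place e c h) = Circuit.inv (d.map (Gate.place e c h)) := by
      intro d
      simp only [Circuit.inv, List.map_reverse, List.map_map]
      rfl
    cases b
    · simp [Instr.inv, Instr.expand, key]
    · simp [Instr.inv, Instr.expand, key, Circuit.inv_inv]

theorem substitute_inverse (c : List (Instr U.toInterface Q)) :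
    substitute U (inverse c) = Circuit.inv (substitute U c) := by
  induction c with
  | nil => rfl
  | cons i c ih =>
    have h1 : inverse (i :: c) = inverse c ++ [i.inv] := by simp [inverse]
    have h2 : substitute U (i :: c) = Instr.expand U i ++ substitute U c := rfl
    have h3 : substitute U [i.inv] = Instr.expand U i.inv := by simp [substitute]
    rw [h1, substitute_append, ih, h2, Circuit.inv_append, h3, Instr.expand_inv]

theorem sem_nil : sem U ([] : List (Instr U.toInterface Q)) = 1 := rfl

theorem sem_append (c d : List (Instr U.toInterface Q)) :
    sem U (c ++ d) = sem U d * sem U c := by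
  rw [sem, substitute_append, Circuit.matrix_append]; rfl

theorem sem_gate (g : Gate Q) : sem U [Instr.gate g] = g.matrix :=
  Circuit.matrix_singleton g

theorem substitute_map_gate (c : Circuit Q) :
    substitute U (c.map (Instr.gate (I := U.toInterface))) = c := by
  induction c with
  | nil => rfl
  | cons g c ih =>
    have : substitute U ((g :: c).map (Instr.gate (I := U.toInterface))) =
      g :: substitute U (c.map (Instr.gate (I := U.toInterface))) := rfl
    rw [this, ih]

theorem sem_map_gate (c : Circuit Q) :
    sem U (c.map (Instr.gate (I := U.toInterface))) = Circuit.matrix c := by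
  rw [sem, substitute_map_gate]

theorem sem_place (e : Q ↪ Q') (ctrl : Finset Q') (h : ∀ q, e q ∉ ctrl)
    (c : List (Instr U.toInterface Q)) : sem U (place e ctrl h c) = lift e ctrl (sem U c) := by
  rw [sem, substitute_place, Circuit.matrix_place]; rfl

theorem sem_on (e : Q ↪ Q') (c : List (Instr U.toInterface Q)) :
    sem U (on e c) = lift e ∅ (sem U c) :=
  sem_place _ _ _ _

theorem sem_inverse (c : List (Instr U.toInterface Q)) : sem U (inverse c) = (sem U c)ᴴ := by
  rw [sem, substitute_inverse, Circuit.matrix_inv]; rfl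

theorem sem_mul_conjTranspose (c : List (Instr U.toInterface Q)) : sem U c * (sem U c)ᴴ = 1 :=
  Circuit.matrix_mul_conjTranspose _

theorem conjTranspose_mul_sem (c : List (Instr U.toInterface Q)) : (sem U c)ᴴ * sem U c = 1 :=
  Circuit.conjTranspose_mul_matrix _

theorem cost_nil : cost U ([] : List (Instr U.toInterface Q)) = 0 := rfl

theorem cost_append (c d : List (Instr U.toInterface Q)) :
    cost U (c ++ d) = cost U c + cost U d := by
  rw [cost, substitute_append, Circuit.gates_append]; rfl

theorem cost_gate (g : Gate Q) : cost U [Instr.gate g] = g.cost := by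
  simp [cost, substitute, Instr.expand, Circuit.gates]

theorem cost_map_gate (c : Circuit Q) :
    cost U (c.map (Instr.gate (I := U.toInterface))) = Circuit.gates c := by
  rw [cost, substitute_map_gate]

theorem cost_place_le (e : Q ↪ Q') (ctrl : Finset Q') (h : ∀ q, e q ∉ ctrl)
    (c : List (Instr U.toInterface Q)) :
    cost U (place e ctrl h c) ≤ (1 + ctrl.card) * cost U c := by
  rw [cost, substitute_place]; exact Circuit.gates_place_le _ _ _ _

theorem le_cost_place (e : Q ↪ Q') (ctrl : Finset Q') (h : ∀ q, e q ∉ ctrl)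
    (c : List (Instr U.toInterface Q)) : cost U c ≤ cost U (place e ctrl h c) := by
  rw [cost, cost, substitute_place]; exact Circuit.le_gates_place _ _ _ _

theorem cost_on (e : Q ↪ Q') (c : List (Instr U.toInterface Q)) : cost U (on e c) = cost U c := by
  refine le_antisymm ?_ (le_cost_place _ _ _ _)
  simpa [on] using cost_place_le e ∅ (fun _ => Finset.notMem_empty _) c

theorem cost_inverse (c : List (Instr U.toInterface Q)) : cost U (inverse c) = cost U c := by
  rw [cost, substitute_inverse, Circuit.gates_inv]; rfl

end Prog

/-! ### One-qubit gates and reversible gates -/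

section Gates
variable {Q R : Type} [Fintype Q] [DecidableEq Q] [Fintype R] [DecidableEq R]

theorem pauliX_mem : pauliX ∈ Matrix.unitaryGroup Bool ℂ := by
  rw [Matrix.mem_unitaryGroup_iff]
  ext a b
  rcases a <;> rcases b <;> simp [pauliX, Matrix.mul_apply, Matrix.star_apply]

/-- The gate `X`. -/
noncomputable def xV : Matrix.unitaryGroup Bool ℂ := ⟨pauliX, pauliX_mem⟩

/-- The Pauli matrix `Z`. -/
def pauliZ : Matrix Bool Bool ℂ := fun a b => if a = b then (if a then -1 else 1) else 0

theorem pauliZ_mem : pauliZ ∈ Matrix.unitaryGroup Bool ℂ := by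
  rw [Matrix.mem_unitaryGroup_iff]
  ext a b
  rcases a <;> rcases b <;> simp [pauliZ, Matrix.mul_apply, Matrix.star_apply]

/-- The gate `Z`. -/
noncomputable def zV : Matrix.unitaryGroup Bool ℂ := ⟨pauliZ, pauliZ_mem⟩

/-- The scalar one-qubit gate `-1`. -/
noncomputable def negV : Matrix.unitaryGroup Bool ℂ := -1

/-- A real rotation with the matrix element `⟨0|V|0⟩ = c`, if `|c| ≤ 1`. -/
noncomputable def rotMat (c : ℝ) : Matrix Bool Bool ℂ := fun a b =>
  if a = b then (Real.cos (Real.arccos c) : ℂ)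
  else if a then (Real.sin (Real.arccos c) : ℂ) else -(Real.sin (Real.arccos c) : ℂ)

theorem rotMat_mem (c : ℝ) : rotMat c ∈ Matrix.unitaryGroup Bool ℂ := by
  rw [Matrix.mem_unitaryGroup_iff]
  have h : ((Real.cos (Real.arccos c) : ℝ) : ℂ) * (Real.cos (Real.arccos c) : ℝ) +
      ((Real.sin (Real.arccos c) : ℝ) : ℂ) * (Real.sin (Real.arccos c) : ℝ) = 1 := by
    exact_mod_cast (by nlinarith [Real.sin_sq_add_cos_sq (Real.arccos c)] :
      Real.cos (Real.arccos c) * Real.cos (Real.arccos c) +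
      Real.sin (Real.arccos c) * Real.sin (Real.arccos c) = 1)
  have hstar : star (rotMat c) = (rotMat c)ᵀ := by
    ext a b
    rw [Matrix.star_apply, Matrix.transpose_apply]
    simp only [rotMat]
    split_ifs <;> simp [← Complex.ofReal_neg, Complex.conj_ofReal, -Complex.ofReal_sin,
      -Complex.ofReal_cos]
  rw [hstar]
  ext a b
  generalize hx : ((Real.cos (Real.arccos c) : ℝ) : ℂ) = x at h
  generalize hy : ((Real.sin (Real.arccos c) : ℝ) : ℂ) = y at h
  simp only [Matrix.mul_apply, Matrix.transpose_apply, rotMat, hx, hy, Fintype.univ_bool]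
  rcases a <;> rcases b <;> simp <;> first | ring1 | linear_combination h

/-- The rotation gate with the matrix element `⟨0|V|0⟩ = c`. -/
noncomputable def rotV (c : ℝ) : Matrix.unitaryGroup Bool ℂ := ⟨rotMat c, rotMat_mem c⟩

/-- A one-qubit gate without controls. -/
def gate1 (q : Q) (V : Matrix.unitaryGroup Bool ℂ) : Gate Q :=
  ⟨q, ∅, Finset.notMem_empty _, V⟩

theorem gate1_matrix (q : Q) (V : Matrix.unitaryGroup Bool ℂ) :
    (gate1 q V).matrix = lift (single q) ∅ (unitOp V) :=
  Gate.matrix_eq_lift _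

/-- The matrix of a map of the basis states. -/
noncomputable def permMat (F : (Q → Bool) → (Q → Bool)) : Matrix (Q → Bool) (Q → Bool) ℂ :=
  fun t s => if t = F s then 1 else 0

theorem permMat_mul (G F : (Q → Bool) → (Q → Bool)) :
    permMat G * permMat F = permMat (G ∘ F) := by
  ext t s
  simp [permMat, Matrix.mul_apply]

/-- The action of a controlled NOT gate on basis states. -/
def flipIf (ctrl : Finset Q) (q : Q) (s : Q → Bool) : Q → Bool :=
  if ∀ c ∈ ctrl, s c = true then Function.update s q (!s q) else s

/-- A NOT gate with controls. -/
noncomputable def cnot (ctrl : Finset Q) (q : Q) (h : q ∉ ctrl) : Gate Q := ⟨q, ctrl, h, xV⟩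

theorem cnot_matrix (ctrl : Finset Q) (q : Q) (h : q ∉ ctrl) :
    (cnot ctrl q h).matrix = permMat (flipIf ctrl q) := by
  ext t s
  have hg : (cnot ctrl q h).matrix t s = if ∀ c ∈ ctrl, s c = true then
      if ∀ r, r ≠ q → t r = s r then pauliX (t q) (s q) else 0 else if t = s then 1 else 0 := rfl
  have hp : permMat (flipIf ctrl q) t s = if t = flipIf ctrl q s then 1 else 0 := rfl
  rw [hg, hp]
  by_cases h1 : ∀ c ∈ ctrl, s c = true
  · rw [if_pos h1, flipIf, if_pos h1]
    by_cases h3 : t = Function.update s q (!s q)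
    · rw [if_pos h3, if_pos]
      · rw [h3]; simp [pauliX]
      · intro r hr; rw [h3, Function.update_of_ne hr]
    · rw [if_neg h3]
      by_cases h2 : ∀ r, r ≠ q → t r = s r
      · have : t q = s q := by
          by_contra hne
          apply h3
          funext r
          by_cases hr : r = q
          · subst hr; simp only [Function.update_self]
            cases hs : s r <;> cases ht : t r <;> simp_all
          · rw [Function.update_of_ne hr, h2 r hr]
        rw [if_pos h2]
        simp [pauliX, this]
      · rw [if_neg h2]
  · rw [if_neg h1, flipIf, if_neg h1]

/-- NOT gates on all the qubits of a list. -/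
noncomputable def xLayer (l : List Q) : Circuit Q := l.map fun q => gate1 q xV

open Classical in
theorem xLayer_matrix (l : List Q) (hl : l.Nodup) :
    Circuit.matrix (xLayer l) = permMat fun s q => if q ∈ l then !s q else s q := by
  induction l with
  | nil =>
    ext t s
    simp only [xLayer, List.map_nil, Circuit.matrix, permMat, Matrix.one_apply, List.not_mem_nil,
      if_false]
  | cons a l ih =>
    rw [List.nodup_cons] at hl
    have h1 : xLayer (a :: l) = gate1 a xV :: xLayer l := rfl
    have h2 : gate1 a xV = cnot ∅ a (Finset.notMem_empty _) := rfl
    rw [h1, Circuit.matrix, ih hl.2, h2, cnot_matrix, permMat_mul]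
    congr 1
    funext s q
    by_cases hq : q = a
    · subst hq
      simp [flipIf, hl.1]
    · simp [flipIf, hq, Function.update_of_ne]

theorem xLayer_gates (l : List Q) : Circuit.gates (xLayer l) = l.length := by
  induction l with
  | nil => rfl
  | cons a l ih =>
    simp only [xLayer, Circuit.gates, List.map_cons, List.sum_cons, List.length_cons] at ih ⊢
    rw [ih]; simp [Gate.cost, gate1, add_comm]

theorem lift_refl (M : Matrix (Q → Bool) (Q → Bool) ℂ) :
    lift (Function.Embedding.refl Q) ∅ M = M := by
  ext t s
  simp [lift, Function.comp_def]

/-- An operator on a part of the qubits of a register acts as usual on the states for which the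
qubits outside the register are in the state `w`. -/
theorem lift_trans_mul_inj {P : Type} [Fintype P] [DecidableEq P] (j : P ↪ Q) (h : Q ↪ R)
    (w : R → Bool) (M : Matrix (P → Bool) (P → Bool) ℂ) :
    lift (j.trans h) ∅ M * inj h w = inj h w * lift j ∅ M := by
  classical
  have := lift_mul_inj (Function.Embedding.refl P) (j.trans h) h j w (fun _ => rfl)
    (fun s p hs => ⟨p, (h.injective hs).symm, rfl⟩) ∅ (by simp) M M (by
      have h1 : inj (Function.Embedding.refl P) (w ∘ (j.trans h)) = 1 := by
        ext t u
        have : Function.extend (Function.Embedding.refl P) u (w ∘ (j.trans h)) = u :=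
          extend_comp_self (Function.Embedding.refl P) u _
        rw [inj, this, Matrix.one_apply]
      rw [h1, Matrix.mul_one, Matrix.one_mul])
  simpa using this

theorem lift_mul_inj_self (h : Q ↪ R) (w : R → Bool) (M : Matrix (Q → Bool) (Q → Bool) ℂ) :
    lift h ∅ M * inj h w = inj h w * M := by
  have := lift_trans_mul_inj (Function.Embedding.refl Q) h w M
  rwa [lift_refl] at this

/-- Base change without controls, see `lift_mul_inj`. -/
theorem lift_empty_mul_inj {A P S : Type} [Fintype P] [DecidableEq P] [Fintype A] [DecidableEq A]
    [Fintype S] [DecidableEq S] (e : A ↪ P) (g : P ↪ Q) (h : S ↪ Q) (j : A ↪ S)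
    (hsq : ∀ a, h (j a) = g (e a)) (hpb : ∀ s p, h s = g p → ∃ a, j a = s ∧ e a = p)
    (C : Matrix (P → Bool) (P → Bool) ℂ) (M : Matrix (A → Bool) (A → Bool) ℂ)
    (hCM : C * zinj e = zinj e * M) :
    lift g ∅ C * zinj h = zinj h * lift j ∅ M := by
  have := lift_mul_inj e g h j (fun _ => false) hsq hpb ∅ (by simp) C M hCM
  simpa using this

end Gates

/-! ### Controlled-NOT gates of projections -/

section NotOp
variable {Q Q' R S T B : Type} [Fintype Q] [DecidableEq Q] [Fintype Q'] [DecidableEq Q']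
  [Fintype R] [DecidableEq R] [Fintype S] [DecidableEq S] [Fintype T] [DecidableEq T]
  [Fintype B] [DecidableEq B]

/-- An intertwining relation inside a right-associated product. -/
theorem reassoc {a b c d f : Type} [Fintype b] [Fintype c] [Fintype d] {A : Matrix a b ℂ}
    {z : Matrix b c ℂ} {z' : Matrix a d ℂ} {M : Matrix d c ℂ} (h : A * z = z' * M)
    (X : Matrix c f ℂ) : A * (z * X) = z' * (M * X) := by
  rw [← Matrix.mul_assoc, h, Matrix.mul_assoc]

/-- The inclusion of the first summand. -/
abbrev inlE (Q R : Type) : Q ↪ Q ⊕ R := Function.Embedding.inl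

/-- The inclusion of all the qubits except for the workspace qubits. -/
def flagEmb (Q B : Type) : Q ⊕ Unit ↪ Q ⊕ (Unit ⊕ B) :=
  (Function.Embedding.refl Q).sumMap Function.Embedding.inl

/-- A NOT gate on the qubit `q`. -/
noncomputable abbrev xOn (q : S) : Matrix (S → Bool) (S → Bool) ℂ :=
  lift (single q) ∅ (unitOp pauliX)

/-- The controlled-NOT gate `Π ⊗ X + (1 - Π) ⊗ 1`. -/
noncomputable def notOp (Pi : Matrix (Q → Bool) (Q → Bool) ℂ) :
    Matrix ((Q ⊕ Unit) → Bool) ((Q ⊕ Unit) → Bool) ℂ :=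
  1 - lift (inlE Q Unit) ∅ Pi + lift (inlE Q Unit) ∅ Pi * xOn (Sum.inr ())

/-- `C` is the controlled-NOT gate of `Π` if the workspace qubits are in state `0`. -/
def IsNot (C : Matrix ((Q ⊕ (Unit ⊕ B)) → Bool) ((Q ⊕ (Unit ⊕ B)) → Bool) ℂ)
    (Pi : Matrix (Q → Bool) (Q → Bool) ℂ) : Prop :=
  C * zinj (flagEmb Q B) = zinj (flagEmb Q B) * notOp Pi

theorem lift_single_mul_inj (h : Q ↪ S) (w : S → Bool) (q : S) (hq : q ∉ Set.range h)
    (V : Matrix Bool Bool ℂ) :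
    lift (single q) ∅ (unitOp V) * inj h w =
      V false (w q) • inj h (Function.update w q false) +
        V true (w q) • inj h (Function.update w q true) := by
  classical
  ext t u
  have hoff : ∀ r, r ∉ Set.range (single q) ↔ r ≠ q := by
    intro r; exact ⟨fun h hr => h ⟨(), hr.symm⟩, fun h ⟨_, hr⟩ => h hr.symm⟩
  have hext : ∀ b, Function.extend h u (Function.update w q b) =
      Function.update (Function.extend h u w) q b := by
    intro b
    symm
    rw [eq_extend_iff]
    constructor
    · intro r hr
      by_cases hrq : r = q
      · subst hrq; simp
      · rw [Function.update_of_ne hrq, Function.update_of_ne hrq, extend_off h u w hr]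
    · funext p
      have : h p ≠ q := fun hp => hq ⟨p, hp⟩
      simp [Function.update_of_ne this, h.injective.extend_apply]
  have hagree : ∀ b, t = Function.update (Function.extend h u w) q b ↔
      (∀ r, r ≠ q → t r = Function.extend h u w r) ∧ t q = b := by
    intro b
    constructor
    · rintro rfl
      exact ⟨fun r hr => Function.update_of_ne hr _ _, Function.update_self _ _ _⟩
    · rintro ⟨h1, rfl⟩
      funext r
      by_cases hr : r = q
      · subst hr; simp
      · rw [Function.update_of_ne hr, h1 r hr]
  rw [mul_inj_apply]
  simp only [Matrix.add_apply, Matrix.smul_apply, inj, hext, hagree, lift, hoff,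
    Finset.notMem_empty, false_imp_iff, implies_true, if_true, unitOp, smul_eq_mul,
    Function.comp_apply]
  have hs : single q () = q := rfl
  rw [hs, extend_off h u w hq]
  by_cases h1 : ∀ r, r ≠ q → t r = Function.extend h u w r
  · rw [if_pos h1]
    have h2 : ∀ b, ((∀ r, r ≠ q → t r = Function.extend h u w r) ∧ t q = b) ↔ t q = b :=
      fun b => and_iff_right h1
    simp only [h2]
    cases htq : t q <;> simp
  · rw [if_neg h1, if_neg (fun hh => h1 hh.1), if_neg (fun hh => h1 hh.1)]; simp

theorem xOn_mul_inj (h : Q ↪ S) (w : S → Bool) (q : S) (hq : q ∉ Set.range h) :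
    xOn q * inj h w = inj h (Function.update w q (!w q)) := by
  rw [lift_single_mul_inj h w q hq]
  cases w q <;> simp [pauliX]

theorem lift_notOp (j : Q ⊕ Unit ↪ S) (Pi : Matrix (Q → Bool) (Q → Bool) ℂ) :
    lift j ∅ (notOp Pi) = 1 - lift ((inlE Q Unit).trans j) ∅ Pi +
      lift ((inlE Q Unit).trans j) ∅ Pi * xOn (j (Sum.inr ())) := by
  rw [notOp, lift_add, lift_sub, lift_one, lift_mul j ∅ (fun _ => Finset.notMem_empty _), lift_trans,
    lift_trans]
  simp only [Finset.map_empty, Finset.union_empty]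
  rfl

/-- The action of a controlled-NOT gate if the qubit to be flipped is in the basis state `w`. -/
theorem lift_notOp_mul_inj (j : Q ⊕ Unit ↪ S) (h : R ↪ S) (k : Q ↪ R) (w : S → Bool)
    (hk : ∀ q, h (k q) = j (Sum.inl q)) (hq : j (Sum.inr ()) ∉ Set.range h)
    (Pi : Matrix (Q → Bool) (Q → Bool) ℂ) :
    lift j ∅ (notOp Pi) * inj h w = inj h w * (1 - lift k ∅ Pi) +
      inj h (Function.update w (j (Sum.inr ())) (!w (j (Sum.inr ())))) * lift k ∅ Pi := by
  have hjk : (inlE Q Unit).trans j = k.trans h := by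
    ext q; exact (hk q).symm
  rw [lift_notOp, hjk, Matrix.add_mul, Matrix.sub_mul, Matrix.one_mul, lift_trans_mul_inj,
    Matrix.mul_assoc, xOn_mul_inj h w _ hq, lift_trans_mul_inj, Matrix.mul_sub, Matrix.mul_one]

variable {μ₁ μ₂ : Type} {U : Encoding Gate μ₁ μ₂}

/-- A circuit for a controlled-NOT gate of a projection as a part of a larger circuit, all of
whose workspace qubits are outside the register `h`. -/
theorem IsNot.on {pc : List (Instr U.toInterface (Q ⊕ (Unit ⊕ B)))}
    {Pi : Matrix (Q → Bool) (Q → Bool) ℂ} (hpc : IsNot (sem U pc) Pi)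
    (g : Q ⊕ (Unit ⊕ B) ↪ T) (h : S ↪ T) (j : Q ⊕ Unit ↪ S)
    (hsq : ∀ a, h (j a) = g (flagEmb Q B a)) (hB : ∀ s b, h s ≠ g (Sum.inr (Sum.inr b))) :
    sem U (QEnc.on g pc) * zinj h = zinj h * lift j ∅ (notOp Pi) := by
  rw [sem_on]
  refine lift_empty_mul_inj (flagEmb Q B) g h j hsq ?_ _ _ hpc
  rintro s (q | u | b) hs
  · exact ⟨Sum.inl q, h.injective ((hsq _).trans hs.symm), rfl⟩
  · exact ⟨Sum.inr u, h.injective ((hsq _).trans hs.symm), rfl⟩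
  · exact absurd hs (hB s b)

/-- The projection `P ⊗ ⟨0|`, with `P` on the qubits `e ·`. -/
noncomputable def extP {ν : Type} (e : Q ↪ Q') (P : Matrix ν (Q → Bool) ℂ) :
    Matrix ν (Q' → Bool) ℂ := P * (zinj e)ᴴ

theorem extP_apply {ν : Type} (e : Q ↪ Q') (P : Matrix ν (Q → Bool) ℂ) (i : ν) (s : Q' → Bool)
    [Decidable (∀ q, q ∉ Set.range e → s q = false)] :
    extP e P i s = if ∀ q, q ∉ Set.range e → s q = false then P i (s ∘ e) else 0 := by
  have h := inj_mul_apply e (fun _ => false) Pᴴ s i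
  have h2 : extP e P = (zinj e * Pᴴ)ᴴ := by
    rw [Matrix.conjTranspose_mul, Matrix.conjTranspose_conjTranspose]; rfl
  rw [h2, Matrix.conjTranspose_apply, h]
  split_ifs <;> simp

theorem extP_orthonormal {ν : Type} [DecidableEq ν] (e : Q ↪ Q') (P : Matrix ν (Q → Bool) ℂ)
    (hP : P * Pᴴ = 1) : extP e P * (extP e P)ᴴ = 1 := by
  rw [extP, Matrix.conjTranspose_mul, Matrix.conjTranspose_conjTranspose, Matrix.mul_assoc,
    ← Matrix.mul_assoc _ (zinj e), inj_conjTranspose_mul_inj, Matrix.one_mul, hP]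

theorem extP_extP {ν : Type} (e : Q ↪ R) (f : R ↪ S) (P : Matrix ν (Q → Bool) ℂ) :
    extP f (extP e P) = extP (e.trans f) P := by
  rw [extP, extP, extP, Matrix.mul_assoc, ← Matrix.conjTranspose_mul]
  congr 2
  exact inj_mul_inj e f fun _ => false

/-- The orthogonal projection onto the range of `Pᴴ`. -/
noncomputable abbrev rangeProj {ν : Type} [Fintype ν] (P : Matrix ν (Q → Bool) ℂ) :
    Matrix (Q → Bool) (Q → Bool) ℂ := Pᴴ * P

theorem rangeProj_mul_self {ν : Type} [Fintype ν] [DecidableEq ν] {P : Matrix ν (Q → Bool) ℂ}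
    (hP : P * Pᴴ = 1) : rangeProj P * rangeProj P = rangeProj P := by
  rw [rangeProj, Matrix.mul_assoc, ← Matrix.mul_assoc P, hP, Matrix.one_mul]

theorem rangeProj_extP {ν : Type} [Fintype ν] (e : Q ↪ Q') (P : Matrix ν (Q → Bool) ℂ) :
    rangeProj (extP e P) = lift e ∅ (rangeProj P) * (zinj e * (zinj e)ᴴ) := by
  rw [rangeProj, extP, Matrix.conjTranspose_mul, Matrix.conjTranspose_conjTranspose,
    ← Matrix.mul_assoc (lift e ∅ _), lift_mul_inj_self, rangeProj]
  simp only [Matrix.mul_assoc]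

/-! ### Reflections -/

/-- The state `1` of the last qubit. -/
def flagOne (Q : Type) : Q ⊕ Unit → Bool := Sum.elim (fun _ => false) (fun _ => true)

theorem update_zero_flag (Q : Type) [DecidableEq Q] :
    Function.update (fun _ : Q ⊕ Unit => false) (Sum.inr ()) true = flagOne Q := by
  funext x
  rcases x with x | x <;> simp [flagOne]

theorem update_one_flag (Q : Type) [DecidableEq Q] :
    Function.update (flagOne Q) (Sum.inr ()) false = fun _ => false := by
  funext x
  rcases x with x | x <;> simp [flagOne]

theorem inr_notMem_range : (Sum.inr () : Q ⊕ Unit) ∉ Set.range (inlE Q Unit) := by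
  rintro ⟨x, hx⟩; cases hx

variable (Q) in
/-- The isometry that adds a qubit in state `0`. -/
noncomputable def ket0 : Matrix ((Q ⊕ Unit) → Bool) (Q → Bool) ℂ := zinj (inlE Q Unit)

variable (Q) in
/-- The isometry that adds a qubit in state `1`. -/
noncomputable def ket1 : Matrix ((Q ⊕ Unit) → Bool) (Q → Bool) ℂ := inj (inlE Q Unit) (flagOne Q)

theorem notOp_mul_ket0 (Pi : Matrix (Q → Bool) (Q → Bool) ℂ) :
    notOp Pi * ket0 Q = ket0 Q * (1 - Pi) + ket1 Q * Pi := by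
  have h := lift_notOp_mul_inj (Function.Embedding.refl (Q ⊕ Unit)) (inlE Q Unit)
    (Function.Embedding.refl Q) (fun _ => false) (fun _ => rfl) inr_notMem_range Pi
  rw [lift_refl, lift_refl] at h
  rw [ket0, ket1, ← update_zero_flag]
  exact h

theorem notOp_mul_ket1 (Pi : Matrix (Q → Bool) (Q → Bool) ℂ) :
    notOp Pi * ket1 Q = ket1 Q * (1 - Pi) + ket0 Q * Pi := by
  have h := lift_notOp_mul_inj (Function.Embedding.refl (Q ⊕ Unit)) (inlE Q Unit)
    (Function.Embedding.refl Q) (flagOne Q) (fun _ => rfl) inr_notMem_range Pi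
  rw [lift_refl, lift_refl] at h
  rw [ket0, zinj, ← update_one_flag]
  exact h

theorem bra0_mul_ket0 : (ket0 Q)ᴴ * ket0 Q = 1 := inj_conjTranspose_mul_inj _ _

theorem bra0_mul_ket1 : (ket0 Q)ᴴ * ket1 Q = 0 := by
  ext u v
  rw [ket0, inj_conjTranspose_mul_apply, ket1, inj, if_neg]
  · rfl
  · intro h
    have := congrFun h (Sum.inr ())
    rw [extend_off _ _ _ inr_notMem_range, extend_off _ _ _ inr_notMem_range] at this
    simp [flagOne] at this

variable (B) in
theorem zinj_flagEmb_mul : zinj (flagEmb Q B) * ket0 Q = zinj (inlE Q (Unit ⊕ B)) :=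
  inj_mul_inj (inlE Q Unit) (flagEmb Q B) fun _ => false

/-- A one-qubit gate on a qubit in state `0`. -/
theorem gate_mul_ket0 (V : Matrix Bool Bool ℂ) :
    lift (single (Sum.inr () : Q ⊕ Unit)) ∅ (unitOp V) * ket0 Q =
      V false false • ket0 Q + V true false • ket1 Q := by
  have h1 := lift_single_mul_inj (inlE Q Unit) (fun _ => false) (Sum.inr ())
    inr_notMem_range V
  rw [update_zero_flag] at h1
  have e2 : Function.update (fun _ : Q ⊕ Unit => false) (Sum.inr ()) false = fun _ => false := by
    rw [Function.update_eq_self_iff]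
  rw [e2] at h1
  exact h1

/-- A one-qubit gate on a qubit in state `1`. -/
theorem gate_mul_ket1 (V : Matrix Bool Bool ℂ) :
    lift (single (Sum.inr () : Q ⊕ Unit)) ∅ (unitOp V) * ket1 Q =
      V false true • ket0 Q + V true true • ket1 Q := by
  have h1 := lift_single_mul_inj (inlE Q Unit) (flagOne Q) (Sum.inr ())
    inr_notMem_range V
  have e2 : Function.update (flagOne Q) (Sum.inr ()) true = flagOne Q := by
    rw [Function.update_eq_self_iff]; rfl
  rw [e2, update_one_flag] at h1
  exact h1

/-- The reflection `1 - 2 Π`, implemented by two controlled-NOT gates of `Π` and a gate `Z` between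
them. -/
noncomputable def reflect {I : Interface μ₁ μ₂} (pc : List (Instr I (Q ⊕ (Unit ⊕ B)))) :
    List (Instr I (Q ⊕ (Unit ⊕ B))) :=
  pc ++ (Instr.gate (gate1 (Sum.inr (Sum.inl ())) zV) :: pc)

theorem sem_reflect {pc : List (Instr U.toInterface (Q ⊕ (Unit ⊕ B)))}
    {Pi : Matrix (Q → Bool) (Q → Bool) ℂ} (hpc : IsNot (sem U pc) Pi) (hPi : Pi * Pi = Pi) :
    sem U (reflect pc) * zinj (inlE Q (Unit ⊕ B)) =
      zinj (inlE Q (Unit ⊕ B)) * (1 - 2 * Pi) := by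
  have h0 : reflect pc = pc ++ ([Instr.gate (gate1 (Sum.inr (Sum.inl ())) zV)] ++ pc) := rfl
  have hZ : (gate1 (Sum.inr (Sum.inl ()) : Q ⊕ (Unit ⊕ B)) zV).matrix * zinj (flagEmb Q B) =
      zinj (flagEmb Q B) * lift (single (Sum.inr ())) ∅ (unitOp pauliZ) :=
    (congrArg (· * zinj (flagEmb Q B)) (gate1_matrix _ _)).trans
      (lift_trans_mul_inj (single (Sum.inr ())) (flagEmb Q B) _ _)
  have hidem : Pi * (1 - Pi) = 0 := by rw [Matrix.mul_sub, Matrix.mul_one, hPi, sub_self]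
  have hidem' : (1 - Pi) * Pi = 0 := by rw [Matrix.sub_mul, Matrix.one_mul, hPi, sub_self]
  have hidem2 : (1 - Pi) * (1 - Pi) = 1 - Pi := by
    rw [Matrix.mul_sub, Matrix.mul_one, hidem', sub_zero]
  have h1 : lift (single (Sum.inr () : Q ⊕ Unit)) ∅ (unitOp pauliZ) * ket0 Q = ket0 Q := by
    rw [gate_mul_ket0]; simp [pauliZ]
  have h2 : lift (single (Sum.inr () : Q ⊕ Unit)) ∅ (unitOp pauliZ) * ket1 Q = -ket1 Q := by
    rw [gate_mul_ket1]; simp [pauliZ]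
  have hN : sem U pc * zinj (flagEmb Q B) = zinj (flagEmb Q B) * notOp Pi := hpc
  have key : notOp Pi * (lift (single (Sum.inr () : Q ⊕ Unit)) ∅ (unitOp pauliZ) *
      (notOp Pi * ket0 Q)) = ket0 Q * (1 - 2 * Pi) := by
    rw [notOp_mul_ket0, Matrix.mul_add, ← Matrix.mul_assoc _ (ket0 Q), h1,
      ← Matrix.mul_assoc _ (ket1 Q), h2, Matrix.neg_mul, ← sub_eq_add_neg, Matrix.mul_sub,
      ← Matrix.mul_assoc, notOp_mul_ket0, ← Matrix.mul_assoc, notOp_mul_ket1,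
      Matrix.add_mul, Matrix.add_mul, Matrix.mul_assoc _ _ (1 - Pi), Matrix.mul_assoc _ Pi,
      hidem, Matrix.mul_assoc _ _ Pi, hidem', Matrix.mul_assoc _ Pi Pi, hPi, hidem2,
      Matrix.mul_zero, add_zero, zero_add, ← Matrix.mul_sub, two_mul]
    congr 1; abel
  rw [h0, sem_append, sem_append, sem_gate, ← zinj_flagEmb_mul B]
  simp only [Matrix.mul_assoc]
  rw [reassoc hN, reassoc hZ, reassoc hN, key]

theorem cost_reflect (pc : List (Instr U.toInterface (Q ⊕ (Unit ⊕ B)))) :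
    cost U (reflect pc) = 2 * cost U pc + 1 := by
  have h0 : reflect pc = pc ++ ([Instr.gate (gate1 (Sum.inr (Sum.inl ())) zV)] ++ pc) := rfl
  rw [h0, cost_append, cost_append, cost_gate]
  simp [Gate.cost, gate1]; ring

end NotOp

/-! ### Projections on a larger register -/

section ExtProj
variable {Q Q' S B : Type} [Fintype Q] [DecidableEq Q] [Fintype Q'] [DecidableEq Q']
  [Fintype S] [DecidableEq S] [Fintype B] [DecidableEq B]
variable {μ₁ μ₂ : Type} {U : Encoding Gate μ₁ μ₂}

open Classical in
/-- The qubits outside a register. -/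
noncomputable def outside (e : Q ↪ Q') : Finset Q' := Finset.univ.filter (· ∉ Set.range e)

theorem mem_outside (e : Q ↪ Q') (q : Q') : q ∈ outside e ↔ q ∉ Set.range e := by
  simp [outside]

theorem card_outside (e : Q ↪ Q') : (outside e).card + Fintype.card Q = Fintype.card Q' := by
  classical
  have h1 : outside e = (Finset.univ.map e)ᶜ := by
    ext q; simp [mem_outside]
  have h2 := Finset.card_compl_add_card (Finset.univ.map e)
  rw [h1]
  simpa using h2

/-- The qubit to be flipped, inside the register with one workspace qubit. -/
abbrev flagQ : Q' ⊕ (Unit ⊕ Unit) := Sum.inr (Sum.inl ())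

/-- The workspace qubit. -/
abbrev workQ : Q' ⊕ (Unit ⊕ Unit) := Sum.inr (Sum.inr ())

/-- A controlled NOT gate that is applied if all the qubits outside `e` are in state `0` and the
workspace qubit is in state `1`. -/
noncomputable def zeroCheck (e : Q ↪ Q') : Circuit (Q' ⊕ (Unit ⊕ Unit)) :=
  xLayer ((outside e).toList.map Sum.inl) ++
    (cnot (insert workQ ((outside e).map Function.Embedding.inl)) flagQ (by simp) ::
      xLayer ((outside e).toList.map Sum.inl))

open Classical in
/-- The action of `zeroCheck` on basis states. -/
noncomputable def zeroCheckFun (e : Q ↪ Q') (s : Q' ⊕ (Unit ⊕ Unit) → Bool) :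
    Q' ⊕ (Unit ⊕ Unit) → Bool :=
  if s workQ = true ∧ ∀ q, q ∉ Set.range e → s (Sum.inl q) = false then
    Function.update s flagQ (!s flagQ) else s

theorem zeroCheck_matrix (e : Q ↪ Q') :
    Circuit.matrix (zeroCheck e) = permMat (zeroCheckFun e) := by
  classical
  have hnd : ((outside e).toList.map (Sum.inl : Q' → Q' ⊕ (Unit ⊕ Unit))).Nodup :=
    (Finset.nodup_toList _).map Sum.inl_injective
  rw [zeroCheck, Circuit.matrix_append, Circuit.matrix, xLayer_matrix _ hnd, cnot_matrix,
    permMat_mul, permMat_mul]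
  congr 1
  funext s
  simp only [Function.comp_apply]
  have hmem : ∀ x : Q' ⊕ (Unit ⊕ Unit), x ∈ (outside e).toList.map Sum.inl ↔
      ∃ q, q ∉ Set.range e ∧ Sum.inl q = x := by
    intro x; simp [mem_outside]
  have hL : ∀ x : Q' ⊕ (Unit ⊕ Unit), (∃ q, q ∉ Set.range e ∧ Sum.inl q = x) ∨
      ¬ ∃ q, q ∉ Set.range e ∧ Sum.inl q = x := fun x => em _
  simp only [hmem]
  have hw : ¬ ∃ q, q ∉ Set.range e ∧ (Sum.inl q : Q' ⊕ (Unit ⊕ Unit)) = workQ := by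
    rintro ⟨q, -, hq⟩; cases hq
  have hf : ¬ ∃ q, q ∉ Set.range e ∧ (Sum.inl q : Q' ⊕ (Unit ⊕ Unit)) = flagQ := by
    rintro ⟨q, -, hq⟩; cases hq
  have hcond : (∀ c ∈ insert workQ ((outside e).map Function.Embedding.inl),
      (if ∃ q, q ∉ Set.range e ∧ (Sum.inl q : Q' ⊕ (Unit ⊕ Unit)) = c then !s c else s c) = true) ↔
      (s workQ = true ∧ ∀ q, q ∉ Set.range e → s (Sum.inl q) = false) := by
    rw [Finset.forall_mem_insert, if_neg hw]
    refine and_congr Iff.rfl ?_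
    simp only [Finset.mem_map, mem_outside]
    constructor
    · intro h q hq
      have := h (Sum.inl q) ⟨q, hq, rfl⟩
      rw [if_pos ⟨q, hq, rfl⟩] at this
      simpa using this
    · rintro h c ⟨q, hq, rfl⟩
      rw [if_pos ⟨q, hq, rfl⟩]
      have := h q hq
      simp only [Function.Embedding.inl_apply, this, Bool.not_false]
  rw [flipIf, zeroCheckFun]
  simp only [hcond]
  by_cases hc : s workQ = true ∧ ∀ q, q ∉ Set.range e → s (Sum.inl q) = false
  · rw [if_pos hc, if_pos hc]
    funext x
    by_cases hx : x = flagQ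
    · subst hx
      rw [if_neg hf, Function.update_self, Function.update_self, if_neg hf]
    · rw [Function.update_of_ne hx, Function.update_of_ne hx]
      by_cases h : ∃ q, q ∉ Set.range e ∧ (Sum.inl q : Q' ⊕ (Unit ⊕ Unit)) = x
      · rw [if_pos h, if_pos h, Bool.not_not]
      · rw [if_neg h, if_neg h]
  · rw [if_neg hc, if_neg hc]
    funext x
    by_cases h : ∃ q, q ∉ Set.range e ∧ (Sum.inl q : Q' ⊕ (Unit ⊕ Unit)) = x
    · rw [if_pos h, if_pos h, Bool.not_not]
    · rw [if_neg h, if_neg h]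

theorem zeroCheck_gates (e : Q ↪ Q') :
    Circuit.gates (zeroCheck e) = 3 * (outside e).card + 2 := by
  have h : zeroCheck e = xLayer ((outside e).toList.map Sum.inl) ++
    ([cnot (insert workQ ((outside e).map Function.Embedding.inl)) flagQ (by simp)] ++
      xLayer ((outside e).toList.map Sum.inl)) := rfl
  rw [h, Circuit.gates_append, Circuit.gates_append, xLayer_gates]
  have : workQ ∉ (outside e).map (Function.Embedding.inl (β := Unit ⊕ Unit)) := by simp
  simp [Circuit.gates, Gate.cost, cnot, Finset.card_insert_of_notMem this]
  ring

/-- The register of a smaller controlled-NOT gate, which flips a workspace qubit. -/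
def extEmb (e : Q ↪ Q') (B : Type) : Q ⊕ (Unit ⊕ B) ↪ Q' ⊕ (Unit ⊕ (Unit ⊕ B)) :=
  e.sumMap Function.Embedding.inr

/-- All the qubits except for the workspace of the smaller controlled-NOT gate. -/
def checkEmb (Q' B : Type) : Q' ⊕ (Unit ⊕ Unit) ↪ Q' ⊕ (Unit ⊕ (Unit ⊕ B)) :=
  (Function.Embedding.refl Q').sumMap
    ((Function.Embedding.refl Unit).sumMap Function.Embedding.inl)

/-- A circuit for the controlled-NOT gate of `P ⊗ ⟨0|`, obtained from a circuit for the
controlled-NOT gate of `P`. -/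
noncomputable def extProj {I : Interface μ₁ μ₂} (e : Q ↪ Q')
    (pc : List (Instr I (Q ⊕ (Unit ⊕ B)))) : List (Instr I (Q' ⊕ (Unit ⊕ (Unit ⊕ B)))) :=
  on (extEmb e B) pc ++ (on (checkEmb Q' B) ((zeroCheck e).map Instr.gate) ++ on (extEmb e B) pc)

theorem cost_extProj (e : Q ↪ Q') (pc : List (Instr U.toInterface (Q ⊕ (Unit ⊕ B)))) :
    cost U (extProj e pc) = 2 * cost U pc + 3 * (outside e).card + 2 := by
  rw [extProj, cost_append, cost_append, cost_on, cost_on, cost_map_gate, zeroCheck_gates]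
  ring

/-- The operator that flips the last qubit if all the qubits outside `e` are in state `0`. -/
noncomputable def zeroFlip (e : Q ↪ Q') : Matrix ((Q' ⊕ Unit) → Bool) ((Q' ⊕ Unit) → Bool) ℂ :=
  1 - lift (inlE Q' Unit) ∅ (zinj e * (zinj e)ᴴ) +
    lift (inlE Q' Unit) ∅ (zinj e * (zinj e)ᴴ) * xOn (Sum.inr ())

open Classical in
theorem zinj_mul_conjTranspose_apply (e : Q ↪ Q') (t s : Q' → Bool) :
    (zinj e * (zinj e)ᴴ) t s = if t = s ∧ ∀ q, q ∉ Set.range e → s q = false then 1 else 0 := by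
  rw [inj_mul_apply, Matrix.conjTranspose_apply, zinj, inj]
  by_cases h : t = s
  · subst h
    by_cases h2 : ∀ q, q ∉ Set.range e → t q = false
    · rw [if_pos h2, if_pos ((eq_extend_iff e t _ _).2 ⟨h2, rfl⟩), star_one,
        if_pos (And.intro rfl h2)]
    · rw [if_neg h2, if_neg (fun h : _ ∧ _ => h2 h.2)]
  · rw [if_neg (fun h' : _ ∧ _ => h h'.1)]
    split_ifs with h2 h3
    · exfalso
      apply h
      rw [eq_extend_iff] at h3
      rw [(eq_extend_iff e t (fun _ => false) (t ∘ e)).2 ⟨h2, rfl⟩]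
      exact ((eq_extend_iff e s _ _).2 h3).symm
    · simp
    · rfl

theorem zeroFlip_apply (e : Q ↪ Q') (t s : (Q' ⊕ Unit) → Bool)
    [Decidable (∀ q, q ∉ Set.range e → s (Sum.inl q) = false)] :
    zeroFlip e t s = if t = (if ∀ q, q ∉ Set.range e → s (Sum.inl q) = false then
      Function.update s (Sum.inr ()) (!s (Sum.inr ())) else s) then 1 else 0 := by
  classical
  have hD : lift (inlE Q' Unit) ∅ (zinj e * (zinj e)ᴴ) = Matrix.diagonal fun s =>
      if ∀ q, q ∉ Set.range e → s (Sum.inl q) = false then (1 : ℂ) else 0 := by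
    ext t s
    rw [lift, if_pos (by simp), zinj_mul_conjTranspose_apply, Matrix.diagonal_apply]
    by_cases h : t = s
    · subst h; simp
    · rw [if_neg h]
      split_ifs with h1 h2
      · exact absurd ((eq_iff_agree (inlE Q' Unit) t s).2 ⟨h1, h2.1⟩) h
      · rfl
      · rfl
  have hX : xOn (Sum.inr () : Q' ⊕ Unit) = permMat (flipIf ∅ (Sum.inr ())) := by
    rw [← cnot_matrix _ _ (Finset.notMem_empty _), Gate.matrix_eq_lift]; rfl
  rw [zeroFlip, hD, hX, Matrix.add_apply, Matrix.sub_apply, Matrix.diagonal_mul,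
    Matrix.one_apply, Matrix.diagonal_apply, permMat]
  have hfl : flipIf ∅ (Sum.inr ()) s = Function.update s (Sum.inr ()) (!s (Sum.inr ())) := by
    simp [flipIf]
  rw [hfl]
  have hne : s ≠ Function.update s (Sum.inr ()) (!s (Sum.inr ())) := by
    intro h
    have := congrFun h (Sum.inr ())
    simp at this
  by_cases h : ∀ q, q ∉ Set.range e → s (Sum.inl q) = false
  · rw [if_pos h]
    by_cases h1 : t = Function.update s (Sum.inr ()) (!s (Sum.inr ()))
    · have : ∀ q, q ∉ Set.range e → t (Sum.inl q) = false := by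
        intro q hq; rw [h1, Function.update_of_ne (by simp)]; exact h q hq
      rw [if_pos h1, if_pos this, if_neg (fun hts => hne (hts.symm.trans h1))]
      simp
    · rw [if_neg h1]
      by_cases h2 : t = s
      · subst h2; rw [if_pos h]; simp
      · simp [h2]
  · rw [if_neg h]
    by_cases h1 : t = Function.update s (Sum.inr ()) (!s (Sum.inr ()))
    · have : ¬ ∀ q, q ∉ Set.range e → t (Sum.inl q) = false := by
        intro hh; apply h; intro q hq
        have := hh q hq
        rwa [h1, Function.update_of_ne (by simp)] at this
      rw [if_neg this, if_neg (fun hts => hne (hts.symm.trans h1))]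
      simp
    · rw [if_neg h1]
      by_cases h2 : t = s
      · subst h2; simp only [if_true]; rw [if_neg h]; simp
      · simp [h2]

/-- The state of the workspace qubit is `1`. -/
def workOne (Q' : Type) : Q' ⊕ (Unit ⊕ Unit) → Bool :=
  Sum.elim (fun _ => false) (Sum.elim (fun _ => false) fun _ => true)

theorem workQ_notMem : (workQ : Q' ⊕ (Unit ⊕ Unit)) ∉ Set.range (flagEmb Q' Unit) := by
  rintro ⟨x | x, hx⟩
  · cases hx
  · cases Sum.inr.inj hx

theorem zeroCheck_mul_zinj (e : Q ↪ Q') :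
    Circuit.matrix (zeroCheck e) * zinj (flagEmb Q' Unit) = zinj (flagEmb Q' Unit) := by
  ext t u
  have h : zeroCheckFun e (Function.extend (flagEmb Q' Unit) u fun _ => false) =
      Function.extend (flagEmb Q' Unit) u fun _ => false := by
    rw [zeroCheckFun, if_neg]
    rintro ⟨h, -⟩
    rw [extend_off _ _ _ workQ_notMem] at h
    cases h
  rw [mul_inj_apply, zeroCheck_matrix, permMat, h, zinj, inj]

theorem zeroCheck_mul_inj (e : Q ↪ Q') :
    Circuit.matrix (zeroCheck e) * inj (flagEmb Q' Unit) (workOne Q') =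
      inj (flagEmb Q' Unit) (workOne Q') * zeroFlip e := by
  classical
  ext t u
  rw [mul_inj_apply, zeroCheck_matrix, permMat, inj_mul_apply, zeroFlip_apply, zeroCheckFun,
    ← ite_and]
  congr 1
  have h0 : Function.extend (flagEmb Q' Unit) u (workOne Q') workQ = true :=
    extend_off _ _ _ workQ_notMem
  have h1 : ∀ q, Function.extend (flagEmb Q' Unit) u (workOne Q') (Sum.inl q) = u (Sum.inl q) :=
    fun q => (flagEmb Q' Unit).injective.extend_apply u (workOne Q') (Sum.inl q)
  have h2 : Function.extend (flagEmb Q' Unit) u (workOne Q') flagQ = u (Sum.inr ()) :=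
    (flagEmb Q' Unit).injective.extend_apply u (workOne Q') (Sum.inr ())
  have hu : ∀ b, Function.update (Function.extend (flagEmb Q' Unit) u (workOne Q')) flagQ b =
      Function.extend (flagEmb Q' Unit) (Function.update u (Sum.inr ()) b) (workOne Q') := by
    intro b
    rw [eq_extend_iff]
    constructor
    · intro q hq
      rw [Function.update_of_ne, extend_off _ _ _ hq]
      rintro rfl
      exact hq ⟨Sum.inr (), rfl⟩
    · funext x
      have hx := (flagEmb Q' Unit).injective.extend_apply u (workOne Q') x
      rcases x with x | x
      · rw [Function.comp_apply, Function.update_of_ne (by intro h; cases h),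
          Function.update_of_ne]
        · exact hx
        · intro h; cases h
      · simp [flagEmb, flagQ]
  simp only [h0, h1, h2, true_and, hu]
  rw [← eq_extend_iff]
  split_ifs <;> rfl

/-- The controlled-NOT gate of `P` is applied to an additional workspace qubit, the result is
combined with the check of the remaining qubits, and the workspace qubit is uncomputed. -/
theorem isNot_extProj {ν : Type} [Fintype ν] [DecidableEq ν] (e : Q ↪ Q')
    {pc : List (Instr U.toInterface (Q ⊕ (Unit ⊕ B)))} {P : Matrix ν (Q → Bool) ℂ}
    (hP : P * Pᴴ = 1) (hpc : IsNot (sem U pc) (rangeProj P)) :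
    IsNot (sem U (extProj e pc)) (rangeProj (extP e P)) := by
  have hF : zinj (checkEmb Q' B) * zinj (flagEmb Q' Unit) = zinj (flagEmb Q' (Unit ⊕ B)) := by
    have : (flagEmb Q' Unit).trans (checkEmb Q' B) = flagEmb Q' (Unit ⊕ B) := by
      ext x; rcases x with x | x <;> rfl
    rw [← this]
    exact inj_mul_inj (flagEmb Q' Unit) (checkEmb Q' B) fun _ => false
  -- the register of the smaller gate inside the register without its workspace
  set j : Q ⊕ Unit ↪ Q' ⊕ (Unit ⊕ Unit) := e.sumMap Function.Embedding.inr with hj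
  set Pi := rangeProj P with hPi
  set A := lift (e.trans (inlE Q' Unit)) ∅ Pi with hA
  have hAA : A * A = A := by
    rw [hA, ← lift_mul _ _ (fun _ => Finset.notMem_empty _), hPi, rangeProj_mul_self hP]
  have h1 : sem U (on (extEmb e B) pc) * zinj (checkEmb Q' B) =
      zinj (checkEmb Q' B) * lift j ∅ (notOp Pi) := by
    refine hpc.on (extEmb e B) (checkEmb Q' B) j ?_ ?_
    · rintro (x | x) <;> rfl
    · rintro (s | s | s) b h
      · cases h
      · cases Sum.inr.inj h
      · cases Sum.inr.inj (Sum.inr.inj h)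
  have h2 : sem U (on (checkEmb Q' B) ((zeroCheck e).map Instr.gate)) * zinj (checkEmb Q' B) =
      zinj (checkEmb Q' B) * Circuit.matrix (zeroCheck e) := by
    rw [sem_on, sem_map_gate, lift_mul_inj_self]
  have hup1 : Function.update (fun _ : Q' ⊕ (Unit ⊕ Unit) => false) workQ true = workOne Q' := by
    funext x; rcases x with x | x | x <;> simp [workOne, workQ]
  have hup2 : Function.update (workOne Q') workQ false = fun _ => false := by
    funext x; rcases x with x | x | x <;> simp [workOne, workQ]
  have h3 : lift j ∅ (notOp Pi) * zinj (flagEmb Q' Unit) =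
      zinj (flagEmb Q' Unit) * (1 - A) + inj (flagEmb Q' Unit) (workOne Q') * A := by
    have := lift_notOp_mul_inj j (flagEmb Q' Unit) (e.trans (inlE Q' Unit)) (fun _ => false)
      (fun _ => rfl) workQ_notMem Pi
    rw [← hup1]
    exact this
  have h4 : lift j ∅ (notOp Pi) * inj (flagEmb Q' Unit) (workOne Q') =
      inj (flagEmb Q' Unit) (workOne Q') * (1 - A) + zinj (flagEmb Q' Unit) * A := by
    have := lift_notOp_mul_inj j (flagEmb Q' Unit) (e.trans (inlE Q' Unit)) (workOne Q')
      (fun _ => rfl) workQ_notMem Pi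
    rw [zinj, ← hup2]
    exact this
  set D := lift (inlE Q' Unit) ∅ (zinj e * (zinj e)ᴴ) with hD
  have hext : lift (inlE Q' Unit) ∅ (rangeProj (extP e P)) = A * D := by
    rw [rangeProj_extP, lift_mul _ _ (fun _ => Finset.notMem_empty _), lift_trans]
    simp only [Finset.map_empty, Finset.union_empty]
    rfl
  have hDA : D * A = A * D := by
    have hz : zinj e * (zinj e)ᴴ * lift e ∅ Pi = lift e ∅ Pi * (zinj e * (zinj e)ᴴ) := by
      have hherm : Piᴴ = Pi := by
        rw [hPi, rangeProj, Matrix.conjTranspose_mul, Matrix.conjTranspose_conjTranspose]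
      have hl : lift e ∅ Pi * zinj e = zinj e * Pi := lift_mul_inj_self e (fun _ => false) Pi
      have hl2 : (zinj e)ᴴ * lift e ∅ Pi = Pi * (zinj e)ᴴ := by
        have := congrArg Matrix.conjTranspose hl
        rwa [Matrix.conjTranspose_mul, Matrix.conjTranspose_mul, hherm,
          lift_conjTranspose _ _ (fun _ => Finset.notMem_empty _), hherm] at this
      rw [← Matrix.mul_assoc (lift e ∅ Pi), hl, Matrix.mul_assoc, hl2, ← Matrix.mul_assoc]
    have hA' : A = lift (inlE Q' Unit) ∅ (lift e ∅ Pi) := by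
      rw [lift_trans]; simp only [Finset.map_empty, Finset.union_empty]; rfl
    rw [hA', hD, ← lift_mul _ _ (fun _ => Finset.notMem_empty _), hz,
      lift_mul _ _ (fun _ => Finset.notMem_empty _)]
  have hXA : xOn (Sum.inr ()) * A = A * xOn (Sum.inr ()) :=
    lift_commute (single (Sum.inr ())) (e.trans (inlE Q' Unit)) (fun p r h => by cases h) _ _
  have hZA : zeroFlip e * A = A * zeroFlip e := by
    rw [zeroFlip, ← hD, Matrix.add_mul, Matrix.sub_mul, Matrix.mul_add, Matrix.mul_sub,
      Matrix.one_mul, Matrix.mul_one, hDA, Matrix.mul_assoc, hXA, ← Matrix.mul_assoc, hDA,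
      Matrix.mul_assoc]
  have hA0 : A * (1 - A) = 0 := by rw [Matrix.mul_sub, Matrix.mul_one, hAA, sub_self]
  have hA1 : (1 - A) * A = 0 := by rw [Matrix.sub_mul, Matrix.one_mul, hAA, sub_self]
  have hA2 : (1 - A) * (1 - A) = 1 - A := by rw [Matrix.mul_sub, Matrix.mul_one, hA1, sub_zero]
  have hfinal : notOp (rangeProj (extP e P)) = (1 - A) + A * zeroFlip e := by
    rw [notOp, hext, zeroFlip, ← hD, Matrix.mul_add, Matrix.mul_sub, Matrix.mul_one,
      Matrix.mul_assoc]
    abel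
  have key : lift j ∅ (notOp Pi) * (Circuit.matrix (zeroCheck e) *
      (lift j ∅ (notOp Pi) * zinj (flagEmb Q' Unit))) =
      zinj (flagEmb Q' Unit) * notOp (rangeProj (extP e P)) := by
    rw [h3, Matrix.mul_add, ← Matrix.mul_assoc _ (zinj (flagEmb Q' Unit)), zeroCheck_mul_zinj,
      ← Matrix.mul_assoc _ (inj (flagEmb Q' Unit) (workOne Q')), zeroCheck_mul_inj,
      Matrix.mul_assoc _ (zeroFlip e), hZA, Matrix.mul_add,
      ← Matrix.mul_assoc _ (zinj (flagEmb Q' Unit)), h3,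
      ← Matrix.mul_assoc _ (inj (flagEmb Q' Unit) (workOne Q')), h4, Matrix.add_mul, Matrix.add_mul,
      Matrix.mul_assoc _ (1 - A), hA2, Matrix.mul_assoc _ A (1 - A), hA0,
      Matrix.mul_assoc _ (1 - A), ← Matrix.mul_assoc (1 - A) A, hA1, Matrix.zero_mul,
      Matrix.mul_zero, add_zero, zero_add, Matrix.mul_assoc _ A,
      ← Matrix.mul_assoc A A, hAA, hfinal, Matrix.mul_add]
  rw [IsNot, extProj, sem_append, sem_append, ← hF]
  simp only [Matrix.mul_assoc]
  rw [reassoc h1, reassoc h2, reassoc h1, key]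

end ExtProj

/-! ### Block encodings on arbitrary registers -/

/-- The data of a block encoding, with calls to an input with the interface `I`. The qubits `Q` and
the workspace qubits `B₁`, `B₂` of the two projection gates may be any finite types. -/
structure Blk {μ₁ μ₂ : Type} (I : Interface μ₁ μ₂) (ν₁ ν₂ : Type) where
  Q : Type
  B₁ : Type
  B₂ : Type
  [fQ : Fintype Q]
  [dQ : DecidableEq Q]
  [fB₁ : Fintype B₁]
  [dB₁ : DecidableEq B₁]
  [fB₂ : Fintype B₂]
  [dB₂ : DecidableEq B₂]
  circ : List (Instr I Q)
  proj₁ : List (Instr I (Q ⊕ (Unit ⊕ B₁)))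
  proj₂ : List (Instr I (Q ⊕ (Unit ⊕ B₂)))
  P₁ : Matrix ν₁ (Q → Bool) ℂ
  P₂ : Matrix ν₂ (Q → Bool) ℂ

attribute [instance] Blk.fQ Blk.dQ Blk.fB₁ Blk.dB₁ Blk.fB₂ Blk.dB₂

section Blk
variable {μ₁ μ₂ ν₁ ν₂ : Type} {U : Encoding Gate μ₁ μ₂}
  [Fintype ν₁] [DecidableEq ν₁] [Fintype ν₂] [DecidableEq ν₂]

variable (U) in
/-- The circuits implement what they should, for the input `U`. -/
structure Blk.Valid (T : Blk U.toInterface ν₁ ν₂) : Prop where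
  orth₁ : T.P₁ * T.P₁ᴴ = 1
  orth₂ : T.P₂ * T.P₂ᴴ = 1
  not₁ : IsNot (sem U T.proj₁) (rangeProj T.P₁)
  not₂ : IsNot (sem U T.proj₂) (rangeProj T.P₂)
  card₁ : Fintype.card T.B₁ ≤ cost U T.proj₁
  card₂ : Fintype.card T.B₂ ≤ cost U T.proj₂

variable (U) in
/-- The encoded block. -/
noncomputable def Blk.block (T : Blk U.toInterface ν₁ ν₂) : Matrix ν₂ ν₁ ℂ :=
  T.P₂ * (sem U T.circ * T.P₁ᴴ)

/-- The projection `⟨0|` on all the qubits. -/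
def zeroBra (Q : Type) [Fintype Q] [DecidableEq Q] : Matrix Unit (Q → Bool) ℂ :=
  fun _ s => if s = (fun _ => false) then 1 else 0

theorem extP_zeroBra {Q Q' : Type} [Fintype Q] [DecidableEq Q] [Fintype Q'] [DecidableEq Q']
    (e : Q ↪ Q') : extP e (zeroBra Q) = zeroBra Q' := by
  classical
  ext i s
  rw [extP_apply, zeroBra, zeroBra, ← ite_and]
  congr 1
  rw [eq_iff_iff, eq_iff_agree e s fun _ => false]
  rfl

/-- The circuit `c` between two projections that live on registers of the qubits of `c`. -/
noncomputable def assemble {I : Interface μ₁ μ₂} {Q Q₁ Q₂ B₁ B₂ : Type} [Fintype Q] [DecidableEq Q]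
    [Fintype Q₁] [DecidableEq Q₁] [Fintype Q₂] [DecidableEq Q₂]
    [Fintype B₁] [DecidableEq B₁] [Fintype B₂] [DecidableEq B₂]
    (c : List (Instr I Q)) (e₁ : Q₁ ↪ Q) (e₂ : Q₂ ↪ Q)
    (p₁ : List (Instr I (Q ⊕ (Unit ⊕ (Unit ⊕ B₁)))))
    (p₂ : List (Instr I (Q ⊕ (Unit ⊕ (Unit ⊕ B₂)))))
    (P₁ : Matrix ν₁ (Q₁ → Bool) ℂ) (P₂ : Matrix ν₂ (Q₂ → Bool) ℂ) : Blk I ν₁ ν₂ where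
  Q := Q
  B₁ := Unit ⊕ B₁
  B₂ := Unit ⊕ B₂
  circ := c
  proj₁ := p₁
  proj₂ := p₂
  P₁ := extP e₁ P₁
  P₂ := extP e₂ P₂

section assemble
variable {Q Q₁ Q₂ B₁ B₂ : Type} [Fintype Q] [DecidableEq Q]
    [Fintype Q₁] [DecidableEq Q₁] [Fintype Q₂] [DecidableEq Q₂]
    [Fintype B₁] [DecidableEq B₁] [Fintype B₂] [DecidableEq B₂]

theorem assemble_valid (c : List (Instr U.toInterface Q)) (e₁ : Q₁ ↪ Q) (e₂ : Q₂ ↪ Q)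
    {p₁ : List (Instr U.toInterface (Q₁ ⊕ (Unit ⊕ B₁)))}
    {p₂ : List (Instr U.toInterface (Q₂ ⊕ (Unit ⊕ B₂)))}
    {P₁ : Matrix ν₁ (Q₁ → Bool) ℂ} {P₂ : Matrix ν₂ (Q₂ → Bool) ℂ}
    (orth₁ : P₁ * P₁ᴴ = 1) (orth₂ : P₂ * P₂ᴴ = 1)
    (not₁ : IsNot (sem U p₁) (rangeProj P₁)) (not₂ : IsNot (sem U p₂) (rangeProj P₂))
    (card₁ : Fintype.card B₁ ≤ cost U p₁) (card₂ : Fintype.card B₂ ≤ cost U p₂) :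
    (assemble c e₁ e₂ (extProj e₁ p₁) (extProj e₂ p₂) P₁ P₂).Valid U where
  orth₁ := extP_orthonormal e₁ P₁ orth₁
  orth₂ := extP_orthonormal e₂ P₂ orth₂
  not₁ := isNot_extProj e₁ orth₁ not₁
  not₂ := isNot_extProj e₂ orth₂ not₂
  card₁ := by
    have h : Fintype.card (Unit ⊕ B₁) ≤ cost U (extProj e₁ p₁) := by
      rw [cost_extProj, Fintype.card_sum, Fintype.card_unit]; omega
    exact h
  card₂ := by
    have h : Fintype.card (Unit ⊕ B₂) ≤ cost U (extProj e₂ p₂) := by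
      rw [cost_extProj, Fintype.card_sum, Fintype.card_unit]; omega
    exact h

theorem assemble_block (c : List (Instr U.toInterface Q)) (e₁ : Q₁ ↪ Q) (e₂ : Q₂ ↪ Q)
    (p₁ : List (Instr U.toInterface (Q ⊕ (Unit ⊕ (Unit ⊕ B₁)))))
    (p₂ : List (Instr U.toInterface (Q ⊕ (Unit ⊕ (Unit ⊕ B₂)))))
    (P₁ : Matrix ν₁ (Q₁ → Bool) ℂ) (P₂ : Matrix ν₂ (Q₂ → Bool) ℂ)
    (M : Matrix (Q₂ → Bool) (Q₁ → Bool) ℂ) (hM : (zinj e₂)ᴴ * (sem U c * zinj e₁) = M) :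
    (assemble c e₁ e₂ p₁ p₂ P₁ P₂).block U = P₂ * (M * P₁ᴴ) := by
  have h : (assemble c e₁ e₂ p₁ p₂ P₁ P₂).block U = extP e₂ P₂ * (sem U c * (extP e₁ P₁)ᴴ) := rfl
  rw [h, extP, extP, Matrix.conjTranspose_mul, Matrix.conjTranspose_conjTranspose, ← hM]
  simp only [Matrix.mul_assoc]
end assemble

/-! ### Rescaling -/

/-- The block encoding with the amplitude multiplied by `s`: an additional qubit is rotated. -/
noncomputable def Blk.scale {I : Interface μ₁ μ₂} (s : ℝ) (T : Blk I ν₁ ν₂) : Blk I ν₁ ν₂ :=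
  assemble (on (inlE T.Q Unit) T.circ ++ [Instr.gate (gate1 (Sum.inr ()) (rotV s))])
    (inlE T.Q Unit) (inlE T.Q Unit) (extProj (inlE T.Q Unit) T.proj₁)
    (extProj (inlE T.Q Unit) T.proj₂) T.P₁ T.P₂

theorem Blk.Valid.scale {T : Blk U.toInterface ν₁ ν₂} (h : T.Valid U) (s : ℝ) :
    (T.scale s).Valid U :=
  assemble_valid _ _ _ h.orth₁ h.orth₂ h.not₁ h.not₂ h.card₁ h.card₂

theorem Blk.scale_block (T : Blk U.toInterface ν₁ ν₂) {s : ℝ} (h0 : -1 ≤ s) (h1 : s ≤ 1) :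
    (T.scale s).block U = (s : ℂ) • T.block U := by
  refine (assemble_block (U := U) _ _ _ _ _ _ _ ((s : ℂ) • sem U T.circ) ?_).trans ?_
  · have hg : (gate1 (Sum.inr () : T.Q ⊕ Unit) (rotV s)).matrix * ket0 T.Q =
        (s : ℂ) • ket0 T.Q + rotMat s true false • ket1 T.Q := by
      rw [gate1_matrix]
      refine (gate_mul_ket0 (rotMat s)).trans ?_
      rw [rotMat, if_pos rfl, Real.cos_arccos h0 h1]
    have hc : lift (inlE T.Q Unit) ∅ (sem U T.circ) * ket0 T.Q = ket0 T.Q * sem U T.circ :=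
      lift_mul_inj_self (inlE T.Q Unit) (fun _ => false) (sem U T.circ)
    have hz : zinj (inlE T.Q Unit) = ket0 T.Q := rfl
    rw [hz, sem_append, sem_gate, sem_on, Matrix.mul_assoc, hc, ← Matrix.mul_assoc _ (ket0 T.Q), hg,
      ← Matrix.mul_assoc, Matrix.mul_add, Matrix.mul_smul, Matrix.mul_smul, bra0_mul_ket0,
      bra0_mul_ket1, smul_zero, add_zero, Matrix.smul_mul, Matrix.one_mul]
  · rw [Matrix.smul_mul, Matrix.mul_smul]; rfl

theorem Blk.cost_scale_circ (T : Blk U.toInterface ν₁ ν₂) (s : ℝ) :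
    cost U (T.scale s).circ = cost U T.circ + 1 := by
  have h : cost U (on (inlE T.Q Unit) T.circ ++ [Instr.gate (gate1 (Sum.inr ()) (rotV s))]) =
      cost U T.circ + 1 := by
    rw [cost_append, cost_on, cost_gate]
    simp [Gate.cost, gate1]
  exact h

theorem card_outside_inl (Q R : Type) [Fintype Q] [DecidableEq Q] [Fintype R] [DecidableEq R] :
    (outside (inlE Q R)).card = Fintype.card R := by
  have := card_outside (inlE Q R)
  rw [Fintype.card_sum] at this
  omega

theorem Blk.cost_scale_proj₁ (T : Blk U.toInterface ν₁ ν₂) (s : ℝ) :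
    cost U (T.scale s).proj₁ = 2 * cost U T.proj₁ + 5 := by
  refine (cost_extProj (inlE T.Q Unit) T.proj₁).trans ?_
  rw [card_outside_inl]; simp

theorem Blk.cost_scale_proj₂ (T : Blk U.toInterface ν₁ ν₂) (s : ℝ) :
    cost U (T.scale s).proj₂ = 2 * cost U T.proj₂ + 5 := by
  refine (cost_extProj (inlE T.Q Unit) T.proj₂).trans ?_
  rw [card_outside_inl]; simp

/-! ### Amplitude amplification -/

section amplify
variable {I : Interface μ₁ μ₂}

/-- The qubits of an amplified circuit. -/
abbrev Blk.AmpQ (T : Blk I ν₁ ν₂) : Type := T.Q ⊕ (Unit ⊕ (T.B₁ ⊕ T.B₂))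

/-- The register of the first projection gate. -/
def Blk.ampEmb₁ (T : Blk I ν₁ ν₂) : T.Q ⊕ (Unit ⊕ T.B₁) ↪ T.AmpQ :=
  (Function.Embedding.refl _).sumMap ((Function.Embedding.refl _).sumMap Function.Embedding.inl)

/-- The register of the second projection gate. -/
def Blk.ampEmb₂ (T : Blk I ν₁ ν₂) : T.Q ⊕ (Unit ⊕ T.B₂) ↪ T.AmpQ :=
  (Function.Embedding.refl _).sumMap ((Function.Embedding.refl _).sumMap Function.Embedding.inr)

/-- One Grover iteration `-U (1 - 2 Π₁) U† (1 - 2 Π₂)`. -/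
noncomputable def Blk.groverStep (T : Blk I ν₁ ν₂) : List (Instr I T.AmpQ) :=
  on T.ampEmb₂ (reflect T.proj₂) ++ (on (inlE T.Q _) (inverse T.circ) ++
    (on T.ampEmb₁ (reflect T.proj₁) ++ (on (inlE T.Q _) T.circ ++
      [Instr.gate (gate1 (Sum.inr (Sum.inl ())) negV)])))

/-- The circuit followed by `r` Grover iterations. -/
noncomputable def Blk.ampCirc (T : Blk I ν₁ ν₂) : ℕ → List (Instr I T.AmpQ)
  | 0 => on (inlE T.Q _) T.circ
  | r + 1 => T.ampCirc r ++ T.groverStep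

/-- Amplitude amplification with `r` Grover iterations. -/
noncomputable def Blk.amplify (T : Blk I ν₁ ν₂) (r : ℕ) : Blk I ν₁ ν₂ :=
  assemble (T.ampCirc r) (inlE T.Q (Unit ⊕ (T.B₁ ⊕ T.B₂))) (inlE T.Q (Unit ⊕ (T.B₁ ⊕ T.B₂)))
    (extProj (inlE T.Q _) T.proj₁) (extProj (inlE T.Q _) T.proj₂) T.P₁ T.P₂

end amplify

/-- The workspace of the projection gates becomes part of the qubits of the amplified encoding,
whose projections contain `⟨0|` on it. -/
theorem Blk.Valid.amplify {T : Blk U.toInterface ν₁ ν₂} (h : T.Valid U) (r : ℕ) :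
    (T.amplify r).Valid U :=
  assemble_valid _ _ _ h.orth₁ h.orth₂ h.not₁ h.not₂ h.card₁ h.card₂

variable (U) in
/-- The unitary of a Grover iteration. -/
noncomputable def Blk.grover (T : Blk U.toInterface ν₁ ν₂) : Matrix (T.Q → Bool) (T.Q → Bool) ℂ :=
  -(sem U T.circ * ((1 - 2 * rangeProj T.P₁) * ((sem U T.circ)ᴴ * (1 - 2 * rangeProj T.P₂))))

theorem Blk.Valid.sem_groverStep {T : Blk U.toInterface ν₁ ν₂} (h : T.Valid U) :
    sem U T.groverStep * zinj (inlE T.Q (Unit ⊕ (T.B₁ ⊕ T.B₂))) =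
      zinj (inlE T.Q (Unit ⊕ (T.B₁ ⊕ T.B₂))) * T.grover U := by
  have h1 : sem U (on T.ampEmb₁ (reflect T.proj₁)) * zinj (inlE T.Q (Unit ⊕ (T.B₁ ⊕ T.B₂))) =
      zinj (inlE T.Q (Unit ⊕ (T.B₁ ⊕ T.B₂))) * (1 - 2 * rangeProj T.P₁) := by
    rw [sem_on]
    refine (lift_empty_mul_inj (inlE T.Q (Unit ⊕ T.B₁)) _ _ (Function.Embedding.refl _) ?_ ?_ _ _
      (sem_reflect h.not₁ (rangeProj_mul_self h.orth₁))).trans ?_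
    · intro a; rfl
    · rintro s (p | p) hs
      · exact ⟨p, (Sum.inl.inj hs).symm, rfl⟩
      · cases hs
    · rw [lift_refl]
  have h2 : sem U (on T.ampEmb₂ (reflect T.proj₂)) * zinj (inlE T.Q (Unit ⊕ (T.B₁ ⊕ T.B₂))) =
      zinj (inlE T.Q (Unit ⊕ (T.B₁ ⊕ T.B₂))) * (1 - 2 * rangeProj T.P₂) := by
    rw [sem_on]
    refine (lift_empty_mul_inj (inlE T.Q (Unit ⊕ T.B₂)) _ _ (Function.Embedding.refl _) ?_ ?_ _ _
      (sem_reflect h.not₂ (rangeProj_mul_self h.orth₂))).trans ?_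
    · intro a; rfl
    · rintro s (p | p) hs
      · exact ⟨p, (Sum.inl.inj hs).symm, rfl⟩
      · cases hs
    · rw [lift_refl]
  have h3 : ∀ c : List (Instr U.toInterface T.Q),
      sem U (on (inlE T.Q (Unit ⊕ (T.B₁ ⊕ T.B₂))) c) * zinj (inlE T.Q (Unit ⊕ (T.B₁ ⊕ T.B₂))) =
      zinj (inlE T.Q (Unit ⊕ (T.B₁ ⊕ T.B₂))) * sem U c := fun c => by
    rw [sem_on]; exact lift_mul_inj_self _ _ _
  have h4 : (gate1 (Sum.inr (Sum.inl ()) : T.AmpQ) negV).matrix = -1 := by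
    rw [gate1_matrix]
    have : unitOp (negV : Matrix Bool Bool ℂ) = -1 := by
      ext a b
      have h1 := congrFun (congrFun unitOp_one a) b
      simp only [unitOp] at h1
      simp only [unitOp, negV, Matrix.neg_apply]
      rw [← h1]; rfl
    rw [this, ← zero_sub, lift_sub, lift_one]
    ext t s
    simp [lift]
  rw [Blk.groverStep]
  rw [sem_append, sem_append, sem_append, sem_append, sem_gate, h4]
  simp only [Matrix.mul_assoc]
  rw [h2, reassoc (h3 _), reassoc h1, reassoc (h3 _), sem_inverse, Blk.grover, Matrix.neg_mul,
    Matrix.one_mul, Matrix.mul_neg]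

theorem Blk.Valid.sem_ampCirc {T : Blk U.toInterface ν₁ ν₂} (h : T.Valid U) (r : ℕ) :
    sem U (T.ampCirc r) * zinj (inlE T.Q (Unit ⊕ (T.B₁ ⊕ T.B₂))) =
      zinj (inlE T.Q (Unit ⊕ (T.B₁ ⊕ T.B₂))) * (T.grover U ^ r * sem U T.circ) := by
  induction r with
  | zero =>
    rw [Blk.ampCirc, sem_on, pow_zero, Matrix.one_mul]; exact lift_mul_inj_self _ _ _
  | succ r ih =>
    rw [Blk.ampCirc, sem_append, Matrix.mul_assoc, ih, reassoc h.sem_groverStep, pow_succ',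
      Matrix.mul_assoc]

theorem Blk.Valid.amplify_block_eq {T : Blk U.toInterface ν₁ ν₂} (h : T.Valid U) (r : ℕ) :
    (T.amplify r).block U = T.P₂ * (T.grover U ^ r * (sem U T.circ * T.P₁ᴴ)) := by
  refine (assemble_block (U := U) _ _ _ _ _ _ _ (T.grover U ^ r * sem U T.circ) ?_).trans ?_
  · rw [h.sem_ampCirc, ← Matrix.mul_assoc, inj_conjTranspose_mul_inj, Matrix.one_mul]
  · rw [Matrix.mul_assoc]

/-- The coefficients `(a, b)` of the two components of the state after `r` Grover iterations, if `p`
is the probability of the first component in the initial state. -/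
noncomputable def groverCoeff (p : ℝ) : ℕ → ℝ × ℝ
  | 0 => (1, 1)
  | r + 1 =>
    let c := (groverCoeff p r).2 * (1 - p) - (groverCoeff p r).1 * p
    ((groverCoeff p r).1 + 2 * c, 2 * c - (groverCoeff p r).2)

/-- The recursion of the Grover coefficients is the addition theorem for the angle `2 θ`. The
factors `sin θ` and `cos θ` avoid divisions by zero. -/
theorem groverCoeff_mul_sin (θ : ℝ) (r : ℕ) :
    (groverCoeff (Real.sin θ ^ 2) r).1 * Real.sin θ = Real.sin ((2 * r + 1) * θ) ∧
      (groverCoeff (Real.sin θ ^ 2) r).2 * Real.cos θ = Real.cos ((2 * r + 1) * θ) := by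
  induction r with
  | zero => simp [groverCoeff]
  | succ r ih =>
    obtain ⟨h1, h2⟩ := ih
    have e : (2 * ((r + 1 : ℕ) : ℝ) + 1) * θ = (2 * r + 1) * θ + 2 * θ := by push_cast; ring
    rw [e, Real.sin_add, Real.cos_add, ← h1, ← h2, Real.sin_two_mul, Real.cos_two_mul]
    simp only [groverCoeff]
    have := Real.sin_sq_add_cos_sq θ
    have hp : Real.cos θ ^ 2 = 1 - Real.sin θ ^ 2 := by linarith
    constructor
    · linear_combination (2 * (groverCoeff (Real.sin θ ^ 2) r).2 * Real.sin θ) * (-hp) +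
        (-2) * (groverCoeff (Real.sin θ ^ 2) r).1 * Real.sin θ * hp
    · linear_combination (-2) * (groverCoeff (Real.sin θ ^ 2) r).2 * Real.cos θ * hp

variable (U) in
/-- The probability of finding the state of a vector encoding in the range of the projection. -/
noncomputable def Blk.prob (T : Blk U.toInterface Unit ν₂) : ℝ := ∑ i, ‖T.block U i ()‖ ^ 2

/-- Amplitude amplification multiplies the encoded vector by a scalar; its direction is preserved
exactly. -/
theorem Blk.Valid.amplify_block {T : Blk U.toInterface Unit ν₂} (h : T.Valid U) (r : ℕ) :
    (T.amplify r).block U = ((groverCoeff (T.prob U) r).1 : ℂ) • T.block U := by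
  set ψ := sem U T.circ * T.P₁ᴴ with hψ
  set Pi := rangeProj T.P₂ with hPi
  have hψψ : ψᴴ * ψ = 1 := by
    rw [hψ, Matrix.conjTranspose_mul, Matrix.conjTranspose_conjTranspose, Matrix.mul_assoc,
      ← Matrix.mul_assoc (sem U T.circ)ᴴ, conjTranspose_mul_sem, Matrix.one_mul, h.orth₁]
  have hrefl : sem U T.circ * ((1 - 2 * rangeProj T.P₁) * (sem U T.circ)ᴴ) = 1 - 2 * (ψ * ψᴴ) := by
    rw [Matrix.sub_mul, Matrix.one_mul, Matrix.mul_sub, sem_mul_conjTranspose, two_mul, two_mul,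
      Matrix.add_mul, Matrix.mul_add, hψ, rangeProj, Matrix.conjTranspose_mul,
      Matrix.conjTranspose_conjTranspose]
    simp only [Matrix.mul_assoc]
  clear_value ψ
  have hp : ψᴴ * (Pi * ψ) = ((T.prob U : ℝ) : ℂ) • (1 : Matrix Unit Unit ℂ) := by
    have hb : ψᴴ * (Pi * ψ) = (T.block U)ᴴ * T.block U := by
      rw [Blk.block, ← hψ, hPi, rangeProj, Matrix.conjTranspose_mul, Matrix.mul_assoc,
        Matrix.mul_assoc]
    rw [hb]
    ext a b
    rw [Matrix.mul_apply, Matrix.smul_apply, Matrix.one_apply_eq, Blk.prob, smul_eq_mul, mul_one,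
      Complex.ofReal_sum]
    refine Finset.sum_congr rfl fun i _ => ?_
    rw [Matrix.conjTranspose_apply, Complex.ofReal_pow, ← Complex.conj_mul']
    rfl
  have hPP : Pi * Pi = Pi := rangeProj_mul_self h.orth₂
  have hG : ∀ X : Matrix (T.Q → Bool) Unit ℂ, T.grover U * X =
      2 • (ψ * (ψᴴ * ((1 - 2 * Pi) * X))) - (1 - 2 * Pi) * X := by
    intro X
    have h1 : T.grover U = -((1 - 2 * (ψ * ψᴴ)) * (1 - 2 * Pi)) := by
      rw [← hrefl, Blk.grover]
      simp only [Matrix.mul_assoc]; rfl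
    rw [h1, Matrix.neg_mul, Matrix.mul_assoc, Matrix.sub_mul, Matrix.one_mul, two_mul (ψ * ψᴴ),
      ← two_nsmul, Matrix.smul_mul, neg_sub, Matrix.mul_assoc]
  have key : T.grover U ^ r * ψ = ((groverCoeff (T.prob U) r).1 : ℂ) • (Pi * ψ) +
      ((groverCoeff (T.prob U) r).2 : ℂ) • (ψ - Pi * ψ) := by
    induction r with
    | zero => simp [groverCoeff]
    | succ r ih =>
      have hf : ∀ α β : ℂ, (1 - 2 * Pi) * (α • (Pi * ψ) + β • (ψ - Pi * ψ)) =
          -(α • (Pi * ψ)) + β • (ψ - Pi * ψ) := by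
        intro α β
        have e1 : (1 - 2 * Pi) * (Pi * ψ) = -(Pi * ψ) := by
          rw [Matrix.sub_mul, Matrix.one_mul, two_mul, Matrix.add_mul, ← Matrix.mul_assoc Pi Pi ψ, hPP]
          abel
        have e2 : (1 - 2 * Pi) * ψ = ψ - Pi * ψ - Pi * ψ := by
          rw [Matrix.sub_mul, Matrix.one_mul, two_mul, Matrix.add_mul]
          abel
        rw [Matrix.mul_add, Matrix.mul_smul, Matrix.mul_smul, Matrix.mul_sub, e1, e2, smul_neg]
        congr 2
        abel
      rw [pow_succ', Matrix.mul_assoc, ih, hG, hf, Matrix.mul_add, Matrix.mul_neg, Matrix.mul_smul,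
        Matrix.mul_smul, Matrix.mul_sub, hp, hψψ]
      simp only [Matrix.mul_add, Matrix.mul_neg, Matrix.mul_smul, Matrix.mul_sub, Matrix.mul_one,
        groverCoeff]
      ext x y
      simp only [Matrix.add_apply, Matrix.sub_apply, Matrix.smul_apply, Matrix.neg_apply,
        smul_eq_mul, nsmul_eq_mul]
      push_cast
      ring
  rw [h.amplify_block_eq, ← hψ, key, Matrix.mul_add, Matrix.mul_smul, Matrix.mul_smul,
    Matrix.mul_sub, ← Matrix.mul_assoc T.P₂ Pi, hPi, rangeProj, ← Matrix.mul_assoc T.P₂ T.P₂ᴴ,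
    h.orth₂, Matrix.one_mul, sub_self, smul_zero, add_zero, hψ]
  rfl

/-- The amplitude of the amplified encoding, if the initial amplitude is `sin θ`. -/
theorem Blk.Valid.prob_amplify {T : Blk U.toInterface Unit ν₂} (h : T.Valid U) (r : ℕ) {θ : ℝ}
    (hθ : T.prob U = Real.sin θ ^ 2) :
    (T.amplify r).prob U = Real.sin ((2 * r + 1) * θ) ^ 2 := by
  rw [Blk.prob, h.amplify_block]
  simp only [Matrix.smul_apply, norm_smul, mul_pow]
  rw [← Finset.mul_sum, ← (groverCoeff_mul_sin θ r).1, mul_pow, ← hθ, Complex.norm_real,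
    Real.norm_eq_abs, sq_abs]
  rfl

/-! ### The number of gates of an amplified encoding -/

theorem Blk.cost_groverStep (T : Blk U.toInterface ν₁ ν₂) :
    cost U T.groverStep =
      2 * cost U T.circ + 2 * cost U T.proj₁ + 2 * cost U T.proj₂ + 3 := by
  rw [Blk.groverStep, cost_append, cost_append, cost_append, cost_append, cost_on, cost_on, cost_on,
    cost_on, cost_inverse, cost_reflect, cost_reflect, cost_gate]
  simp only [Gate.cost, gate1, Finset.card_empty]
  ring

theorem Blk.cost_amplify_circ (T : Blk U.toInterface ν₁ ν₂) (r : ℕ) :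
    cost U (T.amplify r).circ = cost U T.circ +
      r * (2 * cost U T.circ + 2 * cost U T.proj₁ + 2 * cost U T.proj₂ + 3) := by
  have h : cost U (T.ampCirc r) = cost U T.circ +
      r * (2 * cost U T.circ + 2 * cost U T.proj₁ + 2 * cost U T.proj₂ + 3) := by
    induction r with
    | zero => rw [Blk.ampCirc, cost_on]; ring
    | succ r ih => rw [Blk.ampCirc, cost_append, ih, T.cost_groverStep]; ring
  exact h

theorem Blk.cost_amplify_proj₁ (T : Blk U.toInterface ν₁ ν₂) (r : ℕ) :
    cost U (T.amplify r).proj₁ =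
      2 * cost U T.proj₁ + 3 * (1 + (Fintype.card T.B₁ + Fintype.card T.B₂)) + 2 := by
  refine (cost_extProj (inlE T.Q _) T.proj₁).trans ?_
  rw [card_outside_inl, Fintype.card_sum, Fintype.card_sum, Fintype.card_unit]

theorem Blk.cost_amplify_proj₂ (T : Blk U.toInterface ν₁ ν₂) (r : ℕ) :
    cost U (T.amplify r).proj₂ =
      2 * cost U T.proj₂ + 3 * (1 + (Fintype.card T.B₁ + Fintype.card T.B₂)) + 2 := by
  refine (cost_extProj (inlE T.Q _) T.proj₂).trans ?_
  rw [card_outside_inl, Fintype.card_sum, Fintype.card_sum, Fintype.card_unit]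

end Blk

/-! ### Conversion from and to encodings on numbered qubits -/

section Convert
variable {Q Q' B : Type} [Fintype Q] [DecidableEq Q] [Fintype Q'] [DecidableEq Q']
  [Fintype B] [DecidableEq B]

theorem mul_permMat_apply {ι : Type} (M : Matrix ι (Q → Bool) ℂ) (F : (Q → Bool) → (Q → Bool))
    (t : ι) (s : Q → Bool) : (M * permMat F) t s = M t (F s) := by
  simp [Matrix.mul_apply, permMat]

theorem xOn_eq_permMat (q : Q) : xOn q = permMat (fun s => Function.update s q (!s q)) := by
  have h := cnot_matrix ∅ q (Finset.notMem_empty q)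
  rw [Gate.matrix_eq_lift] at h
  refine Eq.trans ?_ (h.trans ?_)
  · rfl
  · congr 1
    funext s
    simp [flipIf]

theorem lift_inl_apply (Pi : Matrix (Q → Bool) (Q → Bool) ℂ) (t s : Q ⊕ Unit → Bool) :
    lift (inlE Q Unit) ∅ Pi t s =
      if t (Sum.inr ()) = s (Sum.inr ()) then Pi (t ∘ Sum.inl) (s ∘ Sum.inl) else 0 := by
  have h : (∀ q, q ∉ Set.range (inlE Q Unit) → t q = s q) ↔ t (Sum.inr ()) = s (Sum.inr ()) := by
    constructor
    · intro h; exact h _ inr_notMem_range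
    · rintro h (q | q) hq
      · exact absurd ⟨q, rfl⟩ hq
      · exact h
  rw [lift, if_pos (by simp)]
  simp only [h]
  rfl

theorem notOp_apply (Pi : Matrix (Q → Bool) (Q → Bool) ℂ) (t s : Q ⊕ Unit → Bool) :
    notOp Pi t s = Pi (t ∘ Sum.inl) (s ∘ Sum.inl) * pauliX (t (Sum.inr ())) (s (Sum.inr ())) +
      (1 - Pi) (t ∘ Sum.inl) (s ∘ Sum.inl) *
        (1 : Matrix Bool Bool ℂ) (t (Sum.inr ())) (s (Sum.inr ())) := by
  have h1 : (Function.update s (Sum.inr ()) (!s (Sum.inr ()))) ∘ Sum.inl = s ∘ Sum.inl := by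
    funext q; simp
  have h2 : (1 : Matrix (Q ⊕ Unit → Bool) _ ℂ) t s =
      lift (inlE Q Unit) ∅ (1 : Matrix (Q → Bool) (Q → Bool) ℂ) t s := by rw [lift_one]
  rw [notOp, xOn_eq_permMat, Matrix.add_apply, Matrix.sub_apply, mul_permMat_apply, h2,
    lift_inl_apply, lift_inl_apply, lift_inl_apply, h1, Function.update_self, Matrix.sub_apply,
    Matrix.one_apply (i := t _), pauliX]
  cases t (Sum.inr ()) <;> cases s (Sum.inr ()) <;> simp

theorem extend_flagEmb (s : Q ⊕ Unit → Bool) :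
    Function.extend (flagEmb Q B) s (fun _ => false) =
      Sum.elim (s ∘ Sum.inl) (Sum.elim (fun _ => s (Sum.inr ())) fun _ => false) := by
  symm
  rw [eq_extend_iff]
  constructor
  · rintro (q | q | q) hq
    · exact absurd ⟨Sum.inl q, rfl⟩ hq
    · exact absurd ⟨Sum.inr q, rfl⟩ hq
    · rfl
  · funext q
    rcases q with q | q <;> rfl

theorem notMem_range_flagEmb (w : Q ⊕ (Unit ⊕ B) → Bool) :
    (∀ q, q ∉ Set.range (flagEmb Q B) → w q = false) ↔
      (fun b => w (Sum.inr (Sum.inr b))) = fun _ => false := by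
  constructor
  · intro h
    funext b
    refine h _ ?_
    rintro ⟨q | q, hq⟩
    · cases hq
    · cases Sum.inr.inj hq
  · rintro h (q | q | q) hq
    · exact absurd ⟨Sum.inl q, rfl⟩ hq
    · exact absurd ⟨Sum.inr q, rfl⟩ hq
    · exact congrFun h q

/-- The controlled-NOT gate on numbered qubits, in terms of operators on registers. -/
theorem ImplementsProjNot.isNot {ν : Type} [Fintype ν] {m b : ℕ} {c : Circuit (ProjQubits m b)}
    {P : Matrix ν (Fin m → Bool) ℂ} (h : ImplementsProjNot c P) :
    IsNot (Circuit.matrix c) (rangeProj P) := by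
  classical
  rw [IsNot]
  ext t s
  have ht : t = Sum.elim (fun q => t (Sum.inl q)) (Sum.elim (fun _ => t (Sum.inr (Sum.inl ())))
      fun q => t (Sum.inr (Sum.inr q))) := by
    funext q; rcases q with q | q | q <;> rfl
  rw [mul_inj_apply, inj_mul_apply, extend_flagEmb]
  have h2 := h.2 (fun q => t (Sum.inl q)) (s ∘ Sum.inl) (t (Sum.inr (Sum.inl ())))
    (s (Sum.inr ())) fun q => t (Sum.inr (Sum.inr q))
  rw [← ht] at h2
  rw [if_congr (notMem_range_flagEmb t) rfl rfl]
  refine h2.trans ?_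
  rw [notOp_apply]
  rfl

theorem IsNot.implements {ν : Type} [Fintype ν] {m b : ℕ} {c : Circuit (ProjQubits m b)}
    {P : Matrix ν (Fin m → Bool) ℂ} (h : IsNot (Circuit.matrix c) (rangeProj P))
    (hb : b ≤ c.gates) : ImplementsProjNot c P := by
  classical
  refine ⟨hb, fun a' a f' f w => ?_⟩
  have h2 := congrFun (congrFun h (Sum.elim a' (Sum.elim (fun _ => f') w)))
    (Sum.elim a fun _ => f)
  have h4 := notMem_range_flagEmb (Sum.elim a' (Sum.elim (fun _ => f') w))
  rw [mul_inj_apply, inj_mul_apply, extend_flagEmb, if_congr h4 rfl rfl] at h2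
  refine h2.trans ?_
  rw [notOp_apply]
  rfl

variable {μ₁ μ₂ ν₁ ν₂ : Type} {U : Encoding Gate μ₁ μ₂}
  [Fintype ν₁] [DecidableEq ν₁] [Fintype ν₂] [DecidableEq ν₂]

theorem zinj_equiv_mul (e : Q ≃ Q') : zinj e.toEmbedding * (zinj e.toEmbedding)ᴴ = 1 := by
  ext t s
  have h : ∀ q, q ∉ Set.range e.toEmbedding → s q = false :=
    fun q hq => absurd (e.surjective q) hq
  rw [zinj_mul_conjTranspose_apply, Matrix.one_apply]
  exact if_congr (and_iff_left h) rfl rfl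

theorem isNot_equiv {B' : Type} [Fintype B'] [DecidableEq B'] (e : Q ≃ Q') (f : B ≃ B')
    {pc : List (Instr U.toInterface (Q ⊕ (Unit ⊕ B)))} {P : Matrix ν₁ (Q → Bool) ℂ}
    (h : IsNot (sem U pc) (rangeProj P)) :
    IsNot (sem U (on (Equiv.sumCongr e (Equiv.sumCongr (Equiv.refl Unit) f)).toEmbedding pc))
      (rangeProj (extP e.toEmbedding P)) := by
  have h1 := h.on (Equiv.sumCongr e (Equiv.sumCongr (Equiv.refl Unit) f)).toEmbedding
    (flagEmb Q' B') (e.toEmbedding.sumMap (Function.Embedding.refl Unit))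
    (by rintro (q | q) <;> rfl) (by
      rintro (q | q) b hq
      · cases hq
      · cases Sum.inr.inj hq)
  refine h1.trans ?_
  congr 1
  rw [lift_notOp, notOp, rangeProj_extP, zinj_equiv_mul, Matrix.mul_one, lift_trans]
  simp only [Finset.map_empty, Finset.union_empty]
  rfl

/-- The block encoding with numbered qubits and the normalization factor `γ`. -/
noncomputable def Blk.toEncoding {I : Interface μ₁ μ₂} (T : Blk I ν₁ ν₂) (γ : ℝ) :
    Encoding (Instr I) ν₁ ν₂ where
  m := Fintype.card T.Q
  b₁ := Fintype.card T.B₁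
  b₂ := Fintype.card T.B₂
  P₁ := extP (Fintype.equivFin T.Q).toEmbedding T.P₁
  P₂ := extP (Fintype.equivFin T.Q).toEmbedding T.P₂
  γ := γ
  circ := on (Fintype.equivFin T.Q).toEmbedding T.circ
  proj₁ := on (Equiv.sumCongr (Fintype.equivFin T.Q)
    (Equiv.sumCongr (Equiv.refl Unit) (Fintype.equivFin T.B₁))).toEmbedding T.proj₁
  proj₂ := on (Equiv.sumCongr (Fintype.equivFin T.Q)
    (Equiv.sumCongr (Equiv.refl Unit) (Fintype.equivFin T.B₂))).toEmbedding T.proj₂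

/-- The number of atomic gates of the three circuits. -/
noncomputable def Blk.gates (U : Encoding Gate μ₁ μ₂) (T : Blk U.toInterface ν₁ ν₂) : ℕ :=
  cost U T.circ + cost U T.proj₁ + cost U T.proj₂

theorem Blk.gates_toEncoding (T : Blk U.toInterface ν₁ ν₂) (γ : ℝ) :
    (U.instantiate (T.toEncoding γ)).gates = T.gates U := by
  have h : (U.instantiate (T.toEncoding γ)).gates =
    cost U (on (Fintype.equivFin T.Q).toEmbedding T.circ) +
    cost U (on (Equiv.sumCongr (Fintype.equivFin T.Q)
      (Equiv.sumCongr (Equiv.refl Unit) (Fintype.equivFin T.B₁))).toEmbedding T.proj₁) +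
    cost U (on (Equiv.sumCongr (Fintype.equivFin T.Q)
      (Equiv.sumCongr (Equiv.refl Unit) (Fintype.equivFin T.B₂))).toEmbedding T.proj₂) := rfl
  rw [h, cost_on, cost_on, cost_on]; rfl

theorem Blk.block_toEncoding (T : Blk U.toInterface ν₁ ν₂) (γ : ℝ) :
    (U.instantiate (T.toEncoding γ)).block = T.block U := by
  have h : (U.instantiate (T.toEncoding γ)).block =
    extP (Fintype.equivFin T.Q).toEmbedding T.P₂ *
      sem U (on (Fintype.equivFin T.Q).toEmbedding T.circ) *
        (extP (Fintype.equivFin T.Q).toEmbedding T.P₁)ᴴ := rfl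
  have h2 : lift (Fintype.equivFin T.Q).toEmbedding ∅ (sem U T.circ) *
      zinj (Fintype.equivFin T.Q).toEmbedding =
      zinj (Fintype.equivFin T.Q).toEmbedding * sem U T.circ := lift_mul_inj_self _ _ _
  rw [h, sem_on, extP, extP, Matrix.conjTranspose_mul, Matrix.conjTranspose_conjTranspose]
  simp only [Matrix.mul_assoc]
  rw [reassoc h2, ← Matrix.mul_assoc (zinj _)ᴴ, inj_conjTranspose_mul_inj, Matrix.one_mul]
  rfl

theorem Blk.Valid.isBlockEncoding {T : Blk U.toInterface ν₁ ν₂} (h : T.Valid U) {γ ε : ℝ}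
    {S : Matrix ν₂ ν₁ ℂ} (hγ : specNorm S ≤ γ)
    (hS : specNorm ((γ : ℂ) • T.block U - S) ≤ ε * specNorm S) :
    (U.instantiate (T.toEncoding γ)).IsBlockEncoding S ε where
  orthonormal₁ := extP_orthonormal _ _ h.orth₁
  orthonormal₂ := extP_orthonormal _ _ h.orth₂
  implements₁ := by
    refine IsNot.implements (isNot_equiv (Fintype.equivFin T.Q) (Fintype.equivFin T.B₁) h.not₁) ?_
    exact h.card₁.trans (cost_on _ _).ge
  implements₂ := by
    refine IsNot.implements (isNot_equiv (Fintype.equivFin T.Q) (Fintype.equivFin T.B₂) h.not₂) ?_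
    exact h.card₂.trans (cost_on _ _).ge
  le_gamma := hγ
  approx := by rw [T.block_toEncoding]; exact hS

theorem dataProj_eq_extP {N n m : ℕ} (E : Matrix (Fin N) (Fin n → Bool) ℂ)
    (pos : Fin n ↪ Fin m) : dataProj E pos = extP pos E := by
  classical
  ext i s
  rw [extP_apply, dataProj]
  rfl

theorem zeroProj_eq_zeroBra (m : ℕ) : zeroProj m = zeroBra (Fin m) := rfl

/-! ### The input -/

variable (I : Interface ν₁ ν₂)

/-- The input, as a block encoding that consists of calls to its circuits. -/
noncomputable def ofInput : Blk I ν₁ ν₂ where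
  Q := Fin I.m
  B₁ := Fin I.b₁
  B₂ := Fin I.b₂
  circ := [Instr.call Port.main false (Function.Embedding.refl (Fin I.m)) ∅
    fun _ => Finset.notMem_empty _]
  proj₁ := [Instr.call Port.proj₁ false (Function.Embedding.refl (ProjQubits I.m I.b₁)) ∅
    fun _ => Finset.notMem_empty _]
  proj₂ := [Instr.call Port.proj₂ false (Function.Embedding.refl (ProjQubits I.m I.b₂)) ∅
    fun _ => Finset.notMem_empty _]
  P₁ := I.P₁
  P₂ := I.P₂

variable {I}

theorem map_place_refl {Q : Type} [DecidableEq Q] (c : Circuit Q) :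
    c.map (Gate.place (Function.Embedding.refl Q) ∅ fun _ => Finset.notMem_empty _) = c := by
  have : (Gate.place (Function.Embedding.refl Q) ∅ fun _ => Finset.notMem_empty _) = id := by
    funext g
    simp [Gate.place]
  rw [this, List.map_id]

variable {V : Encoding Gate ν₁ ν₂}

theorem substitute_ofInput_circ : substitute V (ofInput V.toInterface).circ = V.circ :=
  (List.append_nil _).trans (map_place_refl V.circ)

theorem substitute_ofInput_proj₁ : substitute V (ofInput V.toInterface).proj₁ = V.proj₁ :=
  (List.append_nil _).trans (map_place_refl V.proj₁)

theorem substitute_ofInput_proj₂ : substitute V (ofInput V.toInterface).proj₂ = V.proj₂ :=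
  (List.append_nil _).trans (map_place_refl V.proj₂)

theorem gates_ofInput : (ofInput V.toInterface).gates V = V.gates := by
  rw [Blk.gates, cost, cost, cost, substitute_ofInput_circ, substitute_ofInput_proj₁,
    substitute_ofInput_proj₂]; rfl

theorem block_ofInput : (ofInput V.toInterface).block V = V.block := by
  rw [Blk.block, sem, substitute_ofInput_circ, Encoding.block, Matrix.mul_assoc]; rfl

theorem valid_ofInput {S : Matrix ν₂ ν₁ ℂ} {ε : ℝ} (h : V.IsBlockEncoding S ε) :
    (ofInput V.toInterface).Valid V where
  orth₁ := h.orthonormal₁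
  orth₂ := h.orthonormal₂
  not₁ := by rw [sem, substitute_ofInput_proj₁]; exact h.implements₁.isNot
  not₂ := by rw [sem, substitute_ofInput_proj₂]; exact h.implements₂.isNot
  card₁ := by
    rw [cost, substitute_ofInput_proj₁]
    exact (Fintype.card_fin _).trans_le h.implements₁.1
  card₂ := by
    rw [cost, substitute_ofInput_proj₂]
    exact (Fintype.card_fin _).trans_le h.implements₂.1

/-! ### Qubits that a circuit has to touch -/

/-- The qubits on which a circuit acts. -/
def touched {Q : Type} [DecidableEq Q] : Circuit Q → Finset Q
  | [] => ∅
  | g :: c => insert g.target g.controls ∪ touched c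

theorem card_touched_le (c : Circuit Q) : (touched c).card ≤ c.gates := by
  induction c with
  | nil => simp [touched]
  | cons g c ih =>
    have h1 := Finset.card_union_le (insert g.target g.controls) (touched c)
    have h2 := Finset.card_insert_le g.target g.controls
    simp only [touched, Circuit.gates, List.map_cons, List.sum_cons, Gate.cost] at ih ⊢
    omega

/-- The basis state with one qubit flipped. -/
def flipAt (q : Q) (s : Q → Bool) : Q → Bool := Function.update s q (!s q)

theorem flipAt_flipAt (q : Q) (s : Q → Bool) : flipAt q (flipAt q s) = s := by
  funext r
  by_cases h : r = q
  · subst h; simp [flipAt]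
  · simp [flipAt, Function.update_of_ne h]

/-- A circuit commutes with NOT gates on the qubits that it does not touch. -/
theorem Circuit.matrix_flipAt (c : Circuit Q) (q : Q) (hq : q ∉ touched c) (t s : Q → Bool) :
    Circuit.matrix c (flipAt q t) (flipAt q s) = Circuit.matrix c t s := by
  have hinj : Function.Injective (flipAt q) := fun a b h => by
    rw [← flipAt_flipAt q a, h, flipAt_flipAt]
  induction c generalizing t s with
  | nil => simp only [Circuit.matrix, Matrix.one_apply, hinj.eq_iff]
  | cons g c ih =>
    simp only [touched, Finset.mem_union, Finset.mem_insert, not_or] at hq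
    obtain ⟨⟨h1, h2⟩, h3⟩ := hq
    have hg : ∀ t s, g.matrix (flipAt q t) (flipAt q s) = g.matrix t s := by
      intro t s
      have e1 : (∀ x ∈ g.controls, flipAt q s x = true) ↔ ∀ x ∈ g.controls, s x = true := by
        refine forall₂_congr fun x hx => ?_
        rw [flipAt, Function.update_of_ne (fun h => h2 (by rwa [h] at hx))]
      have e2 : (∀ x, x ≠ g.target → flipAt q t x = flipAt q s x) ↔
          ∀ x, x ≠ g.target → t x = s x := by
        refine forall₂_congr fun x hx => ?_
        by_cases hxq : x = q
        · subst hxq; simp [flipAt]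
        · simp [flipAt, Function.update_of_ne hxq]
      have e3 : ∀ s : Q → Bool, flipAt q s g.target = s g.target := fun s =>
        Function.update_of_ne (Ne.symm h1) _ _
      simp only [Gate.matrix, e1, e2, e3, hinj.eq_iff]
    rw [Circuit.matrix, Matrix.mul_apply, Matrix.mul_apply,
      ← Equiv.sum_comp (Function.Involutive.toPerm _ (flipAt_flipAt q))]
    refine Finset.sum_congr rfl fun u _ => ?_
    exact congrArg₂ _ (ih h3 _ _) (hg _ _)

section touch
variable {ν : Type} [Fintype ν] [DecidableEq ν] {m b : ℕ} {c : Circuit (ProjQubits m b)}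
  {P : Matrix ν (Fin m → Bool) ℂ}

theorem rangeProj_apply_self (P : Matrix ν (Q → Bool) ℂ) (a : Q → Bool) :
    rangeProj P a a = ((∑ i, ‖P i a‖ ^ 2 : ℝ) : ℂ) := by
  rw [rangeProj, Matrix.mul_apply, Complex.ofReal_sum]
  refine Finset.sum_congr rfl fun i _ => ?_
  rw [Matrix.conjTranspose_apply, Complex.ofReal_pow, ← Complex.conj_mul']
  rfl

theorem rangeProj_apply_self_ne_zero {P : Matrix ν (Q → Bool) ℂ} {i : ν} {a : Q → Bool}
    (h : P i a ≠ 0) : rangeProj P a a ≠ 0 := by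
  rw [rangeProj_apply_self, Complex.ofReal_ne_zero]
  refine (lt_of_lt_of_le ?_ (Finset.single_le_sum (f := fun i => ‖P i a‖ ^ 2)
    (fun i _ => sq_nonneg _) (Finset.mem_univ i))).ne'
  positivity

theorem exists_apply_ne_zero [Nonempty ν] {P : Matrix ν (Q → Bool) ℂ} (hP : P * Pᴴ = 1) :
    ∃ i a, P i a ≠ 0 := by
  by_contra! h
  have : P = 0 := by ext i a; exact h i a
  rw [this, Matrix.zero_mul] at hP
  have := congrFun (congrFun hP (Classical.arbitrary ν)) (Classical.arbitrary ν)
  simp at this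

theorem ImplementsProjNot.diag (h : ImplementsProjNot c P) (a : Fin m → Bool) :
    c.matrix (Sum.elim a (Sum.elim (fun _ => true) fun _ => false))
      (Sum.elim a (Sum.elim (fun _ => false) fun _ => false)) = rangeProj P a a := by
  rw [h.2, if_pos rfl, projNot, Matrix.add_apply, Matrix.kronecker_apply, Matrix.kronecker_apply]
  simp [pauliX]

/-- A circuit for the controlled-NOT gate of a projection touches all the qubits which the
projection requires to be in state `0`. -/
theorem ImplementsProjNot.mem_touched [Nonempty ν] (h : ImplementsProjNot c P) (hP : P * Pᴴ = 1)
    {q : Fin m} (hq : ∀ i a, P i a ≠ 0 → a q = false) : Sum.inl q ∈ touched c := by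
  by_contra hmem
  obtain ⟨i, a, hia⟩ := exists_apply_ne_zero hP
  have h1 := Circuit.matrix_flipAt c _ hmem
    (Sum.elim a (Sum.elim (fun _ => true) fun _ => false))
    (Sum.elim a (Sum.elim (fun _ => false) fun _ => false))
  have hf : ∀ b : Unit ⊕ Fin b → Bool, flipAt (Sum.inl q) (Sum.elim a b) =
      Sum.elim (flipAt q a) b := by
    intro b
    funext x
    rcases x with x | x
    · by_cases hx : x = q
      · subst hx; simp [flipAt]
      · simp [flipAt, hx]
    · simp [flipAt]
  rw [hf, hf, h.diag, h.diag] at h1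
  refine rangeProj_apply_self_ne_zero hia (h1.symm.trans ?_)
  rw [rangeProj_apply_self, Complex.ofReal_eq_zero]
  refine Finset.sum_eq_zero fun j _ => ?_
  by_contra hne
  have h2 : P j (flipAt q a) ≠ 0 := by
    intro h0; rw [h0] at hne; simp at hne
  have h3 := hq j _ h2
  rw [flipAt, Function.update_self, hq i a hia] at h3
  cases h3

/-- The number of qubits that a projection requires to be in state `0` is bounded by the number of
gates. -/
theorem ImplementsProjNot.card_outside_le [Nonempty ν] (h : ImplementsProjNot c P)
    {Q : Type} [Fintype Q] [DecidableEq Q] {e : Q ↪ Fin m} {F : Matrix ν (Q → Bool) ℂ}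
    (hPF : P = extP e F) (hP : P * Pᴴ = 1) : (outside e).card ≤ c.gates := by
  classical
  refine le_trans ?_ (card_touched_le c)
  rw [← Finset.card_map (Function.Embedding.inl (β := Unit ⊕ Fin b))]
  refine Finset.card_le_card fun x hx => ?_
  obtain ⟨q, hq, rfl⟩ := Finset.mem_map.1 hx
  refine h.mem_touched hP fun i a ha => ?_
  rw [hPF, extP_apply] at ha
  by_contra hne
  exact ha (if_neg fun h0 => hne (h0 q ((mem_outside e q).1 hq)))

theorem ImplementsProjNot.one_le_gates [Nonempty ν] (h : ImplementsProjNot c P)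
    (hP : P * Pᴴ = 1) : 1 ≤ c.gates := by
  obtain ⟨i, a, hia⟩ := exists_apply_ne_zero hP
  have h1 := h.diag a
  cases c with
  | nil =>
    exfalso
    rw [Circuit.matrix, Matrix.one_apply_ne] at h1
    · exact rangeProj_apply_self_ne_zero hia h1.symm
    · intro h2
      have := congrFun h2 (Sum.inr (Sum.inl ()))
      simp at this
  | cons g c =>
    simp only [Circuit.gates, List.map_cons, List.sum_cons, Gate.cost]
    omega

end touch

end Convert

/-! ### Projecting and measuring the state of an encoded vector -/

section Purify
variable {μ₁ μ₂ ν₁ ν₂ : Type} {U : Encoding Gate μ₁ μ₂} {I : Interface μ₁ μ₂}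
  [Fintype ν₁] [DecidableEq ν₁] [Fintype ν₂] [DecidableEq ν₂]

/-- The circuit followed by a gate that flips an additional qubit to `1` unless the state is in the
range of the second projection. -/
noncomputable def Blk.purified (T : Blk I ν₁ ν₂) : List (Instr I (T.Q ⊕ (Unit ⊕ T.B₂))) :=
  on (inlE T.Q _) T.circ ++ ([Instr.gate (gate1 (Sum.inr (Sum.inl ())) xV)] ++ T.proj₂)

/-- If the additional qubits are required to be `0` before and after `purified`, it acts as the
circuit followed by the projection. -/
theorem Blk.Valid.sem_purified {T : Blk U.toInterface ν₁ ν₂} (h : T.Valid U) :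
    (zinj (inlE T.Q (Unit ⊕ T.B₂)))ᴴ * (sem U T.purified * zinj (inlE T.Q (Unit ⊕ T.B₂))) =
      rangeProj T.P₂ * sem U T.circ := by
  have h1 : sem U (on (inlE T.Q (Unit ⊕ T.B₂)) T.circ) * zinj (inlE T.Q (Unit ⊕ T.B₂)) =
      zinj (inlE T.Q (Unit ⊕ T.B₂)) * sem U T.circ := by
    rw [sem_on]; exact lift_mul_inj_self _ _ _
  have h2 : (gate1 (Sum.inr (Sum.inl ()) : T.Q ⊕ (Unit ⊕ T.B₂)) xV).matrix *
      zinj (flagEmb T.Q T.B₂) =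
      zinj (flagEmb T.Q T.B₂) * lift (single (Sum.inr ())) ∅ (unitOp pauliX) :=
    (congrArg (· * zinj (flagEmb T.Q T.B₂)) (gate1_matrix _ _)).trans
      (lift_trans_mul_inj (single (Sum.inr ())) (flagEmb T.Q T.B₂) _ _)
  have h3 : sem U T.proj₂ * zinj (flagEmb T.Q T.B₂) =
      zinj (flagEmb T.Q T.B₂) * notOp (rangeProj T.P₂) := h.not₂
  have h4 : lift (single (Sum.inr () : T.Q ⊕ Unit)) ∅ (unitOp pauliX) * ket0 T.Q = ket1 T.Q := by
    rw [gate_mul_ket0]; simp [pauliX]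
  generalize rangeProj T.P₂ = Pi at h3 ⊢
  rw [Blk.purified, sem_append, sem_append, sem_gate]
  simp only [Matrix.mul_assoc]
  rw [h1, ← zinj_flagEmb_mul T.B₂]
  simp only [Matrix.mul_assoc]
  rw [reassoc h2, reassoc h3, Matrix.conjTranspose_mul]
  simp only [Matrix.mul_assoc]
  rw [← Matrix.mul_assoc (zinj (flagEmb T.Q T.B₂))ᴴ, inj_conjTranspose_mul_inj, Matrix.one_mul,
    ← Matrix.mul_assoc _ (ket0 T.Q), h4, ← Matrix.mul_assoc (notOp _), notOp_mul_ket1,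
    ← Matrix.mul_assoc, Matrix.mul_add, ← Matrix.mul_assoc, bra0_mul_ket1, ← Matrix.mul_assoc,
    bra0_mul_ket0, Matrix.zero_mul, zero_add, Matrix.one_mul]

theorem Blk.cost_purified (T : Blk U.toInterface ν₁ ν₂) :
    cost U T.purified = cost U T.circ + cost U T.proj₂ + 1 := by
  rw [Blk.purified, cost_append, cost_append, cost_on, cost_gate]
  simp only [Gate.cost, gate1, Finset.card_empty]
  ring

/-- The circuit followed by the second projection gate, whose target qubit indicates whether the
state is in the range of the projection. -/
noncomputable def Blk.flagged (T : Blk I ν₁ ν₂) : List (Instr I (T.Q ⊕ (Unit ⊕ T.B₂))) :=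
  on (inlE T.Q _) T.circ ++ T.proj₂

theorem Blk.Valid.sem_flagged {T : Blk U.toInterface ν₁ ν₂} (h : T.Valid U) :
    sem U T.flagged * zinj (inlE T.Q (Unit ⊕ T.B₂)) =
      zinj (flagEmb T.Q T.B₂) * (ket0 T.Q * ((1 - rangeProj T.P₂) * sem U T.circ) +
        ket1 T.Q * (rangeProj T.P₂ * sem U T.circ)) := by
  have h1 : sem U (on (inlE T.Q (Unit ⊕ T.B₂)) T.circ) * zinj (inlE T.Q (Unit ⊕ T.B₂)) =
      zinj (inlE T.Q (Unit ⊕ T.B₂)) * sem U T.circ := by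
    rw [sem_on]; exact lift_mul_inj_self _ _ _
  have h3 : sem U T.proj₂ * zinj (flagEmb T.Q T.B₂) =
      zinj (flagEmb T.Q T.B₂) * notOp (rangeProj T.P₂) := h.not₂
  rw [Blk.flagged, sem_append, Matrix.mul_assoc, h1, ← zinj_flagEmb_mul T.B₂]
  simp only [Matrix.mul_assoc]
  rw [reassoc h3, ← Matrix.mul_assoc (notOp _), notOp_mul_ket0, Matrix.add_mul]
  simp only [Matrix.mul_assoc]

theorem mul_zeroBra_conjTranspose_apply {Q ι : Type} [Fintype Q] [DecidableEq Q]
    (M : Matrix ι (Q → Bool) ℂ) (t : ι) (x : Unit) :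
    (M * (zeroBra Q)ᴴ) t x = M t fun _ => false := by
  rw [Matrix.mul_apply, Finset.sum_eq_single fun _ => false]
  · rw [Matrix.conjTranspose_apply, zeroBra, if_pos rfl, star_one, mul_one]
  · intro s _ hs
    rw [Matrix.conjTranspose_apply, zeroBra, if_neg hs, star_zero, mul_zero]
  · intro h; exact absurd (Finset.mem_univ _) h

/-- The state in which the circuit `flagged` is left. -/
theorem Blk.Valid.flagged_apply {T : Blk U.toInterface Unit ν₂} (h : T.Valid U)
    (hP : T.P₁ = zeroBra T.Q) (s : T.Q → Bool) (f : Bool) (w : T.B₂ → Bool) :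
    sem U T.flagged (Sum.elim s (Sum.elim (fun _ => f) w)) (fun _ => false) =
      if w = fun _ => false then
        (if f then (T.P₂ᴴ * T.block U) s () else
          (sem U T.circ * T.P₁ᴴ - T.P₂ᴴ * T.block U) s ()) else 0 := by
  classical
  have h1 := congrFun (congrFun (congrArg (· * T.P₁ᴴ) h.sem_flagged)
    (Sum.elim s (Sum.elim (fun _ => f) w))) ()
  have h2 : (sem U T.flagged * zinj (inlE T.Q (Unit ⊕ T.B₂)) * T.P₁ᴴ)
      (Sum.elim s (Sum.elim (fun _ => f) w)) () =
      sem U T.flagged (Sum.elim s (Sum.elim (fun _ => f) w)) (fun _ => false) := by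
    have h4 := congrArg Matrix.conjTranspose (extP_zeroBra (inlE T.Q (Unit ⊕ T.B₂)))
    rw [extP, Matrix.conjTranspose_mul, Matrix.conjTranspose_conjTranspose, ← hP] at h4
    rw [Matrix.mul_assoc, h4, mul_zeroBra_conjTranspose_apply]
  rw [← h2]
  refine h1.trans ?_
  have hb : T.P₂ᴴ * T.block U = rangeProj T.P₂ * (sem U T.circ * T.P₁ᴴ) := by
    rw [Blk.block, rangeProj, Matrix.mul_assoc]
  have h5 := notMem_range_flagEmb (Sum.elim s (Sum.elim (fun _ => f) w))
  clear h1 h2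
  generalize rangeProj T.P₂ = Pi at hb ⊢
  have h7 : zinj (flagEmb T.Q T.B₂) * (ket0 T.Q * ((1 - Pi) * sem U T.circ) +
      ket1 T.Q * (Pi * sem U T.circ)) * T.P₁ᴴ = zinj (flagEmb T.Q T.B₂) *
      (ket0 T.Q * (sem U T.circ * T.P₁ᴴ - T.P₂ᴴ * T.block U) +
        ket1 T.Q * (T.P₂ᴴ * T.block U)) := by
    rw [hb]
    simp only [Matrix.mul_assoc, Matrix.add_mul, Matrix.sub_mul, Matrix.one_mul]
  refine (congrFun (congrFun h7 _) _).trans ?_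
  rw [inj_mul_apply, if_congr h5 rfl rfl]
  refine if_congr Iff.rfl ?_ rfl
  have h6 : ∀ (w : T.Q ⊕ Unit → Bool) (t : T.Q ⊕ Unit → Bool),
      (∀ q, q ∉ Set.range (inlE T.Q Unit) → t q = w q) ↔ t (Sum.inr ()) = w (Sum.inr ()) := by
    intro w t
    refine ⟨fun h => h _ inr_notMem_range, ?_⟩
    rintro h (q | q) hq
    · exact absurd ⟨q, rfl⟩ hq
    · exact h
  rw [Matrix.add_apply, ket0, ket1, inj_mul_apply, inj_mul_apply, if_congr (h6 _ _) rfl rfl,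
    if_congr (h6 _ _) rfl rfl]
  cases f
  · have e : ¬ ((Sum.elim s (Sum.elim (fun _ => false) w) ∘ flagEmb T.Q T.B₂) (Sum.inr ()) =
        flagOne T.Q (Sum.inr ())) := by simp [flagEmb, flagOne]
    refine (congrArg₂ (· + ·) (if_pos rfl) (if_neg e)).trans ?_
    exact add_zero _
  · have e : ¬ ((Sum.elim s (Sum.elim (fun _ => true) w) ∘ flagEmb T.Q T.B₂) (Sum.inr ()) =
        (fun _ => false : T.Q ⊕ Unit → Bool) (Sum.inr ())) := by simp [flagEmb]
    refine (congrArg₂ (· + ·) (if_neg e) (if_pos rfl)).trans ?_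
    exact zero_add _

theorem sum_normSq_isometry {ι : Type} [Fintype ι] {P : Matrix ν₂ ι ℂ} (hP : P * Pᴴ = 1)
    (b : Matrix ν₂ Unit ℂ) : ∑ s, ‖(Pᴴ * b) s ()‖ ^ 2 = ∑ i, ‖b i ()‖ ^ 2 := by
  have key : ∀ {κ : Type} [Fintype κ] (c : Matrix κ Unit ℂ),
      ((∑ i, ‖c i ()‖ ^ 2 : ℝ) : ℂ) = (cᴴ * c) () () := by
    intro κ _ c
    rw [Matrix.mul_apply, Complex.ofReal_sum]
    refine Finset.sum_congr rfl fun i _ => ?_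
    rw [Matrix.conjTranspose_apply, Complex.ofReal_pow, ← Complex.conj_mul']
    rfl
  rw [← Complex.ofReal_inj, key, key, Matrix.conjTranspose_mul, Matrix.conjTranspose_conjTranspose,
    Matrix.mul_assoc, ← Matrix.mul_assoc P, hP, Matrix.one_mul]

/-- The distribution of the measured flag. -/
theorem Blk.Valid.sum_flagged {T : Blk U.toInterface Unit ν₂} (h : T.Valid U)
    (hP : T.P₁ = zeroBra T.Q) (F : Bool → ℝ) :
    ∑ s : T.Q ⊕ (Unit ⊕ T.B₂) → Bool, ‖sem U T.flagged s (fun _ => false)‖ ^ 2 *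
      F (s (Sum.inr (Sum.inl ()))) = T.prob U * F true + (1 - T.prob U) * F false := by
  classical
  have hsplit : ∀ G : (T.Q ⊕ (Unit ⊕ T.B₂) → Bool) → ℝ, ∑ s, G s =
      ∑ s : T.Q → Bool, ∑ f : Bool, ∑ w : T.B₂ → Bool,
        G (Sum.elim s (Sum.elim (fun _ => f) w)) := by
    intro G
    rw [← (Equiv.sumArrowEquivProdArrow T.Q (Unit ⊕ T.B₂) Bool).symm.sum_comp,
      Fintype.sum_prod_type]
    refine Finset.sum_congr rfl fun s _ => ?_
    rw [← (Equiv.sumArrowEquivProdArrow Unit T.B₂ Bool).symm.sum_comp, Fintype.sum_prod_type,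
      ← (Equiv.funUnique Unit Bool).symm.sum_comp]
    rfl
  have hG : ∀ F : Bool → ℝ,
      ∑ s : T.Q ⊕ (Unit ⊕ T.B₂) → Bool, ‖sem U T.flagged s (fun _ => false)‖ ^ 2 *
        F (s (Sum.inr (Sum.inl ()))) = T.prob U * F true +
        (∑ s : T.Q → Bool, ‖(sem U T.circ * T.P₁ᴴ - T.P₂ᴴ * T.block U) s ()‖ ^ 2) * F false := by
    intro F
    rw [hsplit]
    simp only [h.flagged_apply hP, Sum.elim_inr, Sum.elim_inl]
    have e1 : ∀ s f, ∑ w : T.B₂ → Bool, ‖if w = fun _ => false then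
        (if f then (T.P₂ᴴ * T.block U) s () else
          (sem U T.circ * T.P₁ᴴ - T.P₂ᴴ * T.block U) s ()) else 0‖ ^ 2 * F f =
        ‖(if f then (T.P₂ᴴ * T.block U) s () else
          (sem U T.circ * T.P₁ᴴ - T.P₂ᴴ * T.block U) s ())‖ ^ 2 * F f := by
      intro s f
      rw [Finset.sum_eq_single fun _ => false]
      · rw [if_pos rfl]
      · intro w _ hw; rw [if_neg hw]; simp
      · intro hw; exact absurd (Finset.mem_univ _) hw
    simp only [e1, Fintype.sum_bool, if_true]
    rw [Finset.sum_add_distrib, ← Finset.sum_mul, ← Finset.sum_mul, sum_normSq_isometry h.orth₂]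
    rfl
  have hone := hG fun _ => 1
  have hnorm : ∑ s : T.Q ⊕ (Unit ⊕ T.B₂) → Bool, ‖sem U T.flagged s (fun _ => false)‖ ^ 2 = 1 := by
    have h1 := congrFun (congrFun (conjTranspose_mul_sem (U := U) T.flagged) fun _ => false)
      fun _ => false
    rw [Matrix.mul_apply, Matrix.one_apply_eq] at h1
    rw [← Complex.ofReal_inj, Complex.ofReal_sum, Complex.ofReal_one, ← h1]
    refine Finset.sum_congr rfl fun i _ => ?_
    rw [Matrix.conjTranspose_apply, Complex.ofReal_pow, ← Complex.conj_mul']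
    rfl
  simp only [mul_one, hnorm] at hone
  rw [hG F]
  congr 2
  linarith

theorem Blk.cost_flagged (T : Blk U.toInterface ν₁ ν₂) :
    cost U T.flagged = cost U T.circ + cost U T.proj₂ := by
  rw [Blk.flagged, cost_append, cost_on]

theorem Blk.Valid.prob_le_one {T : Blk U.toInterface Unit ν₂} (h : T.Valid U)
    (hP : T.P₁ = zeroBra T.Q) : T.prob U ≤ 1 := by
  have h1 := h.sum_flagged hP fun b => if b then 0 else 1
  simp only [if_true, Bool.false_eq_true, if_false, mul_zero, mul_one, zero_add] at h1
  have h2 : 0 ≤ 1 - T.prob U := by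
    rw [← h1]
    refine Finset.sum_nonneg fun s _ => mul_nonneg (sq_nonneg _) ?_
    split_ifs <;> norm_num
  linarith

end Purify

/-! ### Preparing a superposition of control states -/

section Ket
variable {Q R : Type} [Fintype Q] [DecidableEq Q] [Fintype R] [DecidableEq R]

/-- A basis state. -/
noncomputable def ket (s : Q → Bool) : (Q → Bool) → ℂ := Pi.single s 1

theorem mulVec_ket {ι : Type} (M : Matrix ι (Q → Bool) ℂ) (s : Q → Bool) :
    M *ᵥ ket s = fun t => M t s := by
  funext t
  rw [ket, Matrix.mulVec_single_one]; rfl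

theorem permMat_mulVec_ket (F : (Q → Bool) → (Q → Bool)) (s : Q → Bool) :
    permMat F *ᵥ ket s = ket (F s) := by
  rw [mulVec_ket]
  funext t
  simp [permMat, ket, Pi.single_apply]

theorem Gate.matrix_mulVec_ket (g : Gate Q) (s : Q → Bool) :
    g.matrix *ᵥ ket s = if ∀ c ∈ g.controls, s c = true then
      (g.V : Matrix Bool Bool ℂ) false (s g.target) • ket (Function.update s g.target false) +
      (g.V : Matrix Bool Bool ℂ) true (s g.target) • ket (Function.update s g.target true)
      else ket s := by
  rw [mulVec_ket]
  funext t
  rw [Gate.matrix]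
  split_ifs with h1 h2 h3
  · have ht : t = Function.update s g.target (t g.target) := by
      funext q
      by_cases hq : q = g.target
      · subst hq; simp
      · rw [Function.update_of_ne hq, h2 q hq]
    have hne : ∀ b, t g.target ≠ b → t ≠ Function.update s g.target b := by
      intro b hb h
      apply hb
      rw [h, Function.update_self]
    cases hb : t g.target
    · rw [hb] at ht hne
      have h4 := hne true (by simp)
      simp [ket, ← ht, h4]
    · rw [hb] at ht hne
      have h4 := hne false (by simp)
      simp [ket, ← ht, h4]
  · have hne : ∀ b, t ≠ Function.update s g.target b := by
      rintro b rfl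
      exact h2 fun q hq => Function.update_of_ne hq _ _
    simp [ket, hne]
  · rw [h3]; simp [ket]
  · simp [ket, h3]

/-- The control state `k`: the qubits `inl i` form a unary encoding of `k`, and the qubits `inr i`
are their negations. -/
def code (κ k : ℕ) : Fin κ ⊕ Fin κ → Bool :=
  Sum.elim (fun i => decide ((i : ℕ) < k)) fun i => decide (k ≤ (i : ℕ))

theorem code_injective {κ j k : ℕ} (hj : j ≤ κ) (hk : k ≤ κ) (h : code κ j = code κ k) :
    j = k := by
  by_contra hne
  rcases Nat.lt_or_gt_of_ne hne with hlt | hlt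
  · have := congrFun h (Sum.inl ⟨j, by omega⟩)
    simp [code, hlt] at this
  · have := congrFun h (Sum.inl ⟨k, by omega⟩)
    simp [code, hlt] at this

/-- The control of the rotation of the qubit `inl i`: the preceding qubit. -/
def prevCtrl (κ i : ℕ) : Finset (Fin κ ⊕ Fin κ) :=
  if h : 1 ≤ i ∧ i ≤ κ then {Sum.inl ⟨i - 1, by omega⟩} else ∅

theorem inl_notMem_prevCtrl {κ i : ℕ} (h : i < κ) : Sum.inl ⟨i, h⟩ ∉ prevCtrl κ i := by
  rw [prevCtrl]
  split_ifs with h1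
  · simp only [Finset.mem_singleton, Sum.inl.injEq, Fin.mk.injEq]; omega
  · simp

theorem card_prevCtrl_le (κ i : ℕ) : (prevCtrl κ i).card ≤ 1 := by
  rw [prevCtrl]
  split_ifs <;> simp

theorem prevCtrl_code {κ i k : ℕ} (hi : i ≤ κ) :
    (∀ c ∈ prevCtrl κ i, code κ k c = true) ↔ i ≤ k := by
  rw [prevCtrl]
  split_ifs with h
  · simp [code]; omega
  · simp; omega

variable (p : ℕ → ℝ) (κ : ℕ)

/-- The amplitude of all the control states from `i` on. -/
noncomputable def tailAmp (i : ℕ) : ℝ := √(∑ k ∈ Finset.Ico i (κ + 1), p k)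

/-- The gates that split off the control state `i`. -/
noncomputable def prepStep (i : ℕ) : Circuit (Fin κ ⊕ Fin κ) :=
  if h : i < κ then
    [⟨Sum.inl ⟨i, h⟩, prevCtrl κ i, inl_notMem_prevCtrl h, rotV (√(p i) / tailAmp p κ i)⟩,
      cnot {Sum.inl ⟨i, h⟩} (Sum.inr ⟨i, h⟩) (by simp)]
  else []

/-- The preparation of the superposition of the control states with the amplitudes `√(p k)`. -/
noncomputable def prepCirc : ℕ → Circuit (Fin κ ⊕ Fin κ)
  | 0 => xLayer ((Finset.univ : Finset (Fin κ)).toList.map Sum.inr)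
  | i + 1 => prepCirc i ++ prepStep p κ i

theorem prepCirc_gates (i : ℕ) : Circuit.gates (prepCirc p κ i) ≤ κ + 4 * i := by
  induction i with
  | zero => simp [prepCirc, xLayer_gates]
  | succ i ih =>
    have h : Circuit.gates (prepStep p κ i) ≤ 4 := by
      rw [prepStep]
      split_ifs
      · have := card_prevCtrl_le κ i
        simp [Circuit.gates, Gate.cost, cnot]; omega
      · simp [Circuit.gates]
    rw [prepCirc, Circuit.gates_append]
    omega

theorem prepStep_mulVec_lt {i k : ℕ} (hk : k < i) :
    Circuit.matrix (prepStep p κ i) *ᵥ ket (code κ k) = ket (code κ k) := by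
  rw [prepStep]
  split_ifs with h
  · rw [Circuit.matrix, Circuit.matrix_singleton, cnot_matrix, ← Matrix.mulVec_mulVec,
      Gate.matrix_mulVec_ket, if_neg, permMat_mulVec_ket, flipIf, if_neg]
    · simp [code]; omega
    · rw [prevCtrl_code h.le]; omega
  · rw [Circuit.matrix, Matrix.one_mulVec]

theorem update_code {i : ℕ} (h : i < κ) :
    Function.update (Function.update (code κ i) (Sum.inl ⟨i, h⟩) true) (Sum.inr ⟨i, h⟩) false =
      code κ (i + 1) := by
  funext q
  rcases q with q | q
  · rw [Function.update_of_ne (by simp)]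
    by_cases hq : q = ⟨i, h⟩
    · subst hq; simp [code]
    · rw [Function.update_of_ne (by simpa using hq)]
      have : (q : ℕ) ≠ i := fun h' => hq (Fin.ext h')
      simp [code]; omega
  · by_cases hq : q = ⟨i, h⟩
    · rw [hq, Function.update_self, code, Sum.elim_inr]; simp
    · rw [Function.update_of_ne (by simpa using hq), Function.update_of_ne (by simp)]
      have : (q : ℕ) ≠ i := fun h' => hq (Fin.ext h')
      simp [code]; omega

theorem prepStep_mulVec_self {i : ℕ} (h : i < κ) :
    Circuit.matrix (prepStep p κ i) *ᵥ ket (code κ i) =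
      (Real.cos (Real.arccos (√(p i) / tailAmp p κ i)) : ℂ) • ket (code κ i) +
      (Real.sin (Real.arccos (√(p i) / tailAmp p κ i)) : ℂ) • ket (code κ (i + 1)) := by
  have hf : code κ i (Sum.inl ⟨i, h⟩) = false := by simp [code]
  have h0 : Function.update (code κ i) (Sum.inl ⟨i, h⟩) false = code κ i := by
    rw [Function.update_eq_self_iff, hf]
  rw [prepStep, dif_pos h, Circuit.matrix, Circuit.matrix_singleton, cnot_matrix,
    ← Matrix.mulVec_mulVec, Gate.matrix_mulVec_ket, if_pos ((prevCtrl_code h.le).2 le_rfl)]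
  simp only [hf, h0, Matrix.mulVec_add, Matrix.mulVec_smul, permMat_mulVec_ket]
  congr 2
  · rw [flipIf, if_neg]
    intro h'
    have := h' _ (Finset.mem_singleton_self _)
    rw [hf] at this
    cases this
  · rw [flipIf, if_pos (by simp), Function.update_of_ne (by simp), ← update_code κ h]
    congr 2
    simp [code]

variable {p κ}

theorem tailAmp_cos_sin (hp : ∀ k, 0 ≤ p k) {i : ℕ} (hi : i < κ) :
    tailAmp p κ i * Real.cos (Real.arccos (√(p i) / tailAmp p κ i)) = √(p i) ∧
    tailAmp p κ i * Real.sin (Real.arccos (√(p i) / tailAmp p κ i)) = tailAmp p κ (i + 1) := by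
  have hsum : ∑ k ∈ Finset.Ico i (κ + 1), p k = p i + ∑ k ∈ Finset.Ico (i + 1) (κ + 1), p k :=
    Finset.sum_eq_sum_Ico_succ_bot (by omega) _
  have hnn : 0 ≤ ∑ k ∈ Finset.Ico (i + 1) (κ + 1), p k := Finset.sum_nonneg fun k _ => hp k
  have hb : tailAmp p κ i ^ 2 = p i + tailAmp p κ (i + 1) ^ 2 := by
    rw [tailAmp, tailAmp, Real.sq_sqrt (Finset.sum_nonneg fun k _ => hp k), Real.sq_sqrt hnn, hsum]
  have hb0 : 0 ≤ tailAmp p κ i := Real.sqrt_nonneg _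
  have hb1 : 0 ≤ tailAmp p κ (i + 1) := Real.sqrt_nonneg _
  have hs : √(p i) ^ 2 = p i := Real.sq_sqrt (hp i)
  have hs0 := Real.sqrt_nonneg (p i)
  rcases hb0.eq_or_lt with h0 | h0
  · rw [← h0] at hb ⊢
    constructor
    · nlinarith
    · nlinarith
  · have hle : √(p i) ≤ tailAmp p κ i := by
      refine abs_le_of_sq_le_sq' ?_ hb0 |>.2
      nlinarith
    have hq0 : 0 ≤ √(p i) / tailAmp p κ i := by positivity
    have hq1 : √(p i) / tailAmp p κ i ≤ 1 := by rwa [div_le_one h0]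
    rw [Real.cos_arccos (by linarith) hq1, Real.sin_arccos]
    constructor
    · field_simp
    · have : 1 - (√(p i) / tailAmp p κ i) ^ 2 = (tailAmp p κ (i + 1) / tailAmp p κ i) ^ 2 := by
        field_simp
        nlinarith
      rw [this, Real.sqrt_sq (by positivity)]
      field_simp

/-- After `i` steps the control states below `i` have their final amplitudes, and the state `i`
carries all the remaining amplitude. -/
theorem prepCirc_mulVec (hp : ∀ k, 0 ≤ p k) (hp1 : ∑ k ∈ Finset.range (κ + 1), p k = 1) {i : ℕ}
    (hi : i ≤ κ) : Circuit.matrix (prepCirc p κ i) *ᵥ ket (fun _ => false) =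
      ∑ k ∈ Finset.range i, (√(p k) : ℂ) • ket (code κ k) + (tailAmp p κ i : ℂ) • ket (code κ i) := by
  induction i with
  | zero =>
    have h0 : tailAmp p κ 0 = 1 := by
      rw [tailAmp, ← Finset.range_eq_Ico, hp1, Real.sqrt_one]
    rw [prepCirc, xLayer_matrix _ ((Finset.nodup_toList _).map Sum.inr_injective),
      permMat_mulVec_ket, h0]
    simp only [Finset.range_zero, Finset.sum_empty, zero_add, Complex.ofReal_one, one_smul]
    congr 1
    funext q
    rcases q with q | q <;> simp [code]
  | succ i ih =>
    have hi' : i < κ := hi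
    obtain ⟨h1, h2⟩ := tailAmp_cos_sin (p := p) hp hi'
    rw [prepCirc, Circuit.matrix_append, ← Matrix.mulVec_mulVec, ih hi'.le, Matrix.mulVec_add,
      Matrix.mulVec_smul, prepStep_mulVec_self p κ hi', Matrix.mulVec_sum, Finset.sum_range_succ,
      smul_add, smul_smul, smul_smul, ← Complex.ofReal_mul, ← Complex.ofReal_mul, h1, h2, add_assoc]
    congr 1
    refine Finset.sum_congr rfl fun k hk => ?_
    rw [Matrix.mulVec_smul, prepStep_mulVec_lt p κ (Finset.mem_range.1 hk)]

theorem prepCirc_mulVec_top (hp : ∀ k, 0 ≤ p k) (hp1 : ∑ k ∈ Finset.range (κ + 1), p k = 1) :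
    Circuit.matrix (prepCirc p κ κ) *ᵥ ket (fun _ => false) =
      ∑ k ∈ Finset.range (κ + 1), (√(p k) : ℂ) • ket (code κ k) := by
  rw [prepCirc_mulVec hp hp1 le_rfl, Finset.sum_range_succ, tailAmp]
  simp

end Ket

/-! ### Linear combinations of controlled circuits -/

section Select
variable {C R : Type} [Fintype C] [DecidableEq C] [Fintype R] [DecidableEq R]
  {μ₁ μ₂ : Type} {U : Encoding Gate μ₁ μ₂}

/-- The inclusion of the second summand. -/
abbrev inrE (C R : Type) : R ↪ C ⊕ R := Function.Embedding.inr

/-- The isometry that adds the control register in the state `s`. -/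
noncomputable def ctrlKet (R : Type) [Fintype R] [DecidableEq R] (s : C → Bool) :
    Matrix (C ⊕ R → Bool) (R → Bool) ℂ := inj (inrE C R) (Sum.elim s fun _ => false)

theorem ctrlKet_apply (s : C → Bool) (t : C ⊕ R → Bool) (u : R → Bool) :
    ctrlKet R s t u = if t = Sum.elim s u then 1 else 0 := by
  have : Function.extend (inrE C R) u (Sum.elim s fun _ => false) = Sum.elim s u := by
    symm
    rw [eq_extend_iff]
    constructor
    · rintro (q | q) hq
      · rfl
      · exact absurd ⟨q, rfl⟩ hq
    · rfl
  rw [ctrlKet, inj, this]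

theorem bra_mul_ctrlKet (s s' : C → Bool) :
    (ctrlKet R s)ᴴ * ctrlKet R s' = if s = s' then 1 else 0 := by
  ext u v
  rw [Matrix.mul_apply]
  simp only [Matrix.conjTranspose_apply, ctrlKet_apply]
  have : ∀ x : C ⊕ R → Bool, star (if x = Sum.elim s u then (1 : ℂ) else 0) *
      (if x = Sum.elim s' v then 1 else 0) =
      if x = Sum.elim s u then (if s = s' ∧ u = v then 1 else 0) else 0 := by
    intro x
    by_cases hx : x = Sum.elim s u
    · subst hx
      simp only [if_true, star_one, one_mul]
      refine if_congr ⟨fun h => ⟨?_, ?_⟩, fun h => by rw [h.1, h.2]⟩ rfl rfl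
      · funext q; exact congrFun h (Sum.inl q)
      · funext q; exact congrFun h (Sum.inr q)
    · simp [hx]
  simp only [this, Finset.sum_ite_eq', Finset.mem_univ, if_true]
  by_cases hs : s = s'
  · simp [hs, Matrix.one_apply]
  · simp [hs]

/-- A circuit on the register, with controls in the control register. -/
def ctrlPlace {I : Interface μ₁ μ₂} (ctrl : Finset C) (c : List (Instr I R)) :
    List (Instr I (C ⊕ R)) :=
  place (inrE C R) (ctrl.map Function.Embedding.inl) (by simp) c

theorem sem_ctrlPlace_mul (ctrl : Finset C) (c : List (Instr U.toInterface R)) (s : C → Bool)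
    [Decidable (∀ q ∈ ctrl, s q = true)] :
    sem U (ctrlPlace ctrl c) * ctrlKet R s =
      ctrlKet R s * (if ∀ q ∈ ctrl, s q = true then sem U c else 1) := by
  classical
  have h := lift_mul_inj (Function.Embedding.refl R) (inrE C R) (inrE C R)
    (Function.Embedding.refl R) (Sum.elim s fun _ => false) (fun _ => rfl)
    (fun a b hab => ⟨a, rfl, Sum.inr.inj hab⟩) (ctrl.map Function.Embedding.inl) (by simp)
    (sem U c) (sem U c) (by
      have h1 : inj (Function.Embedding.refl R) ((Sum.elim s fun _ => false) ∘ inrE C R) = 1 := by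
        ext t u
        have : Function.extend (Function.Embedding.refl R) u
            ((Sum.elim s fun _ => false) ∘ inrE C R) = u :=
          extend_comp_self (Function.Embedding.refl R) u _
        rw [inj, this, Matrix.one_apply]
      rw [h1, Matrix.mul_one, Matrix.one_mul])
  rw [ctrlPlace, sem_place, ctrlKet, h, lift_refl]
  congr 1
  refine if_congr ?_ rfl rfl
  simp

theorem cost_ctrlPlace_le (ctrl : Finset C) (c : List (Instr U.toInterface R)) :
    cost U (ctrlPlace ctrl c) ≤ (1 + ctrl.card) * cost U c := by
  have := cost_place_le (inrE C R) (ctrl.map Function.Embedding.inl) (by simp) c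
  rwa [Finset.card_map] at this

theorem le_cost_ctrlPlace (ctrl : Finset C) (c : List (Instr U.toInterface R)) :
    cost U c ≤ cost U (ctrlPlace ctrl c) :=
  le_cost_place _ _ _ _

/-- The product of the matrices `N a`, in the order of circuits. -/
noncomputable def seqProd {α : Type} (N : α → Matrix (R → Bool) (R → Bool) ℂ) :
    List α → Matrix (R → Bool) (R → Bool) ℂ
  | [] => 1
  | a :: l => seqProd N l * N a

theorem sem_flatMap_mul {α : Type} {κ : Type} [Fintype κ] [DecidableEq κ] (l : List α)
    (c : α → List (Instr U.toInterface κ)) (J : Matrix (κ → Bool) (R → Bool) ℂ)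
    (N : α → Matrix (R → Bool) (R → Bool) ℂ) (h : ∀ a ∈ l, sem U (c a) * J = J * N a) :
    sem U (l.flatMap c) * J = J * seqProd N l := by
  induction l with
  | nil => rw [List.flatMap_nil, sem_nil, seqProd, Matrix.one_mul, Matrix.mul_one]
  | cons a l ih =>
    rw [List.flatMap_cons, sem_append, Matrix.mul_assoc, h a (by simp), ← Matrix.mul_assoc,
      ih fun b hb => h b (by simp [hb]), seqProd, Matrix.mul_assoc]

theorem seqProd_eq_one {α : Type} (N : α → Matrix (R → Bool) (R → Bool) ℂ) (l : List α)
    (h : ∀ a ∈ l, N a = 1) : seqProd N l = 1 := by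
  induction l with
  | nil => rfl
  | cons a l ih => rw [seqProd, ih fun b hb => h b (by simp [hb]), h a (by simp), Matrix.one_mul]

theorem seqProd_eq_single {α : Type} (N : α → Matrix (R → Bool) (R → Bool) ℂ) {l : List α}
    (hl : l.Nodup) {k : α} (hk : k ∈ l) (h : ∀ a, a ≠ k → N a = 1) : seqProd N l = N k := by
  induction l with
  | nil => cases hk
  | cons a l ih =>
    rw [List.nodup_cons] at hl
    rw [seqProd]
    rcases List.mem_cons.1 hk with rfl | hk'
    · rw [seqProd_eq_one, Matrix.one_mul]
      intro b hb
      exact h b fun hbk => hl.1 (hbk ▸ hb)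
    · rw [ih hl.2 hk', h a fun hak => hl.1 (hak ▸ hk'), Matrix.mul_one]

/-- A circuit that is controlled by the state of the control register, between a preparation of
the control register and its inverse, implements a linear combination. -/
theorem prep_select {α : Type} [DecidableEq α] (L : Circuit C) (M : List (Instr U.toInterface (C ⊕ R)))
    (S : Finset α) (code : α → C → Bool) (hcode : Set.InjOn code S) (p : α → ℝ)
    (hp : ∀ k, 0 ≤ p k)
    (hL : Circuit.matrix L *ᵥ ket (fun _ => false) = ∑ k ∈ S, (√(p k) : ℂ) • ket (code k))
    (N : α → Matrix (R → Bool) (R → Bool) ℂ)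
    (hM : ∀ k ∈ S, sem U M * ctrlKet R (code k) = ctrlKet R (code k) * N k) :
    (zinj (inrE C R))ᴴ * (sem U (on (inlE C R) (L.map Instr.gate) ++
      (M ++ inverse (on (inlE C R) (L.map Instr.gate)))) * zinj (inrE C R)) =
      ∑ k ∈ S, (p k : ℂ) • N k := by
  set V := lift (inlE C R) ∅ (Circuit.matrix L) with hV
  have hprep : V * zinj (inrE C R) = ∑ k ∈ S, (√(p k) : ℂ) • ctrlKet R (code k) := by
    have hz : zinj (inrE C R) = ctrlKet R fun _ => false := by
      rw [ctrlKet, zinj]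
      congr 1
      funext q; rcases q with q | q <;> rfl
    ext t u
    have hz2 : ∀ x : C ⊕ R → Bool, ctrlKet R (fun _ : C => false) x u =
        if x = Sum.elim (fun _ => false) u then 1 else 0 := fun x => ctrlKet_apply _ _ _
    have hlift : V t (Sum.elim (fun _ => false) u) = if t ∘ Sum.inr = u then
        (Circuit.matrix L *ᵥ ket (fun _ => false)) (t ∘ Sum.inl) else 0 := by
      rw [mulVec_ket, hV, lift, if_pos (by simp)]
      refine if_congr ?_ rfl rfl
      constructor
      · intro h; funext q
        exact h (Sum.inr q) (by rintro ⟨x, hx⟩; cases hx)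
      · rintro rfl (q | q) hq
        · exact absurd ⟨q, rfl⟩ hq
        · rfl
    rw [hz, Matrix.mul_apply]
    simp only [hz2, mul_ite, mul_one, mul_zero, Finset.sum_ite_eq', Finset.mem_univ, if_true]
    rw [hlift, hL, Matrix.sum_apply, Finset.sum_apply]
    simp only [Pi.smul_apply, Matrix.smul_apply, ctrlKet_apply, ket, Pi.single_apply]
    have heq : ∀ k, (t = Sum.elim (code k) u) ↔ t ∘ Sum.inr = u ∧ t ∘ Sum.inl = code k := by
      intro k
      constructor
      · rintro rfl; exact ⟨rfl, rfl⟩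
      · rintro ⟨rfl, h⟩
        rw [← h]
        funext q; rcases q with q | q <;> rfl
    split_ifs with h
    · refine Finset.sum_congr rfl fun k _ => ?_
      congr 1
      exact if_congr (by rw [heq k, and_iff_right h]) rfl rfl
    · symm
      refine Finset.sum_eq_zero fun k _ => ?_
      rw [if_neg fun h2 => h ((heq k).1 h2).1, smul_zero]
  have hsel : sem U M * (∑ k ∈ S, (√(p k) : ℂ) • ctrlKet R (code k)) =
      ∑ k ∈ S, (√(p k) : ℂ) • (ctrlKet R (code k) * N k) := by
    rw [Matrix.mul_sum]
    refine Finset.sum_congr rfl fun k hk => ?_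
    rw [Matrix.mul_smul, hM k hk]
  have hconj : (zinj (inrE C R))ᴴ * Vᴴ = ∑ k ∈ S, (√(p k) : ℂ) • (ctrlKet R (code k))ᴴ := by
    rw [← Matrix.conjTranspose_mul, hprep, Matrix.conjTranspose_sum]
    refine Finset.sum_congr rfl fun k _ => ?_
    rw [Matrix.conjTranspose_smul]
    simp
  rw [sem_append, sem_append, sem_inverse, sem_on, sem_map_gate, ← hV, Matrix.mul_assoc, hprep,
    Matrix.mul_assoc, hsel, ← Matrix.mul_assoc, hconj, Matrix.sum_mul]
  refine Finset.sum_congr rfl fun k hk => ?_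
  rw [Matrix.mul_sum, Finset.sum_eq_single k]
  · rw [Matrix.smul_mul, Matrix.mul_smul, smul_smul, ← Matrix.mul_assoc, bra_mul_ctrlKet, if_pos rfl,
      Matrix.one_mul, ← Complex.ofReal_mul, Real.mul_self_sqrt (hp k)]
  · intro j hj hjk
    rw [Matrix.smul_mul, Matrix.mul_smul, ← Matrix.mul_assoc, bra_mul_ctrlKet,
      if_neg fun h => hjk (hcode hk hj h).symm, Matrix.zero_mul, smul_zero, smul_zero]
  · intro h; exact absurd hk h

end Select

/-! ### Moving data and placing several copies of a circuit -/

section Move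
variable {D P R : Type} [Fintype D] [DecidableEq D] [Fintype R] [DecidableEq R]
  [Fintype P] [DecidableEq P]

/-- Moving the state of the qubits `e ·` to the qubits `e' ·`, which are in state `0`. -/
noncomputable def moveCirc (e e' : D ↪ R) (h : ∀ r r', e r ≠ e' r') (l : List D) : Circuit R :=
  l.flatMap fun r => [cnot {e r} (e' r) (by simpa using (h r r).symm),
    cnot {e' r} (e r) (by simpa using h r r)]

theorem moveCirc_gates (e e' : D ↪ R) (h : ∀ r r', e r ≠ e' r') (l : List D) :
    Circuit.gates (moveCirc e e' h l) = 4 * l.length := by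
  induction l with
  | nil => simp [moveCirc, Circuit.gates]
  | cons r l ih =>
    have : moveCirc e e' h (r :: l) = [cnot {e r} (e' r) (by simpa using (h r r).symm),
      cnot {e' r} (e r) (by simpa using h r r)] ++ moveCirc e e' h l := rfl
    rw [this, Circuit.gates_append, ih]
    simp [Circuit.gates, Gate.cost, cnot]
    ring

/-- The action of `moveCirc` on basis states. -/
def moveFun (e e' : D ↪ R) : List D → (R → Bool) → R → Bool
  | [], s => s
  | r :: l, s => moveFun e e' l (flipIf {e' r} (e r) (flipIf {e r} (e' r) s))

theorem moveCirc_matrix (e e' : D ↪ R) (h : ∀ r r', e r ≠ e' r') (l : List D) :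
    Circuit.matrix (moveCirc e e' h l) = permMat (moveFun e e' l) := by
  induction l with
  | nil =>
    ext t s
    simp only [moveCirc, List.flatMap_nil, Circuit.matrix, permMat, Matrix.one_apply, moveFun]
    exact if_congr Iff.rfl rfl rfl
  | cons r l ih =>
    have : moveCirc e e' h (r :: l) = [cnot {e r} (e' r) (by simpa using (h r r).symm),
      cnot {e' r} (e r) (by simpa using h r r)] ++ moveCirc e e' h l := rfl
    rw [this, Circuit.matrix_append, ih, Circuit.matrix, Circuit.matrix_singleton, cnot_matrix,
      cnot_matrix, permMat_mul, permMat_mul]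
    rfl

/-- The value of each qubit after the transfer, provided that the target qubits are initially `0`.
-/
theorem moveFun_apply (e e' : D ↪ R) (h : ∀ r r', e r ≠ e' r') (l : List D) (hl : l.Nodup)
    (s : R → Bool) (hs : ∀ r ∈ l, s (e' r) = false) (q : R) :
    (∀ r ∈ l, q = e' r → moveFun e e' l s q = s (e r)) ∧
    (∀ r ∈ l, q = e r → moveFun e e' l s q = false) ∧
    ((∀ r ∈ l, q ≠ e r ∧ q ≠ e' r) → moveFun e e' l s q = s q) := by
  induction l generalizing s with
  | nil => simp [moveFun]
  | cons a l ih =>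
    rw [List.nodup_cons] at hl
    set s' := flipIf {e' a} (e a) (flipIf {e a} (e' a) s) with hs'
    have h0 : s (e' a) = false := hs a (by simp)
    have hval : ∀ x, s' x = if x = e a then false else if x = e' a then s (e a) else s x := by
      intro x
      have hne := h a a
      have e1 : flipIf {e a} (e' a) s = Function.update s (e' a) (s (e a)) := by
        rw [flipIf]
        cases hc : s (e a)
        · rw [if_neg (by simp [hc])]
          rw [eq_comm, Function.update_eq_self_iff, h0]
        · rw [if_pos (by simp [hc]), h0]; rfl
      rw [hs', e1, flipIf]
      cases hc : s (e a)
      · rw [if_neg (by simp)]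
        by_cases hx : x = e a
        · subst hx; rw [Function.update_of_ne hne, if_pos rfl, hc]
        · rw [if_neg hx]
          by_cases hx' : x = e' a
          · subst hx'; simp
          · rw [Function.update_of_ne hx', if_neg hx']
      · rw [if_pos (by simp)]
        by_cases hx : x = e a
        · subst hx; rw [Function.update_self, Function.update_of_ne hne, if_pos rfl, hc]; rfl
        · rw [if_neg hx, Function.update_of_ne hx]
          by_cases hx' : x = e' a
          · subst hx'; simp
          · rw [Function.update_of_ne hx', if_neg hx']
    have hs2 : ∀ r ∈ l, s' (e' r) = false := by
      intro r hr
      rw [hval, if_neg (h a r).symm, if_neg, hs r (by simp [hr])]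
      intro hh
      exact hl.1 (e'.injective hh ▸ hr)
    obtain ⟨i1, i2, i3⟩ := ih hl.2 s' hs2
    have hmv : moveFun e e' (a :: l) s q = moveFun e e' l s' q := rfl
    rw [hmv]
    refine ⟨?_, ?_, ?_⟩
    · intro r hr hq
      rcases List.mem_cons.1 hr with rfl | hr'
      · rw [i3, hval, hq, if_neg (h r r).symm, if_pos rfl]
        intro r' hr'
        refine ⟨hq ▸ (h r' r).symm, ?_⟩
        rintro hh
        exact hl.1 (e'.injective (hq.symm.trans hh) ▸ hr')
      · rw [i1 r hr' hq, hval, if_neg, if_neg (h r a)]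
        intro hh
        exact hl.1 (e.injective hh ▸ hr')
    · intro r hr hq
      rcases List.mem_cons.1 hr with rfl | hr'
      · rw [i3, hval, if_pos hq]
        intro r' hr'
        refine ⟨?_, hq ▸ h r r'⟩
        rintro hh
        exact hl.1 (e.injective (hq.symm.trans hh) ▸ hr')
      · exact i2 r hr' hq
    · intro hq
      rw [i3 fun r hr => hq r (by simp [hr]), hval, if_neg (hq a (by simp)).1,
        if_neg (hq a (by simp)).2]

theorem moveCirc_mul_zinj (e e' : D ↪ R) (h : ∀ r r', e r ≠ e' r') :
    Circuit.matrix (moveCirc e e' h Finset.univ.toList) * zinj e = zinj e' := by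
  ext t u
  rw [mul_inj_apply, moveCirc_matrix, permMat, zinj, inj]
  have : moveFun e e' Finset.univ.toList (Function.extend e u fun _ => false) =
      Function.extend e' u fun _ => false := by
    have hoff : ∀ r, Function.extend e u (fun _ => false) (e' r) = false := fun r =>
      extend_off e u _ (by rintro ⟨x, hx⟩; exact h x r hx)
    rw [eq_extend_iff]
    have key := moveFun_apply e e' h _ (Finset.nodup_toList Finset.univ)
      (Function.extend e u fun _ => false) fun r _ => hoff r
    constructor
    · intro q hq
      obtain ⟨-, k2, k3⟩ := key q
      by_cases hqe : q ∈ Set.range e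
      · obtain ⟨r, rfl⟩ := hqe
        exact k2 r (by simp) rfl
      · rw [k3, extend_off e u _ hqe]
        exact fun r _ => ⟨fun hh => hqe ⟨r, hh.symm⟩, fun hh => hq ⟨r, hh.symm⟩⟩
    · funext r
      rw [Function.comp_apply, (key (e' r)).1 r (by simp) rfl]
      exact e.injective.extend_apply _ _ _
  rw [this]

theorem mul_lift_apply (A : Matrix (R → Bool) (R → Bool) ℂ) (e : P ↪ R)
    (X : Matrix (P → Bool) (P → Bool) ℂ) (t s : R → Bool) :
    (A * lift e ∅ X) t s = ∑ u : P → Bool, A t (Function.extend e u s) * X u (s ∘ e) := by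
  classical
  rw [Matrix.mul_apply]
  have := sum_agree e s fun v => A t v * X (v ∘ e) (s ∘ e)
  simp only [extend_comp_self] at this
  rw [← this]
  refine Finset.sum_congr rfl fun v _ => ?_
  rw [lift, if_pos (by simp)]
  split_ifs <;> simp

open Classical in
/-- The entries of a product of operators on disjoint registers. -/
theorem seqProd_lift_apply {α : Type} (e : α → P ↪ R)
    (hd : ∀ i j, i ≠ j → ∀ p p', e i p ≠ e j p') (X : Matrix (P → Bool) (P → Bool) ℂ)
    (good : α → Prop) [DecidablePred good] (l : List α) (hl : l.Nodup) (t s : R → Bool) :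
    seqProd (fun i => if good i then lift (e i) ∅ X else 1) l t s =
      if ∀ q, (∀ i ∈ l, good i → q ∉ Set.range (e i)) → t q = s q then
        (l.map fun i => if good i then X (t ∘ e i) (s ∘ e i) else 1).prod else 0 := by
  induction l generalizing s with
  | nil =>
    simp only [seqProd, Matrix.one_apply, List.not_mem_nil, false_imp_iff, implies_true,
      true_imp_iff, List.map_nil, List.prod_nil]
    exact if_congr funext_iff rfl rfl
  | cons a l ih =>
    rw [List.nodup_cons] at hl
    rw [seqProd, List.map_cons, List.prod_cons]
    by_cases ha : good a
    · rw [if_pos ha, if_pos ha, mul_lift_apply, Finset.sum_eq_single (t ∘ e a)]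
      · rw [ih hl.2]
        have hcond : (∀ q, (∀ i ∈ l, good i → q ∉ Set.range (e i)) →
            t q = Function.extend (e a) (t ∘ e a) s q) ↔
            ∀ q, (∀ i ∈ a :: l, good i → q ∉ Set.range (e i)) → t q = s q := by
          constructor
          · intro h q hq
            rw [h q fun i hi => hq i (by simp [hi]), extend_off _ _ _ (hq a (by simp) ha)]
          · intro h q hq
            by_cases hqa : q ∈ Set.range (e a)
            · obtain ⟨x, rfl⟩ := hqa
              exact ((e a).injective.extend_apply (t ∘ e a) s x).symm
            · rw [extend_off _ _ _ hqa]
              refine h q fun i hi hg => ?_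
              rcases List.mem_cons.1 hi with rfl | hi'
              · exact hqa
              · exact hq i hi' hg
        rw [if_congr hcond rfl rfl, ite_mul, zero_mul, mul_comm]
        refine if_congr Iff.rfl ?_ rfl
        congr 2
        refine List.map_congr_left fun i hi => ?_
        have : Function.extend (e a) (t ∘ e a) s ∘ e i = s ∘ e i := by
          funext x
          refine extend_off _ _ _ ?_
          rintro ⟨y, hy⟩
          exact hd a i (fun hai => hl.1 (hai ▸ hi)) y x hy
        rw [this]
      · intro u _ hu
        rw [ih hl.2, if_neg, zero_mul]
        intro h
        apply hu
        funext x
        rw [Function.comp_apply, h (e a x), (e a).injective.extend_apply]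
        rintro i hi - ⟨y, hy⟩
        exact hd i a (fun hai => hl.1 (hai ▸ hi)) y x hy
      · intro h; exact absurd (Finset.mem_univ _) h
    · rw [if_neg ha, if_neg ha, Matrix.mul_one, ih hl.2, one_mul]
      refine if_congr (forall_congr' fun q => ?_) rfl rfl
      simp [ha]

theorem zinj_conjTranspose_mul_lift (e : P ↪ R) (X : Matrix (P → Bool) (P → Bool) ℂ) :
    (zinj e)ᴴ * lift e ∅ X = X * (zinj e)ᴴ := by
  have := congrArg Matrix.conjTranspose (lift_mul_inj_self e (fun _ => false) Xᴴ)
  rwa [Matrix.conjTranspose_mul, Matrix.conjTranspose_mul, Matrix.conjTranspose_conjTranspose,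
    lift_conjTranspose _ _ (fun _ => Finset.notMem_empty _),
    Matrix.conjTranspose_conjTranspose] at this

end Move

/-! ### Linear combinations of multilinear maps of an encoded vector -/

/-- The data of a linear combination of circuits `u k`. The circuit `u k` is applied to `k` copies
of a state, which is prepared by the circuit `cx` and whose data are on the qubits `d ·`, and
to the qubits `iIn ·`; the qubits `a k ·` of `u k` hold these arguments. The result, which `u k`
leaves on the qubits `o k ·`, is moved to the qubits `oOut ·`. -/
structure Comb {μ₁ μ₂ : Type} (I : Interface μ₁ μ₂) (D D' : Type) where
  κ : ℕ
  Qx : Type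
  In : Type
  Out : Type
  [fQ : Fintype Qx]
  [dQ : DecidableEq Qx]
  [fI : Fintype In]
  [dI : DecidableEq In]
  [fO : Fintype Out]
  [dO : DecidableEq Out]
  cx : List (Instr I Qx)
  d : D ↪ Qx
  iIn : D' ↪ In
  oOut : D ↪ Out
  m : Fin (κ + 1) → ℕ
  u : ∀ k, Circuit (Fin (m k))
  a : ∀ k : Fin (κ + 1), (Fin k × D) ⊕ D' ↪ Fin (m k)
  o : ∀ k, D ↪ Fin (m k)
  p : ℕ → ℝ

attribute [instance] Comb.fQ Comb.dQ Comb.fI Comb.dI Comb.fO Comb.dO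

namespace Comb
variable {μ₁ μ₂ : Type} {I : Interface μ₁ μ₂} {D D' : Type} [Fintype D] [DecidableEq D]
  [Fintype D'] [DecidableEq D']

section defs
variable (T : Comb I D D')

/-- The control qubits. -/
abbrev Ctl : Type := Fin T.κ ⊕ Fin T.κ

/-- The qubits of `u k` that do not hold an argument. -/
abbrev Pool (k : Fin (T.κ + 1)) : Type := {q // q ∈ outside (T.a k)}

/-- All the qubits except for the control qubits. -/
abbrev Reg : Type := (Fin T.κ × T.Qx) ⊕ (T.In ⊕ (T.Out ⊕ Σ k, T.Pool k))

/-- The qubits of the `i`-th copy of the state. -/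
def copy (i : Fin T.κ) : T.Qx ↪ T.Reg :=
  ⟨fun q => Sum.inl (i, q), fun _ _ h => (Prod.mk.inj (Sum.inl.inj h)).2⟩

/-- The inclusion of the input register. -/
def inReg : T.In ↪ T.Reg := ⟨fun q => Sum.inr (Sum.inl q), fun _ _ h => Sum.inl.inj (Sum.inr.inj h)⟩

/-- The inclusion of the output register. -/
def outReg : T.Out ↪ T.Reg :=
  ⟨fun q => Sum.inr (Sum.inr (Sum.inl q)), fun _ _ h => Sum.inl.inj (Sum.inr.inj (Sum.inr.inj h))⟩

/-- The place of an argument of `u k`. -/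
def argPlace (k : Fin (T.κ + 1)) : (Fin k × D) ⊕ D' → T.Reg
  | .inl (i, r) => Sum.inl (Fin.castLE (Nat.lt_succ_iff.1 k.2) i, T.d r)
  | .inr r => Sum.inr (Sum.inl (T.iIn r))

theorem argPlace_injective (k : Fin (T.κ + 1)) : Function.Injective (T.argPlace k) := by
  rintro (⟨i, r⟩ | r) (⟨i', r'⟩ | r') h
  · obtain ⟨h1, h2⟩ := Prod.mk.inj (Sum.inl.inj h)
    rw [T.d.injective h2, Fin.castLE_injective _ h1]
  · cases h
  · cases h
  · rw [T.iIn.injective (Sum.inl.inj (Sum.inr.inj h))]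

open Classical in
/-- The place of a qubit of `u k`. -/
noncomputable def placeFun (k : Fin (T.κ + 1)) (q : Fin (T.m k)) : T.Reg :=
  if h : ∃ y, T.a k y = q then T.argPlace k h.choose
  else Sum.inr (Sum.inr (Sum.inr ⟨k, q, (mem_outside _ _).2 fun ⟨y, hy⟩ => h ⟨y, hy⟩⟩))

theorem placeFun_a (k : Fin (T.κ + 1)) (y : (Fin k × D) ⊕ D') :
    T.placeFun k (T.a k y) = T.argPlace k y := by
  have h : ∃ y', T.a k y' = T.a k y := ⟨y, rfl⟩
  rw [placeFun, dif_pos h, (T.a k).injective h.choose_spec]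

theorem placeFun_pool (k : Fin (T.κ + 1)) (q : T.Pool k) :
    T.placeFun k q.1 = Sum.inr (Sum.inr (Sum.inr ⟨k, q⟩)) := by
  rw [placeFun, dif_neg]
  rintro ⟨y, hy⟩
  exact (mem_outside _ _).1 q.2 ⟨y, hy⟩

/-- The qubits of `u k` inside the register. -/
noncomputable def place (k : Fin (T.κ + 1)) : Fin (T.m k) ↪ T.Reg :=
  ⟨T.placeFun k, by
    intro q q' h
    by_cases hq : ∃ y, T.a k y = q <;> by_cases hq' : ∃ y, T.a k y = q'
    · obtain ⟨y, rfl⟩ := hq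
      obtain ⟨y', rfl⟩ := hq'
      rw [placeFun_a, placeFun_a] at h
      rw [T.argPlace_injective k h]
    · obtain ⟨y, rfl⟩ := hq
      have h2 := T.placeFun_pool k ⟨q', (mem_outside _ _).2 fun ⟨y, hy⟩ => hq' ⟨y, hy⟩⟩
      rw [placeFun_a, h2] at h
      rcases y with y | y <;> cases h
    · obtain ⟨y, rfl⟩ := hq'
      have h2 := T.placeFun_pool k ⟨q, (mem_outside _ _).2 fun ⟨y, hy⟩ => hq ⟨y, hy⟩⟩
      rw [placeFun_a, h2] at h
      rcases y with y | y <;> cases h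
    · have h1 := T.placeFun_pool k ⟨q, (mem_outside _ _).2 fun ⟨y, hy⟩ => hq ⟨y, hy⟩⟩
      have h2 := T.placeFun_pool k ⟨q', (mem_outside _ _).2 fun ⟨y, hy⟩ => hq' ⟨y, hy⟩⟩
      have h3 := (h1.symm.trans h).trans h2
      have h4 := Sum.inr.inj (Sum.inr.inj (Sum.inr.inj h3))
      have h5 := eq_of_heq (Sigma.mk.inj h4).2
      exact congrArg Subtype.val h5⟩

theorem place_ne_outReg (k : Fin (T.κ + 1)) (q : Fin (T.m k)) (q' : T.Out) :
    T.place k q ≠ T.outReg q' := by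
  intro h
  by_cases hq : ∃ y, T.a k y = q
  · obtain ⟨y, rfl⟩ := hq
    have h1 := (T.placeFun_a k y).symm.trans h
    rcases y with y | y <;> cases h1
  · have h1 := T.placeFun_pool k ⟨q, (mem_outside _ _).2 fun ⟨y, hy⟩ => hq ⟨y, hy⟩⟩
    have h3 := h1.symm.trans h
    cases Sum.inr.inj (Sum.inr.inj h3)

/-- The controls of `u k`, which are all in state `1` only in the control state `k`. -/
def codeCtrl (k : Fin (T.κ + 1)) : Finset T.Ctl :=
  prevCtrl T.κ k ∪ (if h : (k : ℕ) < T.κ then {Sum.inr ⟨k, h⟩} else ∅)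

theorem codeCtrl_iff (j k : Fin (T.κ + 1)) :
    (∀ c ∈ T.codeCtrl j, code T.κ k c = true) ↔ j = k := by
  have hj := j.2
  have hk := k.2
  have h1 := prevCtrl_code (κ := T.κ) (i := j) (k := k) (by omega)
  simp only [codeCtrl, Finset.mem_union, or_imp, forall_and, h1, Fin.ext_iff]
  split_ifs with h
  · simp [code]; omega
  · simp; omega

theorem card_codeCtrl_le (k : Fin (T.κ + 1)) : (T.codeCtrl k).card ≤ 2 := by
  have h1 := card_prevCtrl_le T.κ k
  refine (Finset.card_union_le _ _).trans ?_
  split_ifs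
  · simp; omega
  · simp; omega

/-- The circuit `u k` followed by the transfer of its output. -/
noncomputable def term (k : Fin (T.κ + 1)) : Circuit T.Reg :=
  (T.u k).map (Gate.place (T.place k) ∅ fun _ => Finset.notMem_empty _) ++
    moveCirc ((T.o k).trans (T.place k)) (T.oOut.trans T.outReg)
      (fun _ _ => T.place_ne_outReg _ _ _) Finset.univ.toList

/-- The controlled circuits. -/
noncomputable def select : List (Instr I (T.Ctl ⊕ T.Reg)) :=
  (List.finRange T.κ).flatMap (fun i => ctrlPlace {Sum.inl i} (on (T.copy i) T.cx)) ++
    (List.finRange (T.κ + 1)).flatMap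
      (fun k => ctrlPlace (T.codeCtrl k) ((T.term k).map Instr.gate))

/-- The circuit for the linear combination. -/
noncomputable def circ : List (Instr I (T.Ctl ⊕ T.Reg)) :=
  on (inlE T.Ctl T.Reg) ((prepCirc T.p T.κ T.κ).map Instr.gate) ++
    (T.select ++ inverse (on (inlE T.Ctl T.Reg) ((prepCirc T.p T.κ T.κ).map Instr.gate)))

end defs

section sem
variable {U : Encoding Gate μ₁ μ₂} (T : Comb U.toInterface D D')

/-- The wave function of the prepared state on the data qubits. -/
noncomputable def wave (y : D → Bool) : ℂ :=
  sem U T.cx (Function.extend T.d y fun _ => false) fun _ => false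

open Classical in
/-- The amplitudes of the arguments of `u k`. -/
noncomputable def args (k : Fin (T.κ + 1)) : Matrix (Fin (T.m k) → Bool) (D' → Bool) ℂ := fun v i =>
  if (∀ q, q ∉ Set.range (T.a k) → v q = false) ∧ ∀ r, v (T.a k (Sum.inr r)) = i r then
    ∏ j : Fin k, T.wave fun r => v (T.a k (Sum.inl (j, r))) else 0

/-- The operator implemented in the control state `k`. -/
noncomputable def branch (k : Fin (T.κ + 1)) : Matrix (T.Reg → Bool) (T.Reg → Bool) ℂ :=
  Circuit.matrix (T.term k) * seqProd (fun i : Fin T.κ =>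
    if (i : ℕ) < k then lift (T.copy i) ∅ (sem U T.cx) else 1) (List.finRange T.κ)

/-- In the control state `k`, the circuit that prepares a copy is applied `k` times, and among the
circuits `u j` only `u k` is applied. -/
theorem sem_select (k : Fin (T.κ + 1)) :
    sem U T.select * ctrlKet T.Reg (code T.κ k) = ctrlKet T.Reg (code T.κ k) * T.branch k := by
  classical
  have h1 := sem_flatMap_mul (U := U) (List.finRange T.κ)
    (fun i => ctrlPlace {Sum.inl i} (on (T.copy i) T.cx)) (ctrlKet T.Reg (code T.κ k))
    (fun i : Fin T.κ => if (i : ℕ) < k then lift (T.copy i) ∅ (sem U T.cx) else 1) (by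
      intro i _
      rw [sem_ctrlPlace_mul, sem_on]
      congr 1
      refine if_congr ?_ rfl rfl
      simp [code])
  have h2 := sem_flatMap_mul (U := U) (List.finRange (T.κ + 1))
    (fun j => ctrlPlace (T.codeCtrl j) ((T.term j).map Instr.gate)) (ctrlKet T.Reg (code T.κ k))
    (fun j => if j = k then Circuit.matrix (T.term j) else 1) (by
      intro j _
      rw [sem_ctrlPlace_mul, sem_map_gate]
      congr 1
      exact if_congr (T.codeCtrl_iff j k) rfl rfl)
  rw [seqProd_eq_single _ (List.nodup_finRange _) (List.mem_finRange k) fun j hj => if_neg hj,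
    if_pos rfl] at h2
  rw [select, sem_append, Matrix.mul_assoc, h1, reassoc h2, branch]

/-- The copies are on disjoint registers, so their joint amplitude is a product of wave functions;
the requirement that all other qubits are `0` at the end removes the components outside the data
register. -/
theorem copies_apply (k : Fin (T.κ + 1)) (v : Fin (T.m k) → Bool) (i : D' → Bool) :
    seqProd (fun i : Fin T.κ => if (i : ℕ) < k then lift (T.copy i) ∅ (sem U T.cx) else 1)
      (List.finRange T.κ) (Function.extend (T.place k) v fun _ => false)
      (Function.extend (T.iIn.trans T.inReg) i fun _ => false) = T.args k v i := by
  classical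
  set t := Function.extend (T.place k) v fun _ => false with ht
  set s := Function.extend (T.iIn.trans T.inReg) i fun _ => false with hs
  have hta : ∀ y, t (T.argPlace k y) = v (T.a k y) := fun y => by
    rw [← T.placeFun_a]; exact (T.place k).injective.extend_apply _ _ _
  have htp : ∀ q : T.Pool k, t (Sum.inr (Sum.inr (Sum.inr ⟨k, q⟩))) = v q.1 := fun q => by
    rw [← T.placeFun_pool]; exact (T.place k).injective.extend_apply _ _ _
  have ht0 : ∀ x, (∀ y, x ≠ T.argPlace k y) →
      (∀ q : T.Pool k, x ≠ Sum.inr (Sum.inr (Sum.inr ⟨k, q⟩))) → t x = false := by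
    intro x h1 h2
    refine extend_off _ _ _ ?_
    rintro ⟨q, rfl⟩
    by_cases hq : ∃ y, T.a k y = q
    · obtain ⟨y, rfl⟩ := hq
      exact h1 y (T.placeFun_a k y)
    · set q' : T.Pool k := ⟨q, (mem_outside _ _).2 fun ⟨y, hy⟩ => hq ⟨y, hy⟩⟩
      exact h2 q' (T.placeFun_pool k q')
  have hsi : ∀ r, s (Sum.inr (Sum.inl (T.iIn r))) = i r := fun r =>
    (T.iIn.trans T.inReg).injective.extend_apply _ _ r
  have hs0 : ∀ x, (∀ r, x ≠ Sum.inr (Sum.inl (T.iIn r))) → s x = false := by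
    intro x h1
    refine extend_off _ _ _ ?_
    rintro ⟨r, rfl⟩
    exact h1 r rfl
  rw [seqProd_lift_apply T.copy _ _ (fun i : Fin T.κ => (i : ℕ) < k) _ (List.nodup_finRange _)]
  · rw [args]
    have hcond : (∀ q, (∀ i ∈ List.finRange T.κ, (i : ℕ) < k → q ∉ Set.range (T.copy i)) →
        t q = s q) ↔ ((∀ q, q ∉ Set.range (T.a k) → v q = false) ∧
          ∀ r, v (T.a k (Sum.inr r)) = i r) := by
      constructor
      · intro h
        constructor
        · intro q hq
          have hq' := (mem_outside _ _).2 hq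
          rw [← htp ⟨q, hq'⟩, h, hs0]
          · intro r hr; cases Sum.inr.inj hr
          · rintro i - - ⟨x, hx⟩; cases hx
        · intro r
          rw [← hta, ← hsi]
          refine h _ ?_
          rintro i - - ⟨x, hx⟩; cases hx
      · rintro ⟨h1, h2⟩ q hq
        rcases q with ⟨j, x⟩ | q | q | ⟨k', q⟩
        · have hj : ¬ (j : ℕ) < k := fun hj => hq j (List.mem_finRange _) hj ⟨x, rfl⟩
          rw [hs0 _ (by intro r hr; cases hr), ht0]
          · rintro (⟨j', r⟩ | r) hh
            · have := (Prod.mk.inj (Sum.inl.inj hh)).1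
              rw [this] at hj
              exact hj j'.2
            · cases hh
          · intro q hh; cases hh
        · by_cases hr : ∃ r, q = T.iIn r
          · obtain ⟨r, rfl⟩ := hr
            rw [hsi, ← h2, ← hta]; rfl
          · rw [hs0, ht0]
            · rintro (y | r) hh
              · cases hh
              · exact hr ⟨r, Sum.inl.inj (Sum.inr.inj hh)⟩
            · intro q hh; cases Sum.inr.inj hh
            · intro r hh; exact hr ⟨r, Sum.inl.inj (Sum.inr.inj hh)⟩
        · rw [hs0 _ (by intro r hr; cases Sum.inr.inj hr), ht0]
          · rintro (y | y) hh <;> cases hh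
          · intro q hh; cases Sum.inr.inj (Sum.inr.inj hh)
        · rw [hs0 _ (by intro r hr; cases Sum.inr.inj hr)]
          by_cases hk : k' = k
          · subst hk
            rw [htp, h1 _ ((mem_outside _ _).1 q.2)]
          · rw [ht0]
            · rintro (y | y) hh <;> cases hh
            · intro q' hh
              exact hk (Sigma.mk.inj (Sum.inr.inj (Sum.inr.inj (Sum.inr.inj hh)))).1
    simp only [hcond]
    split_ifs
    swap
    · rfl
    rw [← Fin.prod_univ_def]
    symm
    refine Fintype.prod_of_injective (Fin.castLE (Nat.lt_succ_iff.1 k.2))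
      (Fin.castLE_injective _) _ _ ?_ ?_
    · intro j hj
      rw [if_neg]
      intro hjk
      exact hj ⟨⟨j, hjk⟩, rfl⟩
    · intro j
      have hjk : ((Fin.castLE (Nat.lt_succ_iff.1 k.2) j : Fin T.κ) : ℕ) < k := j.2
      rw [if_pos hjk, wave]
      congr 1
      · symm
        rw [eq_extend_iff]
        constructor
        · intro q hq
          refine ht0 _ ?_ ?_
          · rintro (⟨j', r⟩ | r) hh
            · exact hq ⟨r, (Prod.mk.inj (Sum.inl.inj hh)).2.symm⟩
            · cases hh
          · intro q hh; cases hh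
        · funext r
          exact hta (Sum.inl (j, r))
      · funext q
        exact (hs0 _ (by intro r hr; cases hr)).symm
  · intro j j' hj q q' hq
    exact hj (Prod.mk.inj (Sum.inl.inj hq)).1

theorem branch_block (k : Fin (T.κ + 1)) :
    (zinj (T.oOut.trans T.outReg))ᴴ * (T.branch k * zinj (T.iIn.trans T.inReg)) =
      (zinj (T.o k))ᴴ * (Circuit.matrix (T.u k) * T.args k) := by
  set e := (T.o k).trans (T.place k) with he
  have hmove := moveCirc_mul_zinj e (T.oOut.trans T.outReg) (fun _ _ => T.place_ne_outReg _ _ _)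
  set M := Circuit.matrix (moveCirc e (T.oOut.trans T.outReg)
    (fun _ _ => T.place_ne_outReg _ _ _) Finset.univ.toList) with hM
  have h1 : (zinj (T.oOut.trans T.outReg))ᴴ * M = (zinj e)ᴴ := by
    rw [← hmove, Matrix.conjTranspose_mul, Matrix.mul_assoc, hM, Circuit.conjTranspose_mul_matrix,
      Matrix.mul_one]
  have h2 : Circuit.matrix (T.term k) = M * lift (T.place k) ∅ (Circuit.matrix (T.u k)) := by
    rw [term, Circuit.matrix_append, Circuit.matrix_place]
  have h3 : zinj e = zinj (T.place k) * zinj (T.o k) :=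
    (inj_mul_inj (T.o k) (T.place k) fun _ => false).symm
  have h4 : (zinj (T.place k))ᴴ * (seqProd (fun i : Fin T.κ =>
      if (i : ℕ) < k then lift (T.copy i) ∅ (sem U T.cx) else 1) (List.finRange T.κ) *
        zinj (T.iIn.trans T.inReg)) = T.args k := by
    ext v i
    rw [inj_conjTranspose_mul_apply, mul_inj_apply, T.copies_apply]
  rw [branch, h2]
  simp only [Matrix.mul_assoc]
  rw [← Matrix.mul_assoc _ M, h1, h3, Matrix.conjTranspose_mul, Matrix.mul_assoc,
    ← Matrix.mul_assoc (zinj (T.place k))ᴴ, zinj_conjTranspose_mul_lift, Matrix.mul_assoc, h4]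

/-- The block of the linear combination. -/
theorem circ_block (hp : ∀ k, 0 ≤ T.p k) (hp1 : ∑ k ∈ Finset.range (T.κ + 1), T.p k = 1) :
    (zinj ((T.oOut.trans T.outReg).trans (inrE T.Ctl T.Reg)))ᴴ * (sem U T.circ *
      zinj ((T.iIn.trans T.inReg).trans (inrE T.Ctl T.Reg))) =
      ∑ k : Fin (T.κ + 1), (T.p k : ℂ) •
        ((zinj (T.o k))ᴴ * (Circuit.matrix (T.u k) * T.args k)) := by
  have h1 := prep_select (U := U) (prepCirc T.p T.κ T.κ) T.select Finset.univ
    (fun k : Fin (T.κ + 1) => code T.κ k)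
    (fun j _ k _ h => Fin.ext (code_injective (Nat.lt_succ_iff.1 j.2) (Nat.lt_succ_iff.1 k.2) h))
    (fun k => T.p k) (fun k => hp k) (by rw [prepCirc_mulVec_top hp hp1, Finset.sum_range])
    T.branch (fun k _ => T.sem_select k)
  have h2 : zinj ((T.oOut.trans T.outReg).trans (inrE T.Ctl T.Reg)) =
      zinj (inrE T.Ctl T.Reg) * zinj (T.oOut.trans T.outReg) :=
    (inj_mul_inj (T.oOut.trans T.outReg) (inrE T.Ctl T.Reg) fun _ => false).symm
  have h3 : zinj ((T.iIn.trans T.inReg).trans (inrE T.Ctl T.Reg)) =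
      zinj (inrE T.Ctl T.Reg) * zinj (T.iIn.trans T.inReg) :=
    (inj_mul_inj (T.iIn.trans T.inReg) (inrE T.Ctl T.Reg) fun _ => false).symm
  rw [h2, h3, Matrix.conjTranspose_mul, Matrix.mul_assoc, ← Matrix.mul_assoc (sem U T.circ),
    ← Matrix.mul_assoc (zinj (inrE T.Ctl T.Reg))ᴴ]
  rw [circ, h1, Matrix.sum_mul, Matrix.mul_sum]
  refine Finset.sum_congr rfl fun k _ => ?_
  rw [Matrix.smul_mul, Matrix.mul_smul, T.branch_block]

end sem
end Comb

/-! ### The number of gates of a linear combination -/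

section Size
variable {μ₁ μ₂ ν₁ ν₂ : Type} {U : Encoding Gate μ₁ μ₂}

theorem cost_flatMap_le {α Q : Type} [Fintype Q] [DecidableEq Q]
    (l : List α) (c : α → List (Instr U.toInterface Q)) (w : α → ℕ)
    (h : ∀ a, cost U (c a) ≤ w a) : cost U (l.flatMap c) ≤ (l.map w).sum := by
  induction l with
  | nil => simp [cost_nil]
  | cons a l ih =>
    rw [List.flatMap_cons, cost_append, List.map_cons, List.sum_cons]
    exact add_le_add (h a) ih

theorem le_cost_flatMap {α Q : Type} [Fintype Q] [DecidableEq Q]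
    {l : List α} (c : α → List (Instr U.toInterface Q)) {a : α} (ha : a ∈ l) :
    cost U (c a) ≤ cost U (l.flatMap c) := by
  induction l with
  | nil => cases ha
  | cons b l ih =>
    rw [List.flatMap_cons, cost_append]
    rcases List.mem_cons.1 ha with rfl | h
    · omega
    · have := ih h; omega

variable (U) in
/-- A measure for the size of a block encoding: the number of its gates and qubits. -/
noncomputable def Blk.size (T : Blk U.toInterface ν₁ ν₂) : ℕ := T.gates U + Fintype.card T.Q + 1

namespace Comb
variable {D D' : Type} [Fintype D] [DecidableEq D] [Fintype D'] [DecidableEq D']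
  (T : Comb U.toInterface D D')

/-- The circuit `cx` is used for each of the `κ` copies, with one control; the circuits `u k` have
two controls. -/
theorem cost_circ_le : cost U T.circ ≤ 10 * T.κ + 2 * (T.κ * cost U T.cx) +
    3 * ((∑ k, Circuit.gates (T.u k)) + 4 * ((T.κ + 1) * Fintype.card D)) := by
  have h1 := prepCirc_gates T.p T.κ T.κ
  have h2 := cost_flatMap_le (U := U) (List.finRange T.κ)
    (fun i => ctrlPlace (C := T.Ctl) {Sum.inl i} (on (T.copy i) T.cx)) (fun _ => 2 * cost U T.cx) fun i => by
      refine (cost_ctrlPlace_le (C := T.Ctl) _ _).trans ?_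
      rw [cost_on]; simp
  have h3 := cost_flatMap_le (U := U) (List.finRange (T.κ + 1))
    (fun k => ctrlPlace (T.codeCtrl k) ((T.term k).map Instr.gate))
    (fun k => 3 * (Circuit.gates (T.u k) + 4 * Fintype.card D)) fun k => by
      refine (cost_ctrlPlace_le _ _).trans (Nat.mul_le_mul ?_ ?_)
      · have := T.card_codeCtrl_le k; omega
      · have h4 := Circuit.gates_place_le (T.u k) (T.place k) ∅ (fun _ => Finset.notMem_empty _)
        have h5 := moveCirc_gates ((T.o k).trans (T.place k)) (T.oOut.trans T.outReg)
          (fun _ _ => T.place_ne_outReg _ _ _) Finset.univ.toList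
        simp only [Finset.card_empty, add_zero, one_mul] at h4
        simp only [Finset.length_toList, Finset.card_univ] at h5
        rw [cost_map_gate, term, Circuit.gates_append]
        exact Nat.add_le_add h4 h5.le
  have e2 : ((List.finRange T.κ).map fun _ => 2 * cost U T.cx).sum = T.κ * (2 * cost U T.cx) := by
    simp
  have e3 : ((List.finRange (T.κ + 1)).map
      fun k => 3 * (Circuit.gates (T.u k) + 4 * Fintype.card D)).sum =
      3 * ((∑ k, Circuit.gates (T.u k)) + 4 * ((T.κ + 1) * Fintype.card D)) := by
    rw [← Fin.sum_univ_def, ← Finset.mul_sum, Finset.sum_add_distrib]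
    simp; ring
  rw [e2] at h2
  rw [e3] at h3
  rw [circ, cost_append, cost_append, cost_inverse, cost_on, cost_map_gate, select, cost_append]
  linarith

theorem le_cost_circ (h : 1 ≤ T.κ) : cost U T.cx ≤ cost U T.circ := by
  have h2 := le_cost_flatMap (U := U) (fun i => ctrlPlace (C := T.Ctl) {Sum.inl i} (on (T.copy i) T.cx))
    (List.mem_finRange (⟨0, h⟩ : Fin T.κ))
  have h3 := le_cost_ctrlPlace (U := U) (C := T.Ctl) {Sum.inl ⟨0, h⟩} (on (T.copy ⟨0, h⟩) T.cx)
  rw [cost_on] at h3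
  rw [circ, cost_append, cost_append, select, cost_append]
  linarith

theorem card_qubits : Fintype.card (T.Ctl ⊕ T.Reg) = 2 * T.κ + T.κ * Fintype.card T.Qx +
    Fintype.card T.In + Fintype.card T.Out + ∑ k, (outside (T.a k)).card := by
  simp only [Fintype.card_sum, Fintype.card_prod, Fintype.card_sigma, Fintype.card_fin,
    Fintype.card_coe]
  ring

end Comb
end Size

/-! ### Polynomials of an encoded vector -/

section Poly
variable {μ₁ μ₂ : Type} {I : Interface μ₁ μ₂} {N n : ℕ}

/-- Terms that are applied to copies of the vector encoded by `X`, whose data are on the qubits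
`d ·`, and to an additional register. -/
noncomputable def combOf {D' : Type} (X : Blk I Unit (Fin N)) (d : Fin n ↪ X.Q) {In : Type}
    [Fintype In] [DecidableEq In] (iIn : D' ↪ In) (κ : ℕ) {m : Fin (κ + 1) → ℕ}
    (u : ∀ k, Circuit (Fin (m k))) (a : ∀ k : Fin (κ + 1), (Fin k × Fin n) ⊕ D' ↪ Fin (m k))
    (o : ∀ k, Fin n ↪ Fin (m k)) (p : ℕ → ℝ) : Comb I (Fin n) D' where
  κ := κ
  Qx := X.Q ⊕ (Unit ⊕ X.B₂)
  In := In
  Out := X.Q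
  cx := X.purified
  d := d.trans (inlE X.Q (Unit ⊕ X.B₂))
  iIn := iIn
  oOut := d
  m := m
  u := u
  a := a
  o := o
  p := p

/-- The place of the output register. -/
def Comb.outQ {D D' : Type} [Fintype D] [DecidableEq D] [Fintype D'] [DecidableEq D']
    (T : Comb I D D') : T.Out ↪ T.Ctl ⊕ T.Reg := T.outReg.trans (inrE T.Ctl T.Reg)

/-- The place of the input register. -/
def Comb.inQ {D D' : Type} [Fintype D] [DecidableEq D] [Fintype D'] [DecidableEq D']
    (T : Comb I D D') : T.In ↪ T.Ctl ⊕ T.Reg := T.inReg.trans (inrE T.Ctl T.Reg)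

/-- The arguments of the `k`-th term of a polynomial. -/
def polyArgs {k m : ℕ} (pos : Fin k × Fin n ↪ Fin m) : (Fin k × Fin n) ⊕ Empty ↪ Fin m :=
  (Equiv.sumEmpty (Fin k × Fin n) Empty).toEmbedding.trans pos

/-- The arguments of the `k`-th term of a Jacobian. The last argument is the additional register. -/
def jacArgs {k m : ℕ} (pos : Fin (k + 1) × Fin n ↪ Fin m) : (Fin k × Fin n) ⊕ Fin n ↪ Fin m :=
  ⟨Sum.elim (fun x => pos (x.1.castSucc, x.2)) fun r => pos (Fin.last k, r), by
    rintro (⟨i, r⟩ | r) (⟨i', r'⟩ | r') h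
    · obtain ⟨h1, h2⟩ := Prod.mk.inj (pos.injective h)
      have h3 : r = r' := h2
      have h0 : i = i' := Fin.castSucc_injective _ h1
      rw [h0, h3]
    · exact absurd (Prod.mk.inj (pos.injective h)).1 (Fin.castSucc_ne_last i)
    · exact absurd (Prod.mk.inj (pos.injective h)).1.symm (Fin.castSucc_ne_last i')
    · rw [(Prod.mk.inj (pos.injective h)).2]⟩

/-- A linear combination of the vectors `A_k b^{⊗k}`, where `b` is the vector encoded by `X`. -/
noncomputable def polyBlk (X : Blk I Unit (Fin N)) (d : Fin n ↪ X.Q) (κ : ℕ)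
    (V : (k : ℕ) → Encoding Gate (Fin k → Fin N) (Fin N))
    (pos : ∀ k : Fin (κ + 1), Fin k × Fin n ↪ Fin (V k).m)
    (o : ∀ k : Fin (κ + 1), Fin n ↪ Fin (V k).m) (p : ℕ → ℝ) : Blk I Unit (Fin N) :=
  let T := combOf X d (Function.Embedding.refl Empty) κ (fun k => (V k).circ)
    (fun k => polyArgs (pos k)) o p
  assemble T.circ T.outQ T.outQ (extProj T.outQ X.proj₁) (extProj T.outQ X.proj₂) X.P₁ X.P₂

/-- A linear combination of the matrices `A_{k+1} (b^{⊗k} ⊗ Id)`, where `b` is the vector encoded by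
`X`. -/
noncomputable def jacBlk (X : Blk I Unit (Fin N)) (d : Fin n ↪ X.Q) (κ : ℕ)
    (V : (k : ℕ) → Encoding Gate (Fin k → Fin N) (Fin N))
    (pos : ∀ k : Fin (κ + 1), Fin (k + 1) × Fin n ↪ Fin (V (k + 1)).m)
    (o : ∀ k : Fin (κ + 1), Fin n ↪ Fin (V (k + 1)).m) (p : ℕ → ℝ) : Blk I (Fin N) (Fin N) :=
  let T := combOf X d d κ (fun k => (V (k + 1)).circ) (fun k => jacArgs (pos k)) o p
  assemble T.circ T.inQ T.outQ (extProj T.inQ X.proj₂) (extProj T.outQ X.proj₂) X.P₂ X.P₂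

variable {U : Encoding Gate μ₁ μ₂} {E : Matrix (Fin N) (Fin n → Bool) ℂ}
  {X : Blk U.toInterface Unit (Fin N)} {d : Fin n ↪ X.Q}

/-- For the circuit `purified`, the wave function on the data qubits is that of the encoded vector.
-/
theorem wave_combOf (hX : X.Valid U) (h₁ : X.P₁ = zeroBra X.Q) (h₂ : X.P₂ = extP d E)
    {D' : Type} [Fintype D'] [DecidableEq D'] {In : Type} [Fintype In] [DecidableEq In]
    (iIn : D' ↪ In) (κ : ℕ) {m : Fin (κ + 1) → ℕ}
    (u : ∀ k, Circuit (Fin (m k))) (a : ∀ k : Fin (κ + 1), (Fin k × Fin n) ⊕ D' ↪ Fin (m k))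
    (o : ∀ k, Fin n ↪ Fin (m k)) (p : ℕ → ℝ) (y : Fin n → Bool) :
    (combOf X d iIn κ u a o p).wave y = ∑ l, star (E l y) * X.block U l () := by
  have h3 : (combOf X d iIn κ u a o p).wave y = sem U X.purified
      (Function.extend (d.trans (inlE X.Q (Unit ⊕ X.B₂))) y fun _ => false) fun _ => false := rfl
  have h4 := congrFun (congrFun hX.sem_purified (Function.extend d y fun _ => false))
    fun _ => false
  rw [inj_conjTranspose_mul_apply, mul_inj_apply] at h4
  have h5 := extend_extend d (inlE X.Q (Unit ⊕ X.B₂)) y fun _ => false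
  have h6 : Function.extend (inlE X.Q (Unit ⊕ X.B₂)) (fun _ => false) (fun _ => false) =
      fun _ => false :=
    ((eq_extend_iff (inlE X.Q (Unit ⊕ X.B₂)) (fun _ => false) (fun _ => false)
      (fun _ => false)).2 ⟨fun _ _ => rfl, rfl⟩).symm
  have h7 : Function.extend d y ((fun _ => false) ∘ inlE X.Q (Unit ⊕ X.B₂)) =
    Function.extend d y fun _ => false := rfl
  rw [h7] at h5
  rw [h5, h6] at h4
  have h8 : (rangeProj X.P₂ * sem U X.circ) (Function.extend d y fun _ => false)
      (fun _ => false) = ((zinj d * (Eᴴ * X.block U)) : Matrix _ Unit ℂ)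
        (Function.extend d y fun _ => false) () := by
    have h10 := mul_zeroBra_conjTranspose_apply (rangeProj X.P₂ * sem U X.circ)
      (Function.extend d y fun _ => false) ()
    rw [← h₁] at h10
    refine h10.symm.trans ?_
    have h9 : rangeProj X.P₂ * sem U X.circ * X.P₁ᴴ = zinj d * (Eᴴ * X.block U) := by
      rw [Blk.block, rangeProj, Matrix.mul_assoc, Matrix.mul_assoc,
        ← Matrix.mul_assoc (zinj d), h₂]
      congr 1
      rw [extP, Matrix.conjTranspose_mul, Matrix.conjTranspose_conjTranspose]
    rw [h9]
  classical
  rw [h3, h4, h8, inj_mul_apply, if_pos fun q hq => extend_off d y _ hq, extend_comp_self,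
    Matrix.mul_apply]
  rfl

theorem prod_wave {k : ℕ} (b : Matrix (Fin N) Unit ℂ) (f : Fin k → Fin n → Bool) :
    ∏ i, ∑ l, star (E l (f i)) * b l () =
      ∑ j : Fin k → Fin N, star (∏ i, E (j i) (f i)) * ∏ i, b (j i) () := by
  rw [Finset.prod_univ_sum, Fintype.piFinset_univ]
  refine Finset.sum_congr rfl fun j _ => ?_
  rw [star_prod, Finset.prod_mul_distrib]

/-- The tensor power of a column. -/
def tensorCol (k : ℕ) (b : Matrix (Fin N) Unit ℂ) : Matrix (Fin k → Fin N) Unit ℂ :=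
  fun j _ => ∏ i, b (j i) ()

/-- The matrix `b^{⊗k} ⊗ Id`. -/
def tensorColId (k : ℕ) (b : Matrix (Fin N) Unit ℂ) : Matrix (Fin (k + 1) → Fin N) (Fin N) ℂ :=
  fun j c => if j (Fin.last k) = c then ∏ i : Fin k, b (j i.castSucc) () else 0

theorem mul_tensorColId_apply {ι : Type} {k : ℕ} (S : Matrix ι (Fin (k + 1) → Fin N) ℂ)
    (b : Matrix (Fin N) Unit ℂ) (l : ι) (c : Fin N) : (S * tensorColId k b) l c =
      ∑ j : Fin k → Fin N, S l (Fin.snoc (α := fun _ => Fin N) j c) * ∏ i, b (j i) () := by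
  rw [Matrix.mul_apply, ← (Fin.snocEquiv fun _ => Fin N).sum_comp, Fintype.sum_prod_type,
    Finset.sum_eq_single c]
  · refine Finset.sum_congr rfl fun j _ => ?_
    simp [tensorColId, Fin.snocEquiv]
  · intro c' _ hc
    refine Finset.sum_eq_zero fun j _ => ?_
    simp [tensorColId, Fin.snocEquiv, hc]
  · intro h; exact absurd (Finset.mem_univ _) h

theorem polyBlk_valid (hX : X.Valid U) (κ : ℕ)
    (V : (k : ℕ) → Encoding Gate (Fin k → Fin N) (Fin N))
    (pos : ∀ k : Fin (κ + 1), Fin k × Fin n ↪ Fin (V k).m)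
    (o : ∀ k : Fin (κ + 1), Fin n ↪ Fin (V k).m) (p : ℕ → ℝ) :
    (polyBlk X d κ V pos o p).Valid U :=
  assemble_valid _ _ _ hX.orth₁ hX.orth₂ hX.not₁ hX.not₂ hX.card₁ hX.card₂

theorem jacBlk_valid (hX : X.Valid U) (κ : ℕ)
    (V : (k : ℕ) → Encoding Gate (Fin k → Fin N) (Fin N))
    (pos : ∀ k : Fin (κ + 1), Fin (k + 1) × Fin n ↪ Fin (V (k + 1)).m)
    (o : ∀ k : Fin (κ + 1), Fin n ↪ Fin (V (k + 1)).m) (p : ℕ → ℝ) :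
    (jacBlk X d κ V pos o p).Valid U :=
  assemble_valid _ _ _ hX.orth₂ hX.orth₂ hX.not₂ hX.not₂ hX.card₂ hX.card₂

section terms
open Classical

/-- The arguments are the tensor power of the encoded vector. -/
theorem Comb.args_poly (T : Comb U.toInterface (Fin n) Empty) (k : Fin (T.κ + 1))
    (pos : Fin k × Fin n ↪ Fin (T.m k)) (hpos : T.a k = polyArgs pos) (b : Matrix (Fin N) Unit ℂ)
    (hw : ∀ y, T.wave y = ∑ l, star (E l y) * b l ()) :
    T.args k * (zeroBra Empty)ᴴ = (tensorProj E k pos)ᴴ * tensorCol k b := by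
  ext v x
  rw [mul_zeroBra_conjTranspose_apply, Matrix.mul_apply, Comb.args]
  have hr : (∀ q, q ∉ Set.range (T.a k) → v q = false) ↔
      ∀ q, q ∉ Set.range pos → v q = false := by
    refine forall_congr' fun q => imp_congr (not_congr ?_) Iff.rfl
    rw [hpos]
    constructor
    · rintro ⟨y | y, rfl⟩
      · exact ⟨y, rfl⟩
      · cases y
    · rintro ⟨y, rfl⟩; exact ⟨Sum.inl y, rfl⟩
  simp only [Matrix.conjTranspose_apply, tensorProj, tensorCol, hw]
  by_cases h0 : ∀ q, q ∉ Set.range pos → v q = false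
  · rw [if_pos ⟨hr.2 h0, fun r => r.elim⟩]
    simp only [if_pos h0]
    rw [hpos]
    exact prod_wave _ _
  · rw [if_neg fun h : _ ∧ _ => h0 (hr.1 h.1)]
    simp only [if_neg h0, star_zero, zero_mul, Finset.sum_const_zero]

/-- The arguments are the tensor power of the encoded vector and the additional register. -/
theorem Comb.args_jac (T : Comb U.toInterface (Fin n) (Fin n)) (k : Fin (T.κ + 1))
    (pos : Fin (k + 1) × Fin n ↪ Fin (T.m k)) (hpos : T.a k = jacArgs pos)
    (b : Matrix (Fin N) Unit ℂ) (hw : ∀ y, T.wave y = ∑ l, star (E l y) * b l ()) :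
    T.args k * Eᴴ = (tensorProj E (k + 1) pos)ᴴ * tensorColId k b := by
  ext v c
  rw [Matrix.mul_apply, mul_tensorColId_apply]
  have hr : (∀ q, q ∉ Set.range (T.a k) → v q = false) ↔
      ∀ q, q ∉ Set.range pos → v q = false := by
    refine forall_congr' fun q => imp_congr (not_congr ?_) Iff.rfl
    rw [hpos]
    constructor
    · rintro ⟨y | y, rfl⟩ <;> exact ⟨_, rfl⟩
    · rintro ⟨⟨i, r⟩, rfl⟩
      induction i using Fin.lastCases with
      | last => exact ⟨Sum.inr r, rfl⟩
      | cast i => exact ⟨Sum.inl (i, r), rfl⟩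
  have e1 : ∀ i r, T.a k (Sum.inl (i, r)) = pos (i.castSucc, r) := fun _ _ => by rw [hpos]; rfl
  have e2 : ∀ r, T.a k (Sum.inr r) = pos (Fin.last k, r) := fun _ => by rw [hpos]; rfl
  simp only [Matrix.conjTranspose_apply, tensorProj, Comb.args, hw]
  by_cases h0 : ∀ q, q ∉ Set.range pos → v q = false
  · rw [Finset.sum_eq_single fun r => v (T.a k (Sum.inr r))]
    · rw [if_pos ⟨hr.2 h0, fun r => rfl⟩]
      refine (congrArg (· * _) (prod_wave b fun i r => v (T.a k (Sum.inl (i, r))))).trans ?_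
      rw [Finset.sum_mul]
      refine Finset.sum_congr rfl fun j _ => ?_
      rw [if_pos h0, Fin.prod_univ_castSucc]
      simp only [Fin.snoc_castSucc, Fin.snoc_last, star_mul', e1, e2]
      ring
    · intro i _ hi
      rw [if_neg, zero_mul]
      rintro ⟨-, h⟩
      exact hi (funext fun r => (h r).symm)
    · intro h; exact absurd (Finset.mem_univ _) h
  · simp only [if_neg h0, star_zero, zero_mul, Finset.sum_const_zero]
    refine Finset.sum_eq_zero fun i _ => ?_
    rw [if_neg fun h : _ ∧ _ => h0 (hr.1 h.1), zero_mul]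

theorem Comb.term_block {D' ν k' : Type} [Fintype D'] [DecidableEq D'] [Fintype k']
    (T : Comb U.toInterface (Fin n) D')
    (k : Fin (T.κ + 1)) {Z : Matrix (D' → Bool) ν ℂ} {P : Matrix k' (Fin (T.m k) → Bool) ℂ}
    {B : Matrix k' ν ℂ} (h : T.args k * Z = Pᴴ * B) :
    E * ((zinj (T.o k))ᴴ * (Circuit.matrix (T.u k) * T.args k) * Z) =
      dataProj E (T.o k) * Circuit.matrix (T.u k) * Pᴴ * B := by
  rw [dataProj_eq_extP, extP]
  simp only [Matrix.mul_assoc]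
  rw [h]

end terms

/-- The encoding of a polynomial is exact; the weights `p` are probabilities. -/
theorem polyBlk_block (hX : X.Valid U) (h₁ : X.P₁ = zeroBra X.Q) (h₂ : X.P₂ = extP d E) (κ : ℕ)
    (V : (k : ℕ) → Encoding Gate (Fin k → Fin N) (Fin N))
    (pos : ∀ k : Fin (κ + 1), Fin k × Fin n ↪ Fin (V k).m)
    (o : ∀ k : Fin (κ + 1), Fin n ↪ Fin (V k).m) {p : ℕ → ℝ}
    (hpos : ∀ k : Fin (κ + 1), (V k).P₁ = tensorProj E k (pos k))
    (ho : ∀ k : Fin (κ + 1), (V k).P₂ = dataProj E (o k))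
    (hp : ∀ k, 0 ≤ p k) (hp1 : ∑ k ∈ Finset.range (κ + 1), p k = 1) :
    (polyBlk X d κ V pos o p).block U =
      ∑ k ∈ Finset.range (κ + 1), (p k : ℂ) • ((V k).block * tensorCol k (X.block U)) := by
  set T := combOf X d (Function.Embedding.refl Empty) κ (fun k => (V k).circ)
    (fun k => polyArgs (pos k)) o p with hT
  have hc := T.circ_block hp hp1
  have h3 : (polyBlk X d κ V pos o p).block U =
      extP T.outQ X.P₂ * (sem U T.circ * (extP T.outQ X.P₁)ᴴ) := rfl
  have h4 : extP T.outQ X.P₂ = E * (zinj ((T.oOut.trans T.outReg).trans (inrE T.Ctl T.Reg)))ᴴ := by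
    rw [h₂]; exact extP_extP d T.outQ E
  have h5 : extP T.outQ X.P₁ =
      zeroBra Empty * (zinj ((T.iIn.trans T.inReg).trans (inrE T.Ctl T.Reg)))ᴴ := by
    rw [h₁]
    exact (extP_zeroBra T.outQ).trans
      (extP_zeroBra ((T.iIn.trans T.inReg).trans (inrE T.Ctl T.Reg))).symm
  rw [h3, h4, h5, Matrix.conjTranspose_mul, Matrix.conjTranspose_conjTranspose, Matrix.mul_assoc,
    ← Matrix.mul_assoc (sem U T.circ), ← Matrix.mul_assoc (zinj _)ᴴ, hc, Matrix.sum_mul,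
    Matrix.mul_sum, Finset.sum_range]
  refine Finset.sum_congr rfl fun (k : Fin (κ + 1)) _ => ?_
  rw [Matrix.smul_mul, Matrix.mul_smul, Encoding.block, hpos k, ho k]
  exact congrArg _ (T.term_block k (T.args_poly k (pos k) rfl (X.block U)
    (wave_combOf hX h₁ h₂ _ _ _ _ _ _)))

/-- The encoding of a Jacobian is exact; the weights `p` are probabilities. -/
theorem jacBlk_block (hX : X.Valid U) (h₁ : X.P₁ = zeroBra X.Q) (h₂ : X.P₂ = extP d E) (κ : ℕ)
    (V : (k : ℕ) → Encoding Gate (Fin k → Fin N) (Fin N))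
    (pos : ∀ k : Fin (κ + 1), Fin (k + 1) × Fin n ↪ Fin (V (k + 1)).m)
    (o : ∀ k : Fin (κ + 1), Fin n ↪ Fin (V (k + 1)).m) {p : ℕ → ℝ}
    (hpos : ∀ k : Fin (κ + 1), (V (k + 1)).P₁ = tensorProj E (k + 1) (pos k))
    (ho : ∀ k : Fin (κ + 1), (V (k + 1)).P₂ = dataProj E (o k))
    (hp : ∀ k, 0 ≤ p k) (hp1 : ∑ k ∈ Finset.range (κ + 1), p k = 1) :
    (jacBlk X d κ V pos o p).block U = ∑ k ∈ Finset.range (κ + 1),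
      (p k : ℂ) • ((V (k + 1)).block * tensorColId k (X.block U)) := by
  set T := combOf X d d κ (fun k => (V (k + 1)).circ) (fun k => jacArgs (pos k)) o p with hT
  have hc := T.circ_block hp hp1
  have h3 : (jacBlk X d κ V pos o p).block U =
      extP T.outQ X.P₂ * (sem U T.circ * (extP T.inQ X.P₂)ᴴ) := rfl
  have h4 : extP T.outQ X.P₂ = E * (zinj ((T.oOut.trans T.outReg).trans (inrE T.Ctl T.Reg)))ᴴ := by
    rw [h₂]; exact extP_extP d T.outQ E
  have h5 : extP T.inQ X.P₂ = E * (zinj ((T.iIn.trans T.inReg).trans (inrE T.Ctl T.Reg)))ᴴ := by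
    rw [h₂]; exact extP_extP d T.inQ E
  rw [h3, h4, h5, Matrix.conjTranspose_mul, Matrix.conjTranspose_conjTranspose, Matrix.mul_assoc,
    ← Matrix.mul_assoc (sem U T.circ), ← Matrix.mul_assoc (zinj _)ᴴ, hc, Matrix.sum_mul,
    Matrix.mul_sum, Finset.sum_range]
  refine Finset.sum_congr rfl fun (k : Fin (κ + 1)) _ => ?_
  rw [Matrix.smul_mul, Matrix.mul_smul, Encoding.block, hpos k, ho k]
  exact congrArg _ (T.term_block k (T.args_jac k (pos k) rfl (X.block U)
    (wave_combOf hX h₁ h₂ _ _ _ _ _ _)))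

end Poly

/-! ### The size of the combinations -/

section SizeBounds
variable {μ₁ μ₂ ν₁ ν₂ : Type} {U : Encoding Gate μ₁ μ₂} {N n : ℕ}

theorem Blk.gates_eq (T : Blk U.toInterface ν₁ ν₂) :
    T.gates U = cost U T.circ + cost U T.proj₁ + cost U T.proj₂ := rfl

theorem Blk.Valid.size_scale_le [Fintype ν₁] [DecidableEq ν₁] [Fintype ν₂] [DecidableEq ν₂]
    (T : Blk U.toInterface ν₁ ν₂) (s : ℝ) :
    (T.scale s).size U ≤ 13 * T.size U := by
  have h1 := T.cost_scale_circ s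
  have h2 := T.cost_scale_proj₁ s
  have h3 := T.cost_scale_proj₂ s
  have h4 : Fintype.card (T.scale s).Q = Fintype.card T.Q + 1 := by
    show Fintype.card (T.Q ⊕ Unit) = _
    simp
  rw [size, gates_eq, size, gates_eq, h1, h2, h3, h4]
  omega

theorem Blk.Valid.size_amplify_le [Fintype ν₁] [DecidableEq ν₁] [Fintype ν₂] [DecidableEq ν₂]
    {T : Blk U.toInterface ν₁ ν₂} (h : T.Valid U) (r : ℕ) :
    (T.amplify r).size U ≤ (2 * r + 1) * (14 * T.size U) := by
  have h1 := T.cost_amplify_circ r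
  have h2 := T.cost_amplify_proj₁ r
  have h3 := T.cost_amplify_proj₂ r
  have h5 := h.card₁
  have h6 := h.card₂
  have h4 : Fintype.card (T.amplify r).Q =
      Fintype.card T.Q + (1 + (Fintype.card T.B₁ + Fintype.card T.B₂)) := by
    show Fintype.card (T.Q ⊕ (Unit ⊕ (T.B₁ ⊕ T.B₂))) = _
    simp
  rw [size, gates_eq, size, gates_eq, h1, h2, h3, h4]
  have h7 := Nat.zero_le (r * cost U T.circ)
  have h8 := Nat.zero_le (r * cost U T.proj₁)
  have h9 := Nat.zero_le (r * cost U T.proj₂)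
  have h10 := Nat.zero_le (r * Fintype.card T.Q)
  have h11 := Nat.zero_le r
  nlinarith

theorem card_outside_le {Q Q' : Type} [Fintype Q] [DecidableEq Q] [Fintype Q'] [DecidableEq Q']
    (e : Q ↪ Q') : (outside e).card ≤ Fintype.card Q' := by
  have := card_outside e; omega

theorem Circuit.gates_le_gates {ν₁ ν₂ : Type} (V : Encoding Gate ν₁ ν₂) :
    Circuit.gates V.circ ≤ V.gates := by
  rw [Encoding.gates]; omega

/-- All the contributions are at most linear in the degree, since the numbers of unused qubits of
the `u k` are bounded by `t`. -/
theorem comb_size_le {X : Blk U.toInterface Unit (Fin N)} {d : Fin n ↪ X.Q} (hX : X.Valid U)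
    {D' In : Type} [Fintype D'] [DecidableEq D'] [Fintype In] [DecidableEq In] (iIn : D' ↪ In)
    (κ : ℕ) {m : Fin (κ + 1) → ℕ} (u : ∀ k, Circuit (Fin (m k)))
    (a : ∀ k : Fin (κ + 1), (Fin k × Fin n) ⊕ D' ↪ Fin (m k)) (o : ∀ k, Fin n ↪ Fin (m k))
    (p : ℕ → ℝ) {t : ℕ} (hg : ∀ k, (u k).gates ≤ t) (ha : ∀ k, (outside (a k)).card ≤ t)
    (hI : Fintype.card In ≤ Fintype.card X.Q) :
    cost U (combOf X d iIn κ u a o p).circ + 7 * Fintype.card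
      ((combOf X d iIn κ u a o p).Ctl ⊕ (combOf X d iIn κ u a o p).Reg) ≤
      (κ + 1) * (90 * X.size U + 10 * t) := by
  have h1 : cost U (combOf X d iIn κ u a o p).circ ≤ 10 * κ + 2 * (κ * cost U X.purified) +
      3 * ((∑ k, Circuit.gates (u k)) + 4 * ((κ + 1) * Fintype.card (Fin n))) :=
    (combOf X d iIn κ u a o p).cost_circ_le
  have h2 : Fintype.card
      ((combOf X d iIn κ u a o p).Ctl ⊕ (combOf X d iIn κ u a o p).Reg) =
      2 * κ + κ * Fintype.card (X.Q ⊕ (Unit ⊕ X.B₂)) + Fintype.card In + Fintype.card X.Q +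
        ∑ k, (outside (a k)).card := (combOf X d iIn κ u a o p).card_qubits
  have h3 : ∑ k, (u k).gates ≤ (κ + 1) * t := by
    refine (Finset.sum_le_card_nsmul _ _ t fun k _ => hg k).trans ?_
    simp
  have h4 : ∑ k, (outside (a k)).card ≤ (κ + 1) * t := by
    refine (Finset.sum_le_card_nsmul _ _ t fun k _ => ha k).trans ?_
    simp
  have h5 : n ≤ Fintype.card X.Q := by simpa using Fintype.card_le_of_embedding d
  have h6 := hX.card₂
  rw [Blk.cost_purified] at h1
  rw [Fintype.card_fin] at h1
  rw [h2, Fintype.card_sum, Fintype.card_sum, Fintype.card_unit, Blk.size, Blk.gates_eq]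
  have e1 := Nat.mul_le_mul_left (κ + 1) h5
  have e2 := Nat.mul_le_mul_left κ h6
  have e3 := Nat.zero_le (κ * cost U X.circ)
  have e4 := Nat.zero_le (κ * cost U X.proj₁)
  have e5 := Nat.zero_le (κ * cost U X.proj₂)
  have e6 := Nat.zero_le (κ * Fintype.card X.Q)
  have e7 := Nat.zero_le (κ * t)
  nlinarith

theorem polyBlk_size_le {X : Blk U.toInterface Unit (Fin N)} {d : Fin n ↪ X.Q} (hX : X.Valid U)
    (κ : ℕ) (V : (k : ℕ) → Encoding Gate (Fin k → Fin N) (Fin N))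
    (pos : ∀ k : Fin (κ + 1), Fin k × Fin n ↪ Fin (V k).m)
    (o : ∀ k : Fin (κ + 1), Fin n ↪ Fin (V k).m) (p : ℕ → ℝ) {t : ℕ}
    (hg : ∀ k : Fin (κ + 1), (V k).gates ≤ t)
    (ha : ∀ k : Fin (κ + 1), (outside (pos k)).card ≤ t) :
    (polyBlk X d κ V pos o p).size U ≤ (κ + 1) * (100 * X.size U + 100 * t) := by
  have h := comb_size_le (d := d) hX (Function.Embedding.refl Empty) κ (fun k => (V k).circ)
    (fun k => polyArgs (pos k)) o p (fun k => (Circuit.gates_le_gates (V k)).trans (hg k))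
    (fun k => ?_) (by simp)
  · set T := combOf X d (Function.Embedding.refl Empty) κ (fun k => (V k).circ)
      (fun k => polyArgs (pos k)) o p
    have e : (polyBlk X d κ V pos o p).size U = cost U T.circ +
        cost U (polyBlk X d κ V pos o p).proj₁ + cost U (polyBlk X d κ V pos o p).proj₂ +
        Fintype.card (T.Ctl ⊕ T.Reg) + 1 := rfl
    have e₁ : cost U (polyBlk X d κ V pos o p).proj₁ =
      2 * cost U X.proj₁ + 3 * (outside T.outQ).card + 2 := cost_extProj _ _
    have e₂ : cost U (polyBlk X d κ V pos o p).proj₂ =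
      2 * cost U X.proj₂ + 3 * (outside T.outQ).card + 2 := cost_extProj _ _
    rw [e, e₁, e₂]
    have h3 := card_outside_le T.outQ
    have h4 : (κ + 1) * (100 * X.size U + 100 * t) =
      (κ + 1) * (90 * X.size U + 10 * t) + 10 * X.size U + κ * (10 * X.size U) +
        (κ + 1) * (90 * t) := by ring
    rw [h4]
    have h5 : X.size U = cost U X.circ + cost U X.proj₁ + cost U X.proj₂ + Fintype.card X.Q + 1 :=
      rfl
    have h6 := Nat.zero_le (κ * (10 * X.size U))
    have h7 := Nat.zero_le ((κ + 1) * (90 * t))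
    omega
  · have h1 := card_outside (polyArgs (pos k))
    have h2 := card_outside (pos k)
    have h3 := ha k
    simp only [Fintype.card_sum, Fintype.card_empty] at h1
    omega

theorem jacBlk_size_le {X : Blk U.toInterface Unit (Fin N)} {d : Fin n ↪ X.Q} (hX : X.Valid U)
    (κ : ℕ) (V : (k : ℕ) → Encoding Gate (Fin k → Fin N) (Fin N))
    (pos : ∀ k : Fin (κ + 1), Fin (k + 1) × Fin n ↪ Fin (V (k + 1)).m)
    (o : ∀ k : Fin (κ + 1), Fin n ↪ Fin (V (k + 1)).m) (p : ℕ → ℝ) {t : ℕ}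
    (hg : ∀ k : Fin (κ + 1), (V (k + 1)).gates ≤ t)
    (ha : ∀ k : Fin (κ + 1), (outside (pos k)).card ≤ t) :
    (jacBlk X d κ V pos o p).size U ≤ (κ + 1) * (100 * X.size U + 100 * t) := by
  have h := comb_size_le (d := d) hX d κ (fun k => (V (k + 1)).circ)
    (fun k => jacArgs (pos k)) o p (fun k => (Circuit.gates_le_gates (V (k + 1))).trans (hg k))
    (fun k => ?_) le_rfl
  · set T := combOf X d d κ (fun k => (V (k + 1)).circ) (fun k => jacArgs (pos k)) o p
    have e : (jacBlk X d κ V pos o p).size U = cost U T.circ +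
        cost U (jacBlk X d κ V pos o p).proj₁ + cost U (jacBlk X d κ V pos o p).proj₂ +
        Fintype.card (T.Ctl ⊕ T.Reg) + 1 := rfl
    have e₁ : cost U (jacBlk X d κ V pos o p).proj₁ =
      2 * cost U X.proj₂ + 3 * (outside T.inQ).card + 2 := cost_extProj _ _
    have e₂ : cost U (jacBlk X d κ V pos o p).proj₂ =
      2 * cost U X.proj₂ + 3 * (outside T.outQ).card + 2 := cost_extProj _ _
    rw [e, e₁, e₂]
    have h3 := card_outside_le T.outQ
    have h2 := card_outside_le T.inQ
    have h4 : (κ + 1) * (100 * X.size U + 100 * t) =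
      (κ + 1) * (90 * X.size U + 10 * t) + 10 * X.size U + κ * (10 * X.size U) +
        (κ + 1) * (90 * t) := by ring
    rw [h4]
    have h5 : X.size U = cost U X.circ + cost U X.proj₁ + cost U X.proj₂ + Fintype.card X.Q + 1 :=
      rfl
    have h6 := Nat.zero_le (κ * (10 * X.size U))
    have h7 := Nat.zero_le ((κ + 1) * (90 * t))
    omega
  · have h1 := card_outside (jacArgs (pos k))
    have h2 := card_outside (pos k)
    have h3 := ha k
    simp only [Fintype.card_sum, Fintype.card_prod, Fintype.card_fin] at h1 h2
    rw [add_mul, one_mul] at h2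
    omega

end SizeBounds

/-! ### Spectral norms -/

section SpecNorm
open scoped Matrix.Norms.L2Operator
variable {ι κ μ : Type} [Fintype ι] [Fintype κ] [DecidableEq κ] [Fintype μ] [DecidableEq μ]

theorem specNorm_eq (S : Matrix ι κ ℂ) : specNorm S = ‖S‖ := by
  rw [specNorm, Matrix.l2_opNorm_def]; rfl

theorem specNorm_nonneg (S : Matrix ι κ ℂ) : 0 ≤ specNorm S := norm_nonneg _

theorem specNorm_eq_zero {S : Matrix ι κ ℂ} : specNorm S = 0 ↔ S = 0 := by
  rw [specNorm_eq, norm_eq_zero]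

theorem specNorm_smul (c : ℂ) (S : Matrix ι κ ℂ) : specNorm (c • S) = ‖c‖ * specNorm S := by
  rw [specNorm_eq, specNorm_eq, norm_smul]

theorem specNorm_sum_le {α : Type} (s : Finset α) (S : α → Matrix ι κ ℂ) :
    specNorm (∑ k ∈ s, S k) ≤ ∑ k ∈ s, specNorm (S k) := by
  simp only [specNorm_eq]; exact norm_sum_le _ _

theorem specNorm_mul_le (S : Matrix ι κ ℂ) (T : Matrix κ μ ℂ) :
    specNorm (S * T) ≤ specNorm S * specNorm T := by
  simp only [specNorm_eq]; exact Matrix.l2_opNorm_mul S T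

theorem specNorm_one_le : specNorm (1 : Matrix κ κ ℂ) ≤ 1 := by
  rw [specNorm_eq, ← Matrix.diagonal_one, Matrix.l2_opNorm_diagonal]
  exact pi_norm_const_le 1 |>.trans (by simp)

/-- The spectral norm of a matrix with orthogonal columns of the same length. -/
theorem specNorm_le_of_gram {S : Matrix ι κ ℂ} {c : ℝ} (hc : 0 ≤ c)
    (h : Sᴴ * S = ((c ^ 2 : ℝ) : ℂ) • (1 : Matrix κ κ ℂ)) : specNorm S ≤ c := by
  have h1 : specNorm S * specNorm S = specNorm (Sᴴ * S) := by
    simp only [specNorm_eq]; exact (Matrix.l2_opNorm_conjTranspose_mul_self S).symm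
  rw [h, specNorm_smul, Complex.norm_real, Real.norm_of_nonneg (sq_nonneg c)] at h1
  have h2 := mul_le_mul_of_nonneg_left (specNorm_one_le (κ := κ)) (sq_nonneg c)
  nlinarith [specNorm_nonneg S]

theorem sq_specNorm_col (b : Matrix ι Unit ℂ) : specNorm b ^ 2 = ∑ i, ‖b i ()‖ ^ 2 := by
  have h1 : specNorm b * specNorm b = specNorm (bᴴ * b) := by
    simp only [specNorm_eq]; exact (Matrix.l2_opNorm_conjTranspose_mul_self b).symm
  have h2 : bᴴ * b = Matrix.diagonal fun _ => ((∑ i, ‖b i ()‖ ^ 2 : ℝ) : ℂ) := by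
    ext x y
    rw [Matrix.mul_apply, Matrix.diagonal_apply, if_pos (Subsingleton.elim x y)]
    push_cast
    refine Finset.sum_congr rfl fun i _ => ?_
    rw [Matrix.conjTranspose_apply, Subsingleton.elim x (), Subsingleton.elim y ()]
    exact Complex.conj_mul' _
  rw [sq, h1, h2, specNorm_eq, Matrix.l2_opNorm_diagonal, pi_norm_const, Complex.norm_real,
    Real.norm_of_nonneg (Finset.sum_nonneg fun i _ => sq_nonneg _)]

theorem specNorm_column {N : ℕ} (v : EuclideanSpace ℂ (Fin N)) : specNorm (column v) = ‖v‖ := by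
  rw [← sq_eq_sq₀ (specNorm_nonneg _) (norm_nonneg _), sq_specNorm_col, EuclideanSpace.norm_sq_eq]
  rfl

end SpecNorm

/-! ### Polynomials -/

section Polynomial
variable {N : ℕ}

theorem tensorCol_smul (k : ℕ) (c : ℂ) (b : Matrix (Fin N) Unit ℂ) :
    tensorCol k (c • b) = c ^ k • tensorCol k b := by
  ext j x
  simp [tensorCol, Finset.prod_mul_distrib]

theorem tensorColId_smul (k : ℕ) (c : ℂ) (b : Matrix (Fin N) Unit ℂ) :
    tensorColId k (c • b) = c ^ k • tensorColId k b := by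
  ext j x
  simp only [tensorColId, Matrix.smul_apply, smul_eq_mul]
  split_ifs with h
  · simp [Finset.prod_mul_distrib]
  · simp

theorem specNorm_tensorCol (k : ℕ) (b : Matrix (Fin N) Unit ℂ) :
    specNorm (tensorCol k b) = specNorm b ^ k := by
  rw [← sq_eq_sq₀ (specNorm_nonneg _) (pow_nonneg (specNorm_nonneg _) _), sq_specNorm_col,
    ← pow_mul, mul_comm k, pow_mul, sq_specNorm_col, Fintype.sum_pow]
  simp only [tensorCol, norm_prod, Finset.prod_pow]

theorem specNorm_tensorColId_le (k : ℕ) (b : Matrix (Fin N) Unit ℂ) :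
    specNorm (tensorColId k b) ≤ specNorm b ^ k := by
  refine specNorm_le_of_gram (pow_nonneg (specNorm_nonneg _) _) ?_
  ext c c'
  rw [mul_tensorColId_apply, Matrix.smul_apply, Matrix.one_apply, ← pow_mul, mul_comm k, pow_mul,
    sq_specNorm_col, Fintype.sum_pow]
  simp only [Matrix.conjTranspose_apply, tensorColId, Fin.snoc_last, Fin.snoc_castSucc]
  by_cases h : c' = c
  · subst h
    simp only [if_true, smul_eq_mul, mul_one]
    push_cast
    refine Finset.sum_congr rfl fun j _ => ?_
    rw [star_prod, ← Finset.prod_mul_distrib]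
    exact Finset.prod_congr rfl fun i _ => Complex.conj_mul' _
  · simp [h, Ne.symm h]

theorem column_polyEval (A : (k : ℕ) → Matrix (Fin N) (Fin k → Fin N) ℂ) (K : ℕ)
    (x : EuclideanSpace ℂ (Fin N)) : column (polyEval A K x) =
      ∑ k ∈ Finset.range (K + 1), A k * tensorCol k (column x) := by
  ext i y
  rw [Matrix.sum_apply]
  show (∑ k ∈ Finset.range (K + 1), A k *ᵥ tensorPow k x) i = _
  rw [Finset.sum_apply]
  rfl

theorem polyJacobian_eq (A : (k : ℕ) → Matrix (Fin N) (Fin k → Fin N) ℂ) (K : ℕ)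
    (x : EuclideanSpace ℂ (Fin N)) : polyJacobian A K x =
      ∑ k ∈ Finset.range K, ((k + 1 : ℕ) : ℂ) • (A (k + 1) * tensorColId k (column x)) := by
  ext i c
  rw [Matrix.sum_apply]
  refine Finset.sum_congr rfl fun k _ => ?_
  rw [Matrix.smul_apply, mul_tensorColId_apply]
  rfl

/-- By symmetry, all the arguments contribute the same to the derivative of a homogeneous term. -/
theorem sum_erase_eq_last {k : ℕ} {S : (Fin (k + 1) → Fin N) → ℂ}
    (hS : ∀ (σ : Equiv.Perm (Fin (k + 1))) j, S (j ∘ σ) = S j) (x h : Fin N → ℂ)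
    (i : Fin (k + 1)) :
    ∑ j, S j * ((∏ i' ∈ Finset.univ.erase i, x (j i')) * h (j i)) =
      ∑ c, (∑ j : Fin k → Fin N, S (Fin.snoc (α := fun _ => Fin N) j c) * ∏ i', x (j i')) * h c := by
  have h1 : ∑ j, S j * ((∏ i' ∈ Finset.univ.erase i, x (j i')) * h (j i)) =
      ∑ j, S j * ((∏ i' ∈ Finset.univ.erase (Fin.last k), x (j i')) * h (j (Fin.last k))) := by
    rw [← (Equiv.arrowCongr (Equiv.swap i (Fin.last k)) (Equiv.refl (Fin N))).sum_comp]
    refine Finset.sum_congr rfl fun j _ => ?_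
    have e1 : (Equiv.arrowCongr (Equiv.swap i (Fin.last k)) (Equiv.refl (Fin N))) j =
        j ∘ Equiv.swap i (Fin.last k) := by
      ext y; simp [Equiv.arrowCongr]
    rw [e1, hS]
    congr 2
    · refine Finset.prod_bij (fun y _ => Equiv.swap i (Fin.last k) y) ?_ ?_ ?_ ?_
      · intro y hy
        refine Finset.mem_erase.2 ⟨fun h => Finset.ne_of_mem_erase hy ?_, Finset.mem_univ _⟩
        exact (Equiv.swap i (Fin.last k)).injective (h.trans (Equiv.swap_apply_left _ _).symm)
      · intro y _ y' _ h; exact (Equiv.swap i (Fin.last k)).injective h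
      · intro y hy
        refine ⟨Equiv.swap i (Fin.last k) y, ?_, Equiv.swap_apply_self _ _ _⟩
        refine Finset.mem_erase.2 ⟨fun h => Finset.ne_of_mem_erase hy ?_, Finset.mem_univ _⟩
        exact (Equiv.swap i (Fin.last k)).injective (h.trans (Equiv.swap_apply_right _ _).symm)
      · intro y _; rfl
    · simp
  rw [h1, ← (Fin.snocEquiv fun _ => Fin N).sum_comp, Fintype.sum_prod_type]
  refine Finset.sum_congr rfl fun c _ => ?_
  rw [Finset.sum_mul]
  refine Finset.sum_congr rfl fun j _ => ?_
  have h2 : ∀ f : Fin (k + 1) → ℂ, ∏ i' ∈ Finset.univ.erase (Fin.last k), f i' =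
      ∏ i' : Fin k, f i'.castSucc := by
    intro f
    rw [show (Finset.univ.erase (Fin.last k)) = Finset.univ.map Fin.castSuccEmb by
      ext y; simp [Fin.exists_castSucc_eq], Finset.prod_map]
    rfl
  rw [h2]
  simp [Fin.snocEquiv, mul_assoc]

theorem hasFDerivAt_polyEval {A : (k : ℕ) → Matrix (Fin N) (Fin k → Fin N) ℂ} {K : ℕ}
    (hA : ∀ k ≤ K, ∀ (σ : Equiv.Perm (Fin k)) (a : Fin N) (j : Fin k → Fin N),
      A k a (j ∘ σ) = A k a j) (x : EuclideanSpace ℂ (Fin N)) :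
    HasFDerivAt (polyEval A K)
      (Matrix.toEuclideanLin (polyJacobian A K x)).toContinuousLinearMap x := by
  rw [← hasFDerivWithinAt_univ, hasFDerivWithinAt_euclidean]
  simp only [hasFDerivWithinAt_univ]
  intro a
  have h1 : ∀ (k : ℕ) (j : Fin k → Fin N), HasFDerivAt
      (fun y : EuclideanSpace ℂ (Fin N) => A k a j * ∏ i, y (j i))
      (A k a j • ∑ i, (∏ i' ∈ Finset.univ.erase i, x (j i')) •
        (EuclideanSpace.proj (j i) : EuclideanSpace ℂ (Fin N) →L[ℂ] ℂ)) x := fun k j =>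
    (HasFDerivAt.finsetProd fun i _ =>
      (EuclideanSpace.proj (j i) : EuclideanSpace ℂ (Fin N) →L[ℂ] ℂ).hasFDerivAt).const_mul _
  have h2 : HasFDerivAt (fun y => polyEval A K y a) _ x :=
    (HasFDerivAt.fun_sum fun k (_ : k ∈ Finset.range (K + 1)) => HasFDerivAt.fun_sum fun j
      (_ : j ∈ (Finset.univ : Finset (Fin k → Fin N))) => h1 k j).congr_of_eventuallyEq
    (Filter.Eventually.of_forall fun y => by
      show (∑ k ∈ Finset.range (K + 1), A k *ᵥ tensorPow k y) a = _
      rw [Finset.sum_apply]; rfl)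
  refine h2.congr_fderiv ?_
  ext h
  have e1 : ((EuclideanSpace.proj a : EuclideanSpace ℂ (Fin N) →L[ℂ] ℂ).comp
      (Matrix.toEuclideanLin (polyJacobian A K x)).toContinuousLinearMap) h =
      ∑ c, polyJacobian A K x a c * h c := rfl
  refine Eq.trans ?_ e1.symm
  have hproj : ∀ c, (EuclideanSpace.proj c : EuclideanSpace ℂ (Fin N) →L[ℂ] ℂ) h = h c :=
    fun _ => rfl
  simp only [sum_apply, smul_apply, smul_eq_mul,
    hproj, polyJacobian]
  rw [Finset.sum_range_succ']
  have e2 : ∀ k ∈ Finset.range K, ∑ j : Fin (k + 1) → Fin N, A (k + 1) a j *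
      ∑ i, (∏ i' ∈ Finset.univ.erase i, x (j i')) * h (j i) =
      ∑ c, (((k + 1 : ℕ) : ℂ) * ∑ j : Fin k → Fin N,
        A (k + 1) a (Fin.snoc (α := fun _ => Fin N) j c) * tensorPow k x j) * h c := by
    intro k hk
    simp only [Finset.mul_sum]
    rw [Finset.sum_comm]
    rw [Finset.sum_congr rfl fun i _ => sum_erase_eq_last
      (hA (k + 1) (Finset.mem_range.1 hk) · a ·) x h i]
    simp only [Finset.sum_const, Finset.card_univ, Fintype.card_fin, nsmul_eq_mul, tensorPow,
      Finset.mul_sum, Finset.sum_mul, mul_assoc]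
  rw [Finset.sum_congr rfl e2]
  simp only [Finset.univ_eq_empty, Finset.sum_empty, mul_zero, Finset.sum_const_zero, add_zero,
    Finset.sum_mul]
  exact Finset.sum_comm

end Polynomial

/-! ### Exact encodings of coefficients and vectors -/

section Exact
variable {N n : ℕ} {E : Matrix (Fin N) (Fin n → Bool) ℂ}

/-- For the relative tolerance `0` the encoded matrix equals `γ` times the block. -/
theorem Encoding.IsBlockEncoding.eq_smul {ν₁ ν₂ : Type} [Fintype ν₁] [DecidableEq ν₁] [Fintype ν₂]
    [DecidableEq ν₂] {V : Encoding Gate ν₁ ν₂} {S : Matrix ν₂ ν₁ ℂ} (h : V.IsBlockEncoding S 0) :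
    S = (V.γ : ℂ) • V.block := by
  have h1 := h.approx
  rw [zero_mul] at h1
  have h2 := specNorm_eq_zero.1 (le_antisymm h1 (specNorm_nonneg _))
  exact (sub_eq_zero.1 h2).symm

theorem Encoding.IsBlockEncoding.gamma_nonneg {ν₁ ν₂ : Type} [Fintype ν₁] [DecidableEq ν₁]
    [Fintype ν₂] [DecidableEq ν₂] {V : Encoding Gate ν₁ ν₂} {S : Matrix ν₂ ν₁ ℂ} {ε : ℝ}
    (h : V.IsBlockEncoding S ε) : 0 ≤ V.γ := (specNorm_nonneg _).trans h.le_gamma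

theorem Encoding.IsBlockEncoding.specNorm_eq {ν₁ ν₂ : Type} [Fintype ν₁] [DecidableEq ν₁]
    [Fintype ν₂] [DecidableEq ν₂] {V : Encoding Gate ν₁ ν₂} {S : Matrix ν₂ ν₁ ℂ}
    (h : V.IsBlockEncoding S 0) : specNorm S = V.γ * V.eff := by
  conv_lhs => rw [h.eq_smul]
  rw [specNorm_smul, Complex.norm_real, Real.norm_of_nonneg h.gamma_nonneg, Encoding.eff]

theorem tensorProj_eq_extP (k : ℕ) {m : ℕ} (pos : Fin k × Fin n ↪ Fin m) :
    tensorProj E k pos = extP pos fun j s => ∏ i, E (j i) fun r => s (i, r) := by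
  classical
  ext j s
  refine Eq.trans ?_ (extP_apply pos (fun j s => ∏ i, E (j i) fun r => s (i, r)) j s).symm
  rw [tensorProj]
  by_cases h : ∀ q, q ∉ Set.range pos → s q = false
  · rw [if_pos h, if_pos h]; rfl
  · rw [if_neg h, if_neg h]

theorem EncodesCoefficient.outside_le [NeZero N] {k : ℕ}
    {V : Encoding Gate (Fin k → Fin N) (Fin N)} {S : Matrix (Fin N) (Fin k → Fin N) ℂ}
    (h : EncodesCoefficient E V S) {pos : Fin k × Fin n ↪ Fin V.m}
    (hpos : V.P₁ = tensorProj E k pos) : (outside pos).card ≤ V.gates := by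
  have h1 := h.1.implements₁.card_outside_le (hpos.trans (tensorProj_eq_extP k pos))
    h.1.orthonormal₁
  rw [Encoding.gates]; omega

theorem EncodesCoefficient.one_le_gates [NeZero N] {k : ℕ}
    {V : Encoding Gate (Fin k → Fin N) (Fin N)} {S : Matrix (Fin N) (Fin k → Fin N) ℂ}
    (h : EncodesCoefficient E V S) : 1 ≤ V.gates := by
  have h1 := h.1.implements₁.one_le_gates h.1.orthonormal₁
  rw [Encoding.gates]; omega

theorem EncodesVector.m_le_gates {V : Encoding Gate Unit (Fin N)} {x : EuclideanSpace ℂ (Fin N)}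
    {ε : ℝ} (h : EncodesVector E V x ε) : V.m ≤ V.gates := by
  have h1 := h.1.implements₁.card_outside_le (e := (Function.Embedding.ofIsEmpty : Empty ↪ Fin V.m))
    (F := zeroBra Empty) ((h.2.1.trans (zeroProj_eq_zeroBra _)).trans (extP_zeroBra _).symm)
    h.1.orthonormal₁
  have h2 := card_outside (Function.Embedding.ofIsEmpty : Empty ↪ Fin V.m)
  rw [Fintype.card_empty, Fintype.card_fin] at h2
  rw [Encoding.gates]; omega

theorem EncodesVector.one_le_gates {V : Encoding Gate Unit (Fin N)} {x : EuclideanSpace ℂ (Fin N)}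
    {ε : ℝ} (h : EncodesVector E V x ε) : 1 ≤ V.gates := by
  have h1 := h.1.implements₁.one_le_gates h.1.orthonormal₁
  rw [Encoding.gates]; omega

theorem EncodesVector.size_ofInput_le {V : Encoding Gate Unit (Fin N)}
    {x : EuclideanSpace ℂ (Fin N)} {ε : ℝ} (h : EncodesVector E V x ε) :
    (ofInput V.toInterface).size V ≤ 3 * V.gates := by
  have h1 := h.m_le_gates
  have h2 := h.one_le_gates
  have h3 : Fintype.card (ofInput V.toInterface).Q = V.m := Fintype.card_fin _
  rw [Blk.size, gates_ofInput, h3]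
  omega

theorem EncodesVector.norm_eq {V : Encoding Gate Unit (Fin N)} {x : EuclideanSpace ℂ (Fin N)}
    (h : EncodesVector E V x 0) : ‖x‖ = V.γ * V.eff := by
  rw [← specNorm_column, h.1.specNorm_eq]

end Exact

section Returned
variable {μ₁ μ₂ ν₁ ν₂ : Type} {U : Encoding Gate μ₁ μ₂} {N n : ℕ}
  {E : Matrix (Fin N) (Fin n → Bool) ℂ}

theorem Blk.toEncoding_P₁_zero {I : Interface μ₁ μ₂} (T : Blk I Unit ν₂) (h : T.P₁ = zeroBra T.Q)
    (γ : ℝ) : (T.toEncoding γ).P₁ = zeroProj _ := by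
  show extP (Fintype.equivFin T.Q).toEmbedding T.P₁ = zeroProj (Fintype.card T.Q)
  rw [h, extP_zeroBra, zeroProj_eq_zeroBra]

theorem Blk.toEncoding_P₁_data {I : Interface μ₁ μ₂} (T : Blk I (Fin N) ν₂) (d : Fin n ↪ T.Q)
    (h : T.P₁ = extP d E) (γ : ℝ) : ∃ pos, (T.toEncoding γ).P₁ = dataProj E pos := by
  refine ⟨d.trans (Fintype.equivFin T.Q).toEmbedding, ?_⟩
  show extP (Fintype.equivFin T.Q).toEmbedding T.P₁ = _
  rw [h, extP_extP]
  exact (dataProj_eq_extP E _).symm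

theorem Blk.toEncoding_P₂_data {I : Interface μ₁ μ₂} (T : Blk I ν₁ (Fin N)) (d : Fin n ↪ T.Q)
    (h : T.P₂ = extP d E) (γ : ℝ) : ∃ pos, (T.toEncoding γ).P₂ = dataProj E pos := by
  refine ⟨d.trans (Fintype.equivFin T.Q).toEmbedding, ?_⟩
  show extP (Fintype.equivFin T.Q).toEmbedding T.P₂ = _
  rw [h, extP_extP]
  exact (dataProj_eq_extP E _).symm

end Returned

/-! ### The Jacobian -/

section CountCalls
variable {μ₁ μ₂ : Type} {I : Interface μ₁ μ₂} {Q Q' : Type} [DecidableEq Q']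

theorem countP_isMain_place (e : Q ↪ Q') (ctrl : Finset Q') (h : ∀ q, e q ∉ ctrl)
    (c : List (Instr I Q)) :
    (place e ctrl h c).countP Instr.isMain = c.countP Instr.isMain := by
  rw [place, List.countP_map]
  refine List.countP_congr fun a _ => ?_
  cases a with
  | gate g => rfl
  | call p b e c h => cases p <;> rfl

theorem countP_isMain_map_gate (c : Circuit Q) :
    (c.map (Instr.gate (I := I))).countP Instr.isMain = 0 := by
  rw [List.countP_map, List.countP_eq_zero]
  intro a _ h
  cases h

theorem countP_isMain_inverse (c : List (Instr I Q)) :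
    (inverse c).countP Instr.isMain = c.countP Instr.isMain := by
  rw [inverse, List.countP_reverse, List.countP_map]
  refine List.countP_congr fun a _ => ?_
  cases a with
  | gate g => rfl
  | call p b e c h => cases p <;> rfl

theorem Comb.countP_isMain_circ {D D' : Type} [Fintype D] [DecidableEq D] [Fintype D']
    [DecidableEq D'] (T : Comb I D D') :
    T.circ.countP Instr.isMain = T.κ * T.cx.countP Instr.isMain := by
  have h1 : (on (inlE T.Ctl T.Reg) ((prepCirc T.p T.κ T.κ).map (Instr.gate (I := I)))).countP
      Instr.isMain = 0 := by
    rw [on, countP_isMain_place, countP_isMain_map_gate]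
  have h2 : ((List.finRange T.κ).flatMap
      (fun i => ctrlPlace (C := T.Ctl) {Sum.inl i} (on (T.copy i) T.cx))).countP Instr.isMain =
      T.κ * T.cx.countP Instr.isMain := by
    rw [List.countP_flatMap]
    have : ∀ i, (List.countP Instr.isMain ∘ fun i =>
        ctrlPlace (C := T.Ctl) {Sum.inl i} (on (T.copy i) T.cx)) i =
          T.cx.countP Instr.isMain := fun i => by
      rw [Function.comp_apply, ctrlPlace, countP_isMain_place, on, countP_isMain_place]
    rw [funext this]
    simp
  have h3 : ((List.finRange (T.κ + 1)).flatMap (fun k => ctrlPlace (T.codeCtrl k)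
      ((T.term k).map (Instr.gate (I := I))))).countP Instr.isMain = 0 := by
    rw [List.countP_flatMap]
    have : ∀ k, (List.countP Instr.isMain ∘ fun k => ctrlPlace (T.codeCtrl k)
        ((T.term k).map (Instr.gate (I := I)))) k = 0 := fun k => by
      rw [Function.comp_apply, ctrlPlace, countP_isMain_place, countP_isMain_map_gate]
    rw [funext this]
    simp
  rw [circ, List.countP_append, List.countP_append, countP_isMain_inverse, h1, select,
    List.countP_append, h2, h3]
  omega

theorem countP_isMain_jacBlk {N n : ℕ} {I : Interface Unit (Fin N)} (d : Fin n ↪ (ofInput I).Q)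
    (κ : ℕ) (V : (k : ℕ) → Encoding Gate (Fin k → Fin N) (Fin N))
    (pos : ∀ k : Fin (κ + 1), Fin (k + 1) × Fin n ↪ Fin (V (k + 1)).m)
    (o : ∀ k : Fin (κ + 1), Fin n ↪ Fin (V (k + 1)).m) (p : ℕ → ℝ) (γ : ℝ) :
    ((jacBlk (ofInput I) d κ V pos o p).toEncoding γ).circ.countP Instr.isMain = κ := by
  have h : ((jacBlk (ofInput I) d κ V pos o p).toEncoding γ).circ = on
    (Fintype.equivFin (jacBlk (ofInput I) d κ V pos o p).Q).toEmbedding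
    (jacBlk (ofInput I) d κ V pos o p).circ := rfl
  rw [h]
  refine (countP_isMain_place _ _ _ _).trans ?_
  refine (Comb.countP_isMain_circ (combOf (ofInput I) d d κ (fun k => (V (k + 1)).circ)
    (fun k => jacArgs (pos k)) o p)).trans ?_
  have h2 : (ofInput I).purified.countP Instr.isMain = 1 := by
    rw [Blk.purified, List.countP_append, on, countP_isMain_place]
    rfl
  show κ * (ofInput I).purified.countP Instr.isMain = κ
  rw [h2, mul_one]

end CountCalls

/-- The probabilities proportional to the weights `w 0, …, w κ`. If all the weights are zero, the
index `0` has probability one. -/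
noncomputable def weightProb (w : ℕ → ℝ) (κ : ℕ) (k : ℕ) : ℝ :=
  if ∑ l ∈ Finset.range (κ + 1), w l = 0 then (if k = 0 then 1 else 0)
  else w k / ∑ l ∈ Finset.range (κ + 1), w l

section weightProb
variable {w : ℕ → ℝ} (hw : ∀ k, 0 ≤ w k) (κ : ℕ)
include hw

theorem weightProb_nonneg (k : ℕ) : 0 ≤ weightProb w κ k := by
  rw [weightProb]
  split_ifs
  · exact zero_le_one
  · exact le_rfl
  · exact div_nonneg (hw k) (Finset.sum_nonneg fun l _ => hw l)

theorem sum_weightProb : ∑ k ∈ Finset.range (κ + 1), weightProb w κ k = 1 := by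
  simp only [weightProb]
  split_ifs with h
  · rw [Finset.sum_ite_eq' (Finset.range (κ + 1)) 0 (fun _ => (1 : ℝ)), if_pos (by simp)]
  · rw [← Finset.sum_div, div_self h]

theorem sum_mul_weightProb {k : ℕ} (hk : k ∈ Finset.range (κ + 1)) :
    (∑ l ∈ Finset.range (κ + 1), w l) * weightProb w κ k = w k := by
  rw [weightProb]
  split_ifs with h h'
  · rw [h, zero_mul, (Finset.sum_eq_zero_iff_of_nonneg fun l _ => hw l).1 h k hk]
  · rw [h, zero_mul, (Finset.sum_eq_zero_iff_of_nonneg fun l _ => hw l).1 h k hk]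
  · rw [mul_div_cancel₀ _ h]

end weightProb

section Jacobian
variable {N n : ℕ} [NeZero N] {E : Matrix (Fin N) (Fin n → Bool) ℂ}
  {A : (k : ℕ) → Matrix (Fin N) (Fin k → Fin N) ℂ} {κ : ℕ}
  {V : (k : ℕ) → Encoding Gate (Fin k → Fin N) (Fin N)} {tmax : ℕ} {ηmin : ℝ}

/-- The weights for the encoding of the Jacobian, when the vector has the normalization `γ`. -/
noncomputable def jacWeight (V : (k : ℕ) → Encoding Gate (Fin k → Fin N) (Fin N)) (γ : ℝ) (k : ℕ) :
    ℝ := |((k + 1 : ℕ) : ℝ) * (V (k + 1)).γ * γ ^ k|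

open Classical in
/-- The returned encoding of the Jacobian of a polynomial of degree `κ + 1`. The answer is
irrelevant for interfaces that do not encode a vector. -/
noncomputable def jacAlgorithm (E : Matrix (Fin N) (Fin n → Bool) ℂ)
    (V : (k : ℕ) → Encoding Gate (Fin k → Fin N) (Fin N)) (κ : ℕ)
    (pos : ∀ k : Fin (κ + 1), Fin (k + 1) × Fin n ↪ Fin (V (k + 1)).m)
    (o : ∀ k : Fin (κ + 1), Fin n ↪ Fin (V (k + 1)).m) : EncodingAlgorithm N (Fin N) (Fin N) :=
  fun _ _ I _ =>
    if h : ∃ d, I.P₂ = dataProj E d then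
      .output ((jacBlk (ofInput I) h.choose κ V pos o
        (weightProb (jacWeight V I.γ) κ)).toEncoding
          (∑ k ∈ Finset.range (κ + 1), jacWeight V I.γ k))
    else .run 0 []

/-- The algorithm for the Jacobian is correct. The information efficiency is `|Df x|` divided by the
sum of the weights, where `γ_k ≤ |A_k| / ηmin` and `γ_x ≤ |x| / Cie`; the term of degree `k`
contains `k - 1` copies of the input, hence the exponent of `Cie`. -/
theorem isExactConstructiveEncoding_jacAlgorithm {Cie : ℝ} (hC : 0 < Cie) (hη : 0 < ηmin)
    (hV : ∀ k ≤ κ + 1,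
      EncodesCoefficient E (V k) (A k) ∧ (V k).gates ≤ tmax ∧ ηmin ≤ (V k).eff)
    {pos : ∀ k : Fin (κ + 1), Fin (k + 1) × Fin n ↪ Fin (V (k + 1)).m}
    {o : ∀ k : Fin (κ + 1), Fin n ↪ Fin (V (k + 1)).m}
    (hpos : ∀ k : Fin (κ + 1), (V (k + 1)).P₁ = tensorProj E (k + 1) (pos k))
    (ho : ∀ k : Fin (κ + 1), (V (k + 1)).P₂ = dataProj E (o k)) :
    IsExactConstructiveEncoding E Cie (jacAlgorithm E V κ pos o) (polyJacobian A (κ + 1))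
      (fun x => ηmin * Cie ^ κ * specNorm (polyJacobian A (κ + 1) x) *
        (∑ k ∈ Finset.range (κ + 1), ((k + 1 : ℕ) : ℝ) * specNorm (A (k + 1)) * ‖x‖ ^ k)⁻¹)
      (fun _ => ((κ + 1) * (400 * tmax) : ℕ)) κ := by
  intro ε δ _ _ _ _ x U hx hU
  obtain ⟨hx1, hx2, hx3⟩ := id hx
  obtain ⟨d, hd⟩ : ∃ d, d = hx3.choose := ⟨_, rfl⟩
  have hd' : U.P₂ = dataProj E d := hd ▸ hx3.choose_spec
  have hX := valid_ofInput hx1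
  have hγx := hx1.gamma_nonneg
  have hle : ∀ {k}, k ∈ Finset.range (κ + 1) → k + 1 ≤ κ + 1 := fun h => by
    have := Finset.mem_range.1 h; omega
  have hw : ∀ k, 0 ≤ jacWeight V U.γ k := fun k => abs_nonneg _
  have hweq : ∀ k ∈ Finset.range (κ + 1), jacWeight V U.γ k =
      ((k + 1 : ℕ) : ℝ) * (V (k + 1)).γ * U.γ ^ k := fun k hk =>
    abs_of_nonneg (mul_nonneg (mul_nonneg (Nat.cast_nonneg _)
      (hV _ (hle hk)).1.1.gamma_nonneg) (pow_nonneg hγx _))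
  set p := weightProb (jacWeight V U.γ) κ with hp
  set Γ := ∑ k ∈ Finset.range (κ + 1), jacWeight V U.γ k with hΓ
  have hΓ0 : 0 ≤ Γ := Finset.sum_nonneg fun k _ => hw k
  set T := jacBlk (ofInput U.toInterface) d κ V pos o p with hT
  have hTv : T.Valid U := jacBlk_valid hX κ V pos o p
  have hP₁ : (ofInput U.toInterface).P₁ = zeroBra (ofInput U.toInterface).Q :=
    hx2.trans (zeroProj_eq_zeroBra _)
  have hP₂ : (ofInput U.toInterface).P₂ = extP d E := hd'.trans (dataProj_eq_extP E d)
  have hblock : (Γ : ℂ) • T.block U = polyJacobian A (κ + 1) x := by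
    rw [hT, jacBlk_block hX hP₁ hP₂ κ V pos o hpos ho (weightProb_nonneg hw κ)
      (sum_weightProb hw κ), polyJacobian_eq, Finset.smul_sum]
    refine Finset.sum_congr rfl fun k hk => ?_
    have h1 := sum_mul_weightProb hw κ hk
    rw [hweq k hk] at h1
    rw [block_ofInput, smul_smul, ← Complex.ofReal_mul, h1, (hV _ (hle hk)).1.1.eq_smul,
      hx1.eq_smul, tensorColId_smul, Matrix.smul_mul, Matrix.mul_smul, smul_smul, smul_smul]
    push_cast
    ring_nf
  have hS : ∀ k ∈ Finset.range (κ + 1), specNorm (A (k + 1)) * ‖x‖ ^ k ≤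
      (V (k + 1)).γ * U.γ ^ k := fun k hk => by
    refine mul_le_mul (hV _ (hle hk)).1.1.le_gamma ?_ (pow_nonneg (norm_nonneg _) _)
      (hV _ (hle hk)).1.1.gamma_nonneg
    refine pow_le_pow_left₀ (norm_nonneg _) ?_ _
    rw [← specNorm_column]; exact hx1.le_gamma
  have hS' : ∀ k ∈ Finset.range (κ + 1), ηmin * Cie ^ κ * ((V (k + 1)).γ * U.γ ^ k) ≤
      specNorm (A (k + 1)) * ‖x‖ ^ k := fun k hk => by
    rw [(hV _ (hle hk)).1.1.specNorm_eq, hx.norm_eq, mul_pow]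
    have h2 : Cie ^ κ ≤ U.eff ^ k := by
      have h3 : U.eff ≤ 1 := by
        have h4 := hX.prob_le_one hP₁
        rw [Blk.prob, ← sq_specNorm_col, block_ofInput] at h4
        have h5 : 0 ≤ specNorm U.block := specNorm_nonneg _
        rw [Encoding.eff]
        nlinarith
      have h4 : k ≤ κ := by have := Finset.mem_range.1 hk; omega
      calc Cie ^ κ ≤ U.eff ^ κ := pow_le_pow_left₀ hC.le hU _
        _ ≤ U.eff ^ k := pow_le_pow_of_le_one (hC.le.trans hU) h3 h4
    have h3 : ηmin * Cie ^ κ ≤ (V (k + 1)).eff * U.eff ^ k :=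
      mul_le_mul (hV _ (hle hk)).2.2 h2 (pow_nonneg hC.le _) (hη.le.trans (hV _ (hle hk)).2.2)
    have h4 : 0 ≤ (V (k + 1)).γ * U.γ ^ k :=
      mul_nonneg (hV _ (hle hk)).1.1.gamma_nonneg (pow_nonneg hγx _)
    calc _ ≤ (V (k + 1)).eff * U.eff ^ k * ((V (k + 1)).γ * U.γ ^ k) :=
        mul_le_mul_of_nonneg_right h3 h4
      _ = _ := by ring
  have hnorm : specNorm (polyJacobian A (κ + 1) x) = Γ * specNorm (T.block U) := by
    rw [← hblock, specNorm_smul, Complex.norm_real, Real.norm_of_nonneg hΓ0]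
  have hle1 : specNorm (polyJacobian A (κ + 1) x) ≤ Γ := by
    rw [polyJacobian_eq]
    refine (specNorm_sum_le _ _).trans (Finset.sum_le_sum fun k hk => ?_)
    rw [specNorm_smul, Complex.norm_natCast, hweq k hk, mul_assoc]
    refine mul_le_mul_of_nonneg_left ?_ (Nat.cast_nonneg _)
    refine ((specNorm_mul_le _ _).trans (mul_le_mul_of_nonneg_left
      (specNorm_tensorColId_le _ _) (specNorm_nonneg _))).trans ?_
    rw [specNorm_column]
    exact hS k hk
  refine ⟨T.toEncoding Γ, ?_, ⟨?_, ?_, ?_⟩, ?_, ?_, ?_⟩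
  · rw [jacAlgorithm, dif_pos hx3, ← hd]
  · refine hTv.isBlockEncoding hle1 ?_
    rw [hblock, sub_self, zero_mul]
    exact (specNorm_eq_zero.2 rfl).le
  · exact T.toEncoding_P₁_data (d.trans (combOf (ofInput U.toInterface) d d κ
      (fun k => (V (k + 1)).circ) (fun k => jacArgs (pos k)) o p).inQ) (by
      show extP _ (ofInput U.toInterface).P₂ = _
      rw [hP₂]; exact extP_extP d _ E) Γ
  · exact T.toEncoding_P₂_data (d.trans (combOf (ofInput U.toInterface) d d κ
      (fun k => (V (k + 1)).circ) (fun k => jacArgs (pos k)) o p).outQ) (by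
      show extP _ (ofInput U.toInterface).P₂ = _
      rw [hP₂]; exact extP_extP d _ E) Γ
  · beta_reduce
    rw [Encoding.eff, Blk.block_toEncoding, hnorm]
    have h0 := specNorm_nonneg (T.block U)
    rcases hΓ0.eq_or_lt with h1 | h1
    · rw [← h1]; simpa using h0
    · have h2 : ηmin * Cie ^ κ * Γ ≤ ∑ k ∈ Finset.range (κ + 1),
          ((k + 1 : ℕ) : ℝ) * specNorm (A (k + 1)) * ‖x‖ ^ k := by
        rw [hΓ, Finset.mul_sum]
        refine Finset.sum_le_sum fun k hk => ?_
        have h3 := mul_le_mul_of_nonneg_left (hS' k hk) (Nat.cast_nonneg (k + 1) : (0 : ℝ) ≤ _)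
        rw [hweq k hk]
        linarith
      have h3 : 0 < ηmin * Cie ^ κ * Γ := mul_pos (mul_pos hη (pow_pos hC _)) h1
      rw [← mul_assoc, ← div_eq_mul_inv, div_le_iff₀ (h3.trans_le h2),
        mul_comm (specNorm (T.block U))]
      exact mul_le_mul_of_nonneg_right h2 h0
  · rw [complexity, Blk.gates_toEncoding]
    have h1 : (0 : ℝ) < U.gates := Nat.cast_pos.2 hx.one_le_gates
    rw [div_le_iff₀ h1]
    have h2 := jacBlk_size_le (d := d) hX κ V pos o p (t := tmax) (fun k => (hV _ (by omega)).2.1)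
      fun k => ((hV _ (by omega)).1.outside_le (hpos k)).trans (hV _ (by omega)).2.1
    have h3 : T.gates U ≤ T.size U := by rw [Blk.size]; omega
    have h4 := hx.size_ofInput_le
    have h5 := hx.one_le_gates
    have h6 := (hV 0 (by omega)).1.one_le_gates.trans (hV 0 (by omega)).2.1
    have h7 : 100 * (ofInput U.toInterface).size U + 100 * tmax ≤ 400 * tmax * U.gates := by
      nlinarith
    have h8 := h3.trans (h2.trans (Nat.mul_le_mul_left (κ + 1) h7))
    rw [← mul_assoc] at h8
    beta_reduce
    exact_mod_cast h8
  · exact (countP_isMain_jacBlk d κ V pos o p Γ).le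

end Jacobian

/-! ### Strategies -/

section Strategies
variable {μ₁ μ₂ ν₁ ν₂ ν : Type} {I : Interface μ₁ μ₂}

/-- The strategy `𝒮` after the outcomes `h`. -/
def after (𝒮 : Strategy I ν₁ ν₂) (h : List (List Bool)) : Strategy I ν₁ ν₂ := fun h' => 𝒮 (h ++ h')

/-- The strategy that runs a circuit and continues with a strategy that depends on the outcome. -/
def runThen (q : ℕ) (c : List (Instr I (Fin q))) (k : List Bool → Strategy I ν₁ ν₂) :
    Strategy I ν₁ ν₂
  | [] => .run q c
  | o :: h => k o h

/-- The strategy that stops and returns `T`. -/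
def ret (T : Encoding (Instr I) ν₁ ν₂) : Strategy I ν₁ ν₂ := fun _ => .output T

variable {U : Encoding Gate μ₁ μ₂} {good : Encoding Gate ν₁ ν₂ → ℕ → Prop}

/-- The success probability after some outcomes is that of the remaining strategy. -/
theorem probWithin_eq_after (𝒮 : Strategy U.toInterface ν₁ ν₂) (T : ℕ) (h : List (List Bool))
    (c : ℕ) : probWithin U 𝒮 good T h c = probWithin U (after 𝒮 h) good T [] c := by
  have hn : ∀ (𝒮 : Strategy U.toInterface ν₁ ν₂) h, after 𝒮 h [] = 𝒮 h := fun 𝒮 h => by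
    rw [after, List.append_nil]
  induction T generalizing 𝒮 h c with
  | zero => rw [probWithin, probWithin, hn]
  | succ T ih =>
    rw [probWithin, probWithin, hn]
    cases 𝒮 h with
    | output W => rfl
    | run q circ =>
      refine Finset.sum_congr rfl fun s _ => ?_
      rw [ih 𝒮, ih (after 𝒮 h)]
      congr 2
      funext h'
      simp [after]

theorem probWithin_nonneg (𝒮 : Strategy U.toInterface ν₁ ν₂) (T : ℕ) (h : List (List Bool))
    (c : ℕ) : 0 ≤ probWithin U 𝒮 good T h c := by
  induction T generalizing h c with
  | zero =>
    rw [probWithin]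
    cases 𝒮 h with
    | output W => dsimp only; split_ifs <;> norm_num
    | run q circ => exact le_rfl
  | succ T ih =>
    rw [probWithin]
    cases 𝒮 h with
    | output W => dsimp only; split_ifs <;> norm_num
    | run q circ => exact Finset.sum_nonneg fun s _ => mul_nonneg (sq_nonneg _) (ih _ _)

theorem probWithin_le_succ (𝒮 : Strategy U.toInterface ν₁ ν₂) (T : ℕ) (h : List (List Bool))
    (c : ℕ) : probWithin U 𝒮 good T h c ≤ probWithin U 𝒮 good (T + 1) h c := by
  induction T generalizing h c with
  | zero =>
    rw [probWithin, probWithin]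
    cases 𝒮 h with
    | output W => exact le_rfl
    | run q circ =>
      exact Finset.sum_nonneg fun s _ => mul_nonneg (sq_nonneg _) (probWithin_nonneg _ _ _ _)
  | succ T ih =>
    rw [probWithin, probWithin]
    cases 𝒮 h with
    | output W => exact le_rfl
    | run q circ =>
      exact Finset.sum_le_sum fun s _ => mul_le_mul_of_nonneg_left (ih _ _) (sq_nonneg _)

theorem probWithin_mono (𝒮 : Strategy U.toInterface ν₁ ν₂) (h : List (List Bool)) (c : ℕ) :
    Monotone fun T => probWithin U 𝒮 good T h c :=
  monotone_nat_of_le_succ fun T => probWithin_le_succ 𝒮 T h c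

variable (U good) in
/-- The probability that the strategy `𝒮`, when `c` gates have been executed before, succeeds is at
least `p`. -/
def SuccAfter (𝒮 : Strategy U.toInterface ν₁ ν₂) (c : ℕ) (p : ℝ) : Prop :=
  ∃ T, p ≤ probWithin U 𝒮 good T [] c

theorem SuccAfter.mono {𝒮 : Strategy U.toInterface ν₁ ν₂} {c : ℕ} {p p' : ℝ}
    (h : SuccAfter U good 𝒮 c p) (hp : p' ≤ p) : SuccAfter U good 𝒮 c p' :=
  h.imp fun _ hT => hp.trans hT

theorem SuccAfter.of_nonpos (𝒮 : Strategy U.toInterface ν₁ ν₂) (c : ℕ) {p : ℝ} (hp : p ≤ 0) :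
    SuccAfter U good 𝒮 c p := ⟨0, hp.trans (probWithin_nonneg _ _ _ _)⟩

theorem SuccAfter.ret {T : Encoding (Instr U.toInterface) ν₁ ν₂} {c : ℕ}
    (h : good (U.instantiate T) c) : SuccAfter U good (ret T) c 1 := by
  refine ⟨0, ?_⟩
  rw [probWithin, QEnc.ret]
  simp [h]

/-- The rule for a measurement: the success probability is the expectation of that of the strategy
that follows. -/
theorem SuccAfter.runThen {q : ℕ} {circ : List (Instr U.toInterface (Fin q))}
    {k : List Bool → Strategy U.toInterface ν₁ ν₂} {c : ℕ} {p : (Fin q → Bool) → ℝ}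
    (h : ∀ s, SuccAfter U good (k (List.ofFn s)) (c + cost U circ) (p s)) :
    SuccAfter U good (runThen q circ k) c
      (∑ s, ‖sem U circ s (fun _ => false)‖ ^ 2 * p s) := by
  choose T hT using h
  refine ⟨Finset.univ.sup T + 1, ?_⟩
  rw [probWithin]
  show _ ≤ ∑ s, _
  refine Finset.sum_le_sum fun s _ => mul_le_mul_of_nonneg_left ?_ (sq_nonneg _)
  rw [probWithin_eq_after]
  exact (hT s).trans (probWithin_mono _ _ _ (Finset.le_sup (Finset.mem_univ s)))

/-- The strategy that measures whether the state encoded by `T` is in the range of the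
projection. -/
noncomputable def flip (T : Blk I Unit ν) (k : Bool → Strategy I ν₁ ν₂) : Strategy I ν₁ ν₂ :=
  runThen (Fintype.card (T.Q ⊕ (Unit ⊕ T.B₂)))
    (on (Fintype.equivFin (T.Q ⊕ (Unit ⊕ T.B₂))).toEmbedding T.flagged)
    fun o => k (o.getD (Fintype.equivFin (T.Q ⊕ (Unit ⊕ T.B₂)) (Sum.inr (Sum.inl ()))) false)

theorem sem_on_equiv {Q Q' : Type} [Fintype Q] [DecidableEq Q] [Fintype Q'] [DecidableEq Q']
    (e : Q ≃ Q') (c : List (Instr U.toInterface Q)) (s t : Q' → Bool) :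
    sem U (on e.toEmbedding c) s t = sem U c (s ∘ e) (t ∘ e) := by
  rw [sem_on, lift, if_pos (by simp), if_pos]
  · rfl
  · intro q hq
    exact absurd ⟨e.symm q, e.apply_symm_apply q⟩ hq

variable [Fintype ν] [DecidableEq ν]

/-- A flip is positive with probability `T.prob U`. -/
theorem SuccAfter.flip {T : Blk U.toInterface Unit ν} (hT : T.Valid U) (hP : T.P₁ = zeroBra T.Q)
    {k : Bool → Strategy U.toInterface ν₁ ν₂} {c : ℕ} {p : Bool → ℝ}
    (h : ∀ b, SuccAfter U good (k b) (c + cost U T.flagged) (p b)) :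
    SuccAfter U good (flip T k) c (T.prob U * p true + (1 - T.prob U) * p false) := by
  set e := Fintype.equivFin (T.Q ⊕ (Unit ⊕ T.B₂)) with he
  have h1 : SuccAfter U good (QEnc.flip T k) c (∑ s,
      ‖sem U (on e.toEmbedding T.flagged) s (fun _ => false)‖ ^ 2 *
        p (s (e (Sum.inr (Sum.inl ()))))) := by
    refine SuccAfter.runThen fun s => ?_
    rw [cost_on]
    have h2 : (List.ofFn s).getD (e (Sum.inr (Sum.inl ()))) false =
        s (e (Sum.inr (Sum.inl ()))) := by
      rw [List.getD_eq_getElem _ _ (by rw [List.length_ofFn]; exact Fin.is_lt _), List.getElem_ofFn]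
    rw [h2]
    exact h _
  refine h1.mono (le_of_eq ?_)
  rw [← hT.sum_flagged hP, ← (Equiv.arrowCongr e (Equiv.refl Bool)).sum_comp]
  refine Finset.sum_congr rfl fun s _ => ?_
  have h3 : (Equiv.arrowCongr e (Equiv.refl Bool)) s ∘ e = s := by
    funext q; simp [Equiv.arrowCongr]
  have h4 : (Equiv.arrowCongr e (Equiv.refl Bool)) s (e (Sum.inr (Sum.inl ()))) =
    s (Sum.inr (Sum.inl ())) := congrFun h3 _
  rw [sem_on_equiv, h3, h4]
  rfl

/-- The strategy that repeats a measurement `M` times and continues with a strategy that depends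
on the number of positive outcomes. -/
noncomputable def flips (T : Blk I Unit ν) (k : ℕ → Strategy I ν₁ ν₂) : ℕ → ℕ → Strategy I ν₁ ν₂
  | 0, n => k n
  | M + 1, n => flip T fun b => flips T k M (n + if b then 1 else 0)

/-- The expectation of `F (n + X)` for a binomial variable `X` with parameters `M` and `p`. -/
def binomialExp (p : ℝ) (F : ℕ → ℝ) : ℕ → ℕ → ℝ
  | 0, n => F n
  | M + 1, n => p * binomialExp p F M (n + 1) + (1 - p) * binomialExp p F M n

theorem SuccAfter.flips {T : Blk U.toInterface Unit ν} (hT : T.Valid U) (hP : T.P₁ = zeroBra T.Q)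
    {k : ℕ → Strategy U.toInterface ν₁ ν₂} {F : ℕ → ℝ} (M : ℕ) {n c : ℕ}
    (h : ∀ n', SuccAfter U good (k n') (c + M * cost U T.flagged) (F n')) :
    SuccAfter U good (flips T k M n) c (binomialExp (T.prob U) F M n) := by
  induction M generalizing n c with
  | zero => simpa [QEnc.flips, binomialExp] using h n
  | succ M ih =>
    have h1 := SuccAfter.flip (good := good) (c := c) hT hP
      (k := fun b => QEnc.flips T k M (n + if b then 1 else 0))
      (p := fun b => binomialExp (T.prob U) F M (n + if b then 1 else 0)) fun b => ih fun n' => by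
        have h2 := h n'
        rwa [show c + (M + 1) * cost U T.flagged =
          c + cost U T.flagged + M * cost U T.flagged by ring] at h2
    exact h1

end Strategies

/-! ### Tails of the binomial distribution -/

section Tails

/-- The exponential moment method: the factor `(1 + p (z - 1)) ^ M` is the moment generating
function of the binomial distribution. -/
theorem le_binomialExp {p : ℝ} (hp : 0 ≤ p) (hp1 : p ≤ 1) {F : ℕ → ℝ} {P a z : ℝ}
    (hF : ∀ n, P - a * z ^ n ≤ F n) (M n : ℕ) :
    P - a * z ^ n * (1 + p * (z - 1)) ^ M ≤ binomialExp p F M n := by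
  induction M generalizing n with
  | zero => simpa [binomialExp] using hF n
  | succ M ih =>
    rw [binomialExp]
    have h1 := mul_le_mul_of_nonneg_left (ih (n + 1)) hp
    have h2 := mul_le_mul_of_nonneg_left (ih n) (sub_nonneg.2 hp1)
    refine le_trans (le_of_eq ?_) (add_le_add h1 h2)
    ring

/-- A Chernoff bound, if the continuation succeeds for a fraction of positive outcomes below the
threshold. -/
theorem binomialExp_upper {p t g P : ℝ} (hp : 0 ≤ p) (hp1 : p ≤ 1) (hg : 0 ≤ g) (hg1 : g ≤ 1)
    (hpt : p ≤ t - g) (hP : P ≤ 1) {F : ℕ → ℝ} {M : ℕ} (h0 : ∀ n, 0 ≤ F n)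
    (hF : ∀ n : ℕ, (n : ℝ) < t * M → P ≤ F n) :
    P - Real.exp (-(g ^ 2 / 4) * M) ≤ binomialExp p F M 0 := by
  have h1 := le_binomialExp hp hp1 (F := F) (P := P) (a := Real.exp (-(g / 2 * (t * M))))
    (z := Real.exp (g / 2)) (fun n => by
      have h2 : Real.exp (-(g / 2 * (t * M))) * Real.exp (g / 2) ^ n =
          Real.exp (g / 2 * (n - t * M)) := by
        rw [← Real.exp_nat_mul, ← Real.exp_add]; ring_nf
      rw [h2]
      rcases lt_or_ge (n : ℝ) (t * M) with h | h
      · linarith [hF n h, Real.exp_pos (g / 2 * (n - t * M))]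
      · have : 1 ≤ Real.exp (g / 2 * (n - t * M)) :=
          Real.one_le_exp (mul_nonneg (by linarith) (by linarith))
        linarith [h0 n]) M 0
  refine le_trans (sub_le_sub_left ?_ P) h1
  have h3 : Real.exp (g / 2) - 1 ≤ g / 2 + (g / 2) ^ 2 := by
    have := (abs_le.1 (Real.abs_exp_sub_one_sub_id_le (x := g / 2)
      (by rw [abs_of_nonneg (by linarith)]; linarith))).2
    linarith
  have h4 : 0 ≤ Real.exp (g / 2) - 1 := sub_nonneg.2 (Real.one_le_exp (by linarith))
  have h5 : 1 + p * (Real.exp (g / 2) - 1) ≤ Real.exp (g / 2 * t - g ^ 2 / 4) := by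
    refine le_trans ?_ (Real.exp_le_exp.2 (?_ : p * (g / 2 + (g / 2) ^ 2) ≤ _))
    · have := Real.add_one_le_exp (p * (g / 2 + (g / 2) ^ 2))
      have := mul_le_mul_of_nonneg_left h3 hp
      linarith
    · nlinarith [sq_nonneg g]
  have h6 := pow_le_pow_left₀ (by positivity) h5 M
  rw [pow_zero, mul_one]
  refine (mul_le_mul_of_nonneg_left h6 (Real.exp_pos _).le).trans (le_of_eq ?_)
  rw [← Real.exp_nat_mul, ← Real.exp_add]
  ring_nf

/-- A Chernoff bound, if the continuation succeeds for a fraction of positive outcomes above the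
threshold. -/
theorem binomialExp_lower {p t g P : ℝ} (hp : 0 ≤ p) (hp1 : p ≤ 1) (hg : 0 ≤ g) (hg1 : g ≤ 1)
    (hpt : t + g ≤ p) (hP : P ≤ 1) {F : ℕ → ℝ} {M : ℕ} (h0 : ∀ n, 0 ≤ F n)
    (hF : ∀ n : ℕ, t * M ≤ (n : ℝ) → P ≤ F n) :
    P - Real.exp (-(g ^ 2 / 4) * M) ≤ binomialExp p F M 0 := by
  have h1 := le_binomialExp hp hp1 (F := F) (P := P) (a := Real.exp (g / 2 * (t * M)))
    (z := Real.exp (-(g / 2))) (fun n => by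
      have h2 : Real.exp (g / 2 * (t * M)) * Real.exp (-(g / 2)) ^ n =
          Real.exp (g / 2 * (t * M - n)) := by
        rw [← Real.exp_nat_mul, ← Real.exp_add]; ring_nf
      rw [h2]
      rcases lt_or_ge (n : ℝ) (t * M) with h | h
      · have : 1 ≤ Real.exp (g / 2 * (t * M - n)) :=
          Real.one_le_exp (mul_nonneg (by linarith) (by linarith))
        linarith [h0 n]
      · linarith [hF n h, Real.exp_pos (g / 2 * (t * M - n))]) M 0
  refine le_trans (sub_le_sub_left ?_ P) h1
  have h3 : Real.exp (-(g / 2)) - 1 ≤ -(g / 2) + (g / 2) ^ 2 := by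
    have := (abs_le.1 (Real.abs_exp_sub_one_sub_id_le (x := -(g / 2))
      (by rw [abs_neg, abs_of_nonneg (by linarith)]; linarith))).2
    linarith [neg_sq (g / 2)]
  have h5 : 1 + p * (Real.exp (-(g / 2)) - 1) ≤ Real.exp (-(g / 2 * t) - g ^ 2 / 4) := by
    refine le_trans ?_ (Real.exp_le_exp.2 (?_ : p * (-(g / 2) + (g / 2) ^ 2) ≤ _))
    · have := Real.add_one_le_exp (p * (-(g / 2) + (g / 2) ^ 2))
      have := mul_le_mul_of_nonneg_left h3 hp
      linarith
    · nlinarith [sq_nonneg g]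
  have h7 : 0 ≤ 1 + p * (Real.exp (-(g / 2)) - 1) := by
    nlinarith [Real.exp_pos (-(g / 2))]
  have h6 := pow_le_pow_left₀ h7 h5 M
  rw [pow_zero, mul_one]
  refine (mul_le_mul_of_nonneg_left h6 (Real.exp_pos _).le).trans (le_of_eq ?_)
  rw [← Real.exp_nat_mul, ← Real.exp_add]
  ring_nf

/-- If the probability `p` is small, it is unlikely that an eighth of the outcomes is positive. In
contrast to `binomialExp_upper`, the bound improves with `p`. -/
theorem binomialExp_eighth {p x P : ℝ} (hp : 0 ≤ p) (hx : 0 < x) (hpx : p ≤ x) (hx1 : x ≤ 1)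
    (hP : P ≤ 1) {F : ℕ → ℝ} {m : ℕ} (h0 : ∀ n, 0 ≤ F n) (hF : ∀ n : ℕ, n < m → P ≤ F n) :
    P - (256 * x) ^ m ≤ binomialExp p F (8 * m) 0 := by
  have h1 := le_binomialExp hp (hpx.trans hx1) (F := F) (P := P) (a := x ^ m) (z := x⁻¹)
    (fun n => by
      rcases lt_or_ge n m with h | h
      · have : 0 ≤ x ^ m * x⁻¹ ^ n := by positivity
        linarith [hF n h]
      · have : 1 ≤ x ^ m * x⁻¹ ^ n := by
          rw [inv_pow, ← div_eq_mul_inv, one_le_div (by positivity)]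
          exact pow_le_pow_of_le_one hx.le hx1 h
        linarith [h0 n]) (8 * m) 0
  refine le_trans (sub_le_sub_left ?_ P) h1
  have h2 : 1 + p * (x⁻¹ - 1) ≤ 2 := by
    have : p * x⁻¹ ≤ 1 := by rw [← div_eq_mul_inv]; exact (div_le_one hx).2 hpx
    linarith
  have h3 : 0 ≤ 1 + p * (x⁻¹ - 1) := by
    have : 1 ≤ x⁻¹ := (one_le_inv₀ hx).2 hx1
    nlinarith
  have h4 := pow_le_pow_left₀ h3 h2 (8 * m)
  rw [pow_zero, mul_one]
  refine (mul_le_mul_of_nonneg_left h4 (by positivity)).trans (le_of_eq ?_)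
  rw [pow_mul, ← mul_pow]
  norm_num [mul_comm]

end Tails

/-! ### Trigonometric estimates -/

section Trig
open Real

/-- The sine is expanding up to a constant factor on `[0, π/4]`. -/
theorem sub_le_mul_sin_sub_sin {x y : ℝ} (hx : 0 ≤ x) (hxy : x ≤ y) (hy : y ≤ π / 4) :
    y - x ≤ 2.3 * (sin y - sin x) := by
  have h1 := sin_sub_sin y x
  have h2 := mul_le_sin (x := (y - x) / 2) (by linarith) (by linarith [pi_pos])
  have h3 : (0.7 : ℝ) ≤ cos ((y + x) / 2) := by
    have h4 : cos (π / 4) ≤ cos ((y + x) / 2) :=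
      cos_le_cos_of_nonneg_of_le_pi (by linarith) (by linarith [pi_pos]) (by linarith)
    rw [cos_pi_div_four] at h4
    have : (1.4 : ℝ) ≤ √2 := le_sqrt_of_sq_le (by norm_num)
    linarith
  have h5 : (0.63 : ℝ) ≤ 2 / π := by
    rw [le_div_iff₀ pi_pos]; nlinarith [pi_lt_d2]
  have h6 : 0.63 * ((y - x) / 2) ≤ sin ((y - x) / 2) :=
    (mul_le_mul_of_nonneg_right h5 (by linarith)).trans h2
  have h7 : 0.63 * ((y - x) / 2) * 0.7 ≤ sin ((y - x) / 2) * cos ((y + x) / 2) :=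
    mul_le_mul h6 h3 (by norm_num) ((by nlinarith : (0:ℝ) ≤ _).trans h6)
  rw [h1]
  nlinarith

theorem sin_sub_sin_le {x y : ℝ} (hxy : x ≤ y) : sin y - sin x ≤ y - x := by
  rw [sin_sub_sin]
  have h1 : sin ((y - x) / 2) ≤ (y - x) / 2 := sin_le (by linarith)
  have h2 := cos_le_one ((y + x) / 2)
  have h3 := neg_one_le_cos ((y + x) / 2)
  have h4 : |sin ((y - x) / 2)| ≤ (y - x) / 2 := by
    have := abs_sin_le_abs (x := (y - x) / 2)
    rwa [abs_of_nonneg (by linarith : 0 ≤ (y - x) / 2)] at this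
  have h5 : sin ((y - x) / 2) * cos ((y + x) / 2) ≤ |sin ((y - x) / 2)| * 1 := by
    refine (le_abs_self _).trans ?_
    rw [abs_mul]
    exact mul_le_mul_of_nonneg_left (abs_le.2 ⟨h3, h2⟩) (abs_nonneg _)
  linarith

theorem sin_sq_sub_sin_sq (x y : ℝ) : sin x ^ 2 - sin y ^ 2 = sin (x - y) * sin (x + y) := by
  rw [sin_sub, sin_add]
  linear_combination (-(sin x ^ 2)) * sin_sq_add_cos_sq y + sin y ^ 2 * sin_sq_add_cos_sq x

theorem arcsin_le_pi_div_four {y : ℝ} (hy : y ≤ 0.7) : arcsin y ≤ π / 4 := by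
  have h1 : (1.4 : ℝ) ≤ √2 := le_sqrt_of_sq_le (by norm_num)
  rw [arcsin_le_iff_le_sin' ⟨by linarith [pi_pos], by linarith [pi_pos]⟩, sin_pi_div_four]
  linarith

/-- A constant that bounds the distance of the success probabilities of a test from its threshold,
when the unknown amplitude is close to one of the ends of the known interval. -/
noncomputable def testGap : ℝ := sin (3 / 4096) ^ 2 / 2

theorem sin_gap_pos : 0 < sin (3 / 4096) := sin_pos_of_pos_of_lt_pi (by norm_num)
  (by linarith [pi_gt_three])

theorem testGap_pos : 0 < testGap := by
  have := sin_gap_pos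
  rw [testGap]; positivity

theorem testGap_le : testGap ≤ 1 / 8 := by
  have h1 : sin (3 / 4096) ≤ 3 / 4096 := sin_le (by norm_num)
  rw [testGap]
  nlinarith [sin_gap_pos]

/-- The scale factor `s` is chosen such that the angle for the lower end of the interval is close
to a multiple of `π`, after multiplication with `R`. -/
theorem exists_scale {a R : ℝ} (ha : 0 ≤ a) (ha2 : a ≤ 2) (hR : 0 < R) :
    ∃ (s : ℝ) (j : ℕ), 1 / 128 ≤ s ∧ s ≤ 1 / 8 ∧ j * π ≤ R * arcsin (s * a) ∧
      R * arcsin (s * a) ≤ j * π + π / 4 := by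
  set v := arcsin (a / 8) with hv
  have hv0 : 0 ≤ v := arcsin_nonneg.2 (by linarith)
  have hv4 : v ≤ π / 4 := arcsin_le_pi_div_four (by linarith)
  have hsv : sin v = a / 8 := sin_arcsin (by linarith) (by linarith)
  obtain ⟨j, hj⟩ : ∃ j, j = ⌊R * v / π⌋₊ := ⟨_, rfl⟩
  have hj1 : j * π ≤ R * v := by
    rw [hj, ← le_div_iff₀ pi_pos]
    exact Nat.floor_le (div_nonneg (mul_nonneg hR.le hv0) pi_pos.le)
  have hj2 : R * v < (j + 1) * π := by
    rw [hj, ← div_lt_iff₀ pi_pos]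
    exact Nat.lt_floor_add_one _
  rcases Nat.eq_zero_or_pos j with h0 | h0
  · refine ⟨1 / 128, 0, le_rfl, by norm_num, ?_, ?_⟩
    · rw [Nat.cast_zero, zero_mul]
      exact mul_nonneg hR.le (arcsin_nonneg.2 (by linarith))
    · have h1 := sub_le_mul_sin_sub_sin (x := 0) (y := arcsin (1 / 128 * a)) le_rfl
        (arcsin_nonneg.2 (by linarith)) (arcsin_le_pi_div_four (by linarith))
      rw [sin_arcsin (by linarith) (by linarith), sin_zero] at h1
      have h2 : a / 8 ≤ v := hsv ▸ sin_le hv0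
      rw [h0, Nat.cast_zero, zero_add, one_mul] at hj2
      have h3 := mul_le_mul_of_nonneg_left h1 hR.le
      have h4 := mul_le_mul_of_nonneg_left h2 hR.le
      rw [Nat.cast_zero, zero_mul]
      nlinarith [pi_pos]
  · have hj' : (1 : ℝ) ≤ j := by exact_mod_cast h0
    have ha' : 0 < a := by
      rcases ha.eq_or_lt with h | h
      · rw [← h, zero_div, arcsin_zero] at hv
        rw [hv, mul_zero] at hj1
        nlinarith [pi_pos]
      · exact h
    set x := j * π / R with hx
    have hx0 : 0 ≤ x := div_nonneg (mul_nonneg (Nat.cast_nonneg _) pi_pos.le) hR.le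
    have hxv : x ≤ v := (div_le_iff₀ hR).2 (by linarith)
    have hvx : v / 2 ≤ x := by
      rw [hx, le_div_iff₀ hR]
      nlinarith [pi_pos]
    have h1 : sin x ≤ a / 8 := hsv ▸ sin_le_sin_of_le_of_le_pi_div_two (by linarith [pi_pos])
      (by linarith [pi_pos]) hxv
    have h2 : a / 16 ≤ sin x := by
      have h3 : sin (v / 2) ≤ sin x := sin_le_sin_of_le_of_le_pi_div_two (by linarith [pi_pos])
        (by linarith [pi_pos]) hvx
      have h4 := sin_two_mul (v / 2)
      rw [mul_div_cancel₀ v (two_ne_zero), hsv] at h4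
      have h5 := cos_le_one (v / 2)
      have h6 : 0 ≤ sin (v / 2) := sin_nonneg_of_nonneg_of_le_pi (by linarith)
        (by linarith [pi_pos])
      nlinarith
    have h3 : arcsin (sin x / a * a) = x := by
      rw [div_mul_cancel₀ _ ha'.ne', arcsin_sin (by linarith [pi_pos]) (by linarith [pi_pos])]
    have h4 : R * x = j * π := by rw [hx]; field_simp
    refine ⟨sin x / a, j, ?_, ?_, ?_, ?_⟩
    · rw [le_div_iff₀ ha']; linarith
    · rw [div_le_iff₀ ha']; linarith
    · rw [h3, h4]
    · rw [h3, h4]; linarith [pi_pos]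

/-- For an unknown amplitude `η` in the interval `[a, a + w]` there is a test, consisting of a
scaling and of amplitude amplification, that distinguishes whether `η` is close to the lower or
to the upper end of the interval. -/
theorem exists_test {a w : ℝ} (ha : 0 ≤ a) (hw : 0 < w) (haw : a + w ≤ 2) :
    ∃ (r : ℕ) (s t : ℝ), 0 ≤ s ∧ s ≤ 1 ∧ (2 * r + 1 : ℝ) ≤ 3 / w ∧
      ∀ η, a ≤ η → η ≤ a + w →
        (η ≤ a + w / 8 → sin ((2 * r + 1) * arcsin (s * η)) ^ 2 ≤ t - testGap) ∧
        (a + 7 * w / 8 ≤ η → t + testGap ≤ sin ((2 * r + 1) * arcsin (s * η)) ^ 2) := by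
  -- for this number of iterations `(2 r + 1) w` is of order one, but so small that the amplified
  -- angles of the interval stay within `[0, π / 2]`, modulo `π`
  obtain ⟨r, hr⟩ : ∃ r, r = ⌊1 / (8 * w)⌋₊ := ⟨_, rfl⟩
  have hr1 : (r : ℝ) ≤ 1 / (8 * w) := hr ▸ Nat.floor_le (by positivity)
  have hr2 : 1 / (8 * w) < r + 1 := hr ▸ Nat.lt_floor_add_one _
  have hrw1 : r * w ≤ 1 / 8 := by
    have := mul_le_mul_of_nonneg_right hr1 hw.le
    rwa [show 1 / (8 * w) * w = 1 / 8 by field_simp] at this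
  have hrw2 : 1 / 8 < (r + 1) * w := by
    have := mul_lt_mul_of_pos_right hr2 hw
    rwa [show 1 / (8 * w) * w = 1 / 8 by field_simp] at this
  have hr0 : (0 : ℝ) ≤ r := Nat.cast_nonneg r
  set R : ℝ := 2 * r + 1 with hRdef
  have hR : 0 < R := by positivity
  have hRw2 : R * w ≤ 2 := by
    rcases Nat.eq_zero_or_pos r with h | h
    · rw [hRdef, h]; norm_num; linarith
    · have : (1 : ℝ) ≤ r := by exact_mod_cast h
      nlinarith
  have hRw1 : 1 / 8 ≤ R * w := by nlinarith [mul_nonneg hr0 hw.le]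
  obtain ⟨s, j, hs1, hs2, hj1, hj2⟩ := exists_scale ha (by linarith) hR
  have key : ∀ η₁ η₂, a ≤ η₁ → η₁ ≤ η₂ → η₂ ≤ a + w →
      R * (s * (η₂ - η₁)) ≤ R * arcsin (s * η₂) - R * arcsin (s * η₁) ∧
      R * arcsin (s * η₂) - R * arcsin (s * η₁) ≤ 2.3 * (R * (s * (η₂ - η₁))) := by
    intro η₁ η₂ h1 h2 h3
    have e1 : 0 ≤ s * η₁ := mul_nonneg (by linarith) (by linarith)
    have e2 : s * η₁ ≤ s * η₂ := mul_le_mul_of_nonneg_left h2 (by linarith)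
    have e3 : s * η₂ ≤ 1 / 4 := by nlinarith
    have f1 : arcsin (s * η₁) ≤ arcsin (s * η₂) := monotone_arcsin e2
    have f2 := sub_le_mul_sin_sub_sin (arcsin_nonneg.2 e1) f1
      (arcsin_le_pi_div_four (by linarith))
    have f3 := sin_sub_sin_le f1
    rw [sin_arcsin (by linarith) (by linarith), sin_arcsin (by linarith) (by linarith)] at f2 f3
    constructor
    · have := mul_le_mul_of_nonneg_left f3 hR.le
      linarith
    · have := mul_le_mul_of_nonneg_left f2 hR.le
      linarith
  set φ : ℝ → ℝ := fun η => R * arcsin (s * η) - j * π with hφ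
  have hφsin : ∀ η, sin (R * arcsin (s * η)) ^ 2 = sin (φ η) ^ 2 := fun η => by
    rw [hφ]
    simp only [sin_sub_nat_mul_pi, mul_pow, ← pow_mul, mul_comm j 2]
    rw [pow_mul, neg_one_sq, one_pow, one_mul]
  have hφ0 : ∀ η, a ≤ η → η ≤ a + w → 0 ≤ φ η ∧ φ η ≤ 1.37 := by
    intro η h1 h2
    obtain ⟨k1, k2⟩ := key a η le_rfl h1 h2
    have k3 : 0 ≤ R * (s * (η - a)) :=
      mul_nonneg hR.le (mul_nonneg (by linarith) (by linarith))
    have k4 : R * (s * (η - a)) ≤ 1 / 4 := by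
      have e1 : s * (η - a) ≤ 1 / 8 * w := mul_le_mul hs2 (by linarith) (by linarith) (by norm_num)
      have e2 := mul_le_mul_of_nonneg_left e1 hR.le
      linarith
    constructor
    · simp only [hφ]; linarith
    · simp only [hφ]; linarith [pi_lt_d2]
  have hmono : ∀ η₁ η₂, a ≤ η₁ → η₁ ≤ η₂ → η₂ ≤ a + w → sin (φ η₁) ^ 2 ≤ sin (φ η₂) ^ 2 := by
    intro η₁ η₂ h1 h2 h3
    have e1 := hφ0 η₁ h1 (by linarith)
    have e2 := hφ0 η₂ (by linarith) h3
    have e3 : φ η₁ ≤ φ η₂ := by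
      have e4 := (key η₁ η₂ h1 h2 h3).1
      have e5 : 0 ≤ R * (s * (η₂ - η₁)) :=
        mul_nonneg hR.le (mul_nonneg (by linarith) (by linarith))
      simp only [hφ]; linarith
    refine pow_le_pow_left₀ (sin_nonneg_of_nonneg_of_le_pi e1.1 (by linarith [pi_gt_three])) ?_ 2
    exact sin_le_sin_of_le_of_le_pi_div_two (by linarith [pi_pos]) (by linarith [pi_gt_d2]) e3
  have hgap : 2 * testGap ≤ sin (φ (a + 7 * w / 8)) ^ 2 - sin (φ (a + w / 8)) ^ 2 := by
    have e1 := hφ0 (a + w / 8) (by linarith) (by linarith)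
    have e2 := hφ0 (a + 7 * w / 8) (by linarith) (by linarith)
    have e3 : 3 / 4096 ≤ φ (a + 7 * w / 8) - φ (a + w / 8) := by
      have e4 := (key (a + w / 8) (a + 7 * w / 8) (by linarith) (by linarith) (by linarith)).1
      have e5 : 1 / 128 * (1 / 8) ≤ s * (R * w) := mul_le_mul hs1 hRw1 (by norm_num) (by linarith)
      simp only [hφ]; linarith
    have e6 : ∀ u, 3 / 4096 ≤ u → u ≤ 2.8 → sin (3 / 4096) ≤ sin u := by
      intro u h1 h2
      rcases le_total u (π / 2) with h | h
      · exact sin_le_sin_of_le_of_le_pi_div_two (by linarith [pi_pos]) h h1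
      · rw [← sin_pi_sub u]
        exact sin_le_sin_of_le_of_le_pi_div_two (by linarith [pi_pos]) (by linarith)
          (by linarith [pi_gt_three])
    have e7 := e6 _ e3 (by linarith)
    have e8 := e6 (φ (a + 7 * w / 8) + φ (a + w / 8)) (by linarith) (by linarith)
    have e9 : sin (φ (a + 7 * w / 8)) ^ 2 - sin (φ (a + w / 8)) ^ 2 =
        sin (φ (a + 7 * w / 8) - φ (a + w / 8)) * sin (φ (a + 7 * w / 8) + φ (a + w / 8)) :=
      sin_sq_sub_sin_sq _ _
    rw [e9, testGap]
    have := mul_le_mul e7 e8 sin_gap_pos.le (sin_gap_pos.le.trans e7)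
    linarith
  refine ⟨r, s, (sin (φ (a + 7 * w / 8)) ^ 2 + sin (φ (a + w / 8)) ^ 2) / 2, by linarith,
    by linarith, ?_, fun η h1 h2 => ⟨fun h3 => ?_, fun h3 => ?_⟩⟩
  · rw [le_div_iff₀ hw]; linarith
  · rw [hφsin]
    have := hmono η (a + w / 8) h1 h3 (by linarith)
    linarith
  · rw [hφsin]
    have := hmono (a + 7 * w / 8) η (by linarith) h3 h2
    linarith

/-- Amplitude amplification that is tuned to an estimate of the amplitude leads to an amplitude
close to one. -/
theorem le_sin_mul_arcsin {R u t : ℝ} (hR : 3 ≤ R) (hu : |u - 1| ≤ t) (ht : t ≤ 1 / 4) :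
    1 - 2 * t ≤ sin (R * arcsin (u * sin (π / (2 * R)))) := by
  obtain ⟨hu1, hu2⟩ := abs_le.1 hu
  have ht0 : 0 ≤ t := (abs_nonneg _).trans hu
  have hR0 : 0 < R := by linarith
  set x := π / (2 * R) with hx
  have hx0 : 0 < x := div_pos pi_pos (by linarith)
  have hRx : R * x = π / 2 := by rw [hx]; field_simp
  have hx6 : x ≤ π / 6 := by
    rw [hx]; exact div_le_div_of_nonneg_left pi_pos.le (by norm_num) (by linarith)
  have hsx : sin x ≤ 1 / 2 := by
    rw [← sin_pi_div_six]
    exact sin_le_sin_of_le_of_le_pi_div_two (by linarith [pi_pos]) (by linarith [pi_pos]) hx6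
  have hsx0 : 0 ≤ sin x := sin_nonneg_of_nonneg_of_le_pi hx0.le (by linarith [pi_pos])
  have hsx1 : sin x ≤ x := sin_le hx0.le
  have h0 : 0 ≤ u * sin x := mul_nonneg (by linarith) hsx0
  have h1 : u * sin x ≤ 0.7 := by nlinarith
  set θ := arcsin (u * sin x) with hθ
  have hθ0 : 0 ≤ θ := arcsin_nonneg.2 h0
  have hθ4 : θ ≤ π / 4 := arcsin_le_pi_div_four h1
  have hsθ : sin θ = u * sin x := sin_arcsin (by linarith) (by linarith)
  have h2 : |θ - x| ≤ 2.3 * (t * x) := by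
    have h3 : |sin θ - sin x| ≤ t * x := by
      rw [hsθ, show u * sin x - sin x = (u - 1) * sin x by ring, abs_mul, abs_of_nonneg hsx0]
      exact mul_le_mul hu hsx1 hsx0 ht0
    obtain ⟨h4, h5⟩ := abs_le.1 h3
    rcases le_total θ x with h | h
    · have := sub_le_mul_sin_sub_sin hθ0 h (by linarith [pi_pos])
      rw [abs_of_nonpos (by linarith)]
      linarith
    · have := sub_le_mul_sin_sub_sin hx0.le h hθ4
      rw [abs_of_nonneg (by linarith)]
      linarith
  have h3 : |R * θ - π / 2| ≤ 4 * t := by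
    rw [← hRx, ← mul_sub, abs_mul, abs_of_pos hR0]
    have := mul_le_mul_of_nonneg_left h2 hR0.le
    have h4 : R * (2.3 * (t * x)) = 2.3 * t * (π / 2) := by rw [← hRx]; ring
    rw [h4] at this
    nlinarith [pi_lt_d2]
  have h4 : sin (R * θ) = cos (R * θ - π / 2) := by rw [cos_sub_pi_div_two]
  have h5 := one_sub_sq_div_two_le_cos (x := R * θ - π / 2)
  have h6 : (R * θ - π / 2) ^ 2 ≤ (4 * t) ^ 2 := sq_le_sq.2 (h3.trans (le_abs_self _))
  rw [h4]
  nlinarith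

/-- For `i₀` the amplified angle is of order one. The numbers from `i₀ - 3` to `i₀` all give the
correct order of magnitude of `η`; for smaller `i` the success probability of the test is small, and
it decays geometrically with the distance from `i₀`. -/
theorem exists_coarse {η : ℝ} (h0 : 0 < η) (h1 : η ≤ 1) : ∃ i₀ : ℕ,
    (3 : ℝ) ^ i₀ ≤ 2 / η ∧ (∀ i ≤ i₀, η ≤ 2 * (3 ^ i)⁻¹) ∧
    (∀ i, i₀ ≤ i + 3 → (3 ^ (i + 4))⁻¹ ≤ η) ∧ 1 / 4 ≤ sin (3 ^ i₀ * arcsin η) ^ 2 ∧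
    ∀ i d, i + (d + 4) = i₀ → sin (3 ^ i * arcsin η) ^ 2 ≤ 1 / 512 * (1 / 2) ^ d := by
  set θ := arcsin η with hθ
  have hθ0 : 0 < θ := arcsin_pos.2 h0
  have hθ2 : θ ≤ π / 2 := arcsin_le_pi_div_two η
  have hs : sin θ = η := sin_arcsin (by linarith) h1
  have hηθ : η ≤ θ := hs ▸ sin_le hθ0.le
  have hθη : 2 / π * θ ≤ η := hs ▸ mul_le_sin hθ0.le hθ2
  obtain ⟨i₀, hi1, hi2⟩ := exists_nat_pow_near (x := π / 2 / θ) (y := 3)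
    ((one_le_div hθ0).2 hθ2) (by norm_num)
  rw [le_div_iff₀ hθ0] at hi1
  rw [div_lt_iff₀ hθ0] at hi2
  have h3 : ∀ i : ℕ, (0 : ℝ) < 3 ^ i := fun i => by positivity
  have hmain : ∀ i ≤ i₀, (3 : ℝ) ^ i * θ ≤ 2 := fun i hi => by
    have : (3 : ℝ) ^ i ≤ 3 ^ i₀ := pow_le_pow_right₀ (by norm_num) hi
    nlinarith [pi_lt_d2]
  refine ⟨i₀, ?_, fun i hi => ?_, fun i hi => ?_, ?_, fun i d hd => ?_⟩
  · rw [le_div_iff₀ h0]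
    nlinarith [hmain i₀ le_rfl, h3 i₀]
  · rw [← div_eq_mul_inv, le_div_iff₀ (h3 i)]
    nlinarith [hmain i hi, h3 i]
  · rw [inv_le_iff_one_le_mul₀ (h3 _)]
    have h4 : (3 : ℝ) ^ (i₀ + 1) ≤ 3 ^ (i + 4) := pow_le_pow_right₀ (by norm_num) (by omega)
    have h5 : 1 ≤ 3 ^ (i₀ + 1) * η := by
      have h6 : 2 / π * (π / 2) ≤ 2 / π * (3 ^ (i₀ + 1) * θ) :=
        mul_le_mul_of_nonneg_left hi2.le (by positivity)
      rw [show 2 / π * (π / 2) = 1 by field_simp] at h6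
      calc 1 ≤ 2 / π * (3 ^ (i₀ + 1) * θ) := h6
        _ = 3 ^ (i₀ + 1) * (2 / π * θ) := by ring
        _ ≤ _ := mul_le_mul_of_nonneg_left hθη (h3 _).le
    nlinarith
  · have h4 : sin (π / 6) ≤ sin (3 ^ i₀ * θ) := by
      refine sin_le_sin_of_le_of_le_pi_div_two (by linarith [pi_pos]) hi1 ?_
      rw [pow_succ] at hi2
      linarith
    rw [sin_pi_div_six] at h4
    nlinarith
  · have h4 : |sin (3 ^ i * θ)| ≤ 3 ^ i * θ := by
      have := abs_sin_le_abs (x := 3 ^ i * θ)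
      rwa [abs_of_pos (mul_pos (h3 i) hθ0)] at this
    have h5 : (3 : ℝ) ^ i * θ * (81 * 3 ^ d) ≤ 1.58 := by
      have : (3 : ℝ) ^ i * θ * (81 * 3 ^ d) = 3 ^ i₀ * θ := by
        rw [← hd, pow_add, pow_add]; ring
      rw [this]; linarith [pi_lt_d2]
    have h6 : sin (3 ^ i * θ) ^ 2 ≤ (3 ^ i * θ) ^ 2 := by
      rw [← sq_abs]; exact pow_le_pow_left₀ (abs_nonneg _) h4 2
    have h7 : ((3 : ℝ) ^ i * θ * (81 * 3 ^ d)) ^ 2 ≤ 1.58 ^ 2 :=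
      pow_le_pow_left₀ (by have := h3 i; have := h3 d; positivity) h5 2
    have h8 : (2 : ℝ) ^ d ≤ 9 ^ d := pow_le_pow_left₀ (by norm_num) (by norm_num) d
    have h9 : ((3 : ℝ) ^ i * θ * (81 * 3 ^ d)) ^ 2 = (3 ^ i * θ) ^ 2 * (6561 * 9 ^ d) := by
      rw [mul_pow _ (81 * 3 ^ d), mul_pow 81, ← pow_mul, mul_comm d 2, pow_mul]; norm_num
    have h10 : (3 ^ i * θ) ^ 2 * (6561 * 2 ^ d) ≤ 1.58 ^ 2 := by
      rw [h9] at h7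
      refine le_trans (mul_le_mul_of_nonneg_left ?_ (sq_nonneg _)) h7
      linarith
    have h11 : (0 : ℝ) < 2 ^ d := by positivity
    rw [one_div_pow, mul_one_div, le_div_iff₀ h11]
    nlinarith

end Trig

/-! ### Estimation of the information efficiency -/

section Estimation
variable {μ₁ μ₂ ν₁ ν₂ ν : Type} [Fintype ν] [DecidableEq ν] {I : Interface μ₁ μ₂}

theorem Blk.scale_P₁ {T : Blk I Unit ν} (h : T.P₁ = zeroBra T.Q) (s : ℝ) :
    (T.scale s).P₁ = zeroBra (T.scale s).Q := by
  show extP _ T.P₁ = _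
  rw [h]; exact extP_zeroBra _

theorem Blk.amplify_P₁ {T : Blk I Unit ν} (h : T.P₁ = zeroBra T.Q) (r : ℕ) :
    (T.amplify r).P₁ = zeroBra (T.amplify r).Q := by
  show extP _ T.P₁ = _
  rw [h]; exact extP_zeroBra _

variable {U : Encoding Gate μ₁ μ₂}

theorem Blk.prob_eq (T : Blk U.toInterface Unit ν) : T.prob U = specNorm (T.block U) ^ 2 := by
  rw [sq_specNorm_col]; rfl

theorem Blk.prob_nonneg (T : Blk U.toInterface Unit ν) : 0 ≤ T.prob U := by
  rw [T.prob_eq]; exact sq_nonneg _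

theorem Blk.Valid.specNorm_block_le_one {T : Blk U.toInterface Unit ν} (h : T.Valid U)
    (hP : T.P₁ = zeroBra T.Q) : specNorm (T.block U) ≤ 1 := by
  have h1 := h.prob_le_one hP
  rw [T.prob_eq] at h1
  nlinarith [specNorm_nonneg (T.block U)]

theorem Blk.Valid.prob_amplify_arcsin {T : Blk U.toInterface Unit ν} (h : T.Valid U)
    (hP : T.P₁ = zeroBra T.Q) (r : ℕ) : (T.amplify r).prob U =
      Real.sin ((2 * r + 1) * Real.arcsin (specNorm (T.block U))) ^ 2 := by
  refine h.prob_amplify r ?_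
  rw [Real.sin_arcsin (by linarith [specNorm_nonneg (T.block U)]) (h.specNorm_block_le_one hP),
    T.prob_eq]

theorem Blk.specNorm_scale {T : Blk U.toInterface Unit ν} {s : ℝ} (h0 : 0 ≤ s) (h1 : s ≤ 1) :
    specNorm ((T.scale s).block U) = s * specNorm (T.block U) := by
  rw [T.scale_block (by linarith) h1, specNorm_smul, Complex.norm_real, Real.norm_of_nonneg h0]

theorem Blk.cost_flagged_le_size (T : Blk U.toInterface Unit ν) : cost U T.flagged ≤ T.size U := by
  rw [Blk.cost_flagged, Blk.size, Blk.gates_eq]; omega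

/-- The strategy that applies amplitude amplification `M` times and continues depending on whether
at least the fraction `t` of the measurements is positive. -/
noncomputable def thresholdTest (T : Blk I Unit ν) (t : ℝ) (M : ℕ)
    (k : Bool → Strategy I ν₁ ν₂) : Strategy I ν₁ ν₂ :=
  open Classical in flips T (fun n => k (decide (t * M ≤ n))) M 0

variable {good : Encoding Gate ν₁ ν₂ → ℕ → Prop}

/-- The rule for a test: each of its two outcomes has to be unlikely, or to lead to a strategy that
succeeds. -/
theorem SuccAfter.thresholdTest {T : Blk U.toInterface Unit ν} (hT : T.Valid U)
    (hP : T.P₁ = zeroBra T.Q) {k : Bool → Strategy U.toInterface ν₁ ν₂} {t g P : ℝ} {M c : ℕ}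
    (hg : 0 ≤ g) (hg1 : g ≤ 1) (hP1 : P ≤ 1)
    (htrue : T.prob U ≤ t - g ∨ SuccAfter U good (k true) (c + M * cost U T.flagged) P)
    (hfalse : t + g ≤ T.prob U ∨ SuccAfter U good (k false) (c + M * cost U T.flagged) P) :
    SuccAfter U good (thresholdTest T t M k) c (P - Real.exp (-(g ^ 2 / 4) * M)) := by
  classical
  have hexp := Real.exp_pos (-(g ^ 2 / 4) * M)
  rcases le_total P 0 with h0 | h0
  · exact SuccAfter.of_nonpos _ _ (by linarith)
  set A : Bool → Prop := fun b => SuccAfter U good (k b) (c + M * cost U T.flagged) P with hA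
  set F : ℕ → ℝ := fun n => if A (decide (t * M ≤ n)) then P else 0 with hF
  have h1 : SuccAfter U good (QEnc.thresholdTest T t M k) c (binomialExp (T.prob U) F M 0) := by
    refine SuccAfter.flips hT hP M fun n => ?_
    by_cases h : A (decide (t * M ≤ n))
    · have : F n = P := if_pos h
      rw [this]; convert h
    · have : F n = 0 := if_neg h
      rw [this]; exact SuccAfter.of_nonpos _ _ le_rfl
  have hF0 : ∀ n, 0 ≤ F n := fun n => by
    simp only [hF]; split_ifs
    · exact h0
    · exact le_rfl
  have hFt : A true → ∀ n : ℕ, t * M ≤ n → P ≤ F n := fun h n hn => by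
    have : F n = P := if_pos (by rwa [decide_eq_true hn])
    exact this.ge
  have hFf : A false → ∀ n : ℕ, (n : ℝ) < t * M → P ≤ F n := fun h n hn => by
    have : F n = P := if_pos (by rwa [decide_eq_false (not_le.2 hn)])
    exact this.ge
  refine h1.mono ?_
  have hp0 := T.prob_nonneg
  have hp1 := hT.prob_le_one hP
  rcases htrue with ht | ht
  · rcases hfalse with hf | hf
    · have : g = 0 := by linarith
      subst this
      simp only [ne_eq, OfNat.ofNat_ne_zero, not_false_eq_true, zero_pow, zero_div, neg_zero,
        zero_mul, Real.exp_zero]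
      have h3 := le_binomialExp hp0 hp1 (F := F) (P := 0) (a := 0) (z := 1)
        (fun n => by simpa using hF0 n) M 0
      linarith
    · exact binomialExp_upper hp0 hp1 hg hg1 ht hP1 hF0 (hFf hf)
  · rcases hfalse with hf | hf
    · exact binomialExp_lower hp0 hp1 hg hg1 hf hP1 hF0 (hFt ht)
    · have h3 := le_binomialExp hp0 hp1 (F := F) (P := P) (a := 0) (z := 1)
        (fun n => by
          rw [zero_mul, sub_zero]
          rcases lt_or_ge (n : ℝ) (t * M) with h | h
          · exact hFf hf n h
          · exact hFt ht n h) M 0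
      linarith

/-- The parameters `r`, `s`, `t` of the test in `exists_test`. -/
noncomputable def testParams (a w : ℝ) : ℕ × ℝ × ℝ := Classical.epsilon fun q =>
  0 ≤ q.2.1 ∧ q.2.1 ≤ 1 ∧ (2 * q.1 + 1 : ℝ) ≤ 3 / w ∧ ∀ η, a ≤ η → η ≤ a + w →
    (η ≤ a + w / 8 →
      Real.sin ((2 * q.1 + 1) * Real.arcsin (q.2.1 * η)) ^ 2 ≤ q.2.2 - testGap) ∧
    (a + 7 * w / 8 ≤ η →
      q.2.2 + testGap ≤ Real.sin ((2 * q.1 + 1) * Real.arcsin (q.2.1 * η)) ^ 2)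

theorem testParams_spec {a w : ℝ} (ha : 0 ≤ a) (hw : 0 < w) (haw : a + w ≤ 2) :
    0 ≤ (testParams a w).2.1 ∧ (testParams a w).2.1 ≤ 1 ∧
    (2 * (testParams a w).1 + 1 : ℝ) ≤ 3 / w ∧ ∀ η, a ≤ η → η ≤ a + w →
    (η ≤ a + w / 8 → Real.sin ((2 * (testParams a w).1 + 1) *
      Real.arcsin ((testParams a w).2.1 * η)) ^ 2 ≤ (testParams a w).2.2 - testGap) ∧
    (a + 7 * w / 8 ≤ η → (testParams a w).2.2 + testGap ≤ Real.sin ((2 * (testParams a w).1 + 1) *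
      Real.arcsin ((testParams a w).2.1 * η)) ^ 2) := by
  obtain ⟨r, s, t, h⟩ := exists_test ha hw haw
  exact Classical.epsilon_spec (p := fun q : ℕ × ℝ × ℝ =>
    0 ≤ q.2.1 ∧ q.2.1 ≤ 1 ∧ (2 * q.1 + 1 : ℝ) ≤ 3 / w ∧ ∀ η, a ≤ η → η ≤ a + w →
    (η ≤ a + w / 8 →
      Real.sin ((2 * q.1 + 1) * Real.arcsin (q.2.1 * η)) ^ 2 ≤ q.2.2 - testGap) ∧
    (a + 7 * w / 8 ≤ η →
      q.2.2 + testGap ≤ Real.sin ((2 * q.1 + 1) * Real.arcsin (q.2.1 * η)) ^ 2)) ⟨(r, s, t), h⟩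

/-- The strategy that shrinks the known interval `[a, a + w]` for the information efficiency of `T`
by `n` tests. Each of them cuts off an eighth of the interval. When `l` tests are left, the number
of measurements is `m * l`, so that the failure probabilities add up to a constant multiple of
that of the last test, while most of the gates are executed in the last tests. -/
noncomputable def ladder (T : Blk I Unit ν) (m : ℕ) (k : ℝ → ℝ → Strategy I ν₁ ν₂) :
    ℕ → ℝ → ℝ → Strategy I ν₁ ν₂
  | 0, a, w => k a w
  | n + 1, a, w => thresholdTest ((T.scale (testParams a w).2.1).amplify (testParams a w).1)
      (testParams a w).2.2 (m * (n + 1))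
      fun b => if b then ladder T m k n (a + w / 8) (7 * w / 8) else ladder T m k n a (7 * w / 8)

/-- The failure probability of a test that is repeated `m` times is at most `testError m`. -/
noncomputable def testError (m : ℕ) : ℝ := Real.exp (-(testGap ^ 2 / 4) * m)

/-- The sum `∑ l (7 / 8) ^ l` in the cost bound is kept in closed form for the induction. An error
of a test matters only if the unknown value is in the eighth of the interval that is cut off. -/
theorem SuccAfter.ladder_aux {T : Blk U.toInterface Unit ν} (hT : T.Valid U)
    (hP : T.P₁ = zeroBra T.Q) {k : ℝ → ℝ → Strategy U.toInterface ν₁ ν₂} {P : ℝ} {m : ℕ}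
    (hP1 : P ≤ 1) (n : ℕ) {a w : ℝ} {c : ℕ} (ha : 0 ≤ a) (hw : 0 < w) (haw : a + w ≤ 2)
    (h1 : a ≤ specNorm (T.block U)) (h2 : specNorm (T.block U) ≤ a + w)
    (hk : ∀ (a' v : ℝ) (c' : ℕ), v = w * (7 / 8) ^ n → a ≤ a' → a' + v ≤ a + w →
      a' ≤ specNorm (T.block U) → specNorm (T.block U) ≤ a' + v →
      (c' : ℝ) ≤ c + 546 * m * T.size U / v * (56 - (7 * n + 56) * (7 / 8) ^ n) →
      SuccAfter U good (k a' v) c' P) :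
    SuccAfter U good (ladder T m k n a w) c (P - ∑ l ∈ Finset.range n, testError m ^ (l + 1)) := by
  induction n generalizing a w c with
  | zero =>
    have := hk a w c (by simp) le_rfl le_rfl h1 h2 (by norm_num)
    simpa [QEnc.ladder] using this
  | succ n ih =>
    obtain ⟨hs0, hs1, hr, hspec⟩ := testParams_spec ha hw haw
    set r := (testParams a w).1
    set s := (testParams a w).2.1
    set t := (testParams a w).2.2
    set η := specNorm (T.block U) with hη
    have hX : ((T.scale s).amplify r).Valid U := (hT.scale s).amplify r
    have hXP := Blk.amplify_P₁ (Blk.scale_P₁ hP s) r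
    have hprob : ((T.scale s).amplify r).prob U =
        Real.sin ((2 * r + 1) * Real.arcsin (s * η)) ^ 2 := by
      rw [(hT.scale s).prob_amplify_arcsin (Blk.scale_P₁ hP s), Blk.specNorm_scale hs0 hs1]
    have hcost : (cost U ((T.scale s).amplify r).flagged : ℝ) ≤ 546 * T.size U / w := by
      have e1 := (Blk.cost_flagged_le_size ((T.scale s).amplify r)).trans
        ((hT.scale s).size_amplify_le r)
      have e2 := e1.trans (Nat.mul_le_mul_left (2 * r + 1)
        (Nat.mul_le_mul_left 14 (Blk.Valid.size_scale_le T s)))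
      have e3 : (cost U ((T.scale s).amplify r).flagged : ℝ) ≤
        (2 * r + 1) * (14 * (13 * T.size U)) := by exact_mod_cast e2
      refine e3.trans ((mul_le_mul_of_nonneg_right hr (by positivity)).trans (le_of_eq ?_))
      ring
    set C := c + m * (n + 1) * cost U ((T.scale s).amplify r).flagged with hC
    have hCle : (C : ℝ) ≤ c + 546 * m * T.size U / w * (n + 1) := by
      rw [hC]
      push_cast
      have := mul_le_mul_of_nonneg_left hcost (by positivity : (0 : ℝ) ≤ m * (n + 1))
      calc (c : ℝ) + m * (n + 1) * cost U ((T.scale s).amplify r).flagged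
          ≤ c + m * (n + 1) * (546 * T.size U / w) := by linarith
        _ = _ := by ring
    have hstep : ∀ {b : ℝ}, a ≤ b → b + 7 * w / 8 ≤ a + w → b ≤ η → η ≤ b + 7 * w / 8 →
        SuccAfter U good (QEnc.ladder T m k n b (7 * w / 8)) C
          (P - ∑ l ∈ Finset.range n, testError m ^ (l + 1)) := by
      intro b hb1 hb2 hb3 hb4
      refine ih (ha.trans hb1) (by linarith) (by linarith) hb3 hb4 fun a' v c' hv q1 q2 q3 q4 q5 => ?_
      refine hk a' v c' ?_ (hb1.trans q1) (q2.trans hb2) q3 q4 (q5.trans ?_)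
      · rw [hv]; ring
      · have hx : (0 : ℝ) < (7 / 8) ^ n := by positivity
        have hwv : 546 * m * (T.size U : ℝ) / w * (n + 1) =
            546 * m * T.size U / v * ((n + 1) * (7 / 8) ^ (n + 1)) := by
          rw [hv]; field_simp
          ring
        rw [hwv] at hCle
        have : (56 - (7 * ((n + 1 : ℕ) : ℝ) + 56) * (7 / 8) ^ (n + 1)) =
          (n + 1) * (7 / 8) ^ (n + 1) + (56 - (7 * n + 56) * (7 / 8 : ℝ) ^ n) := by
          push_cast; ring
        rw [this, mul_add]
        linarith
    have herr : Real.exp (-(testGap ^ 2 / 4) * ((m * (n + 1) : ℕ) : ℝ)) =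
        testError m ^ (n + 1) := by
      rw [testError, ← Real.exp_nat_mul]; push_cast; ring_nf
    have hsum : 0 ≤ ∑ l ∈ Finset.range n, testError m ^ (l + 1) :=
      Finset.sum_nonneg fun l _ => pow_nonneg (Real.exp_pos _).le _
    have key := SuccAfter.thresholdTest (good := good) (c := c) (M := m * (n + 1)) hX hXP
      (k := fun b => if b then QEnc.ladder T m k n (a + w / 8) (7 * w / 8) else
        QEnc.ladder T m k n a (7 * w / 8)) (t := t) (g := testGap)
      (P := P - ∑ l ∈ Finset.range n, testError m ^ (l + 1)) testGap_pos.le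
      (testGap_le.trans (by norm_num)) (by linarith) (by
        rcases le_total η (a + w / 8) with h | h
        · exact Or.inl (hprob.le.trans ((hspec η h1 h2).1 h))
        · exact Or.inr (hstep (by linarith) (by linarith) h (by linarith))) (by
        rcases le_total (a + 7 * w / 8) η with h | h
        · exact Or.inl (((hspec η h1 h2).2 h).trans hprob.ge)
        · exact Or.inr (hstep le_rfl (by linarith) h1 h))
    rw [herr] at key
    rw [Finset.sum_range_succ, ← sub_sub]
    exact key

theorem testError_pos (m : ℕ) : 0 < testError m := Real.exp_pos _

/-- The tests shrink the interval to the length `v = w (7 / 8) ^ n`. The cost is `O(1 / v)`, and the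
failure probability does not depend on `n`. -/
theorem SuccAfter.ladder {T : Blk U.toInterface Unit ν} (hT : T.Valid U)
    (hP : T.P₁ = zeroBra T.Q) {k : ℝ → ℝ → Strategy U.toInterface ν₁ ν₂} {P : ℝ} {m : ℕ}
    (hP1 : P ≤ 1) (hm : testError m ≤ 1 / 2) {n : ℕ} {a w : ℝ} {c : ℕ} (ha : 0 ≤ a) (hw : 0 < w)
    (haw : a + w ≤ 2) (h1 : a ≤ specNorm (T.block U)) (h2 : specNorm (T.block U) ≤ a + w)
    (hk : ∀ (a' v : ℝ) (c' : ℕ), v = w * (7 / 8) ^ n → a ≤ a' → a' + v ≤ a + w →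
      a' ≤ specNorm (T.block U) → specNorm (T.block U) ≤ a' + v →
      (c' : ℝ) ≤ c + 30576 * m * T.size U / v → SuccAfter U good (k a' v) c' P) :
    SuccAfter U good (ladder T m k n a w) c (P - 2 * testError m) := by
  refine (SuccAfter.ladder_aux hT hP hP1 n ha hw haw h1 h2
    fun a' v c' hv q1 q2 q3 q4 q5 => hk a' v c' hv q1 q2 q3 q4 (q5.trans ?_)).mono ?_
  · have hv0 : 0 < v := by rw [hv]; positivity
    have e1 : 56 - (7 * n + 56) * (7 / 8 : ℝ) ^ n ≤ 56 := by
      have : (0 : ℝ) ≤ (7 * n + 56) * (7 / 8 : ℝ) ^ n := by positivity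
      linarith
    have e2 := mul_le_mul_of_nonneg_left e1
      (by positivity : (0 : ℝ) ≤ 546 * m * T.size U / v)
    have e3 : 546 * m * (T.size U : ℝ) / v * 56 = 30576 * m * T.size U / v := by ring
    linarith
  · have hq := testError_pos m
    have : ∑ l ∈ Finset.range n, testError m ^ (l + 1) ≤ 2 * testError m - 2 * testError m * (1 / 2) ^ n := by
      clear hk
      induction n with
      | zero => simp
      | succ n ih =>
        rw [Finset.sum_range_succ]
        have h3 : testError m ^ n ≤ (1 / 2) ^ n := pow_le_pow_left₀ hq.le hm n
        have h4 : testError m ^ (n + 1) ≤ testError m * (1 / 2) ^ n := by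
          rw [pow_succ']; exact mul_le_mul_of_nonneg_left h3 hq.le
        have h5 : (1 / 2 : ℝ) ^ (n + 1) = (1 / 2) ^ n / 2 := by rw [pow_succ]; ring
        rw [h5]
        linarith
    have h6 : 0 ≤ 2 * testError m * (1 / 2 : ℝ) ^ n := by positivity
    linarith

end Estimation

/-! ### Search for the order of magnitude -/

section Coarse
variable {μ₁ μ₂ ν₁ ν₂ ν : Type} [Fintype ν] [DecidableEq ν] {I : Interface μ₁ μ₂}

/-- The test of the search: amplitude amplification that multiplies the angle by `3 ^ i`. -/
noncomputable def coarseTest (T : Blk I Unit ν) (m i : ℕ) (k : Bool → Strategy I ν₁ ν₂) :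
    Strategy I ν₁ ν₂ :=
  flips (T.amplify ((3 ^ i - 1) / 2)) (fun n => k (decide (m ≤ n))) (8 * m) 0

/-- The search with a bound for the number of tests. -/
noncomputable def boundedSearch (T : Blk I Unit ν) (m : ℕ) (k : ℕ → Strategy I ν₁ ν₂) :
    ℕ → ℕ → Strategy I ν₁ ν₂
  | 0, _ => fun _ => .run 0 []
  | F + 1, i => coarseTest T m i fun b => if b then k i else boundedSearch T m k F (i + 1)

/-- The strategy that increases `i` until the test is positive. The number of tests is not bounded,
but at every time it is at most the number of measurements. -/
noncomputable def search (T : Blk I Unit ν) (m : ℕ) (k : ℕ → Strategy I ν₁ ν₂) (i : ℕ) :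
    Strategy I ν₁ ν₂ := fun h => boundedSearch T m k (h.length + 1) i h

theorem flips_congr {T : Blk I Unit ν} {k k' : ℕ → Strategy I ν₁ ν₂} (M n : ℕ)
    (h : List (List Bool)) (hk : ∀ n' h', h'.length + M ≤ h.length → k n' h' = k' n' h') :
    flips T k M n h = flips T k' M n h := by
  induction M generalizing n h with
  | zero => exact hk n h le_rfl
  | succ M ih =>
    cases h with
    | nil => rfl
    | cons o h =>
      refine ih _ h fun n' h' hh => hk n' h' ?_
      rw [List.length_cons]; omega

/-- The bound for the number of tests is irrelevant if it exceeds the number of outcomes, because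
every test makes at least one measurement. -/
theorem boundedSearch_congr {T : Blk I Unit ν} {m : ℕ} (hm : 0 < m) {k : ℕ → Strategy I ν₁ ν₂}
    (F F' i : ℕ) (h : List (List Bool)) (hF : h.length < F) (hF' : h.length < F') :
    boundedSearch T m k F i h = boundedSearch T m k F' i h := by
  induction F generalizing F' i h with
  | zero => exact absurd hF (Nat.not_lt_zero _)
  | succ F ih =>
    cases F' with
    | zero => exact absurd hF' (Nat.not_lt_zero _)
    | succ F' =>
      refine flips_congr _ _ _ fun n' h' hh => ?_
      cases hd : decide (m ≤ n') with
      | true => rfl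
      | false => exact ih F' (i + 1) h' (by omega) (by omega)

theorem search_eq {T : Blk I Unit ν} {m : ℕ} (hm : 0 < m) (k : ℕ → Strategy I ν₁ ν₂) (i : ℕ) :
    search T m k i = coarseTest T m i fun b => if b then k i else search T m k (i + 1) := by
  funext h
  refine flips_congr _ _ _ fun n' h' hh => ?_
  cases hd : decide (m ≤ n') with
  | true => rfl
  | false => exact boundedSearch_congr hm _ _ (i + 1) h' (by omega) (by omega)

variable {U : Encoding Gate μ₁ μ₂} {good : Encoding Gate ν₁ ν₂ → ℕ → Prop}

theorem two_mul_half_pow_three (i : ℕ) : 2 * ((3 ^ i - 1) / 2) + 1 = 3 ^ i := by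
  obtain ⟨k, hk⟩ : Odd (3 ^ i) := Odd.pow (by decide)
  omega

/-- The rule for a test of the search, in terms of a binomial expectation. -/
theorem SuccAfter.coarseTest {T : Blk U.toInterface Unit ν} (hT : T.Valid U)
    (hP : T.P₁ = zeroBra T.Q) {k : Bool → Strategy U.toInterface ν₁ ν₂} {P : ℝ} (hP0 : 0 ≤ P)
    (i : ℕ) {m c : ℕ} {D : ℝ} (hD : ∀ F : ℕ → ℝ, (∀ n, 0 ≤ F n) →
      (∀ b, (∀ c' : ℕ, (c' : ℝ) ≤ c + 112 * m * T.size U * 3 ^ i → SuccAfter U good (k b) c' P) →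
        ∀ n : ℕ, decide (m ≤ n) = b → P ≤ F n) →
      D ≤ binomialExp (Real.sin (3 ^ i * Real.arcsin (specNorm (T.block U))) ^ 2) F (8 * m) 0) :
    SuccAfter U good (coarseTest T m i k) c D := by
  classical
  set r := (3 ^ i - 1) / 2 with hr
  have hr3 : 2 * r + 1 = 3 ^ i := two_mul_half_pow_three i
  have hr3' : 2 * (r : ℝ) + 1 = 3 ^ i := by exact_mod_cast hr3
  have hprob : (T.amplify r).prob U =
      Real.sin (3 ^ i * Real.arcsin (specNorm (T.block U))) ^ 2 := by
    rw [hT.prob_amplify_arcsin hP, hr3']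
  have hcost : (cost U (T.amplify r).flagged : ℝ) ≤ 14 * T.size U * 3 ^ i := by
    have e1 := (Blk.cost_flagged_le_size (T.amplify r)).trans (hT.size_amplify_le r)
    rw [hr3] at e1
    have e2 : (cost U (T.amplify r).flagged : ℝ) ≤ 3 ^ i * (14 * T.size U) := by exact_mod_cast e1
    linarith
  set C := c + 8 * m * cost U (T.amplify r).flagged with hC
  have hCle : (C : ℝ) ≤ c + 112 * m * T.size U * 3 ^ i := by
    rw [hC]
    push_cast
    have := mul_le_mul_of_nonneg_left hcost (by positivity : (0 : ℝ) ≤ 8 * m)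
    linarith
  set F : ℕ → ℝ := fun n => if SuccAfter U good (k (decide (m ≤ n))) C P then P else 0 with hF
  have h1 : SuccAfter U good (QEnc.coarseTest T m i k) c
      (binomialExp ((T.amplify r).prob U) F (8 * m) 0) := by
    refine SuccAfter.flips (hT.amplify r) (Blk.amplify_P₁ hP r) (8 * m) fun n => ?_
    by_cases h : SuccAfter U good (k (decide (m ≤ n))) C P
    · have : F n = P := if_pos h
      rw [this]; exact h
    · have : F n = 0 := if_neg h
      rw [this]; exact SuccAfter.of_nonpos _ _ le_rfl
  refine h1.mono ?_
  rw [hprob]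
  refine hD F (fun n => ?_) fun b hb n hn => ?_
  · simp only [hF]; split_ifs
    · exact hP0
    · exact le_rfl
  · have : F n = P := if_pos (by rw [hn]; exact hb C hCle)
    exact this.ge

theorem testError_ge_half_pow (m : ℕ) : (1 / 2 : ℝ) ^ m ≤ testError m ∧
    Real.exp (-((1 / 8 : ℝ) ^ 2 / 4) * (8 * m : ℕ)) ≤ testError m := by
  have h0 := testGap_pos
  have h1 := testGap_le
  have h2 : testGap ^ 2 ≤ (1 / 8) ^ 2 := pow_le_pow_left₀ h0.le h1 2
  have hm : (0 : ℝ) ≤ m := Nat.cast_nonneg m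
  constructor
  · have h3 : (1 / 2 : ℝ) ≤ Real.exp (-(1 / 2)) := by
      have := Real.add_one_le_exp (-(1 / 2 : ℝ)); linarith
    refine (pow_le_pow_left₀ (by norm_num) h3 m).trans ?_
    rw [← Real.exp_nat_mul, testError]
    exact Real.exp_le_exp.2 (by nlinarith)
  · rw [testError]
    push_cast
    exact Real.exp_le_exp.2 (by nlinarith)

/-- The search finds the order of magnitude of the information efficiency. Its cost is a geometric
sum dominated by the last test. -/
theorem SuccAfter.search {T : Blk U.toInterface Unit ν} (hT : T.Valid U)
    (hP : T.P₁ = zeroBra T.Q) {k : ℕ → Strategy U.toInterface ν₁ ν₂} {P : ℝ} (hP1 : P ≤ 1)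
    {m c : ℕ} (hm : 0 < m) (hη : 0 < specNorm (T.block U))
    (hk : ∀ i (c' : ℕ), specNorm (T.block U) ≤ 2 * (3 ^ i)⁻¹ →
      (3 ^ (i + 4))⁻¹ ≤ specNorm (T.block U) →
      (c' : ℝ) ≤ c + 336 * m * T.size U / specNorm (T.block U) → SuccAfter U good (k i) c' P) :
    SuccAfter U good (search T m k 0) c (P - 3 * testError m) := by
  have hq := testError_pos m
  rcases le_total P 0 with h0 | h0
  · exact SuccAfter.of_nonpos _ _ (by linarith)
  set η := specNorm (T.block U) with hηdef
  obtain ⟨i₀, hi1, hi2, hi3, hi4, hi5⟩ := exists_coarse hη (hT.specNorm_block_le_one hP)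
  have hsin : ∀ x : ℝ, 0 ≤ Real.sin x ^ 2 ∧ Real.sin x ^ 2 ≤ 1 := fun x =>
    ⟨sq_nonneg _, Real.sin_sq_le_one x⟩
  -- Premature positive tests are harmless for `d ≤ 3`. For larger `d` their probabilities form a
  -- geometric series, which is summed by the term with the power of `1 / 2`.
  have main : ∀ d i, i + d = i₀ → ∀ c' : ℕ,
      (c' : ℝ) ≤ c + 112 * m * T.size U * ((3 ^ i - 1) / 2) →
      SuccAfter U good (QEnc.search T m k i) c'
        (P - testError m * (3 - 2 * (1 / 2) ^ (d - 3))) := by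
    intro d
    induction d with
    | zero =>
      intro i hi c' hc
      rw [add_zero] at hi
      rw [search_eq hm]
      refine SuccAfter.coarseTest hT hP h0 i fun F hF0 hF => ?_
      have h1 := hF true fun c'' hc'' => hk i c'' (hi2 i hi.le) (hi3 i (by omega)) ?_
      · have h2 := binomialExp_lower (F := F) (P := P) (t := 1 / 8) (g := 1 / 8) (M := 8 * m)
          (hsin (3 ^ i * Real.arcsin η)).1 (hsin _).2 (by norm_num) (by norm_num)
          (by rw [hi]; linarith) hP1 hF0 fun n hn => h1 n (by
            rw [decide_eq_true_eq]
            push_cast at hn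
            exact_mod_cast (by linarith : (m : ℝ) ≤ n))
        have h3 := (testError_ge_half_pow m).2
        refine le_trans ?_ h2
        norm_num at h3 ⊢
        linarith
      · have h2 : 112 * (m : ℝ) * T.size U * 3 ^ i₀ ≤ 112 * m * T.size U * (2 / η) :=
          mul_le_mul_of_nonneg_left hi1 (by positivity)
        have h3 : 112 * (m : ℝ) * T.size U * (2 / η) * (3 / 2) = 336 * m * T.size U / η := by ring
        have h4 : (0 : ℝ) ≤ 112 * m * T.size U := by positivity
        rw [hi] at hc hc''
        linarith
    | succ d ih =>
      intro i hi c' hc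
      set P' := P - testError m * (3 - 2 * (1 / 2) ^ (d - 3)) with hP'
      have hx0 : (0 : ℝ) < (1 / 2) ^ (d - 3) := by positivity
      have hx1 : (1 / 2 : ℝ) ^ (d - 3) ≤ 1 := pow_le_one₀ (by norm_num) (by norm_num)
      have hP'1 : P' ≤ P := by
        have : 0 ≤ testError m * (3 - 2 * (1 / 2) ^ (d - 3)) := mul_nonneg hq.le (by linarith)
        linarith
      rcases le_total P' 0 with hP'0 | hP'0
      · refine SuccAfter.of_nonpos _ _ (le_trans ?_ hP'0)
        have : (1 / 2 : ℝ) ^ (d + 1 - 3) ≤ (1 / 2) ^ (d - 3) :=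
          pow_le_pow_of_le_one (by norm_num) (by norm_num) (by omega)
        have := mul_le_mul_of_nonneg_left this hq.le
        rw [hP']
        linarith
      rw [search_eq hm]
      have h4 : (0 : ℝ) ≤ 112 * m * T.size U := by positivity
      refine SuccAfter.coarseTest hT hP hP'0 i fun F hF0 hF => ?_
      have hfalse := hF false fun c'' hc'' => by
        have := ih (i + 1) (by omega) c'' (hc''.trans (by rw [pow_succ]; linarith))
        simpa using this
      by_cases hd : d < 3
      · have htrue := hF true fun c'' hc'' => by
          refine (SuccAfter.mono ?_ hP'1 : SuccAfter U good (k i) c'' P')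
          refine hk i c'' (hi2 i (by omega)) (hi3 i (by omega)) (hc''.trans ?_)
          have h2 : 112 * (m : ℝ) * T.size U * 3 ^ i ≤ 112 * m * T.size U * (2 / η) :=
            mul_le_mul_of_nonneg_left
              ((pow_le_pow_right₀ (by norm_num) (by omega)).trans hi1) h4
          have h3 : 112 * (m : ℝ) * T.size U * (2 / η) * (3 / 2) = 336 * m * T.size U / η := by
            ring
          linarith
        have h2 := le_binomialExp (hsin (3 ^ i * Real.arcsin η)).1 (hsin _).2 (F := F) (P := P')
          (a := 0) (z := 1) (fun n => by
            rw [zero_mul, sub_zero]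
            cases hn : decide (m ≤ n) with
            | true => exact htrue n hn
            | false => exact hfalse n hn) (8 * m) 0
        rw [zero_mul, zero_mul, sub_zero] at h2
        refine le_trans (le_of_eq ?_) h2
        rw [hP', show d + 1 - 3 = 0 by omega, show d - 3 = 0 by omega]
      · obtain ⟨e, rfl⟩ : ∃ e, d = e + 3 := ⟨d - 3, by omega⟩
        have h2 := binomialExp_eighth (F := F) (P := P') (m := m)
          (hsin (3 ^ i * Real.arcsin η)).1 (x := 1 / 512 * (1 / 2) ^ e) (by positivity)
          (hi5 i e (by omega)) (by
            have : (1 / 2 : ℝ) ^ e ≤ 1 := pow_le_one₀ (by norm_num) (by norm_num)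
            linarith) (hP'1.trans hP1) hF0 fun n hn => hfalse n (by simpa using hn)
        refine le_trans ?_ h2
        have h3 : (256 * (1 / 512 * (1 / 2 : ℝ) ^ e)) ^ m ≤ testError m * (1 / 2) ^ e := by
          rw [show 256 * (1 / 512 * (1 / 2 : ℝ) ^ e) = 1 / 2 * (1 / 2) ^ e by ring, mul_pow]
          refine mul_le_mul (testError_ge_half_pow m).1 ?_ (by positivity) hq.le
          exact pow_le_of_le_one (by positivity) (pow_le_one₀ (by norm_num) (by norm_num)) hm.ne'
        have h5 : (1 / 2 : ℝ) ^ (e + 3 + 1 - 3) = (1 / 2) ^ e * (1 / 2) := by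
          rw [show e + 3 + 1 - 3 = e + 1 by omega, pow_succ]
        rw [h5, hP', show e + 3 - 3 = e by omega]
        linarith
  refine (main i₀ 0 (by omega) c (by simp)).mono ?_
  have : (0 : ℝ) ≤ testError m * (2 * (1 / 2) ^ (i₀ - 3)) := by positivity
  linarith

end Coarse

/-! ### Amplification to an information efficiency close to one -/

section Peak
variable {μ₁ μ₂ ν : Type} [Fintype ν] [DecidableEq ν] {I : Interface μ₁ μ₂}

/-- Amplitude amplification, after a scaling such that an information efficiency `η` is mapped to
one by `r` iterations. -/
noncomputable def Blk.peak (T : Blk I Unit ν) (η : ℝ) (r : ℕ) : Blk I Unit ν :=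
  (T.scale (Real.sin (Real.pi / (2 * (2 * r + 1))) / η)).amplify r

/-- The place of the qubits of `T`. -/
def Blk.peakEmb (T : Blk I Unit ν) (η : ℝ) (r : ℕ) : T.Q ↪ (T.peak η r).Q :=
  (inlE T.Q Unit).trans (inlE (T.Q ⊕ Unit) (Unit ⊕
    ((T.scale (Real.sin (Real.pi / (2 * (2 * r + 1))) / η)).B₁ ⊕
      (T.scale (Real.sin (Real.pi / (2 * (2 * r + 1))) / η)).B₂)))

theorem Blk.peak_P₁ {T : Blk I Unit ν} (h : T.P₁ = zeroBra T.Q) (η : ℝ) (r : ℕ) :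
    (T.peak η r).P₁ = zeroBra (T.peak η r).Q := Blk.amplify_P₁ (Blk.scale_P₁ h _) r

theorem Blk.peak_P₂ (T : Blk I Unit ν) (η : ℝ) (r : ℕ) :
    (T.peak η r).P₂ = extP (T.peakEmb η r) T.P₂ :=
  extP_extP (inlE T.Q Unit) (inlE (T.Q ⊕ Unit) (Unit ⊕
    ((T.scale (Real.sin (Real.pi / (2 * (2 * r + 1))) / η)).B₁ ⊕
      (T.scale (Real.sin (Real.pi / (2 * (2 * r + 1))) / η)).B₂))) T.P₂

variable {U : Encoding Gate μ₁ μ₂} {T : Blk U.toInterface Unit ν}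

theorem Blk.Valid.peak (h : T.Valid U) (η : ℝ) (r : ℕ) : (T.peak η r).Valid U :=
  (h.scale _).amplify r

theorem Blk.Valid.size_peak_le (h : T.Valid U) (η : ℝ) (r : ℕ) :
    (T.peak η r).size U ≤ (2 * r + 1) * (182 * T.size U) := by
  refine ((h.scale _).size_amplify_le r).trans (Nat.mul_le_mul_left _ ?_)
  have := Blk.Valid.size_scale_le T (Real.sin (Real.pi / (2 * (2 * r + 1))) / η)
  omega

theorem Blk.le_gates_peak (T : Blk U.toInterface Unit ν) (η : ℝ) (r : ℕ) :
    r * T.gates U ≤ (T.peak η r).gates U := by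
  have h1 := (T.scale (Real.sin (Real.pi / (2 * (2 * r + 1))) / η)).cost_amplify_circ r
  have h2 := T.cost_scale_circ (Real.sin (Real.pi / (2 * (2 * r + 1))) / η)
  have h3 := T.cost_scale_proj₁ (Real.sin (Real.pi / (2 * (2 * r + 1))) / η)
  have h4 := T.cost_scale_proj₂ (Real.sin (Real.pi / (2 * (2 * r + 1))) / η)
  have h5 : cost U (T.peak η r).circ ≤ (T.peak η r).gates U := by rw [Blk.gates_eq]; omega
  refine le_trans ?_ h5
  rw [Blk.peak, h1, h2, h3, h4, Blk.gates_eq]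
  refine le_trans (Nat.mul_le_mul_left r ?_) (Nat.le_add_left _ _)
  omega

theorem Blk.Valid.amplify_block_arcsin (h : T.Valid U) (hP : T.P₁ = zeroBra T.Q) (r : ℕ)
    (h0 : specNorm (T.block U) ≠ 0) : (T.amplify r).block U =
      ((Real.sin ((2 * r + 1) * Real.arcsin (specNorm (T.block U))) / specNorm (T.block U) : ℝ) : ℂ)
        • T.block U := by
  have hs : Real.sin (Real.arcsin (specNorm (T.block U))) = specNorm (T.block U) :=
    Real.sin_arcsin (by linarith [specNorm_nonneg (T.block U)]) (h.specNorm_block_le_one hP)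
  have h1 := (groverCoeff_mul_sin (Real.arcsin (specNorm (T.block U))) r).1
  rw [hs] at h1
  rw [h.amplify_block, T.prob_eq, ← h1, mul_div_cancel_right₀ _ h0]

/-- If the information efficiency is known up to a relative error `t`, it can be amplified to at
least `1 - 2 t`. The encoded vector keeps its direction. -/
theorem Blk.Valid.exists_peak_block (h : T.Valid U) (hP : T.P₁ = zeroBra T.Q) {η t : ℝ} {r : ℕ}
    (hr : 1 ≤ r) (hη : 0 < η) (h0 : 0 < specNorm (T.block U))
    (hs : Real.sin (Real.pi / (2 * (2 * r + 1))) ≤ η)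
    (hu : |specNorm (T.block U) / η - 1| ≤ t) (ht : t ≤ 1 / 4) :
    ∃ β : ℝ, 1 - 2 * t ≤ β ∧ β ≤ 1 ∧
      (T.peak η r).block U = ((β / specNorm (T.block U) : ℝ) : ℂ) • T.block U := by
  have hr' : (1 : ℝ) ≤ r := by exact_mod_cast hr
  have hx : 0 < Real.sin (Real.pi / (2 * (2 * r + 1))) := by
    refine Real.sin_pos_of_pos_of_lt_pi (by positivity) ?_
    exact div_lt_self Real.pi_pos (by linarith)
  set s := Real.sin (Real.pi / (2 * (2 * r + 1))) / η with hsdef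
  have hs0 : 0 < s := div_pos hx hη
  have hs1 : s ≤ 1 := (div_le_one hη).2 hs
  have hn := Blk.specNorm_scale (T := T) hs0.le hs1
  have h1 := (h.scale s).amplify_block_arcsin (Blk.scale_P₁ hP s) r (by rw [hn]; positivity)
  have hsu : s * specNorm (T.block U) =
      specNorm (T.block U) / η * Real.sin (Real.pi / (2 * (2 * r + 1))) := by
    rw [hsdef]; ring
  refine ⟨Real.sin ((2 * r + 1) * Real.arcsin (s * specNorm (T.block U))), ?_, Real.sin_le_one _,
    ?_⟩
  · rw [hsu]
    exact le_sin_mul_arcsin (by linarith) hu ht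
  · refine h1.trans ?_
    rw [hn, T.scale_block (by linarith) hs1, smul_smul, ← Complex.ofReal_mul]
    congr 2
    field_simp

end Peak

/-! ### The encoded polynomial -/

section PolyBlk
variable {μ₁ μ₂ : Type} {U : Encoding Gate μ₁ μ₂} {N n : ℕ}
  {E : Matrix (Fin N) (Fin n → Bool) ℂ} {X : Blk U.toInterface Unit (Fin N)} {d : Fin n ↪ X.Q}
  {A : (k : ℕ) → Matrix (Fin N) (Fin k → Fin N) ℂ} {κ : ℕ}
  {V : (k : ℕ) → Encoding Gate (Fin k → Fin N) (Fin N)}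
  {pos : ∀ k : Fin (κ + 1), Fin k × Fin n ↪ Fin (V k).m}
  {o : ∀ k : Fin (κ + 1), Fin n ↪ Fin (V k).m}

/-- The weights for the encoding of a polynomial, when the vector has the normalization `γ`. -/
noncomputable def polyWeight (V : (k : ℕ) → Encoding Gate (Fin k → Fin N) (Fin N)) (γ : ℝ) (k : ℕ) :
    ℝ := |(V k).γ * γ ^ k|

/-- The normalization of the encoding of a polynomial. -/
noncomputable def polyScale (V : (k : ℕ) → Encoding Gate (Fin k → Fin N) (Fin N)) (κ : ℕ) (γ : ℝ) :
    ℝ := ∑ k ∈ Finset.range (κ + 1), polyWeight V γ k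

/-- The encoding of a polynomial of the vector that is `γ` times the vector encoded by `X`. -/
noncomputable def valueBlk {I : Interface μ₁ μ₂} (X : Blk I Unit (Fin N)) (d : Fin n ↪ X.Q) (κ : ℕ)
    (V : (k : ℕ) → Encoding Gate (Fin k → Fin N) (Fin N))
    (pos : ∀ k : Fin (κ + 1), Fin k × Fin n ↪ Fin (V k).m)
    (o : ∀ k : Fin (κ + 1), Fin n ↪ Fin (V k).m) (γ : ℝ) : Blk I Unit (Fin N) :=
  polyBlk X d κ V pos o (weightProb (polyWeight V γ) κ)

theorem polyWeight_nonneg (γ : ℝ) (k : ℕ) : 0 ≤ polyWeight V γ k := abs_nonneg _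

theorem polyScale_nonneg (γ : ℝ) : 0 ≤ polyScale V κ γ :=
  Finset.sum_nonneg fun k _ => polyWeight_nonneg γ k

theorem polyWeight_eq (hV : ∀ k ≤ κ, EncodesCoefficient E (V k) (A k)) {γ : ℝ} (hγ : 0 ≤ γ) {k : ℕ}
    (hk : k ∈ Finset.range (κ + 1)) : polyWeight V γ k = (V k).γ * γ ^ k :=
  abs_of_nonneg (mul_nonneg (hV k (by have := Finset.mem_range.1 hk; omega)).1.gamma_nonneg
    (pow_nonneg hγ _))

theorem polyScale_smul_valueBlk_block (hX : X.Valid U) (h₁ : X.P₁ = zeroBra X.Q)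
    (h₂ : X.P₂ = extP d E) (hV : ∀ k ≤ κ, EncodesCoefficient E (V k) (A k))
    (hpos : ∀ k : Fin (κ + 1), (V k).P₁ = tensorProj E k (pos k))
    (ho : ∀ k : Fin (κ + 1), (V k).P₂ = dataProj E (o k)) {γ : ℝ} (hγ : 0 ≤ γ)
    {x : EuclideanSpace ℂ (Fin N)} (hx : column x = (γ : ℂ) • X.block U) :
    (polyScale V κ γ : ℂ) • (valueBlk X d κ V pos o γ).block U = column (polyEval A κ x) := by
  rw [valueBlk, polyBlk_block hX h₁ h₂ κ V pos o hpos ho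
    (weightProb_nonneg (polyWeight_nonneg γ) κ) (sum_weightProb (polyWeight_nonneg γ) κ),
    column_polyEval, Finset.smul_sum]
  refine Finset.sum_congr rfl fun k hk => ?_
  have h1 := sum_mul_weightProb (polyWeight_nonneg (V := V) γ) κ hk
  rw [polyWeight_eq hV hγ hk] at h1
  rw [smul_smul, ← Complex.ofReal_mul, polyScale, h1,
    (hV k (by have := Finset.mem_range.1 hk; omega)).1.eq_smul,
    hx, tensorCol_smul, Matrix.smul_mul, Matrix.mul_smul, smul_smul]
  push_cast
  rfl

theorem valueBlk_valid (hX : X.Valid U) (γ : ℝ) : (valueBlk X d κ V pos o γ).Valid U :=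
  polyBlk_valid hX κ V pos o _

theorem valueBlk_P₁ (h₁ : X.P₁ = zeroBra X.Q) (γ : ℝ) :
    (valueBlk X d κ V pos o γ).P₁ = zeroBra (valueBlk X d κ V pos o γ).Q := by
  show extP _ X.P₁ = _
  rw [h₁]
  exact extP_zeroBra _

theorem valueBlk_P₂ (h₂ : X.P₂ = extP d E) (γ : ℝ) :
    ∃ d', (valueBlk X d κ V pos o γ).P₂ = extP d' E := by
  refine ⟨d.trans (combOf X d (Function.Embedding.refl Empty) κ (fun k => (V k).circ)
    (fun k => polyArgs (pos k)) o (weightProb (polyWeight V γ) κ)).outQ, ?_⟩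
  show extP _ X.P₂ = _
  rw [h₂]
  exact extP_extP d _ E

theorem gates_le_gates_valueBlk (hκ : 1 ≤ κ) (γ : ℝ) :
    X.gates U ≤ (valueBlk X d κ V pos o γ).gates U := by
  have h1 : cost U X.purified ≤ cost U (valueBlk X d κ V pos o γ).circ :=
    (combOf X d (Function.Embedding.refl Empty) κ (fun k => (V k).circ)
      (fun k => polyArgs (pos k)) o (weightProb (polyWeight V γ) κ)).le_cost_circ hκ
  have h2 : cost U X.proj₁ ≤ cost U (valueBlk X d κ V pos o γ).proj₁ := by
    have h3 : cost U (valueBlk X d κ V pos o γ).proj₁ = 2 * cost U X.proj₁ + 3 * (outside (combOf X d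
      (Function.Embedding.refl Empty) κ (fun k => (V k).circ)
      (fun k => polyArgs (pos k)) o (weightProb (polyWeight V γ) κ)).outQ).card + 2 :=
      cost_extProj _ _
    omega
  rw [Blk.cost_purified] at h1
  rw [Blk.gates_eq, Blk.gates_eq]
  omega

theorem size_valueBlk_le [NeZero N] (hX : X.Valid U) {t : ℕ}
    (hV : ∀ k ≤ κ, EncodesCoefficient E (V k) (A k)) (ht : ∀ k ≤ κ, (V k).gates ≤ t)
    (hpos : ∀ k : Fin (κ + 1), (V k).P₁ = tensorProj E k (pos k)) (γ : ℝ) :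
    (valueBlk X d κ V pos o γ).size U ≤ (κ + 1) * (100 * X.size U + 100 * t) :=
  polyBlk_size_le hX κ V pos o _ (fun k => ht k (by omega)) fun k =>
    ((hV k (by omega)).outside_le (hpos k)).trans (ht k (by omega))

theorem norm_polyEval (hX : X.Valid U) (h₁ : X.P₁ = zeroBra X.Q)
    (h₂ : X.P₂ = extP d E) (hV : ∀ k ≤ κ, EncodesCoefficient E (V k) (A k))
    (hpos : ∀ k : Fin (κ + 1), (V k).P₁ = tensorProj E k (pos k))
    (ho : ∀ k : Fin (κ + 1), (V k).P₂ = dataProj E (o k)) {γ : ℝ} (hγ : 0 ≤ γ)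
    {x : EuclideanSpace ℂ (Fin N)} (hx : column x = (γ : ℂ) • X.block U) :
    ‖polyEval A κ x‖ = polyScale V κ γ * specNorm ((valueBlk X d κ V pos o γ).block U) := by
  rw [← specNorm_column, ← polyScale_smul_valueBlk_block hX h₁ h₂ hV hpos ho hγ hx, specNorm_smul,
    Complex.norm_real, Real.norm_of_nonneg (polyScale_nonneg γ)]

/-- The polynomial at a multiple of `x`. -/
theorem norm_polyEval_smul_sub_le (A : (k : ℕ) → Matrix (Fin N) (Fin k → Fin N) ℂ) {κ : ℕ}
    (x : EuclideanSpace ℂ (Fin N)) {ρ σ : ℝ} (hρ : |ρ - 1| ≤ σ) (hσ : κ * σ ≤ 1) (hσ1 : σ ≤ 1) :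
    ‖polyEval A κ ((ρ : ℂ) • x) - polyEval A κ x‖ ≤
      2 * κ * σ * ∑ k ∈ Finset.range (κ + 1), specNorm (A k) * ‖x‖ ^ k := by
  have hcol : ∀ y z : EuclideanSpace ℂ (Fin N), column (y - z) = column y - column z :=
    fun _ _ => rfl
  have hcs : column ((ρ : ℂ) • x) = (ρ : ℂ) • column x := rfl
  have hσ0 : 0 ≤ σ := (abs_nonneg _).trans hρ
  obtain ⟨hρ1, hρ2⟩ := abs_le.1 hρ
  have hpow : ∀ k ≤ κ, |ρ ^ k - 1| ≤ 2 * κ * σ := by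
    intro k hk
    have hk' : (k : ℝ) ≤ κ := by exact_mod_cast hk
    have hkσ : (k : ℝ) * σ ≤ κ * σ := mul_le_mul_of_nonneg_right hk' hσ0
    have hkσ0 : 0 ≤ (k : ℝ) * σ := by positivity
    rw [abs_le]
    constructor
    · have h1 := one_add_mul_le_pow (a := -σ) (by linarith) k
      have h2 : (1 + -σ) ^ k ≤ ρ ^ k := pow_le_pow_left₀ (by linarith) (by linarith) k
      linarith
    · have h1 : ρ ^ k ≤ (1 + σ) ^ k := pow_le_pow_left₀ (by linarith) (by linarith) k
      have h2 : (1 + σ) ^ k ≤ Real.exp (k * σ) := by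
        rw [Real.exp_nat_mul]
        exact pow_le_pow_left₀ (by linarith) (by linarith [Real.add_one_le_exp σ]) k
      have h3 := (abs_le.1 (Real.abs_exp_sub_one_sub_id_le (x := k * σ)
        (by rw [abs_of_nonneg hkσ0]; linarith))).2
      nlinarith
  rw [← specNorm_column, hcol, column_polyEval, column_polyEval, ← Finset.sum_sub_distrib,
    Finset.mul_sum]
  refine (specNorm_sum_le _ _).trans (Finset.sum_le_sum fun k hk => ?_)
  have hk' : k ≤ κ := by have := Finset.mem_range.1 hk; omega
  have h1 : A k * tensorCol k (column ((ρ : ℂ) • x)) - A k * tensorCol k (column x) =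
      ((ρ ^ k - 1 : ℝ) : ℂ) • (A k * tensorCol k (column x)) := by
    rw [hcs, tensorCol_smul, Matrix.mul_smul]
    push_cast
    rw [sub_smul, one_smul]
  rw [h1, specNorm_smul, Complex.norm_real, Real.norm_eq_abs]
  refine mul_le_mul (hpow k hk') ?_ (specNorm_nonneg _)
    (mul_nonneg (mul_nonneg zero_le_two (Nat.cast_nonneg κ)) hσ0)
  refine (specNorm_mul_le _ _).trans ?_
  rw [specNorm_tensorCol, specNorm_column]

end PolyBlk

/-! ### The returned encoding of a polynomial -/

section Output
variable {N n : ℕ} {E : Matrix (Fin N) (Fin n → Bool) ℂ}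
  {A : (k : ℕ) → Matrix (Fin N) (Fin k → Fin N) ℂ} {κ : ℕ}
  {V : (k : ℕ) → Encoding Gate (Fin k → Fin N) (Fin N)}

/-- The input after amplification, when `η` is an estimate of its information efficiency. -/
noncomputable def amplifiedInput (I : Interface Unit (Fin N)) (η : ℝ) : Blk I Unit (Fin N) :=
  (ofInput I).peak η 3

/-- The encoding of the value of the polynomial, without amplification, when `η` is an estimate
of the information efficiency of the input. -/
noncomputable def amplifiedValue (I : Interface Unit (Fin N)) (d : Fin n ↪ (ofInput I).Q) (κ : ℕ)
    (V : (k : ℕ) → Encoding Gate (Fin k → Fin N) (Fin N))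
    (pos : ∀ k : Fin (κ + 1), Fin k × Fin n ↪ Fin (V k).m)
    (o : ∀ k : Fin (κ + 1), Fin n ↪ Fin (V k).m) (η : ℝ) : Blk I Unit (Fin N) :=
  valueBlk (amplifiedInput I η) (d.trans ((ofInput I).peakEmb η 3)) κ V pos o (I.γ * η)

/-- The returned encoding, when `f` is an estimate of the norm of the value of the polynomial and
`η` is an estimate of the information efficiency of the input. -/
noncomputable def outputBlk (I : Interface Unit (Fin N)) (d : Fin n ↪ (ofInput I).Q) (κ : ℕ)
    (V : (k : ℕ) → Encoding Gate (Fin k → Fin N) (Fin N))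
    (pos : ∀ k : Fin (κ + 1), Fin k × Fin n ↪ Fin (V k).m)
    (o : ∀ k : Fin (κ + 1), Fin n ↪ Fin (V k).m) (f η : ℝ) : Blk I Unit (Fin N) :=
  (amplifiedValue I d κ V pos o η).peak (f / polyScale V κ (I.γ * η))
    ⌈polyScale V κ (I.γ * η) / f⌉₊

variable {U : Encoding Gate Unit (Fin N)} {d : Fin n ↪ (ofInput U.toInterface).Q}
  {pos : ∀ k : Fin (κ + 1), Fin k × Fin n ↪ Fin (V k).m}
  {o : ∀ k : Fin (κ + 1), Fin n ↪ Fin (V k).m} {x : EuclideanSpace ℂ (Fin N)}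

/-- The number of iterations is large enough for the rescaling to have a factor of at most one. -/
theorem sin_div_le_of_ceil {y : ℝ} (hy : 0 < y) :
    Real.sin (Real.pi / (2 * (2 * (⌈1 / y⌉₊ : ℝ) + 1))) ≤ y := by
  have h1 : 1 / y ≤ (⌈1 / y⌉₊ : ℝ) := Nat.le_ceil _
  have h2 : 1 ≤ ⌈1 / y⌉₊ * y := by rwa [div_le_iff₀ hy] at h1
  refine (Real.sin_le (by positivity)).trans ?_
  rw [div_le_iff₀ (by positivity)]
  nlinarith [Real.pi_lt_d2]

/-- The estimates of the norm of the value and of the information efficiency of the input are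
sufficiently accurate for the relative tolerance `8 * τ`. -/
structure GoodEstimates (A : (k : ℕ) → Matrix (Fin N) (Fin k → Fin N) ℂ) (κ : ℕ)
    (V : (k : ℕ) → Encoding Gate (Fin k → Fin N) (Fin N)) (U : Encoding Gate Unit (Fin N))
    (x : EuclideanSpace ℂ (Fin N)) (τ f η ε₁ : ℝ) : Prop where
  le_f : ‖polyEval A κ x‖ ≤ f
  f_le : f ≤ (1 + τ) * ‖polyEval A κ x‖
  le_η : U.eff ≤ η
  η_le : η ≤ U.eff + ε₁
  ε_nonneg : 0 ≤ ε₁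
  ε_le : ε₁ ≤ 1 / 16
  mul_ε_le : 8 * κ * ε₁ ≤ 1
  scale_ε_le : 32 * κ * ε₁ * polyScale V κ U.γ ≤ τ * f

/-- Amplification of the encoding of a perturbed vector, when the norm of the vector is known up to
the relative error `τ`. -/
theorem Blk.Valid.encodesVector_peak {ν₀ ν₁ : Type} {U : Encoding Gate ν₀ ν₁}
    {Y : Blk U.toInterface Unit (Fin N)} (hYv : Y.Valid U)
    (hY1 : Y.P₁ = zeroBra Y.Q) (hY2 : ∃ d', Y.P₂ = extP d' E) {Γ f τ : ℝ}
    {v v' : EuclideanSpace ℂ (Fin N)} (hΓ : 0 ≤ Γ) (hYcol : (Γ : ℂ) • Y.block U = column v')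
    (hdiff : ‖v' - v‖ ≤ τ * ‖v‖) (hv : 0 < ‖v‖) (hf1 : ‖v‖ ≤ f) (hf2 : f ≤ (1 + τ) * ‖v‖)
    (hτ : 0 < τ) (hτ1 : τ ≤ 1 / 8) :
    EncodesVector E (U.instantiate ((Y.peak (f / Γ) ⌈Γ / f⌉₊).toEncoding f)) v (8 * τ) ∧
    1 - 4 * τ ≤ (U.instantiate ((Y.peak (f / Γ) ⌈Γ / f⌉₊).toEncoding f)).eff ∧
    (1 - τ) * ‖v‖ ≤ Γ := by
  have hf0 : 0 < f := by linarith
  obtain ⟨hFF1, hFF2⟩ := abs_le.1 ((abs_norm_sub_norm_le _ _).trans hdiff)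
  have hF'0 : 0 < ‖v'‖ := by nlinarith
  have hYn : ‖v'‖ = Γ * specNorm (Y.block U) := by
    rw [← specNorm_column, ← hYcol, specNorm_smul, Complex.norm_real, Real.norm_of_nonneg hΓ]
  have hΓ0 : 0 < Γ := by
    rcases hΓ.eq_or_lt with h0 | h0
    · rw [hYn, ← h0, zero_mul] at hF'0
      exact absurd hF'0 (lt_irrefl _)
    · exact h0
  have hYn0 : 0 < specNorm (Y.block U) := pos_of_mul_pos_right (hYn ▸ hF'0) hΓ0.le
  have hYle : specNorm (Y.block U) ≤ 1 := hYv.specNorm_block_le_one hY1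
  have hr : ⌈Γ / f⌉₊ = ⌈1 / (f / Γ)⌉₊ := by rw [one_div_div]
  have hr1 : 1 ≤ ⌈Γ / f⌉₊ := Nat.one_le_iff_ne_zero.2 (Nat.ceil_pos.2 (div_pos hΓ0 hf0)).ne'
  have hsin : Real.sin (Real.pi / (2 * (2 * (⌈Γ / f⌉₊ : ℝ) + 1))) ≤ f / Γ := by
    rw [hr]; exact sin_div_le_of_ceil (div_pos hf0 hΓ0)
  generalize ⌈Γ / f⌉₊ = r at hr1 hsin
  have hu : |specNorm (Y.block U) / (f / Γ) - 1| ≤ 2 * τ := by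
    have h1 : specNorm (Y.block U) / (f / Γ) = ‖v'‖ / f := by rw [hYn]; field_simp
    rw [h1, abs_le]
    constructor
    · rw [le_sub_iff_add_le, le_div_iff₀ hf0]
      nlinarith
    · rw [sub_le_iff_le_add, div_le_iff₀ hf0]
      nlinarith
  obtain ⟨α, hα1, hα2, hα⟩ := hYv.exists_peak_block hY1 hr1
    (div_pos hf0 hΓ0) hYn0 hsin hu (by linarith)
  have hWv : (Y.peak (f / Γ) r).Valid U := hYv.peak _ _
  have hW1 : (Y.peak (f / Γ) r).P₁ = zeroBra (Y.peak (f / Γ) r).Q := Blk.peak_P₁ hY1 _ _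
  have hW2 : ∃ d', (Y.peak (f / Γ) r).P₂ = extP d' E := by
    obtain ⟨d', hd'⟩ := hY2
    refine ⟨d'.trans (Y.peakEmb (f / Γ) r), (Y.peak_P₂ (f / Γ) r).trans ?_⟩
    rw [hd']
    exact extP_extP d' _ E
  generalize Y.peak (f / Γ) r = W at hα hWv hW1 hW2
  have hα0 : 0 ≤ α := by linarith
  obtain ⟨d', hd'⟩ := hW2
  refine ⟨⟨hWv.isBlockEncoding ?_ ?_, W.toEncoding_P₁_zero hW1 f,
    W.toEncoding_P₂_data d' hd' f⟩, ?_, ?_⟩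
  · rw [specNorm_column]; exact hf1
  · have h1 : (f : ℂ) • W.block U - column v =
        column (((f * α / ‖v'‖ : ℝ) : ℂ) • v' - v) := by
      have e1 : column (((f * α / ‖v'‖ : ℝ) : ℂ) • v' - v) =
        ((f * α / ‖v'‖ : ℝ) : ℂ) • column v' - column v := rfl
      rw [e1, ← hYcol, hα, smul_smul, smul_smul, ← Complex.ofReal_mul, ← Complex.ofReal_mul]
      congr 3
      rw [hYn]
      field_simp
    rw [h1, specNorm_column, specNorm_column]
    have h2 : ((f * α / ‖v'‖ : ℝ) : ℂ) • v' - v =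
        ((f * α / ‖v'‖ - 1 : ℝ) : ℂ) • v' + (v' - v) := by
      push_cast
      rw [sub_smul, one_smul]; abel
    rw [h2]
    refine (norm_add_le _ _).trans ?_
    rw [norm_smul, Complex.norm_real, Real.norm_eq_abs]
    have h3 : |f * α / ‖v'‖ - 1| * ‖v'‖ = |f * α - ‖v'‖| := by
      conv_lhs => rw [← abs_of_pos hF'0, ← abs_mul, abs_of_pos hF'0, sub_mul, one_mul,
        div_mul_cancel₀ _ hF'0.ne']
    rw [h3]
    have h4 : |f * α - ‖v'‖| ≤ 7 * τ * ‖v‖ := by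
      rw [abs_le]
      constructor <;> nlinarith
    linarith
  · rw [Encoding.eff, Blk.block_toEncoding, hα, specNorm_smul, Complex.norm_real,
      Real.norm_of_nonneg (div_nonneg hα0 hYn0.le), div_mul_cancel₀ _ hYn0.ne']
    linarith
  · have : ‖v'‖ ≤ Γ := by rw [hYn]; nlinarith
    linarith

theorem amplifiedInput_P₁ (hx : EncodesVector E U x 0) (η : ℝ) :
    (amplifiedInput U.toInterface η).P₁ = zeroBra (amplifiedInput U.toInterface η).Q :=
  Blk.peak_P₁ (hx.2.1.trans (zeroProj_eq_zeroBra _)) η 3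

theorem amplifiedInput_P₂ (hd : U.P₂ = dataProj E d) (η : ℝ) :
    (amplifiedInput U.toInterface η).P₂ =
      extP (d.trans ((ofInput U.toInterface).peakEmb η 3)) E := by
  have hP₂ : (ofInput U.toInterface).P₂ = extP d E := hd.trans (dataProj_eq_extP E d)
  have := (ofInput U.toInterface).peak_P₂ η 3
  rw [hP₂] at this
  exact this.trans (extP_extP d _ E)

/-- The amplified input encodes `x` with the factor `γ η`, up to a factor `ρ` close to one. Three
iterations suffice since the information efficiency is at least `1 / 4`. -/
theorem exists_amplifiedInput_block (hx : EncodesVector E U x 0) {η ε₁ : ℝ} (he0 : 1 / 4 ≤ U.eff)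
    (hη1 : U.eff ≤ η) (hη2 : η ≤ U.eff + ε₁) (hε1 : ε₁ ≤ 1 / 16) :
    ∃ ρ : ℝ, |ρ - 1| ≤ 8 * ε₁ ∧
      column ((ρ : ℂ) • x) = ((U.γ * η : ℝ) : ℂ) • (amplifiedInput U.toInterface η).block U := by
  have hbl : (ofInput U.toInterface).block U = U.block := block_ofInput
  have heff : specNorm ((ofInput U.toInterface).block U) = U.eff := by rw [hbl]; rfl
  have hcol : column x = (U.γ : ℂ) • (ofInput U.toInterface).block U := by
    rw [hbl]; exact hx.1.eq_smul
  have hη0 : 0 < η := by linarith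
  have he : 0 < U.eff := by linarith
  obtain ⟨β, hβ1, hβ2, hβ⟩ := (valid_ofInput hx.1).exists_peak_block
    (hx.2.1.trans (zeroProj_eq_zeroBra _)) (η := η) (t := 4 * ε₁) (r := 3) (by norm_num)
    hη0 (by rw [heff]; exact he) (by
      refine (Real.sin_le (by positivity)).trans ?_
      rw [div_le_iff₀ (by norm_num)]
      push_cast
      linarith [Real.pi_lt_d2]) (by
      rw [heff, abs_le]
      constructor
      · rw [le_sub_iff_add_le, le_div_iff₀ hη0]
        nlinarith
      · have : U.eff / η ≤ 1 := (div_le_one hη0).2 hη1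
        linarith) (by linarith)
  rw [heff] at hβ
  refine ⟨η * β / U.eff, ?_, ?_⟩
  · rw [abs_le]
    constructor
    · rw [le_sub_iff_add_le, le_div_iff₀ he]
      nlinarith
    · rw [sub_le_iff_le_add, div_le_iff₀ he]
      nlinarith
  · have h1 : column (((η * β / U.eff : ℝ) : ℂ) • x) = ((η * β / U.eff : ℝ) : ℂ) • column x := rfl
    rw [h1, hcol, amplifiedInput, hβ, smul_smul, smul_smul, ← Complex.ofReal_mul,
      ← Complex.ofReal_mul]
    congr 2
    ring

theorem sum_specNorm_le_polyScale (hx : EncodesVector E U x 0)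
    (hV : ∀ k ≤ κ, EncodesCoefficient E (V k) (A k)) :
    ∑ k ∈ Finset.range (κ + 1), specNorm (A k) * ‖x‖ ^ k ≤ polyScale V κ U.γ := by
  refine Finset.sum_le_sum fun k hk => ?_
  have hk' : k ≤ κ := by have := Finset.mem_range.1 hk; omega
  rw [polyWeight_eq hV hx.1.gamma_nonneg hk]
  refine mul_le_mul (hV k hk').1.le_gamma ?_ (pow_nonneg (norm_nonneg _) _) (hV k hk').1.gamma_nonneg
  refine pow_le_pow_left₀ (norm_nonneg _) ?_ k
  rw [← specNorm_column]; exact hx.1.le_gamma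

/-- With good estimates, the returned encoding has the relative tolerance `8 τ` and an information
efficiency of at least `1 - 4 τ`. -/
theorem GoodEstimates.encodes {τ f η ε₁ : ℝ} (h : GoodEstimates A κ V U x τ f η ε₁)
    (hx : EncodesVector E U x 0) (hU : 1 / 4 ≤ U.eff) (hd : U.P₂ = dataProj E d)
    (hV : ∀ k ≤ κ, EncodesCoefficient E (V k) (A k))
    (hpos : ∀ k : Fin (κ + 1), (V k).P₁ = tensorProj E k (pos k))
    (ho : ∀ k : Fin (κ + 1), (V k).P₂ = dataProj E (o k))
    (hf : 0 < ‖polyEval A κ x‖) (hτ : 0 < τ) (hτ1 : τ ≤ 1 / 8) :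
    EncodesVector E (U.instantiate ((outputBlk U.toInterface d κ V pos o f η).toEncoding f))
      (polyEval A κ x) (8 * τ) ∧
    1 - 4 * τ ≤ (U.instantiate ((outputBlk U.toInterface d κ V pos o f η).toEncoding f)).eff ∧
    (1 - τ) * ‖polyEval A κ x‖ ≤ polyScale V κ (U.γ * η) := by
  obtain ⟨hf1, hf2, hη1, hη2, hε0, hε1, hε2, hε3⟩ := h
  obtain ⟨ρ, hρ1, hcol⟩ := exists_amplifiedInput_block hx hU hη1 hη2 hε1
  have hX' : (amplifiedInput U.toInterface η).Valid U := (valid_ofInput hx.1).peak η 3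
  have hγη : 0 ≤ U.γ * η := mul_nonneg hx.1.gamma_nonneg (by linarith)
  have hdiff : ‖polyEval A κ ((ρ : ℂ) • x) - polyEval A κ x‖ ≤ τ * ‖polyEval A κ x‖ := by
    refine (norm_polyEval_smul_sub_le A x hρ1 (by linarith) (by linarith)).trans ?_
    have h2 := mul_le_mul_of_nonneg_left (sum_specNorm_le_polyScale hx hV)
      (by positivity : (0 : ℝ) ≤ 2 * κ * (8 * ε₁))
    have h3 : τ * f ≤ τ * (2 * ‖polyEval A κ x‖) := mul_le_mul_of_nonneg_left (by nlinarith) hτ.le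
    linarith
  exact Blk.Valid.encodesVector_peak (valueBlk_valid hX' _)
    (valueBlk_P₁ (amplifiedInput_P₁ hx η) _) (valueBlk_P₂ (amplifiedInput_P₂ hd η) _)
    (polyScale_nonneg _)
    (polyScale_smul_valueBlk_block hX' (amplifiedInput_P₁ hx η) (amplifiedInput_P₂ hd η) hV hpos ho
      hγη hcol) hdiff hf hf1 hf2 hτ hτ1

/-- The returned encoding consists of at least as many gates as the input, times the number of
iterations. -/
theorem le_gates_outputBlk (hκ : 1 ≤ κ) (f η : ℝ) :
    polyScale V κ (U.γ * η) / f * U.gates ≤ ((outputBlk U.toInterface d κ V pos o f η).gates U : ℝ)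
    := by
  have h1 := Blk.le_gates_peak (amplifiedValue U.toInterface d κ V pos o η)
    (f / polyScale V κ (U.γ * η)) ⌈polyScale V κ (U.γ * η) / f⌉₊
  have h2 : (amplifiedInput U.toInterface η).gates U ≤
      (amplifiedValue U.toInterface d κ V pos o η).gates U := gates_le_gates_valueBlk hκ _
  have h3 := Blk.le_gates_peak (ofInput U.toInterface) (U := U) η 3
  have h4 : U.gates ≤ (amplifiedValue U.toInterface d κ V pos o η).gates U := by
    refine le_trans ?_ h2
    rw [gates_ofInput] at h3
    exact le_trans (by omega) h3
  have h5 : ⌈polyScale V κ (U.γ * η) / f⌉₊ * U.gates ≤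
      (outputBlk U.toInterface d κ V pos o f η).gates U := (Nat.mul_le_mul_left _ h4).trans h1
  have h6 : ((⌈polyScale V κ (U.γ * η) / f⌉₊ * U.gates : ℕ) : ℝ) ≤
      ((outputBlk U.toInterface d κ V pos o f η).gates U : ℝ) := by exact_mod_cast h5
  refine le_trans ?_ h6
  push_cast
  exact mul_le_mul_of_nonneg_right (Nat.le_ceil _) (Nat.cast_nonneg _)

/-- By the hypothesis on `f`, rounding up the number of iterations costs at most a constant factor.
-/
theorem gates_outputBlk_le [NeZero N] (hκ : 1 ≤ κ) (hx : EncodesVector E U x 0) {t : ℕ}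
    (hV : ∀ k ≤ κ, EncodesCoefficient E (V k) (A k)) (ht : ∀ k ≤ κ, (V k).gates ≤ t)
    (hpos : ∀ k : Fin (κ + 1), (V k).P₁ = tensorProj E k (pos k)) {f η : ℝ} (hf : 0 < f)
    (hfΓ : f ≤ 2 * polyScale V κ (U.γ * η)) :
    ((outputBlk U.toInterface d κ V pos o f η).gates U : ℝ) ≤
      8 * (polyScale V κ (U.γ * η) / f) * (2 * 10 ^ 8 * (κ * (t * U.gates))) := by
  have hX := valid_ofInput hx.1
  have hs0 := hx.size_ofInput_le
  have hg := hx.one_le_gates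
  have ht1 := (hV 0 (Nat.zero_le _)).one_le_gates.trans (ht 0 (Nat.zero_le _))
  have h1 : (amplifiedInput U.toInterface η).size U ≤
      (2 * 3 + 1) * (182 * (ofInput U.toInterface).size U) := hX.size_peak_le η 3
  have h2 : (amplifiedValue U.toInterface d κ V pos o η).size U ≤
      (κ + 1) * (100 * (amplifiedInput U.toInterface η).size U + 100 * t) :=
    size_valueBlk_le (hX.peak η 3) hV ht hpos _
  have h3 : (outputBlk U.toInterface d κ V pos o f η).size U ≤
      (2 * ⌈polyScale V κ (U.γ * η) / f⌉₊ + 1) *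
      (182 * (amplifiedValue U.toInterface d κ V pos o η).size U) :=
    Blk.Valid.size_peak_le (valueBlk_valid (hX.peak η 3) _) _ _
  have h4 : (outputBlk U.toInterface d κ V pos o f η).gates U ≤
      (outputBlk U.toInterface d κ V pos o f η).size U := by
    rw [Blk.size, Nat.add_assoc]
    exact Nat.le_add_right _ _
  have h9 : 1 / 2 ≤ polyScale V κ (U.γ * η) / f := by rw [le_div_iff₀ hf]; linarith
  generalize polyScale V κ (U.γ * η) / f = y at h3 h9 ⊢
  generalize (outputBlk U.toInterface d κ V pos o f η).gates U = g₁ at h4 ⊢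
  generalize (outputBlk U.toInterface d κ V pos o f η).size U = s₃ at h3 h4
  generalize (amplifiedValue U.toInterface d κ V pos o η).size U = s₂ at h2 h3
  generalize (amplifiedInput U.toInterface η).size U = s₁ at h1 h2
  generalize (ofInput U.toInterface).size U = s₀ at hs0 h1
  generalize U.gates = g at hs0 hg ⊢
  clear hX
  have h5 : 100 * s₁ + 100 * t ≤ 382300 * (t * g) := by
    have e1 : g ≤ t * g := Nat.le_mul_of_pos_left g ht1
    have e2 : t ≤ t * g := Nat.le_mul_of_pos_right t hg
    omega
  have h6 : 182 * s₂ ≤ 2 * 10 ^ 8 * (κ * (t * g)) := by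
    have e1 := h2.trans (Nat.mul_le_mul_left (κ + 1) h5)
    have e2 : (κ + 1) * (382300 * (t * g)) ≤ (2 * κ) * (382300 * (t * g)) :=
      Nat.mul_le_mul_right _ (by omega)
    have e3 : (2 * κ) * (382300 * (t * g)) = 764600 * (κ * (t * g)) := by ring
    generalize κ * (t * g) = z at e3 ⊢
    omega
  have h7 := h4.trans (h3.trans (Nat.mul_le_mul_left _ h6))
  have h8 : (g₁ : ℝ) ≤ (2 * ⌈y⌉₊ + 1) * (2 * 10 ^ 8 * (κ * (t * g))) := by exact_mod_cast h7
  refine h8.trans (mul_le_mul_of_nonneg_right ?_ (by positivity))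
  have h10 := Nat.ceil_lt_add_one (show 0 ≤ y by linarith)
  linarith

end Output

/-! ### The algorithm for the value of a polynomial -/

open Classical in
/-- A number of steps after which an interval that shrinks by the factor `7 / 8` in every step has
about `y` times its initial length. -/
noncomputable def shrinkCount (y : ℝ) : ℕ :=
  if h : ∃ n : ℕ, (7 / 8 : ℝ) ^ n ≤ y ∧ 7 / 8 * y ≤ (7 / 8) ^ n then h.choose else 0

theorem shrinkCount_spec {y : ℝ} (h0 : 0 < y) (h1 : y ≤ 1) :
    (7 / 8 : ℝ) ^ shrinkCount y ≤ y ∧ 7 / 8 * y ≤ (7 / 8) ^ shrinkCount y := by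
  have h : ∃ n : ℕ, (7 / 8 : ℝ) ^ n ≤ y ∧ 7 / 8 * y ≤ (7 / 8) ^ n := by
    obtain ⟨n, hn1, hn2⟩ := exists_nat_pow_near_of_lt_one h0 h1 (y := (7 / 8 : ℝ)) (by norm_num)
      (by norm_num)
    refine ⟨n + 1, hn1.le, ?_⟩
    rw [pow_succ]
    linarith
  rw [shrinkCount, dif_pos h]
  exact h.choose_spec

/-- A number of repetitions of the tests for a total failure probability of at most `δ`: the three
phases of the algorithm contribute `3`, `2` and `2` times `testError`. -/
noncomputable def testCount (δ : ℝ) : ℕ := ⌈Real.log (7 / δ) / (testGap ^ 2 / 4)⌉₊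

theorem testError_testCount_le {δ : ℝ} (h0 : 0 < δ) : testError (testCount δ) ≤ δ / 7 := by
  have hg := testGap_pos
  have h1 : Real.log (7 / δ) / (testGap ^ 2 / 4) ≤ testCount δ := Nat.le_ceil _
  rw [div_le_iff₀ (by positivity)] at h1
  calc testError (testCount δ) ≤ Real.exp (-Real.log (7 / δ)) := by
        rw [testError]
        exact Real.exp_le_exp.2 (by linarith)
    _ = δ / 7 := by rw [Real.exp_neg, Real.exp_log (by positivity), inv_div]

theorem testCount_pos {δ : ℝ} (h0 : 0 < δ) (h1 : δ < 1) : 0 < testCount δ := by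
  have hg := testGap_pos
  refine Nat.ceil_pos.2 (div_pos (Real.log_pos ?_) (by positivity))
  rw [lt_div_iff₀ h0]
  linarith

theorem testCount_le {δ : ℝ} (h0 : 0 < δ) (h1 : δ < 1) :
    (testCount δ : ℝ) ≤ (8 / testGap ^ 2 + 1) * (1 + Real.logb 2 δ⁻¹) := by
  have hg := testGap_pos
  have hl2 : 0 < Real.log 2 := Real.log_pos (by norm_num)
  have hl2' : Real.log 2 ≤ 1 := by linarith [Real.log_two_lt_d9]
  have hδ : 0 ≤ Real.logb 2 δ⁻¹ := Real.logb_nonneg (by norm_num) (one_le_inv₀ h0 |>.2 h1.le)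
  have h7 : Real.log 7 ≤ 2 := by
    rw [Real.log_le_iff_le_exp (by norm_num)]
    have h2 : Real.exp 2 = Real.exp 1 ^ 2 := by rw [← Real.exp_nat_mul]; norm_num
    rw [h2]
    nlinarith [Real.exp_one_gt_d9]
  have hlog : Real.log (7 / δ) ≤ 2 * (1 + Real.logb 2 δ⁻¹) := by
    rw [div_eq_mul_inv, Real.log_mul (by norm_num) (inv_pos.2 h0).ne']
    have : Real.log δ⁻¹ = Real.logb 2 δ⁻¹ * Real.log 2 := by
      rw [Real.logb, div_mul_cancel₀ _ hl2.ne']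
    rw [this]
    nlinarith
  have hpos : 0 ≤ Real.log (7 / δ) / (testGap ^ 2 / 4) := by
    refine div_nonneg (Real.log_nonneg ?_) (by positivity)
    rw [le_div_iff₀ h0]
    linarith
  have h2 := (Nat.ceil_lt_add_one hpos).le
  have h3 : Real.log (7 / δ) / (testGap ^ 2 / 4) ≤
      2 * (1 + Real.logb 2 δ⁻¹) / (testGap ^ 2 / 4) :=
    div_le_div_of_nonneg_right hlog (by positivity)
  have h4 : 2 * (1 + Real.logb 2 δ⁻¹) / (testGap ^ 2 / 4) =
      8 / testGap ^ 2 * (1 + Real.logb 2 δ⁻¹) := by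
    rw [div_div_eq_mul_div]
    ring
  rw [h4] at h3
  refine h2.trans ?_
  rw [add_mul]
  linarith

section Value
variable {N n : ℕ} {E : Matrix (Fin N) (Fin n → Bool) ℂ}
  {A : (k : ℕ) → Matrix (Fin N) (Fin k → Fin N) ℂ} {κ : ℕ}
  {V : (k : ℕ) → Encoding Gate (Fin k → Fin N) (Fin N)}

/-- Estimation of the information efficiency `η` of the encoding of the value of a polynomial,
up to the relative error `τ` and at the order of magnitude `3⁻ⁱ`, and of the information efficiency
of the input. Afterwards the encoding for these estimates is returned. The initial interval for
`η` ends at `162 * (3 ^ (i + 4))⁻¹ = 2 * (3 ^ i)⁻¹`. The upper ends of the final intervals serve as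
estimates. -/
noncomputable def refineAndReturn (Cie τ : ℝ) (m : ℕ) (I : Interface Unit (Fin N))
    (d : Fin n ↪ (ofInput I).Q) (κ : ℕ) (V : (k : ℕ) → Encoding Gate (Fin k → Fin N) (Fin N))
    (pos : ∀ k : Fin (κ + 1), Fin k × Fin n ↪ Fin (V k).m)
    (o : ∀ k : Fin (κ + 1), Fin n ↪ Fin (V k).m) (i : ℕ) : Strategy I Unit (Fin N) :=
  ladder (valueBlk (ofInput I) d κ V pos o I.γ) m (fun a w =>
    ladder (ofInput I) m (fun a' w' =>
      ret ((outputBlk I d κ V pos o ((a + w) * polyScale V κ I.γ) (a' + w')).toEncoding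
        ((a + w) * polyScale V κ I.γ)))
      (shrinkCount (τ * (a + w) / (32 * κ))) Cie (1 - Cie))
    (shrinkCount (τ / 161)) (3 ^ (i + 4))⁻¹ (161 * (3 ^ (i + 4))⁻¹)

/-- The algorithm for the value of a polynomial. The answer is irrelevant for interfaces that do not
encode a vector. -/
noncomputable def polyAlgorithm (E : Matrix (Fin N) (Fin n → Bool) ℂ) (Cie : ℝ) (κ : ℕ)
    (V : (k : ℕ) → Encoding Gate (Fin k → Fin N) (Fin N))
    (pos : ∀ k : Fin (κ + 1), Fin k × Fin n ↪ Fin (V k).m)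
    (o : ∀ k : Fin (κ + 1), Fin n ↪ Fin (V k).m) : EncodingAlgorithm N Unit (Fin N) :=
  fun ε δ I =>
    if h : ∃ d, I.P₂ = dataProj E d then
      search (valueBlk (ofInput I) h.choose κ V pos o I.γ) (testCount δ)
        (refineAndReturn Cie (ε * (1 - Cie) / 8) (testCount δ) I h.choose κ V pos o) 0
    else fun _ => .run 0 []

variable {U : Encoding Gate Unit (Fin N)} {d : Fin n ↪ (ofInput U.toInterface).Q}
  {pos : ∀ k : Fin (κ + 1), Fin k × Fin n ↪ Fin (V k).m}
  {o : ∀ k : Fin (κ + 1), Fin n ↪ Fin (V k).m} {x : EuclideanSpace ℂ (Fin N)}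

theorem polyScale_le_four_pow (hV : ∀ k ≤ κ, EncodesCoefficient E (V k) (A k)) {γ η : ℝ}
    (hγ : 0 ≤ γ) (hη : 1 / 4 ≤ η) : polyScale V κ γ ≤ 4 ^ κ * polyScale V κ (γ * η) := by
  have hη0 : 0 ≤ γ * η := mul_nonneg hγ (by linarith)
  rw [polyScale, polyScale, Finset.mul_sum]
  refine Finset.sum_le_sum fun k hk => ?_
  have hk' : k ≤ κ := by have := Finset.mem_range.1 hk; omega
  rw [polyWeight_eq hV hγ hk, polyWeight_eq hV hη0 hk]
  have h1 : γ ^ k ≤ (4 * (γ * η)) ^ k := pow_le_pow_left₀ hγ (by nlinarith) k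
  have h2 : (4 : ℝ) ^ k * (γ * η) ^ k ≤ 4 ^ κ * (γ * η) ^ k :=
    mul_le_mul_of_nonneg_right (pow_le_pow_right₀ (by norm_num) hk') (pow_nonneg hη0 k)
  rw [mul_pow] at h1
  have h3 := mul_le_mul_of_nonneg_left (h1.trans h2) (hV k hk').1.gamma_nonneg
  linarith

/-- The normalization of the encoded value, compared with the norms of the coefficients. -/
theorem polyScale_le {τ f η ε₁ ηmin : ℝ} (h : GoodEstimates A κ V U x τ f η ε₁)
    (hx : EncodesVector E U x 0) (hU : 1 / 4 ≤ U.eff) (hη : 0 < ηmin)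
    (hV : ∀ k ≤ κ, EncodesCoefficient E (V k) (A k)) (he : ∀ k ≤ κ, ηmin ≤ (V k).eff) :
    polyScale V κ (U.γ * η) ≤
      2 / ηmin * ∑ k ∈ Finset.range (κ + 1), specNorm (A k) * ‖x‖ ^ k := by
  have hγ := hx.1.gamma_nonneg
  have hη0 : 0 ≤ η := by linarith [h.le_η]
  have hγη : 0 ≤ U.γ * η := mul_nonneg hγ hη0
  rw [polyScale, Finset.mul_sum]
  refine Finset.sum_le_sum fun k hk => ?_
  have hk' : k ≤ κ := by have := Finset.mem_range.1 hk; omega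
  rw [polyWeight_eq hV hγη hk]
  have h1 : (V k).γ ≤ specNorm (A k) / ηmin := by
    rw [le_div_iff₀ hη, (hV k hk').1.specNorm_eq]
    exact mul_le_mul_of_nonneg_left (he k hk') (hV k hk').1.gamma_nonneg
  have h2 : U.γ * η ≤ (1 + 4 * ε₁) * ‖x‖ := by
    have h3 : η ≤ (1 + 4 * ε₁) * U.eff := by nlinarith [h.η_le, h.ε_nonneg]
    have h4 := mul_le_mul_of_nonneg_left h3 hγ
    rw [hx.norm_eq]
    linarith
  have h3 : (1 + 4 * ε₁) ^ k ≤ 2 := by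
    have h4 : (1 + 4 * ε₁) ^ k ≤ Real.exp (k * (4 * ε₁)) := by
      rw [Real.exp_nat_mul]
      exact pow_le_pow_left₀ (by linarith [h.ε_nonneg])
        (by linarith [Real.add_one_le_exp (4 * ε₁)]) k
    have h5 : (k : ℝ) * (4 * ε₁) ≤ 1 / 2 := by
      have : (k : ℝ) ≤ κ := by exact_mod_cast hk'
      have := mul_le_mul_of_nonneg_right this h.ε_nonneg
      linarith [h.mul_ε_le]
    have h6 : Real.exp (1 / 2) ≤ 2 := by
      have h7 : Real.exp 1 = Real.exp (1 / 2) * Real.exp (1 / 2) := by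
        rw [← Real.exp_add]; norm_num
      nlinarith [Real.exp_one_lt_d9, Real.exp_pos (1 / 2)]
    exact h4.trans ((Real.exp_le_exp.2 h5).trans h6)
  have h4 : (U.γ * η) ^ k ≤ 2 * ‖x‖ ^ k := by
    refine (pow_le_pow_left₀ hγη h2 k).trans ?_
    rw [mul_pow]
    exact mul_le_mul_of_nonneg_right h3 (by positivity)
  refine (mul_le_mul h1 h4 (pow_nonneg hγη k) (div_nonneg (specNorm_nonneg _) hη.le)).trans
    (le_of_eq ?_)
  ring

/-- Here `s` is an estimate of the information efficiency `η₀` of the encoded value, up to the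
relative error `τ`. -/
theorem goodEstimates_of_le {τ s η₀ η : ℝ} (hκ : 1 ≤ κ)
    (hF : ‖polyEval A κ x‖ = polyScale V κ U.γ * η₀) (h1 : η₀ ≤ s) (h2 : s ≤ (1 + τ) * η₀)
    (h0 : 0 ≤ s) (hs : s ≤ 2) (hτ : 0 ≤ τ) (hτ1 : τ ≤ 1 / 8) (h3 : U.eff ≤ η)
    (h4 : η ≤ U.eff + τ * s / (32 * κ)) :
    GoodEstimates A κ V U x τ (s * polyScale V κ U.γ) η (τ * s / (32 * κ)) := by
  have hκ' : (1 : ℝ) ≤ κ := by exact_mod_cast hκ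
  have hΓ := polyScale_nonneg (V := V) (κ := κ) U.γ
  have hts : τ * s ≤ 1 / 4 := by nlinarith
  have hts0 : 0 ≤ τ * s := mul_nonneg hτ h0
  have e : κ * (τ * s / (32 * κ)) = τ * s / 32 := by field_simp
  refine ⟨?_, ?_, h3, h4, by positivity, ?_, ?_, ?_⟩
  · rw [hF, mul_comm]
    exact mul_le_mul_of_nonneg_right h1 hΓ
  · rw [hF]
    have := mul_le_mul_of_nonneg_right h2 hΓ
    linarith
  · rw [div_le_iff₀ (by positivity)]
    nlinarith
  · rw [mul_assoc, e]
    linarith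
  · rw [mul_assoc (32 : ℝ), e]
    exact le_of_eq (by ring)

/-- The number of gates that are executed in the three phases of the algorithm, in terms of the
sizes `S₀` and `S₁` of the encodings that are tested. -/
theorem executed_le {m S₀ S₁ c₁ c₂ c₃ v₁ v₂ τ η₀ a₀ s C κ : ℝ} (hm : 0 ≤ m) (hS₀ : 0 ≤ S₀)
    (hS₁ : 0 ≤ S₁) (hτ : 0 < τ) (hτ1 : τ ≤ 1) (hη₀ : 0 < η₀) (hC : 0 < C) (hκ : 0 < κ)
    (h1 : c₁ ≤ 336 * m * S₀ / η₀) (h2 : c₂ ≤ c₁ + 30576 * m * S₀ / v₁)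
    (h3 : c₃ ≤ c₂ + 30576 * m * S₁ / v₂) (ha : η₀ ≤ 162 * a₀) (hv₁ : 7 / 8 * τ * a₀ ≤ v₁)
    (hs : η₀ ≤ s) (hv₂ : C * (7 / 8 * (τ * s / (32 * κ))) ≤ v₂) :
    c₃ ≤ m * ((336 + 30576 * 186) * S₀ + 30576 * (37 * κ / C) * S₁) / (τ * η₀) := by
  have e1 : 336 * m * S₀ / η₀ ≤ 336 * m * S₀ / (τ * η₀) :=
    div_le_div_of_nonneg_left (by positivity) (by positivity) (by nlinarith)
  have e2 : 30576 * m * S₀ / v₁ ≤ 30576 * m * S₀ / (τ * η₀ / 186) := by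
    refine div_le_div_of_nonneg_left (by positivity) (by positivity) (le_trans ?_ hv₁)
    nlinarith [mul_le_mul_of_nonneg_left ha hτ.le, mul_pos hτ hη₀]
  have e3 : 30576 * m * S₁ / v₂ ≤ 30576 * m * S₁ / (τ * η₀ * C / (37 * κ)) := by
    refine div_le_div_of_nonneg_left (by positivity) (by positivity) (le_trans ?_ hv₂)
    rw [div_le_iff₀ (by positivity)]
    have : C * (7 / 8 * (τ * s / (32 * κ))) * (37 * κ) = τ * s * C * (259 / 256) := by
      field_simp
      ring
    rw [this]
    have h4 : τ * η₀ * C ≤ τ * s * C := by gcongr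
    have h5 : 0 < τ * η₀ * C := by positivity
    linarith
  have e4 : 336 * m * S₀ / (τ * η₀) + 30576 * m * S₀ / (τ * η₀ / 186) +
      30576 * m * S₁ / (τ * η₀ * C / (37 * κ)) =
      m * ((336 + 30576 * 186) * S₀ + 30576 * (37 * κ / C) * S₁) / (τ * η₀) := by
    field_simp
  linarith

end Value

section Verification
variable {N n : ℕ} {E : Matrix (Fin N) (Fin n → Bool) ℂ}
  {A : (k : ℕ) → Matrix (Fin N) (Fin k → Fin N) ℂ} {κ : ℕ}
  {V : (k : ℕ) → Encoding Gate (Fin k → Fin N) (Fin N)}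
  {U : Encoding Gate Unit (Fin N)} {d : Fin n ↪ (ofInput U.toInterface).Q}
  {pos : ∀ k : Fin (κ + 1), Fin k × Fin n ↪ Fin (V k).m}
  {o : ∀ k : Fin (κ + 1), Fin n ↪ Fin (V k).m} {x : EuclideanSpace ℂ (Fin N)}

/-- The complexity of the returned encoding: `O(Γ / |f x|)` iterations for an encoding of size
`O(K t_max)` relative to the input, where `Γ` is its normalization. -/
theorem GoodEstimates.complexity_le [NeZero N] {τ f η ε₁ ηmin : ℝ} {t : ℕ}
    (h : GoodEstimates A κ V U x τ f η ε₁) (hκ : 1 ≤ κ) (hx : EncodesVector E U x 0)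
    (hU : 1 / 4 ≤ U.eff) (hηmin : 0 < ηmin)
    (hV : ∀ k ≤ κ, EncodesCoefficient E (V k) (A k) ∧ (V k).gates ≤ t ∧ ηmin ≤ (V k).eff)
    (hpos : ∀ k : Fin (κ + 1), (V k).P₁ = tensorProj E k (pos k))
    (hf : 0 < ‖polyEval A κ x‖) (hfΓ : f ≤ 2 * polyScale V κ (U.γ * η)) :
    complexity (U.instantiate ((outputBlk U.toInterface d κ V pos o f η).toEncoding f)) U ≤
      10 ^ 10 * (κ * t / (ηmin * ‖polyEval A κ x‖) *
        ∑ k ∈ Finset.range (κ + 1), specNorm (A k) * ‖x‖ ^ k) := by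
  have hg : (0 : ℝ) < U.gates := by exact_mod_cast hx.one_le_gates
  have hf0 : 0 < f := hf.trans_le h.le_f
  have h1 := gates_outputBlk_le (d := d) (o := o) hκ hx (fun k hk => (hV k hk).1)
    (fun k hk => (hV k hk).2.1) hpos hf0 hfΓ
  have h2 := polyScale_le h hx hU hηmin (fun k hk => (hV k hk).1) (fun k hk => (hV k hk).2.2)
  have h3 := h.le_f
  have h0 := polyScale_nonneg (V := V) (κ := κ) (U.γ * η)
  rw [complexity, Blk.gates_toEncoding, div_le_iff₀ hg]
  generalize polyScale V κ (U.γ * η) = Γ at h0 h1 h2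
  generalize ∑ k ∈ Finset.range (κ + 1), specNorm (A k) * ‖x‖ ^ k = S at h2 ⊢
  generalize ‖polyEval A κ x‖ = F at *
  have h4 : Γ / f ≤ 2 / ηmin * S / F := div_le_div₀ (h0.trans h2) h2 hf h3
  have h5 : 0 ≤ 2 / ηmin * S / F := (div_nonneg h0 hf0.le).trans h4
  have h6 : (0 : ℝ) ≤ κ * (t * U.gates) := by positivity
  calc ((outputBlk U.toInterface d κ V pos o f η).gates U : ℝ)
      ≤ 8 * (Γ / f) * (2 * 10 ^ 8 * (κ * (t * U.gates))) := h1
    _ ≤ 8 * (2 / ηmin * S / F) * (2 * 10 ^ 8 * (κ * (t * U.gates))) := by gcongr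
    _ = 16 / 10 * 10 ^ 9 * ((2 / ηmin * S / F) * (κ * (t * U.gates))) := by ring
    _ ≤ 5 * 10 ^ 9 * ((2 / ηmin * S / F) * (κ * (t * U.gates))) := by
        have := mul_nonneg h5 h6
        linarith
    _ = 10 ^ 10 * (κ * t / (ηmin * F) * S) * U.gates := by
        field_simp
        ring

/-- The number of executed gates, compared with the number of gates of the returned encoding. -/
theorem GoodEstimates.executed_le {τ f η ε₁ η₀ M : ℝ} (h : GoodEstimates A κ V U x τ f η ε₁)
    (hκ : 1 ≤ κ) (hx : EncodesVector E U x 0) (hU : 1 / 4 ≤ U.eff)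
    (hV : ∀ k ≤ κ, EncodesCoefficient E (V k) (A k))
    (hF : ‖polyEval A κ x‖ = polyScale V κ U.γ * η₀) (hf : 0 < ‖polyEval A κ x‖)
    (hτ : 0 < τ) (hτ1 : τ ≤ 1 / 8) (hM : 0 ≤ M) :
    M * U.gates / (τ * η₀) ≤
      2 * 4 ^ κ * M / τ * (outputBlk U.toInterface d κ V pos o f η).gates U := by
  have hf0 : 0 < f := hf.trans_le h.le_f
  have h1 := le_gates_outputBlk (U := U) (d := d) (pos := pos) (o := o) hκ f η
  have h2 := polyScale_le_four_pow hV hx.1.gamma_nonneg (hU.trans h.le_η)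
  have h3 : f ≤ 2 * ‖polyEval A κ x‖ := by
    refine h.f_le.trans (mul_le_mul_of_nonneg_right (by linarith) hf.le)
  have h4 := polyScale_nonneg (V := V) (κ := κ) (U.γ * η)
  have h5 := polyScale_nonneg (V := V) (κ := κ) U.γ
  generalize polyScale V κ (U.γ * η) = Γ' at h1 h2 h4
  generalize polyScale V κ U.γ = Γ at h2 h5 hF
  generalize ((outputBlk U.toInterface d κ V pos o f η).gates U : ℝ) = w at h1 ⊢
  generalize ‖polyEval A κ x‖ = F at *
  have hη₀ : 0 < η₀ := pos_of_mul_pos_right (hF ▸ hf) h5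
  have hΓ : 0 < Γ := pos_of_mul_pos_left (hF ▸ hf) hη₀.le
  have h6 : 1 / η₀ = Γ / F := by rw [hF]; field_simp
  have h7 : Γ / F ≤ 2 * 4 ^ κ * (Γ' / f) := by
    rw [div_le_iff₀ hf]
    have e1 : 2 * 4 ^ κ * (Γ' / f) * F = 4 ^ κ * Γ' * (2 * F / f) := by ring
    rw [e1]
    have e2 : 1 ≤ 2 * F / f := by rwa [one_le_div hf0]
    exact h2.trans (le_mul_of_one_le_right (by positivity) e2)
  calc M * U.gates / (τ * η₀) = M / τ * (1 / η₀) * U.gates := by field_simp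
    _ ≤ M / τ * (2 * 4 ^ κ * (Γ' / f)) * U.gates := by rw [h6]; gcongr
    _ = 2 * 4 ^ κ * M / τ * (Γ' / f * U.gates) := by ring
    _ ≤ 2 * 4 ^ κ * M / τ * w := by gcongr

theorem GoodEstimates.output [NeZero N] {τ f η ε₁ ηmin ε Cie : ℝ} {t : ℕ}
    (h : GoodEstimates A κ V U x τ f η ε₁) (hκ : 1 ≤ κ) (hx : EncodesVector E U x 0)
    (hU : 1 / 4 ≤ U.eff) (hηmin : 0 < ηmin) (hd : U.P₂ = dataProj E d)
    (hV : ∀ k ≤ κ, EncodesCoefficient E (V k) (A k) ∧ (V k).gates ≤ t ∧ ηmin ≤ (V k).eff)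
    (hpos : ∀ k : Fin (κ + 1), (V k).P₁ = tensorProj E k (pos k))
    (ho : ∀ k : Fin (κ + 1), (V k).P₂ = dataProj E (o k))
    (hf : 0 < ‖polyEval A κ x‖) (hτ : 0 < τ) (hτ1 : τ ≤ 1 / 8) (hε : 8 * τ ≤ ε)
    (hC : Cie ≤ 1 - 4 * τ) {W : Encoding Gate Unit (Fin N)}
    (hW : W = U.instantiate ((outputBlk U.toInterface d κ V pos o f η).toEncoding f)) :
    EncodesVector E W (polyEval A κ x) ε ∧ Cie ≤ W.eff ∧
    complexity W U ≤ 10 ^ 10 * (κ * t / (ηmin * ‖polyEval A κ x‖) *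
        ∑ k ∈ Finset.range (κ + 1), specNorm (A k) * ‖x‖ ^ k) := by
  obtain ⟨hg1, hg2, hg3⟩ := h.encodes hx hU hd (fun k hk => (hV k hk).1) hpos ho hf hτ hτ1
  have hc := h.complexity_le (d := d) (o := o) hκ hx hU hηmin hV hpos hf
    (by have := h.f_le; nlinarith)
  rw [← hW] at hg1 hg2 hc
  exact ⟨⟨⟨hg1.1.1, hg1.1.2, hg1.1.3, hg1.1.4, hg1.1.5,
    hg1.1.6.trans (mul_le_mul_of_nonneg_right hε (specNorm_nonneg _))⟩, hg1.2⟩, hC.trans hg2, hc⟩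

/-- The algorithm for the value of a polynomial is correct: three phases of measurements give
estimates of sufficient accuracy, and the cost of the finest measurements is of the order of
`ε⁻¹` times the size of the returned encoding. -/
theorem isEfficientAmplifiedEncoding_polyAlgorithm [NeZero N] {Cie ηmin : ℝ} {t : ℕ}
    (hC : 1 / 4 ≤ Cie) (hC1 : Cie < 1) (hκ : 1 ≤ κ) (hηmin : 0 < ηmin)
    (hV : ∀ k ≤ κ, EncodesCoefficient E (V k) (A k) ∧ (V k).gates ≤ t ∧ ηmin ≤ (V k).eff)
    (hpos : ∀ k : Fin (κ + 1), (V k).P₁ = tensorProj E k (pos k))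
    (ho : ∀ k : Fin (κ + 1), (V k).P₂ = dataProj E (o k)) :
    IsEfficientAmplifiedEncoding E Cie (polyAlgorithm E Cie κ V pos o) (polyEval A κ)
      {x | polyEval A κ x ≠ 0}
      (fun x => 10 ^ 10 * (κ * t / (ηmin * ‖polyEval A κ x‖) *
        ∑ k ∈ Finset.range (κ + 1), specNorm (A k) * ‖x‖ ^ k)) := by
  have hV1 : ∀ k ≤ κ, EncodesCoefficient E (V k) (A k) := fun k hk => (hV k hk).1
  have hκ' : (1 : ℝ) ≤ κ := by exact_mod_cast hκ
  have hC' : 0 < 1 - Cie := by linarith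
  -- the number of executed gates is at most `m B / (τ η₀)` times the number of gates of the input,
  -- where `m` is the number of repetitions and `η₀` is the information efficiency of the value
  obtain ⟨B, hB, hB0⟩ : ∃ B : ℝ, (336 + 30576 * 186) * ((κ + 1) * (400 * t)) +
      30576 * (37 * κ / (1 - Cie)) * 3 = B ∧ 0 ≤ B := ⟨_, rfl, by positivity⟩
  refine ⟨2 * 4 ^ κ * (B * (8 / testGap ^ 2 + 1)) * (8 / (1 - Cie)),
    fun ε δ hε hε1 hδ hδ1 x hxD U hx hU => ?_⟩
  have hU4 : 1 / 4 ≤ U.eff := hC.trans hU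
  have hF0 : 0 < ‖polyEval A κ x‖ := norm_pos_iff.2 hxD
  have hd : ∃ d, U.P₂ = dataProj E d := hx.2.2
  rw [polyAlgorithm, dif_pos hd]
  have hd' := hd.choose_spec
  generalize hd.choose = d at hd'
  have hm := testCount_pos hδ hδ1
  have hme := testError_testCount_le hδ
  have hml := testCount_le hδ hδ1
  generalize testCount δ = m at hm hme hml
  have hme0 := testError_pos m
  obtain ⟨τ, hτ⟩ : ∃ τ, ε * (1 - Cie) / 8 = τ := ⟨_, rfl⟩
  have hτ0 : 0 < τ := by rw [← hτ]; positivity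
  have hτ1 : τ ≤ 1 / 8 := by rw [← hτ]; nlinarith
  -- `τ` is small for two reasons: the tolerance, and the information efficiency of the output
  have hτ2 : 8 * τ ≤ ε := by
    rw [← hτ]
    have := mul_le_of_le_one_right hε.le (show 1 - Cie ≤ 1 by linarith)
    linarith
  have hτ3 : Cie ≤ 1 - 4 * τ := by
    rw [← hτ]
    have := mul_le_of_le_one_left hC'.le hε1.le
    linarith
  rw [hτ]
  have hX := valid_ofInput hx.1
  have hX1 : (ofInput U.toInterface).P₁ = zeroBra (ofInput U.toInterface).Q :=
    hx.2.1.trans (zeroProj_eq_zeroBra _)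
  have hX2 : (ofInput U.toInterface).P₂ = extP d E := hd'.trans (dataProj_eq_extP E d)
  have hbl : (ofInput U.toInterface).block U = U.block := block_ofInput
  have heff : specNorm ((ofInput U.toInterface).block U) = U.eff := by rw [hbl]; rfl
  have heff1 : U.eff ≤ 1 := heff ▸ hX.specNorm_block_le_one hX1
  have hcol : column x = (U.γ : ℂ) • (ofInput U.toInterface).block U := by
    rw [hbl]; exact hx.1.eq_smul
  have hT : (valueBlk (ofInput U.toInterface) d κ V pos o U.γ).Valid U := valueBlk_valid hX _
  have hTP := valueBlk_P₁ (d := d) (pos := pos) (o := o) hX1 U.γ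
  have hF := norm_polyEval hX hX1 hX2 hV1 hpos ho hx.1.gamma_nonneg hcol
  have hS₀ : (valueBlk (ofInput U.toInterface) d κ V pos o U.γ).size U ≤
      (κ + 1) * (400 * t) * U.gates := by
    have ht1 := (hV 0 (Nat.zero_le _)).1.one_le_gates.trans (hV 0 (Nat.zero_le _)).2.1
    have hs0 := hx.size_ofInput_le
    have hg := hx.one_le_gates
    refine (size_valueBlk_le hX hV1 (fun k hk => (hV k hk).2.1) hpos _).trans ?_
    rw [mul_assoc (κ + 1), mul_assoc]
    refine Nat.mul_le_mul_left _ ?_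
    generalize (ofInput U.toInterface).size U = s₀ at hs0
    have e1 : U.gates ≤ t * U.gates := Nat.le_mul_of_pos_left _ ht1
    have e2 : t ≤ t * U.gates := Nat.le_mul_of_pos_right _ hg
    omega
  have hS₁ := hx.size_ofInput_le
  have hη₀ : 0 < specNorm ((valueBlk (ofInput U.toInterface) d κ V pos o U.γ).block U) :=
    pos_of_mul_pos_right (hF ▸ hF0) (polyScale_nonneg _)
  -- first phase: the order of magnitude of the information efficiency of the value
  refine (SuccAfter.search (P := 1 - 2 * testError m - 2 * testError m) (c := 0) hT hTP
    (by linarith) hm hη₀ fun i c₁ hi1 hi2 hc₁ => ?_).mono (by linarith)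
  unfold refineAndReturn
  obtain ⟨a₀, ha₀⟩ : ∃ a₀ : ℝ, (3 ^ (i + 4) : ℝ)⁻¹ = a₀ := ⟨_, rfl⟩
  have ha₀0 : 0 < a₀ := by rw [← ha₀]; positivity
  have ha₀i : 2 * ((3 : ℝ) ^ i)⁻¹ = 162 * a₀ := by
    rw [← ha₀, pow_add, mul_inv]; ring
  have ha₀1 : 162 * a₀ ≤ 2 := by
    rw [← ha₀i]
    have : ((3 : ℝ) ^ i)⁻¹ ≤ 1 := inv_le_one_of_one_le₀ (one_le_pow₀ (by norm_num))
    linarith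
  rw [ha₀] at hi2 ⊢
  rw [ha₀i] at hi1
  obtain ⟨hn1, hn2⟩ := shrinkCount_spec (y := τ / 161) (by positivity) (by linarith)
  -- second phase: the information efficiency of the value up to the relative error `τ`
  refine SuccAfter.ladder (P := 1 - 2 * testError m) hT hTP (by linarith) (by linarith) ha₀0.le
    (by positivity) (by linarith) hi2 (by linarith) fun a v c₂ hv ha hav h1 h2 hc₂ => ?_
  have hv0 : 0 < v := by rw [hv]; positivity
  have hv1 : v ≤ τ * a₀ := by
    rw [hv]
    have := mul_le_mul_of_nonneg_left hn1 ha₀0.le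
    linarith
  have hv2 : 7 / 8 * τ * a₀ ≤ v := by
    rw [hv]
    have := mul_le_mul_of_nonneg_left hn2 ha₀0.le
    linarith
  generalize hη₀' : specNorm ((valueBlk (ofInput U.toInterface) d κ V pos o U.γ).block U) = η₀ at *
  have hs0 : 0 < a + v := by linarith
  have hs2 : a + v ≤ 2 := by linarith
  have hs1 : a + v ≤ (1 + τ) * η₀ := by
    have := mul_le_mul_of_nonneg_left hi2 hτ0.le
    linarith
  generalize a + v = s at hs0 hs1 hs2 h2 ⊢
  have hy0 : 0 < τ * s / (32 * κ) := by positivity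
  have hy1 : τ * s / (32 * κ) ≤ 1 := by
    rw [div_le_one (by positivity)]
    have := mul_le_mul hτ1 hs2 hs0.le (by norm_num)
    linarith
  obtain ⟨hn3, hn4⟩ := shrinkCount_spec hy0 hy1
  -- third phase: the information efficiency of the input, starting from the interval `[Cie, 1]`
  refine SuccAfter.ladder (P := 1) hX hX1 le_rfl (by linarith) (by linarith) hC'
    (by linarith) (heff ▸ hU) (by linarith) fun a' v' c₃ hv' ha' hav' h3 h4 hc₃ => ?_
  rw [heff] at h3 h4
  have hv'1 : v' ≤ τ * s / (32 * κ) := by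
    rw [hv']
    exact (mul_le_of_le_one_left (by positivity) (by linarith)).trans hn3
  have hv'2 : (1 - Cie) * (7 / 8 * (τ * s / (32 * κ))) ≤ v' := by
    rw [hv']
    exact mul_le_mul_of_nonneg_left hn4 hC'.le
  have hgood := goodEstimates_of_le (V := V) (U := U) (A := A) (x := x) (η := a' + v') hκ hF h2 hs1
    hs0.le hs2 hτ0.le hτ1 h4 (by linarith)
  obtain ⟨hg1, hg2, hg3⟩ := hgood.output (ε := ε) (Cie := Cie) hκ hx hU4 hηmin hd' hV hpos ho hF0 hτ0
    hτ1 hτ2 hτ3 rfl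
  refine SuccAfter.ret ⟨hg1, hg2, hg3, ?_⟩
  clear hg1 hg2 hg3
  have hex := executed_le (m := m) (C := 1 - Cie) (κ := κ) (Nat.cast_nonneg _)
    (Nat.cast_nonneg _) (Nat.cast_nonneg _) hτ0 (by linarith) hη₀ hC' (by positivity)
    (by simpa using hc₁) hc₂ hc₃ hi1 hv2 h2 hv'2
  have hS₀' : ((valueBlk (ofInput U.toInterface) d κ V pos o U.γ).size U : ℝ) ≤
    (κ + 1) * (400 * t) * U.gates := by exact_mod_cast hS₀
  have hS₁' : ((ofInput U.toInterface).size U : ℝ) ≤ 3 * U.gates := by exact_mod_cast hS₁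
  have hM : (m : ℝ) * ((336 + 30576 * 186) *
      ((valueBlk (ofInput U.toInterface) d κ V pos o U.γ).size U : ℝ) +
      30576 * (37 * κ / (1 - Cie)) * ((ofInput U.toInterface).size U : ℝ)) ≤
      (8 / testGap ^ 2 + 1) * (1 + Real.logb 2 δ⁻¹) * B * U.gates := by
    rw [mul_assoc (_ * _) B]
    refine mul_le_mul hml ?_ (by positivity) ((Nat.cast_nonneg m).trans hml)
    have e1 := mul_le_mul_of_nonneg_left hS₀' (by norm_num : (0 : ℝ) ≤ 336 + 30576 * 186)
    have e2 := mul_le_mul_of_nonneg_left hS₁'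
      (by positivity : (0 : ℝ) ≤ 30576 * (37 * κ / (1 - Cie)))
    rw [← hB]
    linarith
  have hfin := hgood.executed_le (d := d) (pos := pos) (o := o) hκ hx hU4 hV1 hF hF0 hτ0 hτ1
    (mul_nonneg ((Nat.cast_nonneg m).trans hml) hB0)
  refine hex.trans ((div_le_div_of_nonneg_right hM (by positivity)).trans (hfin.trans
    (le_of_eq ?_)))
  rw [Blk.gates_toEncoding, ← hτ]
  field_simp

end Verification

end QEnc

theorem theorem2p9 (Cie : ℝ) (hCie : 1 / 4 ≤ Cie) (hCie1 : Cie < 1) :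
    ∃ C : ℝ, 0 < C ∧
      ∀ (N K n : ℕ), 1 ≤ N → 1 ≤ K →
      ∀ (E : Matrix (Fin N) (Fin n → Bool) ℂ), E * E.conjTranspose = 1 →
      ∀ (A : (k : ℕ) → Matrix (Fin N) (Fin k → Fin N) ℂ),
        (∀ k ≤ K, ∀ (σ : Equiv.Perm (Fin k)) (a : Fin N) (j : Fin k → Fin N),
          A k a (j ∘ σ) = A k a j) →
      ∀ (U : (k : ℕ) → Encoding Gate (Fin k → Fin N) (Fin N)) (tmax : ℕ) (ηmin : ℝ), 0 < ηmin →
        (∀ k ≤ K, EncodesCoefficient E (U k) (A k) ∧ (U k).gates ≤ tmax ∧ ηmin ≤ (U k).eff) →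
      (∃ 𝒜 : EncodingAlgorithm N Unit (Fin N),
        IsEfficientAmplifiedEncoding E Cie 𝒜 (polyEval A K) {x | polyEval A K x ≠ 0}
          (fun x => C * (K * tmax / (ηmin * ‖polyEval A K x‖) *
            ∑ k ∈ Finset.range (K + 1), specNorm (A k) * ‖x‖ ^ k))) ∧
      (∀ x : EuclideanSpace ℂ (Fin N), HasFDerivAt (polyEval A K)
        (Matrix.toEuclideanLin (polyJacobian A K x)).toContinuousLinearMap x) ∧
      (∃ 𝒟 : EncodingAlgorithm N (Fin N) (Fin N),
        IsExactConstructiveEncoding E Cie 𝒟 (polyJacobian A K)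
          (fun x => ηmin * Cie ^ (K - 1) * specNorm (polyJacobian A K x) *
            (∑ k ∈ Finset.range K, ((k + 1 : ℕ) : ℝ) * specNorm (A (k + 1)) * ‖x‖ ^ k)⁻¹)
          (fun _ => C * (max (K - 1) 1 * tmax : ℕ)) (K - 1)) := by
  have hC : (0 : ℝ) < Cie := by linarith
  refine ⟨10 ^ 10, by norm_num, fun N K n hN hK E hE A hA U tmax ηmin hηmin hU => ?_⟩
  have : NeZero N := ⟨by omega⟩
  refine ⟨?_, hasFDerivAt_polyEval hA, ?_⟩
  · choose pos hpos using fun k : Fin (K + 1) => (hU k (by omega)).1.2.1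
    choose o ho using fun k : Fin (K + 1) => (hU k (by omega)).1.2.2
    exact ⟨polyAlgorithm E Cie K U pos o,
      isEfficientAmplifiedEncoding_polyAlgorithm hCie hCie1 hK hηmin hU hpos ho⟩
  · obtain ⟨κ, rfl⟩ : ∃ κ, K = κ + 1 := ⟨K - 1, by omega⟩
    choose pos hpos using fun k : Fin (κ + 1) => (hU (k + 1) (by omega)).1.2.1
    choose o ho using fun k : Fin (κ + 1) => (hU (k + 1) (by omega)).1.2.2
    refine ⟨jacAlgorithm E U κ pos o, fun ε δ h1 h2 h3 h4 x X hx hX => ?_⟩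
    obtain ⟨T, hT1, hT2, hT3, hT4, hT5⟩ := isExactConstructiveEncoding_jacAlgorithm hC hηmin hU hpos
      ho ε δ h1 h2 h3 h4 x X hx hX
    refine ⟨T, hT1, hT2, hT3, hT4.trans ?_, hT5⟩
    have h5 : (κ + 1) * (400 * tmax) ≤ 800 * (max (κ + 1 - 1) 1 * tmax) := by
      have h6 : κ + 1 ≤ 2 * max (κ + 1 - 1) 1 := by omega
      have h7 := Nat.mul_le_mul_right (400 * tmax) h6
      calc (κ + 1) * (400 * tmax) ≤ 2 * max (κ + 1 - 1) 1 * (400 * tmax) := h7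
        _ = 800 * (max (κ + 1 - 1) 1 * tmax) := by ring
    have h6 : (((κ + 1) * (400 * tmax) : ℕ) : ℝ) ≤
        800 * ((max (κ + 1 - 1) 1 * tmax : ℕ) : ℝ) := by exact_mod_cast h5
    exact h6.trans (mul_le_mul_of_nonneg_right (by norm_num) (Nat.cast_nonneg _))
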